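/- **Notation.** Let $d\ge 1$, $T>0$, and let $(U,d_U)$ be a non-empty compact metric space. $B(0,R)\subset\mathbb R^d$ is the closed Euclidean ball, $\mathcal P_c(\mathbb R^d)$ is the set of compactly supported Borel probability measures, and $\mathcal P(K)$ is the set of those concentrated on $K$. $\Gamma(\mu,\nu)$ is the set of transport plans between $\mu$ and $\nu$, $W_p$ is the $p$-Wasserstein distance, $\Gamma_o(\mu,\nu)\subset\Gamma(\mu,\nu)$ is the set of optimal plans for the quadratic cost, and $\mathcal M_1(\mu)=\int|x|\,d\mu$. For a plan $\boldsymbol\mu\in\Gamma(\mu_1,\mu_2)$ and $\lambda\in[0,1]$ put $$\boldsymbol\mu_\lambda^{1\to2}:=\big((1-\lambda)\pi^1+\lambda\pi^2\big)_\#\boldsymbol\mu,\qquad W_{2,\boldsymbol\mu}(\mu_1,\mu_2):=\Big(\int|x-y|^2d\boldsymbol\mu(x,y)\Big)^{1/2}.$$ *Wasserstein gradient.* Let $\phi:\mathcal P_c(\mathbb R^d)\to\mathbb R$ and $\mu\in\mathcal P_c(\mathbb R^d)$, and write $B_R(\mu)=\bigcup_{x\in\mathrm{supp}\,\mu}B(x,R)$.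 A map $\xi\in L^2(\mathbb R^d,\mathbb R^d;\mu)$ is in $\partial^-\phi(\mu)$ if $\phi(\nu)-\phi(\mu)\ge\inf_{\gamma\in\Gamma_o(\mu,\nu)}\int\langle\xi(x),y-x\rangle d\gamma(x,y)+o_R(W_2(\mu,\nu))$ for all $R>0$ and $\nu\in\mathcal P(B_R(\mu))$. It is in $\partial^+\phi(\mu)$ if $-\xi\in\partial^-(-\phi)(\mu)$. The functional $\phi$ is *locally differentiable* at $\mu$ if there is a $\nabla\phi(\mu)\in\partial^-\phi(\mu)\cap\partial^+\phi(\mu)$ that lies in the closure in $L^2(\mu)$ of $\{\nabla\psi:\psi\in C_c^\infty(\mathbb R^d)\}$; it is then unique $\mu$-a.e. For $\mathbb R^d$-valued maps this is required of each component, and $\mathrm D\phi(\mu)$ is the matrix whose rows are the gradients of the components. Gradients are identified with representatives: continuity of a gradient means that it has a representative which is continuous as stated. **Data.** Let $v:[0,T]\times\mathcal P_c(\mathbb R^d)\times U\times\mathbb R^d\to\mathbb R^d$ and $\varphi:\mathcal P_c(\mathbb R^d)\to\mathbb R$. The value function is $$\mathcal V(\tau,\mu_\tau):=\inf_{u(\cdot)}\varphi(\mu(T)),\qquad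 \partial_t\mu(t)+\mathrm{div}_x\big(v(t,\mu(t),u(t))\mu(t)\big)=0\ \text{ on }[\tau,T],\quad \mu(\tau)=\mu_\tau .$$ The infimum is over Lebesgue measurable $u:[0,T]\to U$ and $W_1$-continuous curves $\mu:[\tau,T]\to\mathcal P_c(\mathbb R^d)$ solving the equation in the sense of distributions, that is against all $\xi\in C_c^\infty((\tau,T)\times\mathbb R^d)$. **Hypotheses.** Each is required for every $R>0$, with $K:=B(0,R)$. * **(OCP)** (i) There are $m,l_K,L_K\in L^1([0,T],\mathbb R_+)$, independent of $u$, such that for every $u\in U$: $t\mapsto v(t,\mu,u,x)$ is Lebesgue measurable for all $(\mu,x)\in\mathcal P_c(\mathbb R^d)\times\mathbb R^d$, and for a.e. $t\in[0,T]$ one has - $|v(t,\mu,u,x)|\le m(t)(1+|x|+\mathcal M_1(\mu))$ for all $(\mu,x)\in\mathcal P_c(\mathbb R^d)\times\mathbb R^d$; - $|v(t,\mu,u,x)-v(t,\mu,u,y)|\le l_K(t)|x-y|$ and $|v(t,\mu,u,x)-v(t,\nu,u,x)|\le L_K(t)W_1(\mu,\nu)$ for all $\mu,\nu\in\mathcal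 P(K)$, $x,y\in K$; - $x\mapsto v(t,\mu,u,x)$ is Fréchet differentiable on $\mathbb R^d$ for all $\mu\in\mathcal P_c(\mathbb R^d)$, and $(\mu,x)\mapsto\mathrm D_xv(t,\mu,u,x)$ is continuous on $(\mathcal P(K),W_1)\times K$; - $\mu\mapsto v(t,\mu,u,x)$ is locally differentiable on $\mathcal P_c(\mathbb R^d)$ for all $x\in\mathbb R^d$, and $(\mu,x,y)\mapsto\mathrm D_\mu v(t,\mu,u,x)(y)$ is continuous on $(\mathcal P(K),W_1)\times K\times K$. Moreover, for a.e. $t$, $u\mapsto v(t,\mu,u,x)$ is continuous for all $(\mu,x)\in\mathcal P_c(\mathbb R^d)\times\mathbb R^d$. (ii) $\varphi$ is $W_1$-Lipschitz on $\mathcal P(K)$ and locally differentiable, and $x\mapsto\nabla\varphi(\mu)(x)$ is continuous for every $\mu\in\mathcal P_c(\mathbb R^d)$. * **(SC1)** (i) There is $C_K(\cdot)\in L^1([0,T],\mathbb R_+)$ such that for all $u\in U$, $\mu_1,\mu_2\in\mathcal P(K)$, $\gamma\in\Gamma_o(\mu_1,\mu_2)$ and $x,y\in K$, $$\big|(1-\lambda)v(t,\mu_1,u,x)+\lambda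 v(t,\mu_2,u,y)-v(t,\gamma_\lambda^{1\to2},u,(1-\lambda)x+\lambda y)\big|\le C_K(t)\lambda(1-\lambda)\big(|x-y|^2+W_2^2(\mu_1,\mu_2)\big)$$ for a.e. $t\in[0,T]$ and all $\lambda\in[0,1]$. (ii) There is $C_K>0$ such that $(1-\lambda)\varphi(\mu_1)+\lambda\varphi(\mu_2)-\varphi(\gamma^{1\to2}_\lambda)\le C_K\lambda(1-\lambda)W_2^2(\mu_1,\mu_2)$ for all $\mu_1,\mu_2\in\mathcal P(K)$, $\gamma\in\Gamma_o(\mu_1,\mu_2)$, $\lambda\in[0,1]$. * **(SC2)** The same as (SC1), for all plans $\boldsymbol\mu\in\Gamma(\mu_1,\mu_2)$ in place of $\gamma\in\Gamma_o(\mu_1,\mu_2)$, with $W_{2,\boldsymbol\mu}(\mu_1,\mu_2)$ in place of $W_2(\mu_1,\mu_2)$. * **(R)** (i) (OCP)(i) holds with a constant $m(\cdot)\equiv m>0$. (ii) There is $\ell_K>0$ such that $|v(t,\mu,u,x)-v(\tau,\nu,u,y)|\le\ell_K(|t-\tau|+W_1(\mu,\nu)+|x-y|)$ for all $u\in U$,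 $t,\tau\in[0,T]$, $\mu,\nu\in\mathcal P(K)$, $x,y\in K$. **Theorem (joint semiconcavity of the value function).** Assume (OCP) and (R). Then the infimum defining $\mathcal V(\tau,\mu)$ is over a non-empty set bounded from below, for all $(\tau,\mu)\in[0,T]\times\mathcal P_c(\mathbb R^d)$, and the following hold. 1. If (SC1) holds, then for every $K:=B(0,r)$ with $r>0$ there is a constant $\mathcal C_K>0$ such that for all $\tau_1,\tau_2\in[0,T]$, all $\mu_1,\mu_2\in\mathcal P(K)$, each $\gamma\in\Gamma_o(\mu_1,\mu_2)$ and all $\lambda\in[0,1]$, with $\tau_\lambda:=(1-\lambda)\tau_1+\lambda\tau_2$, $$(1-\lambda)\mathcal V(\tau_1,\mu_1)+\lambda\mathcal V(\tau_2,\mu_2)-\mathcal V(\tau_\lambda,\gamma_\lambda^{1\to2})\le\mathcal C_K\,\lambda(1-\lambda)\big(|\tau_1-\tau_2|^2+W_2^2(\mu_1,\mu_2)\big).$$ 2. If (SC2) holds, then for every $K:=B(0,r)$ with $r>0$ there is a constant $\mathcal C_K>0$ such that for all $\tau_1,\tau_2\in[0,T]$, all $\mu_1,\mu_2\in\mathcal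 P(K)$, each $\boldsymbol\mu\in\Gamma(\mu_1,\mu_2)$ and all $\lambda\in[0,1]$, $$(1-\lambda)\mathcal V(\tau_1,\mu_1)+\lambda\mathcal V(\tau_2,\mu_2)-\mathcal V(\tau_\lambda,\boldsymbol\mu_\lambda^{1\to2})\le\mathcal C_K\,\lambda(1-\lambda)\big(|\tau_1-\tau_2|^2+W_{2,\boldsymbol\mu}^2(\mu_1,\mu_2)\big).$$ -/

import Mathlib

open MeasureTheory Set Filter Topology
open scoped ENNReal

noncomputable section

namespace WassersteinControl

/-- Euclidean space `ℝ^d` with its Euclidean norm. -/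
abbrev E (d : ℕ) : Type := EuclideanSpace ℝ (Fin d)

/-! ### Measures, transport plans, Wasserstein distances -/

/-- The closed ball `B(0,R)`. -/
abbrev ball0 (d : ℕ) (R : ℝ) : Set (E d) := Metric.closedBall 0 R

/-- `μ ∈ 𝒫(K)`: a Borel probability measure on `ℝ^d` that is concentrated on `K`. -/
def ProbOn {d : ℕ} (K : Set (E d)) (μ : Measure (E d)) : Prop :=
  IsProbabilityMeasure μ ∧ μ Kᶜ = 0

/-- `μ ∈ 𝒫_c(ℝ^d)`: a Borel probability measure with compact support. Functions on `𝒫_c(ℝ^d)` are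
represented by functions on `Measure (E d)`, of which only the values on `𝒫_c(ℝ^d)` are ever
used. -/
def IsPc {d : ℕ} (μ : Measure (E d)) : Prop :=
  IsProbabilityMeasure μ ∧ IsCompact μ.support

/-- The first moment `∫ |x| dμ(x)`. -/
def moment1 {d : ℕ} (μ : Measure (E d)) : ℝ := ∫ x, ‖x‖ ∂μ

/-- The set `Γ(μ,ν)` of transport plans between `μ` and `ν`. -/
def plans {d : ℕ} (μ ν : Measure (E d)) : Set (Measure (E d × E d)) :=
  {γ | γ.map Prod.fst = μ ∧ γ.map Prod.snd = ν}

/-- The cost `∫ |x - y|^p dγ(x,y)` with values in `[0,∞]` (`edist` is the Euclidean distance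
on `ℝ^d`). -/
def planCost {d : ℕ} (p : ℕ) (γ : Measure (E d × E d)) : ℝ≥0∞ :=
  ∫⁻ z, edist z.1 z.2 ^ p ∂γ

/-- The Wasserstein distance `W_p(μ,ν)`. -/
def wass {d : ℕ} (p : ℕ) (μ ν : Measure (E d)) : ℝ :=
  ((⨅ γ ∈ plans μ ν, planCost p γ) ^ (1 / (p : ℝ))).toReal

/-- The set `Γ_o(μ,ν)` of (quadratically) optimal transport plans. -/
def optPlans {d : ℕ} (μ ν : Measure (E d)) : Set (Measure (E d × E d)) :=
  {γ | γ ∈ plans μ ν ∧ ∀ γ' ∈ plans μ ν, planCost 2 γ ≤ planCost 2 γ'}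

/-- The quantity `W_{2,γ} = (∫ |x - y|^2 dγ(x,y))^{1/2}` attached to a plan `γ`. -/
def wassPlan {d : ℕ} (γ : Measure (E d × E d)) : ℝ :=
  Real.sqrt (∫ z, ‖z.1 - z.2‖ ^ 2 ∂γ)

/-- The interpolation `((1-λ) π¹ + λ π²)_# γ` along the plan `γ`. -/
def interp {d : ℕ} (γ : Measure (E d × E d)) (lam : ℝ) : Measure (E d) :=
  γ.map (fun z => (1 - lam) • z.1 + lam • z.2)

/-! ### Wasserstein gradients -/

/-- The fattening `⋃_{x ∈ supp μ} B(x,R)`. -/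
def fattening {d : ℕ} (μ : Measure (E d)) (R : ℝ) : Set (E d) :=
  ⋃ x ∈ μ.support, Metric.closedBall x R

/-- `ξ` belongs to the localised Fréchet subdifferential of `φ` at `μ`:
`φ(ν) - φ(μ) ≥ inf_{γ ∈ Γ_o(μ,ν)} ∫ ⟨ξ(x), y - x⟩ dγ(x,y) + o_R(W_2(μ,ν))` for every `R > 0` and
every `ν ∈ 𝒫(B_R(μ))`. -/
def InSubdiff {d : ℕ} (φ : Measure (E d) → ℝ) (μ : Measure (E d)) (ξ : E d → E d) : Prop :=
  MemLp ξ 2 μ ∧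
  ∀ R > 0, ∀ ε > 0, ∃ δ > 0, ∀ ν, ProbOn (fattening μ R) ν → wass 2 μ ν < δ →
    (⨅ γ : optPlans μ ν, ∫ z, inner ℝ (ξ z.1) (z.2 - z.1) ∂(γ : Measure (E d × E d)))
      - ε * wass 2 μ ν ≤ φ ν - φ μ

/-- `ξ` belongs to the localised Fréchet superdifferential of `φ` at `μ`. -/
def InSuperdiff {d : ℕ} (φ : Measure (E d) → ℝ) (μ : Measure (E d)) (ξ : E d → E d) : Prop :=
  InSubdiff (fun ν => -φ ν) μ (fun x => -ξ x)

/-- `ξ` belongs to the tangent space `Tan_μ 𝒫_2(ℝ^d)`, the closure in `L^2(μ)` of the gradients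
of smooth compactly supported functions. -/
def InTan {d : ℕ} (μ : Measure (E d)) (ξ : E d → E d) : Prop :=
  MemLp ξ 2 μ ∧
  ∀ ε : ℝ≥0∞, 0 < ε → ∃ ψ : E d → ℝ, ContDiff ℝ (⊤ : ℕ∞) ψ ∧ HasCompactSupport ψ ∧
    eLpNorm (fun x => ξ x - gradient ψ x) 2 μ < ε

/-- `ξ` is (a representative of) the Wasserstein gradient `∇φ(μ)`: it is tangent, and belongs to
both the sub- and the superdifferential of `φ` at `μ`. These conditions determine `ξ` up to
equality `μ`-almost everywhere. -/
def IsWassGradient {d : ℕ} (φ : Measure (E d) → ℝ) (μ : Measure (E d)) (ξ : E d → E d) : Prop :=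
  InTan μ ξ ∧ InSubdiff φ μ ξ ∧ InSuperdiff φ μ ξ

/-! ### Hypotheses on the data -/

/-- A property that holds for Lebesgue almost every `t ∈ [0,T]`. -/
def AETime (T : ℝ) (P : ℝ → Prop) : Prop := ∀ᵐ t ∂(volume.restrict (Icc 0 T)), P t

/-- `m ∈ L^1([0,T],ℝ_+)`. -/
def IsL1Pos (T : ℝ) (m : ℝ → ℝ) : Prop :=
  IntegrableOn m (Icc 0 T) ∧ ∀ t ∈ Icc 0 T, 0 ≤ m t

section Hypotheses

variable {d : ℕ} {U : Type*}

/-- Carathéodory regularity in time and sublinear growth of a non-local velocity field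
`(t,μ,x) ↦ w(t,μ,x)`, with sublinearity function `m`. -/
def CE1 (T : ℝ) (w : ℝ → Measure (E d) → E d → E d) (m : ℝ → ℝ) : Prop :=
  (∀ μ, IsPc μ → ∀ x, AEMeasurable (fun t => w t μ x) (volume.restrict (Icc 0 T))) ∧
  AETime T fun t => ∀ μ, IsPc μ → ∀ x, ‖w t μ x‖ ≤ m t * (1 + ‖x‖ + moment1 μ)

/-- Lipschitz regularity on `K = B(0,R)` in space, with constant `l(t)`, and in measure, with
constant `L(t)`. -/
def CE2 (T : ℝ) (w : ℝ → Measure (E d) → E d → E d) (R : ℝ) (l L : ℝ → ℝ) : Prop :=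
  AETime T fun t => ∀ μ ν, ProbOn (ball0 d R) μ → ProbOn (ball0 d R) ν →
    ∀ x ∈ ball0 d R, ∀ y ∈ ball0 d R,
      ‖w t μ x - w t μ y‖ ≤ l t * ‖x - y‖ ∧ ‖w t μ x - w t ν x‖ ≤ L t * wass 1 μ ν

/-- Fréchet differentiability in space, with a differential that is continuous
on `𝒫_1(K) × K` for `K = B(0,R)`. -/
def CE3 (T : ℝ) (w : ℝ → Measure (E d) → E d → E d) (R : ℝ) : Prop :=
  AETime T fun t =>
    (∀ μ, IsPc μ → Differentiable ℝ (w t μ)) ∧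
    ∀ μ, ProbOn (ball0 d R) μ → ∀ x ∈ ball0 d R, ∀ ε > 0, ∃ δ > 0,
      ∀ ν, ProbOn (ball0 d R) ν → ∀ x' ∈ ball0 d R, wass 1 μ ν < δ → ‖x - x'‖ < δ →
        ‖fderiv ℝ (w t μ) x - fderiv ℝ (w t ν) x'‖ < ε

/-- Local differentiability in measure of the components of the velocity: `G i μ x` is (a
representative of) the Wasserstein gradient at `μ` of the `i`-th component of `μ ↦ w(t,μ,x)`,
that is the `i`-th row of `D_μ w(t,μ,x)(·)`, and `(μ,x,y) ↦ G i μ x y` is continuous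
on `𝒫_1(K) × K × K` for `K = B(0,R)`. -/
def CE4 (T : ℝ) (w : ℝ → Measure (E d) → E d → E d) (R : ℝ) : Prop :=
  AETime T fun t => ∃ G : Fin d → Measure (E d) → E d → E d → E d,
    (∀ i, ∀ μ, IsPc μ → ∀ x, IsWassGradient (fun ν => (w t ν x) i) μ (G i μ x)) ∧
    ∀ i, ∀ μ, ProbOn (ball0 d R) μ → ∀ x ∈ ball0 d R, ∀ y ∈ ball0 d R, ∀ ε > 0, ∃ δ > 0,
      ∀ ν, ProbOn (ball0 d R) ν → ∀ x' ∈ ball0 d R, ∀ y' ∈ ball0 d R,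
        wass 1 μ ν < δ → ‖x - x'‖ < δ → ‖y - y'‖ < δ → ‖G i μ x y - G i ν x' y'‖ < ε

/-- The assumptions on the controlled velocity field in (OCP), with sublinearity function `m`.
The functions `m`, `l`, `L` do not depend on the control value. -/
def VelocityOCP [TopologicalSpace U] (T : ℝ) (v : ℝ → Measure (E d) → U → E d → E d)
    (m : ℝ → ℝ) : Prop :=
  IsL1Pos T m ∧
  (∀ u, CE1 T (fun t μ x => v t μ u x) m) ∧
  (∀ R > 0, ∃ l L : ℝ → ℝ, IsL1Pos T l ∧ IsL1Pos T L ∧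
    ∀ u, CE2 T (fun t μ x => v t μ u x) R l L) ∧
  (∀ R > 0, ∀ u, CE3 T (fun t μ x => v t μ u x) R) ∧
  (∀ R > 0, ∀ u, CE4 T (fun t μ x => v t μ u x) R) ∧
  AETime T fun t => ∀ μ, IsPc μ → ∀ x, Continuous fun u => v t μ u x

/-- The assumptions on the final cost in (OCP). -/
def CostOCP (φ : Measure (E d) → ℝ) : Prop :=
  (∀ R > 0, ∃ L : ℝ, 0 ≤ L ∧ ∀ μ ν, ProbOn (ball0 d R) μ → ProbOn (ball0 d R) ν →
    |φ μ - φ ν| ≤ L * wass 1 μ ν) ∧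
  ∀ μ, IsPc μ → ∃ ξ : E d → E d, Continuous ξ ∧ IsWassGradient φ μ ξ

/-- Hypotheses (OCP). -/
def OCP [TopologicalSpace U] (T : ℝ) (v : ℝ → Measure (E d) → U → E d → E d)
    (φ : Measure (E d) → ℝ) : Prop :=
  (∃ m, VelocityOCP T v m) ∧ CostOCP φ

/-- Local geodesic semiconcavity: semiconcavity along optimal plans. -/
def GeodesicSemiconcave (φ : Measure (E d) → ℝ) : Prop :=
  ∀ R > 0, ∃ C > 0, ∀ μ₁ μ₂, ProbOn (ball0 d R) μ₁ → ProbOn (ball0 d R) μ₂ →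
    ∀ γ ∈ optPlans μ₁ μ₂, ∀ lam ∈ Icc (0 : ℝ) 1,
      (1 - lam) * φ μ₁ + lam * φ μ₂ - φ (interp γ lam)
        ≤ C * (lam * (1 - lam)) * wass 2 μ₁ μ₂ ^ 2

/-- Local strong semiconcavity: semiconcavity along arbitrary plans. -/
def StrongSemiconcave (φ : Measure (E d) → ℝ) : Prop :=
  ∀ R > 0, ∃ C > 0, ∀ μ₁ μ₂, ProbOn (ball0 d R) μ₁ → ProbOn (ball0 d R) μ₂ →
    ∀ γ ∈ plans μ₁ μ₂, ∀ lam ∈ Icc (0 : ℝ) 1,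
      (1 - lam) * φ μ₁ + lam * φ μ₂ - φ (interp γ lam)
        ≤ C * (lam * (1 - lam)) * wassPlan γ ^ 2

/-- Hypotheses (SC1). -/
def SC1 (T : ℝ) (v : ℝ → Measure (E d) → U → E d → E d) (φ : Measure (E d) → ℝ) : Prop :=
  (∀ R > 0, ∃ C : ℝ → ℝ, IsL1Pos T C ∧
    ∀ u, ∀ μ₁ μ₂, ProbOn (ball0 d R) μ₁ → ProbOn (ball0 d R) μ₂ →
    ∀ γ ∈ optPlans μ₁ μ₂, ∀ x ∈ ball0 d R, ∀ y ∈ ball0 d R,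
      AETime T fun t => ∀ lam ∈ Icc (0 : ℝ) 1,
        ‖(1 - lam) • v t μ₁ u x + lam • v t μ₂ u y
            - v t (interp γ lam) u ((1 - lam) • x + lam • y)‖
          ≤ C t * (lam * (1 - lam)) * (‖x - y‖ ^ 2 + wass 2 μ₁ μ₂ ^ 2)) ∧
  GeodesicSemiconcave φ

/-- Hypotheses (SC2). -/
def SC2 (T : ℝ) (v : ℝ → Measure (E d) → U → E d → E d) (φ : Measure (E d) → ℝ) : Prop :=
  (∀ R > 0, ∃ C : ℝ → ℝ, IsL1Pos T C ∧
    ∀ u, ∀ μ₁ μ₂, ProbOn (ball0 d R) μ₁ → ProbOn (ball0 d R) μ₂ →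
    ∀ γ ∈ plans μ₁ μ₂, ∀ x ∈ ball0 d R, ∀ y ∈ ball0 d R,
      AETime T fun t => ∀ lam ∈ Icc (0 : ℝ) 1,
        ‖(1 - lam) • v t μ₁ u x + lam • v t μ₂ u y
            - v t (interp γ lam) u ((1 - lam) • x + lam • y)‖
          ≤ C t * (lam * (1 - lam)) * (‖x - y‖ ^ 2 + wassPlan γ ^ 2)) ∧
  StrongSemiconcave φ

/-- Hypotheses (R): the sublinearity constant does not depend on time, and the velocity is
Lipschitz in time, measure and space on bounded sets, uniformly in the control value. -/
def HypR [TopologicalSpace U] (T : ℝ) (v : ℝ → Measure (E d) → U → E d → E d) : Prop :=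
  (∃ m : ℝ, 0 < m ∧ VelocityOCP T v (fun _ => m)) ∧
  ∀ R > 0, ∃ l > 0, ∀ u, ∀ t ∈ Icc 0 T, ∀ τ ∈ Icc 0 T,
    ∀ μ ν, ProbOn (ball0 d R) μ → ProbOn (ball0 d R) ν →
    ∀ x ∈ ball0 d R, ∀ y ∈ ball0 d R,
      ‖v t μ u x - v τ ν u y‖ ≤ l * (|t - τ| + wass 1 μ ν + ‖x - y‖)

/-! ### Trajectories and the value function -/

/-- `c` is a solution on `[τ,T]` of `∂_t c(t) + div_x (v(t,c(t),u(t)) c(t)) = 0`, `c(τ) = μτ`: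
a `W_1`-continuous curve of compactly supported probability measures which satisfies the equation
in the sense of distributions. Here `fderiv ℝ ξ (t,x) (1,b) = ∂_t ξ(t,x) + ⟨∇_x ξ(t,x), b⟩`. -/
def IsTrajectory (T : ℝ) (v : ℝ → Measure (E d) → U → E d → E d) (u : ℝ → U) (τ : ℝ)
    (μτ : Measure (E d)) (c : ℝ → Measure (E d)) : Prop :=
  (∀ t ∈ Icc τ T, IsPc (c t)) ∧
  (∀ t ∈ Icc τ T, Tendsto (fun s => wass 1 (c s) (c t)) (𝓝[Icc τ T] t) (𝓝 0)) ∧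
  c τ = μτ ∧
  ∀ ξ : ℝ × E d → ℝ, ContDiff ℝ (⊤ : ℕ∞) ξ → HasCompactSupport ξ →
    tsupport ξ ⊆ Ioo τ T ×ˢ univ →
    ∫ t in τ..T, ∫ x, fderiv ℝ ξ (t, x) ((1 : ℝ), v t (c t) (u t) x) ∂(c t) = 0

/-- The set of final costs `φ(μ(T))` over the admissible trajectory-control pairs that start
from `μτ` at time `τ`, the controls being the Lebesgue measurable maps `u : [0,T] → U`. -/
def admissibleCosts [MeasurableSpace U] (T : ℝ) (v : ℝ → Measure (E d) → U → E d → E d)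
    (φ : Measure (E d) → ℝ) (τ : ℝ) (μτ : Measure (E d)) : Set ℝ :=
  {r | ∃ (u : ℝ → U) (c : ℝ → Measure (E d)),
    AEMeasurable u (volume.restrict (Icc 0 T)) ∧ IsTrajectory T v u τ μτ c ∧ r = φ (c T)}

/-- The value function `𝒱(τ,μτ)`. -/
def value [MeasurableSpace U] (T : ℝ) (v : ℝ → Measure (E d) → U → E d → E d)
    (φ : Measure (E d) → ℝ) (τ : ℝ) (μτ : Measure (E d)) : ℝ :=
  sInf (admissibleCosts T v φ τ μτ)

end Hypotheses

end WassersteinControl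

end

/-!
The value function is compared with the costs of competitors that are built from an arbitrary
admissible trajectory for the intermediate datum. The comparison takes place in Lagrangian
coordinates on the probability space `(ℝ^d × ℝ^d, γ)`, where `γ` is the given plan.

*Trajectories are flows.* A distributional solution of the non-local continuity equation is the
image of its initial measure under the characteristics of the velocity field it generates
(`IsTrajectory.exists_isFlow`). Its support stays in a fixed ball, by testing the equation against a
barrier (`IsTrajectory.exists_measureCurve`), and duality with the backward transport equation,
mollified in space, identifies the solution (`integral_eq_integral_curves`). Conversely flows exist
by a fixed point argument in a space of continuous functions (`exists_flow`) and solve the equation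
(`IsFlow.isTrajectory`).

*From optimal plans to all plans.* A plan between final measures that is carried along by the flows
is in general not optimal, even if `γ` is, so semiconcavity along all plans is needed. It follows
from semiconcavity along optimal plans (`semiconcave_along_plan`, `StrongSemiconcave.of_geodesic`,
`SC1.strongVelocitySC`). For finitely supported plans, short displacements are optimal as long as no
two atoms meet, so second differences are bounded away from the finitely many meeting times; at a
meeting time the functional is differentiable along the interpolation, since it has a Wasserstein
gradient and displacements starting from that time are again optimal. A function of one variable
with these two properties is semiconcave (`semiconcave_of_local`), and the general case follows by
approximation. For the velocity, the exceptional null set of times is made independent of the plan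
by working at points where the primitive of the semiconcavity constant is differentiable
(`aeTime_forall_le`).

*The main estimate.* Let `τ₁ ≤ τ₂`, and let `u` be a control for the datum at time
`τ_λ = (1 - λ) τ₁ + λ τ₂`. The competitor for `(τ₂, μ₂)` uses `u`. The competitor for `(τ₁, μ₁)` uses
`u` composed with the affine map of `[τ₁, τ₂]` onto `[τ_λ, τ₂]` (`reparam`), and `u` after time
`τ₂`. On `[τ₁, τ₂]` the first competitor is at distance `O(λ)` from the intermediate trajectory,
up to the change of time; inserting this into the integral equation, whose length was contracted by `1 - λ`, gives an
error `O(λ (1 - λ))` at time `τ₂`. After `τ₂` all controls agree and the semiconcavity of the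
velocity enters as a source term of the same order. Both steps rest on a Grönwall inequality for
families of curves coupled through their mean (`gronwall_mean`). This yields
`CoupledTrajectories.estimate`; with the semiconcavity and the Lipschitz continuity of `φ` it gives
`exists_value_convexComb_le`, from which `value_strongSemiconcave` follows by taking the infimum.
-/


namespace WassersteinControl

/-! ### Compactly supported measures and transport plans -/

section Toolkit

variable {d : ℕ}

theorem ProbOn.ae_mem {K : Set (E d)} {μ : Measure (E d)} (h : ProbOn K μ) : ∀ᵐ x ∂μ, x ∈ K :=
  h.2

theorem ProbOn.ae_norm_le {R : ℝ} {μ : Measure (E d)} (h : ProbOn (ball0 d R) μ) :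
    ∀ᵐ x ∂μ, ‖x‖ ≤ R := by
  filter_upwards [h.ae_mem] with x hx
  simpa using hx

theorem ProbOn.mono {K K' : Set (E d)} {μ : Measure (E d)} (h : ProbOn K μ) (hK : K ⊆ K') :
    ProbOn K' μ :=
  ⟨h.1, measure_mono_null (compl_subset_compl.2 hK) h.2⟩

theorem ProbOn.mono_radius {R R' : ℝ} {μ : Measure (E d)} (h : ProbOn (ball0 d R) μ)
    (hR : R ≤ R') : ProbOn (ball0 d R') μ :=
  h.mono (Metric.closedBall_subset_closedBall hR)

theorem ProbOn.isPc {R : ℝ} {μ : Measure (E d)} (h : ProbOn (ball0 d R) μ) : IsPc μ :=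
  ⟨h.1, (isCompact_closedBall (0 : E d) R).of_isClosed_subset Measure.isClosed_support
    (Measure.support_subset_of_isClosed Metric.isClosed_closedBall h.2)⟩

theorem IsPc.exists_probOn {μ : Measure (E d)} (h : IsPc μ) : ∃ R > 0, ProbOn (ball0 d R) μ := by
  obtain ⟨R, hR, hR'⟩ := h.2.isBounded.subset_closedBall_lt 0 (0 : E d)
  exact ⟨R, hR, h.1, measure_mono_null (compl_subset_compl.2 hR') Measure.measure_compl_support⟩

theorem probOn_map {Ω : Type*} [MeasurableSpace Ω] {P : Measure Ω} [IsProbabilityMeasure P]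
    {f : Ω → E d} (hf : Measurable f) {R : ℝ} (h : ∀ᵐ ω ∂P, ‖f ω‖ ≤ R) :
    ProbOn (ball0 d R) (P.map f) := by
  refine ⟨Measure.isProbabilityMeasure_map hf.aemeasurable, ?_⟩
  have : ∀ᵐ x ∂(P.map f), x ∈ ball0 d R := by
    refine (ae_map_iff hf.aemeasurable Metric.isClosed_closedBall.measurableSet).2 ?_
    simpa using h
  exact this

theorem integrable_of_ae_norm_le {Ω F : Type*} [MeasurableSpace Ω] [NormedAddCommGroup F]
    {P : Measure Ω} [IsFiniteMeasure P] {f : Ω → F} (hf : AEStronglyMeasurable f P) {C : ℝ}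
    (h : ∀ᵐ ω ∂P, ‖f ω‖ ≤ C) : Integrable f P :=
  Integrable.of_bound hf C h

theorem ProbOn.integrable {F : Type*} [NormedAddCommGroup F] {R : ℝ} {μ : Measure (E d)}
    (h : ProbOn (ball0 d R) μ) {f : E d → F} (hf : Continuous f)
    [SecondCountableTopologyEither (E d) F] : Integrable f μ := by
  have := h.1
  obtain ⟨C, hC⟩ := (isCompact_closedBall (0 : E d) R).exists_bound_of_continuousOn hf.continuousOn
  refine integrable_of_ae_norm_le hf.aestronglyMeasurable (C := C) ?_
  filter_upwards [h.ae_mem] with x hx using hC x hx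

theorem ProbOn.norm_integral_le {F : Type*} [NormedAddCommGroup F] [NormedSpace ℝ F] {R : ℝ}
    {μ : Measure (E d)} (h : ProbOn (ball0 d R) μ) {f : E d → F} {C : ℝ}
    (hf : ∀ x ∈ ball0 d R, ‖f x‖ ≤ C) : ‖∫ x, f x ∂μ‖ ≤ C := by
  have := h.1
  have := norm_integral_le_of_norm_le_const (μ := μ) (f := f) (C := C)
    (by filter_upwards [h.ae_mem] with x hx using hf x hx)
  simpa using this

theorem ProbOn.moment1_le {R : ℝ} {μ : Measure (E d)} (h : ProbOn (ball0 d R) μ) :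
    moment1 μ ≤ R := by
  have := h.norm_integral_le (f := fun x => ‖x‖) (C := R) (by intro x hx; simpa using hx)
  exact (le_abs_self _).trans (by simpa [moment1] using this)

theorem isProbabilityMeasure_of_plan {μ ν : Measure (E d)} [IsProbabilityMeasure μ]
    {γ : Measure (E d × E d)} (h : γ ∈ plans μ ν) : IsProbabilityMeasure γ := by
  constructor
  have : γ.map Prod.fst univ = 1 := by rw [h.1]; exact measure_univ
  rwa [Measure.map_apply measurable_fst MeasurableSet.univ] at this

theorem ae_fst_of_plan {μ ν : Measure (E d)} {γ : Measure (E d × E d)} (h : γ ∈ plans μ ν)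
    {p : E d → Prop} (hp : ∀ᵐ x ∂μ, p x) : ∀ᵐ z ∂γ, p z.1 := by
  rw [← h.1] at hp
  exact ae_of_ae_map measurable_fst.aemeasurable hp

theorem ae_snd_of_plan {μ ν : Measure (E d)} {γ : Measure (E d × E d)} (h : γ ∈ plans μ ν)
    {p : E d → Prop} (hp : ∀ᵐ x ∂ν, p x) : ∀ᵐ z ∂γ, p z.2 := by
  rw [← h.2] at hp
  exact ae_of_ae_map measurable_snd.aemeasurable hp

/-- Plans between measures on a ball, seen as measures concentrated on a product of balls. -/
theorem ae_mem_of_plan {R : ℝ} {μ ν : Measure (E d)} (hμ : ProbOn (ball0 d R) μ)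
    (hν : ProbOn (ball0 d R) ν) {γ : Measure (E d × E d)} (h : γ ∈ plans μ ν) :
    ∀ᵐ z ∂γ, ‖z.1‖ ≤ R ∧ ‖z.2‖ ≤ R := by
  filter_upwards [ae_fst_of_plan h hμ.ae_norm_le, ae_snd_of_plan h hν.ae_norm_le] with z h1 h2
  exact ⟨h1, h2⟩

theorem map_mem_plans {Ω : Type*} [MeasurableSpace Ω] {P : Measure Ω} {f g : Ω → E d}
    (hf : Measurable f) (hg : Measurable g) :
    P.map (fun ω => (f ω, g ω)) ∈ plans (P.map f) (P.map g) := by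
  constructor
  · rw [Measure.map_map measurable_fst (hf.prodMk hg)]; rfl
  · rw [Measure.map_map measurable_snd (hf.prodMk hg)]; rfl

theorem planCost_one_eq {γ : Measure (E d × E d)}
    (h : Integrable (fun z : E d × E d => ‖z.1 - z.2‖) γ) :
    planCost 1 γ = ENNReal.ofReal (∫ z, ‖z.1 - z.2‖ ∂γ) := by
  rw [ofReal_integral_eq_lintegral_ofReal h (ae_of_all _ fun z => norm_nonneg _)]
  simp only [planCost, pow_one]
  refine lintegral_congr fun z => ?_
  rw [edist_dist, dist_eq_norm]

theorem wass_one_eq (μ ν : Measure (E d)) :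
    wass 1 μ ν = (⨅ γ ∈ plans μ ν, planCost 1 γ).toReal := by
  simp [wass]

theorem wass_nonneg (p : ℕ) (μ ν : Measure (E d)) : 0 ≤ wass p μ ν := ENNReal.toReal_nonneg

theorem wass_one_le_of_plan {μ ν : Measure (E d)} {γ : Measure (E d × E d)} (hγ : γ ∈ plans μ ν)
    (h : Integrable (fun z : E d × E d => ‖z.1 - z.2‖) γ) :
    wass 1 μ ν ≤ ∫ z, ‖z.1 - z.2‖ ∂γ := by
  rw [wass_one_eq]
  have h0 : 0 ≤ ∫ z, ‖z.1 - z.2‖ ∂γ := integral_nonneg fun _ => norm_nonneg _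
  refine ENNReal.toReal_le_of_le_ofReal h0 ?_
  rw [← planCost_one_eq h]
  exact iInf₂_le γ hγ

/-- The distance `W₁` between the laws of two random variables is at most their mean distance. -/
theorem wass_one_map_le {Ω : Type*} [MeasurableSpace Ω] {P : Measure Ω} {f g : Ω → E d}
    (hf : Measurable f) (hg : Measurable g) (h : Integrable (fun ω => ‖f ω - g ω‖) P) :
    wass 1 (P.map f) (P.map g) ≤ ∫ ω, ‖f ω - g ω‖ ∂P := by
  have hm : Measurable fun ω => (f ω, g ω) := hf.prodMk hg
  have hc : Continuous fun z : E d × E d => ‖z.1 - z.2‖ := by fun_prop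
  have := wass_one_le_of_plan (map_mem_plans (P := P) hf hg)
    ((integrable_map_measure hc.aestronglyMeasurable hm.aemeasurable).2 h)
  rwa [integral_map hm.aemeasurable hc.aestronglyMeasurable] at this

theorem wass_one_map_le_of_bound {Ω : Type*} [MeasurableSpace Ω] {P : Measure Ω}
    [IsProbabilityMeasure P] {f g : Ω → E d} (hf : Measurable f) (hg : Measurable g) {C : ℝ}
    (h : ∀ᵐ ω ∂P, ‖f ω - g ω‖ ≤ C) : wass 1 (P.map f) (P.map g) ≤ C := by
  have hi : Integrable (fun ω => ‖f ω - g ω‖) P :=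
    integrable_of_ae_norm_le (hf.sub hg).norm.aestronglyMeasurable (C := C) (by simpa using h)
  refine (wass_one_map_le hf hg hi).trans ?_
  have := integral_mono_ae hi (integrable_const C) h
  simpa using this

theorem prod_mem_plans {μ ν : Measure (E d)} [IsProbabilityMeasure μ] [IsProbabilityMeasure ν] :
    μ.prod ν ∈ plans μ ν := by
  constructor
  · rw [← Measure.fst]; simp
  · rw [← Measure.snd]; simp

theorem integrable_norm_sub_of_plan {R : ℝ} {μ ν : Measure (E d)} (hμ : ProbOn (ball0 d R) μ)
    (hν : ProbOn (ball0 d R) ν) {γ : Measure (E d × E d)} (h : γ ∈ plans μ ν) :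
    Integrable (fun z : E d × E d => ‖z.1 - z.2‖) γ := by
  have := hμ.1
  have := isProbabilityMeasure_of_plan h
  have hc : Continuous fun z : E d × E d => ‖z.1 - z.2‖ := by fun_prop
  refine integrable_of_ae_norm_le hc.aestronglyMeasurable (C := R + R) ?_
  filter_upwards [ae_mem_of_plan hμ hν h] with z hz
  simpa using (norm_sub_le _ _).trans (add_le_add hz.1 hz.2)

theorem wass_one_le_of_probOn {R : ℝ} {μ ν : Measure (E d)} (hμ : ProbOn (ball0 d R) μ)
    (hν : ProbOn (ball0 d R) ν) : wass 1 μ ν ≤ 2 * R := by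
  have := hμ.1
  have := hν.1
  refine (wass_one_le_of_plan prod_mem_plans
    (integrable_norm_sub_of_plan hμ hν prod_mem_plans)).trans ?_
  have h1 := integral_mono_ae (integrable_norm_sub_of_plan hμ hν prod_mem_plans)
    (integrable_const (2 * R)) (by
      filter_upwards [ae_mem_of_plan hμ hν prod_mem_plans] with z hz
      have := norm_sub_le z.1 z.2
      have := hz.1
      have := hz.2
      linarith)
  simpa using h1

/-- To bound `W₁` from below it suffices to bound the cost of every plan. -/
theorem le_wass_one {R c : ℝ} {μ ν : Measure (E d)} (hμ : ProbOn (ball0 d R) μ)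
    (hν : ProbOn (ball0 d R) ν)
    (h : ∀ γ ∈ plans μ ν, c ≤ ∫ z, ‖z.1 - z.2‖ ∂γ) : c ≤ wass 1 μ ν := by
  have := hμ.1
  have := hν.1
  rw [wass_one_eq]
  have hne : (⨅ γ ∈ plans μ ν, planCost 1 γ) ≠ ⊤ := by
    refine ne_top_of_le_ne_top ?_ (iInf₂_le (μ.prod ν) prod_mem_plans)
    rw [planCost_one_eq (integrable_norm_sub_of_plan hμ hν prod_mem_plans)]
    exact ENNReal.ofReal_ne_top
  rw [← ENNReal.ofReal_le_iff_le_toReal hne]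
  refine le_iInf₂ fun γ hγ => ?_
  rw [planCost_one_eq (integrable_norm_sub_of_plan hμ hν hγ)]
  exact ENNReal.ofReal_le_ofReal (h γ hγ)

/-- The easy half of Kantorovich duality. -/
theorem norm_integral_sub_le_wass {F : Type*} [NormedAddCommGroup F] [NormedSpace ℝ F]
    [CompleteSpace F] [SecondCountableTopologyEither (E d) F]
    {R K : ℝ} {μ ν : Measure (E d)} (hμ : ProbOn (ball0 d R) μ) (hν : ProbOn (ball0 d R) ν)
    {f : E d → F} (hfc : Continuous f) (hK : 0 ≤ K)
    (hf : ∀ x ∈ ball0 d R, ∀ y ∈ ball0 d R, ‖f x - f y‖ ≤ K * ‖x - y‖) :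
    ‖∫ x, f x ∂μ - ∫ x, f x ∂ν‖ ≤ K * wass 1 μ ν := by
  rcases hK.eq_or_lt with rfl | hK
  · have hc : ∀ x ∈ ball0 d R, ∀ y ∈ ball0 d R, f x = f y := by
      intro x hx y hy
      simpa [sub_eq_zero] using hf x hx y hy
    have := hμ.1
    obtain ⟨x₀, hx₀⟩ := hμ.ae_mem.exists
    have e1 : ∫ x, f x ∂μ = f x₀ := by
      rw [integral_congr_ae (g := fun _ => f x₀)
        (by filter_upwards [hμ.ae_mem] with x hx using hc x hx x₀ hx₀)]
      simp
    have := hν.1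
    have e2 : ∫ x, f x ∂ν = f x₀ := by
      rw [integral_congr_ae (g := fun _ => f x₀)
        (by filter_upwards [hν.ae_mem] with x hx using hc x hx x₀ hx₀)]
      simp
    simp [e1, e2]
  rw [← div_le_iff₀' hK]
  refine le_wass_one hμ hν fun γ hγ => ?_
  rw [div_le_iff₀' hK]
  have h1 : ∫ x, f x ∂μ = ∫ z, f z.1 ∂γ := by
    rw [← hγ.1, integral_map measurable_fst.aemeasurable]
    exact hfc.aestronglyMeasurable
  have h2 : ∫ x, f x ∂ν = ∫ z, f z.2 ∂γ := by
    rw [← hγ.2, integral_map measurable_snd.aemeasurable]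
    exact hfc.aestronglyMeasurable
  have i1 : Integrable (fun z : E d × E d => f z.1) γ := by
    have := hμ.integrable hfc
    rw [← hγ.1] at this
    exact this.comp_measurable measurable_fst
  have i2 : Integrable (fun z : E d × E d => f z.2) γ := by
    have := hν.integrable hfc
    rw [← hγ.2] at this
    exact this.comp_measurable measurable_snd
  rw [h1, h2, ← integral_sub i1 i2, ← integral_const_mul]
  refine norm_integral_le_of_norm_le ((integrable_norm_sub_of_plan hμ hν hγ).const_mul K) ?_
  filter_upwards [ae_mem_of_plan hμ hν hγ] with z hz
  exact hf _ (by simpa using hz.1) _ (by simpa using hz.2)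

theorem wass_one_map_le_mul {R K : ℝ} (hK : 0 < K) {μ ν : Measure (E d)}
    (hμ : ProbOn (ball0 d R) μ) (hν : ProbOn (ball0 d R) ν) {f : E d → E d} (hf : Continuous f)
    (hfK : ∀ x y, ‖f x - f y‖ ≤ K * ‖x - y‖) :
    wass 1 (μ.map f) (ν.map f) ≤ K * wass 1 μ ν := by
  rw [← div_le_iff₀' hK]
  refine le_wass_one hμ hν fun γ hγ => ?_
  rw [div_le_iff₀' hK]
  have h1 : μ.map f = γ.map (fun z => f z.1) := by
    rw [← hγ.1, Measure.map_map hf.measurable measurable_fst]; rfl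
  have h2 : ν.map f = γ.map (fun z => f z.2) := by
    rw [← hγ.2, Measure.map_map hf.measurable measurable_snd]; rfl
  have hi := (integrable_norm_sub_of_plan hμ hν hγ).const_mul K
  have hi' : Integrable (fun z : E d × E d => ‖f z.1 - f z.2‖) γ := by
    refine hi.mono' (Continuous.aestronglyMeasurable (by fun_prop)) (ae_of_all _ fun z => ?_)
    simpa using hfK z.1 z.2
  rw [h1, h2, ← integral_const_mul]
  refine (wass_one_map_le (hf.measurable.comp measurable_fst) (hf.measurable.comp measurable_snd)
    hi').trans (integral_mono hi' hi fun z => hfK z.1 z.2)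

theorem wassPlan_sq (γ : Measure (E d × E d)) : wassPlan γ ^ 2 = ∫ z, ‖z.1 - z.2‖ ^ 2 ∂γ :=
  Real.sq_sqrt (integral_nonneg fun _ => by positivity)

theorem integrable_norm_sub_sq_of_plan {R : ℝ} {μ ν : Measure (E d)} (hμ : ProbOn (ball0 d R) μ)
    (hν : ProbOn (ball0 d R) ν) {γ : Measure (E d × E d)} (h : γ ∈ plans μ ν) :
    Integrable (fun z : E d × E d => ‖z.1 - z.2‖ ^ 2) γ := by
  have := hμ.1
  have := isProbabilityMeasure_of_plan h
  have hc : Continuous fun z : E d × E d => ‖z.1 - z.2‖ ^ 2 := by fun_prop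
  refine integrable_of_ae_norm_le hc.aestronglyMeasurable (C := (R + R) ^ 2) ?_
  filter_upwards [ae_mem_of_plan hμ hν h] with z hz
  have := (norm_sub_le _ _).trans (add_le_add hz.1 hz.2)
  rw [Real.norm_of_nonneg (by positivity)]
  gcongr

theorem planCost_two_eq {γ : Measure (E d × E d)}
    (h : Integrable (fun z : E d × E d => ‖z.1 - z.2‖ ^ 2) γ) :
    planCost 2 γ = ENNReal.ofReal (wassPlan γ ^ 2) := by
  rw [wassPlan_sq, ofReal_integral_eq_lintegral_ofReal h (ae_of_all _ fun z => by positivity)]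
  simp only [planCost]
  refine lintegral_congr fun z => ?_
  rw [edist_dist, dist_eq_norm, ENNReal.ofReal_pow (norm_nonneg _)]

theorem wass_two_eq_of_optPlan {R : ℝ} {μ ν : Measure (E d)} (hμ : ProbOn (ball0 d R) μ)
    (hν : ProbOn (ball0 d R) ν) {γ : Measure (E d × E d)} (h : γ ∈ optPlans μ ν) :
    wass 2 μ ν = wassPlan γ := by
  have h1 : (⨅ γ ∈ plans μ ν, planCost 2 γ) = planCost 2 γ :=
    le_antisymm (iInf₂_le γ h.1) (le_iInf₂ h.2)
  have h0 : 0 ≤ wassPlan γ := Real.sqrt_nonneg _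
  rw [wass, h1, planCost_two_eq (integrable_norm_sub_sq_of_plan hμ hν h.1),
    ENNReal.ofReal_rpow_of_nonneg (by positivity) (by norm_num),
    ENNReal.toReal_ofReal (by positivity), ← Real.rpow_natCast, ← Real.rpow_mul h0]
  norm_num

theorem sq_integral_le {Ω : Type*} [MeasurableSpace Ω] {P : Measure Ω} [IsProbabilityMeasure P]
    {f : Ω → ℝ} (hf : Integrable f P) (hf2 : Integrable (fun ω => f ω ^ 2) P) :
    (∫ ω, f ω ∂P) ^ 2 ≤ ∫ ω, f ω ^ 2 ∂P := by
  set c := ∫ ω, f ω ∂P with hc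
  have h : 0 ≤ ∫ ω, (f ω - c) ^ 2 ∂P := integral_nonneg fun _ => sq_nonneg _
  have e : ∫ ω, (f ω - c) ^ 2 ∂P = (∫ ω, f ω ^ 2 ∂P) - c ^ 2 := by
    have : ∀ ω, (f ω - c) ^ 2 = f ω ^ 2 - (2 * c) * f ω + c ^ 2 := fun ω => by ring
    simp_rw [this]
    have hi : Integrable (fun ω => f ω ^ 2 - 2 * c * f ω) P := hf2.sub (hf.const_mul _)
    rw [integral_add hi (integrable_const _),
      integral_sub hf2 (hf.const_mul _), integral_const_mul, ← hc]
    simp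
    ring
  linarith

theorem measurable_interp (lam : ℝ) :
    Measurable fun z : E d × E d => (1 - lam) • z.1 + lam • z.2 :=
  Continuous.measurable (by fun_prop)

theorem norm_convexComb_le {R lam : ℝ} (hlam : lam ∈ Icc (0 : ℝ) 1) {x y : E d} (hx : ‖x‖ ≤ R)
    (hy : ‖y‖ ≤ R) : ‖(1 - lam) • x + lam • y‖ ≤ R := by
  have h1 : 0 ≤ 1 - lam := by linarith [hlam.2]
  calc ‖(1 - lam) • x + lam • y‖ ≤ ‖(1 - lam) • x‖ + ‖lam • y‖ := norm_add_le _ _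
    _ = (1 - lam) * ‖x‖ + lam * ‖y‖ := by
        rw [norm_smul, norm_smul, Real.norm_of_nonneg h1, Real.norm_of_nonneg hlam.1]
    _ ≤ (1 - lam) * R + lam * R := by
        gcongr
        exact hlam.1
    _ = R := by ring

theorem probOn_interp {R lam : ℝ} (hlam : lam ∈ Icc (0 : ℝ) 1) {γ : Measure (E d × E d)}
    [IsProbabilityMeasure γ] (h : ∀ᵐ z ∂γ, ‖z.1‖ ≤ R ∧ ‖z.2‖ ≤ R) :
    ProbOn (ball0 d R) (interp γ lam) := by
  refine probOn_map (measurable_interp lam) ?_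
  filter_upwards [h] with z hz using norm_convexComb_le hlam hz.1 hz.2

/-! ### The radial retraction onto a ball -/

/-- The radial retraction of `ℝ^d` onto the closed ball of radius `R > 0`. -/
noncomputable def retract (R : ℝ) (x : E d) : E d := (R / max R ‖x‖) • x

theorem retract_of_norm_le {R : ℝ} (hR : 0 < R) {x : E d} (hx : ‖x‖ ≤ R) : retract R x = x := by
  simp [retract, max_eq_left hx, hR.ne']

theorem norm_retract_le {R : ℝ} (hR : 0 < R) (x : E d) : ‖retract R x‖ ≤ R := by
  have h : 0 < max R ‖x‖ := lt_max_of_lt_left hR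
  rw [retract, norm_smul, Real.norm_of_nonneg (by positivity), div_mul_eq_mul_div, div_le_iff₀ h]
  gcongr
  exact le_max_right _ _

theorem norm_retract_le_norm {R : ℝ} (hR : 0 < R) (x : E d) : ‖retract R x‖ ≤ ‖x‖ := by
  have h : 0 < max R ‖x‖ := lt_max_of_lt_left hR
  rw [retract, norm_smul, Real.norm_of_nonneg (by positivity)]
  refine mul_le_of_le_one_left (norm_nonneg _) ?_
  rw [div_le_one h]
  exact le_max_left _ _

theorem norm_retract_sub_le {R : ℝ} (hR : 0 < R) (x y : E d) :
    ‖retract R x - retract R y‖ ≤ 2 * ‖x - y‖ := by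
  set a := max R ‖x‖ with ha
  set b := max R ‖y‖ with hb
  have ha0 : 0 < a := lt_max_of_lt_left hR
  have hb0 : 0 < b := lt_max_of_lt_left hR
  have e : retract R x - retract R y = (R / a) • (x - y) + (R / a - R / b) • y := by
    simp only [retract, ← ha, ← hb, smul_sub, sub_smul]
    abel
  have h1 : |b - a| ≤ ‖x - y‖ := by
    have := abs_max_sub_max_le_max R ‖y‖ R ‖x‖
    rw [← ha, ← hb, sub_self, abs_zero, max_eq_right (abs_nonneg _)] at this
    refine this.trans ?_
    rw [norm_sub_rev]
    exact abs_norm_sub_norm_le y x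
  have h2 : ‖(R / a - R / b) • y‖ ≤ ‖x - y‖ := by
    rw [norm_smul, Real.norm_eq_abs]
    have : R / a - R / b = R / a * ((b - a) / b) := by field_simp
    rw [this, abs_mul, abs_div (b - a), abs_of_pos hb0, abs_of_pos (div_pos hR ha0)]
    have h3 : R / a ≤ 1 := (div_le_one ha0).2 (le_max_left _ _)
    calc R / a * (|b - a| / b) * ‖y‖ ≤ 1 * (|b - a| / b) * b := by
          gcongr
          exact le_max_right _ _
      _ = |b - a| := by field_simp
      _ ≤ _ := h1
  have h4 : ‖(R / a) • (x - y)‖ ≤ ‖x - y‖ := by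
    rw [norm_smul, Real.norm_of_nonneg (by positivity)]
    exact mul_le_of_le_one_left (norm_nonneg _) ((div_le_one ha0).2 (le_max_left _ _))
  rw [e]
  linarith [norm_add_le ((R / a) • (x - y)) ((R / a - R / b) • y)]

theorem continuous_retract {R : ℝ} (hR : 0 < R) : Continuous (retract R : E d → E d) :=
  (LipschitzWith.of_dist_le_mul (K := 2) fun x y => by
    simpa [dist_eq_norm] using norm_retract_sub_le hR x y).continuous

end Toolkit

end WassersteinControl

namespace WassersteinControl

/-! ### From optimal plans to arbitrary plans -/

section OneDim

/-- A function on `[0,1]` whose second differences are locally bounded by `2ch²` away from finitely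
many interior points, and which is differentiable at these points, is `c`-semiconcave. -/
theorem semiconcave_of_local {f : ℝ → ℝ} {c : ℝ} (hf : ContinuousOn f (Icc 0 1)) {S : Set ℝ}
    (hS : S.Finite) (hd : ∀ t ∈ S, t ∈ Ioo (0 : ℝ) 1 → DifferentiableAt ℝ f t)
    (hloc : ∀ t ∈ Ioo (0 : ℝ) 1, t ∉ S →
      ∀ᶠ h in 𝓝[>] (0 : ℝ), f (t - h) + f (t + h) - 2 * f t ≤ 2 * c * h ^ 2)
    {lam : ℝ} (hlam : lam ∈ Icc (0 : ℝ) 1) :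
    (1 - lam) * f 0 + lam * f 1 - f lam ≤ c * (lam * (1 - lam)) := by
  by_contra! hcon
  -- If the bound fails at `lam`, the perturbed function `g` below is negative there, so that its
  -- minimum is negative and attained in the interior, since `g ≥ 0` at the end points.
  set k : ℝ → ℝ := fun t => f t - (1 - t) * f 0 - t * f 1 + c * (t * (1 - t)) with hk
  have hk0 : k 0 = 0 := by simp [hk]
  have hk1 : k 1 = 0 := by simp [hk]
  have hkl : k lam < 0 := by simp only [hk]; linarith
  set δ := -k lam / 4 with hδ
  have hδ0 : 0 < δ := by rw [hδ]; linarith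
  -- The slope `η` is chosen so that no point of `S` can be critical for the perturbed function.
  obtain ⟨η, hη, hηS⟩ : ∃ η ∈ Ioo 0 δ,
      η ∉ (fun t => -deriv (fun t => k t + δ * (t * (1 - t))) t) '' S := by
    have : (Ioo 0 δ \ ((fun t => -deriv (fun t => k t + δ * (t * (1 - t))) t) '' S)).Nonempty :=
      ((Ioo_infinite hδ0).sdiff (hS.image _)).nonempty
    obtain ⟨η, h1, h2⟩ := this
    exact ⟨η, h1, h2⟩
  set g : ℝ → ℝ := fun t => k t + δ * (t * (1 - t)) + η * t with hg
  have hgc : ContinuousOn g (Icc 0 1) := by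
    simp only [hg, hk]
    fun_prop
  obtain ⟨s, hs, hmin⟩ := isCompact_Icc.exists_isMinOn ⟨lam, hlam⟩ hgc
  have hgl : g lam < 0 := by
    have h1 : lam * (1 - lam) ≤ 1 := by nlinarith [hlam.1, hlam.2]
    have h2 : δ * (lam * (1 - lam)) ≤ δ * 1 := by gcongr
    have h3 : η * lam ≤ δ * 1 := by
      have := hη.1; have := hη.2; have := hlam.1; have := hlam.2
      gcongr
    simp only [hg]
    linarith
  have hgs : g s < 0 := (hmin hlam).trans_lt hgl
  have hs' : s ∈ Ioo (0 : ℝ) 1 := by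
    refine ⟨lt_of_le_of_ne hs.1 ?_, lt_of_le_of_ne hs.2 ?_⟩
    · rintro rfl
      simp [hg, hk0] at hgs
    · rintro rfl
      simp [hg, hk1] at hgs
      linarith [hη.1]
  have hnhds : Icc (0 : ℝ) 1 ∈ 𝓝 s := Icc_mem_nhds hs'.1 hs'.2
  -- A minimum in `S` is a critical point, which `η` excludes; elsewhere the second difference of
  -- `g` at its minimum is nonnegative, but it is at most `-2δh²`.
  by_cases hsS : s ∈ S
  · have hdf := hd s hsS hs'
    have hloc : IsLocalMin g s := hmin.isLocalMin hnhds
    have hd1 : DifferentiableAt ℝ (fun t => k t + δ * (t * (1 - t))) s := by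
      simp only [hk]
      fun_prop
    have hd2 : HasDerivAt g (deriv (fun t => k t + δ * (t * (1 - t))) s + η * 1) s :=
      hd1.hasDerivAt.add ((hasDerivAt_id s).const_mul η)
    have := hloc.hasDerivAt_eq_zero hd2
    exact hηS ⟨s, hsS, by simp only; linarith⟩
  · have h1 := hloc s hs' hsS
    have h2 : ∀ᶠ h in 𝓝[>] (0 : ℝ), s - h ∈ Icc (0 : ℝ) 1 := by
      have : Tendsto (fun h : ℝ => s - h) (𝓝[>] 0) (𝓝 s) := by
        have : Continuous fun h : ℝ => s - h := by fun_prop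
        simpa using this.continuousWithinAt (s := Ioi 0) (x := 0) |>.tendsto
      exact this hnhds
    have h3 : ∀ᶠ h in 𝓝[>] (0 : ℝ), s + h ∈ Icc (0 : ℝ) 1 := by
      have : Tendsto (fun h : ℝ => s + h) (𝓝[>] 0) (𝓝 s) := by
        have : Continuous fun h : ℝ => s + h := by fun_prop
        simpa using this.continuousWithinAt (s := Ioi 0) (x := 0) |>.tendsto
      exact this hnhds
    obtain ⟨h, h1, h2, h3, h4⟩ := (h1.and (h2.and (h3.and self_mem_nhdsWithin))).exists
    have h5 := hmin h2
    have h6 := hmin h3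
    simp only [hg, hk, mem_ofPred_eq] at h5 h6
    have h7 : 0 < δ * h ^ 2 := mul_pos hδ0 (pow_pos h4 2)
    nlinarith

end OneDim

section Discrete

variable {d : ℕ} {Ω : Type*} [MeasurableSpace Ω]

/-- A coupling that sends each atom of the first law to a nearest atom of the second is optimal. -/
theorem map_mem_optPlans {P : Measure Ω} {S : Set Ω} (hP : ∀ᵐ ω ∂P, ω ∈ S) {f g : Ω → E d}
    (hf : Measurable f) (hg : Measurable g)
    (h : ∀ a ∈ S, ∀ b ∈ S, ‖f a - g a‖ ≤ ‖f a - g b‖) :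
    P.map (fun ω => (f ω, g ω)) ∈ optPlans (P.map f) (P.map g) := by
  refine ⟨map_mem_plans hf hg, fun γ' hγ' => ?_⟩
  -- The squared distance to the atoms of the second law bounds the cost of any plan from below,
  -- and its integral depends on the first law only. The closure makes measurability automatic.
  set D : E d → ℝ≥0∞ := fun x => Metric.infEDist x (closure (g '' S)) ^ 2 with hD
  have hDm : Measurable D := (Metric.continuous_infEDist.measurable).pow_const 2
  have hcost : Measurable fun z : E d × E d => edist z.1 z.2 ^ 2 :=
    (measurable_edist).pow_const 2
  calc planCost 2 (P.map fun ω => (f ω, g ω)) = ∫⁻ ω, edist (f ω) (g ω) ^ 2 ∂P := by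
        rw [planCost, lintegral_map hcost (hf.prodMk hg)]
    _ ≤ ∫⁻ ω, D (f ω) ∂P := by
        refine lintegral_mono_ae ?_
        filter_upwards [hP] with a ha
        simp only [hD]
        gcongr
        rw [Metric.infEDist_closure]
        refine Metric.le_infEDist.2 ?_
        rintro _ ⟨b, hb, rfl⟩
        rw [edist_dist, edist_dist, dist_eq_norm, dist_eq_norm]
        exact ENNReal.ofReal_le_ofReal (h a ha b hb)
    _ = ∫⁻ z, D z.1 ∂γ' := by
        rw [← lintegral_map hDm hf, ← hγ'.1, lintegral_map hDm measurable_fst]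
    _ ≤ planCost 2 γ' := by
        refine lintegral_mono_ae ?_
        have hcl : ∀ᵐ y ∂(P.map g), y ∈ closure (g '' S) := by
          refine (ae_map_iff hg.aemeasurable isClosed_closure.measurableSet).2 ?_
          filter_upwards [hP] with a ha using subset_closure ⟨a, ha, rfl⟩
        filter_upwards [ae_snd_of_plan hγ' hcl] with z hz
        simp only [hD]
        gcongr
        exact Metric.infEDist_le_edist_of_mem hz

theorem measurable_of_eq_zero_off_finite {X F : Type*} [MeasurableSpace X]
    [MeasurableSingletonClass X] [MeasurableSpace F] [Zero F] {T : Set X} (hT : T.Finite)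
    {p : X → F} (hp : ∀ x ∉ T, p x = 0) : Measurable p := by
  refine measurable_of_restrict_of_restrict_compl hT.measurableSet ?_ ?_
  · have := hT.to_subtype
    exact measurable_of_countable _
  · have : Tᶜ.domRestrict p = fun _ => 0 := by
      ext x
      exact hp x x.2
    rw [this]
    exact measurable_const

/-- A coupling of finitely many atoms for which the first atom is the unique nearest one to the
second is the only optimal plan. -/
theorem optPlans_eq_singleton {P : Measure Ω} [IsProbabilityMeasure P] {S : Set Ω} (hS : S.Finite)
    (hP : ∀ᵐ ω ∂P, ω ∈ S)
    {f g : Ω → E d} (hf : Measurable f) (hg : Measurable g)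
    (h : ∀ a ∈ S, ∀ b ∈ S, f a ≠ f b → ‖f a - g a‖ < ‖f b - g a‖) :
    optPlans (P.map f) (P.map g) = {P.map (fun ω => (f ω, g ω))} := by
  have h' : ∀ a ∈ S, ∀ b ∈ S, ‖f a - g a‖ ≤ ‖f b - g a‖ := fun a ha b hb => by
    by_cases hab : f a = f b
    · rw [hab]
    · exact (h a ha b hb hab).le
  set D : E d → ℝ≥0∞ := fun y => Metric.infEDist y (f '' S) ^ 2 with hD
  have hDm : Measurable D := (Metric.continuous_infEDist.measurable).pow_const 2
  have hcost : Measurable fun z : E d × E d => edist z.1 z.2 ^ 2 :=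
    (measurable_edist).pow_const 2
  have hDS : ∀ a ∈ S, D (g a) = edist (f a) (g a) ^ 2 := fun a ha => by
    simp only [hD]
    congr 1
    refine le_antisymm ?_ (Metric.le_infEDist.2 ?_)
    · rw [edist_comm]
      exact Metric.infEDist_le_edist_of_mem ⟨a, ha, rfl⟩
    · rintro _ ⟨b, hb, rfl⟩
      rw [edist_dist, edist_dist, dist_eq_norm, dist_comm, dist_eq_norm]
      exact ENNReal.ofReal_le_ofReal (h' a ha b hb)
  have hfS : ∀ᵐ y ∂(P.map f), y ∈ f '' S := by
    refine (ae_map_iff hf.aemeasurable (hS.image f).measurableSet).2 ?_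
    filter_upwards [hP] with a ha using ⟨a, ha, rfl⟩
  have hgS : ∀ᵐ y ∂(P.map g), y ∈ g '' S := by
    refine (ae_map_iff hg.aemeasurable (hS.image g).measurableSet).2 ?_
    filter_upwards [hP] with a ha using ⟨a, ha, rfl⟩
  have hcostP : planCost 2 (P.map fun ω => (f ω, g ω)) = ∫⁻ y, D y ∂(P.map g) := by
    rw [planCost, lintegral_map hcost (hf.prodMk hg), lintegral_map hDm hg]
    refine lintegral_congr_ae ?_
    filter_upwards [hP] with a ha using (hDS a ha).symm
  have hle : ∀ γ' ∈ plans (P.map f) (P.map g),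
      (fun z : E d × E d => D z.2) ≤ᵐ[γ'] fun z => edist z.1 z.2 ^ 2 := by
    intro γ' hγ'
    filter_upwards [ae_fst_of_plan hγ' hfS] with z hz
    simp only [hD]
    gcongr
    rw [edist_comm]
    exact Metric.infEDist_le_edist_of_mem hz
  have hint : ∀ γ' ∈ plans (P.map f) (P.map g),
      ∫⁻ z, D z.2 ∂γ' = planCost 2 (P.map fun ω => (f ω, g ω)) := by
    intro γ' hγ'
    rw [hcostP, ← hγ'.2, lintegral_map hDm measurable_snd]
  have hfin : planCost 2 (P.map fun ω => (f ω, g ω)) ≠ ⊤ := by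
    rw [hcostP, lintegral_map hDm hg]
    obtain ⟨C, hC⟩ : ∃ C : ℝ, ∀ a ∈ S, ‖f a - g a‖ ≤ C := by
      obtain ⟨C, hC⟩ := (hS.image fun a => ‖f a - g a‖).bddAbove
      exact ⟨C, fun a ha => hC ⟨a, ha, rfl⟩⟩
    have : ∫⁻ ω, D (g ω) ∂P ≤ ∫⁻ _, ENNReal.ofReal C ^ 2 ∂P := by
      refine lintegral_mono_ae ?_
      filter_upwards [hP] with a ha
      rw [hDS a ha, edist_dist, dist_eq_norm]
      gcongr
      exact hC a ha
    refine ne_top_of_le_ne_top ?_ this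
    simp
  have hmem : P.map (fun ω => (f ω, g ω)) ∈ optPlans (P.map f) (P.map g) :=
    ⟨map_mem_plans hf hg, fun γ' hγ' => by
      rw [← hint γ' hγ']
      exact lintegral_mono_ae (hle γ' hγ')⟩
  refine subset_antisymm (fun γ' hγ' => ?_) (singleton_subset_iff.2 hmem)
  -- The inverse coupling, defined on the finitely many atoms of the second law.
  classical
  set p : E d → E d := fun y => if hy : ∃ a ∈ S, g a = y then f hy.choose else 0 with hp
  have hpg : ∀ a ∈ S, p (g a) = f a := fun a ha => by
    have hy : ∃ b ∈ S, g b = g a := ⟨a, ha, rfl⟩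
    simp only [hp, dif_pos hy]
    by_contra hne
    have h1 := h _ hy.choose_spec.1 a ha hne
    have h2 := h' a ha _ hy.choose_spec.1
    rw [hy.choose_spec.2] at h1
    linarith
  have hpm : Measurable p := by
    refine measurable_of_eq_zero_off_finite (hS.image g) fun y hy => ?_
    simp only [hp]
    rw [dif_neg]
    rintro ⟨a, ha, rfl⟩
    exact hy ⟨a, ha, rfl⟩
  -- An optimal plan has the same cost as the given one, hence pays the least cost almost
  -- everywhere, and uniqueness of the nearest atom determines it.
  have hae : (fun z : E d × E d => D z.2) =ᵐ[γ'] fun z => edist z.1 z.2 ^ 2 := by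
    refine ae_eq_of_ae_le_of_lintegral_le (hle γ' hγ'.1) ?_ hcost.aemeasurable ?_
    · rw [hint γ' hγ'.1]; exact hfin
    · rw [hint γ' hγ'.1]
      exact hγ'.2 _ hmem.1
  have hz : ∀ᵐ z ∂γ', z = (p z.2, z.2) := by
    filter_upwards [hae, ae_fst_of_plan hγ'.1 hfS, ae_snd_of_plan hγ'.1 hgS]
    rintro ⟨x, y⟩ h1 ⟨b, hb, hx⟩ ⟨a, ha, hy⟩
    simp only at h1 hx hy ⊢
    subst hx hy
    rw [hpg a ha]
    by_contra hne
    have hne' : f a ≠ f b := fun h => hne (by rw [h])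
    rw [hDS a ha] at h1
    have h2 := h a ha b hb hne'
    have h3 : edist (f a) (g a) < edist (f b) (g a) := by
      rw [edist_dist, edist_dist, dist_eq_norm, dist_eq_norm]
      exact (ENNReal.ofReal_lt_ofReal_iff ((norm_nonneg _).trans_lt h2)).2 h2
    exact (ENNReal.pow_lt_pow_left two_ne_zero h3).ne h1
  rw [mem_singleton_iff]
  calc γ' = γ'.map id := Measure.map_id.symm
    _ = γ'.map (fun z => (p z.2, z.2)) := Measure.map_congr (by
        filter_upwards [hz] with z hz using hz)
    _ = (γ'.map Prod.snd).map (fun y => (p y, y)) := by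
        rw [Measure.map_map (hpm.prodMk measurable_id') measurable_snd]; rfl
    _ = P.map (fun ω => (p (g ω), g ω)) := by
        rw [hγ'.1.2, Measure.map_map (hpm.prodMk measurable_id') hg]; rfl
    _ = P.map (fun ω => (f ω, g ω)) := Measure.map_congr (by
        filter_upwards [hP] with a ha
        rw [hpg a ha])

end Discrete

section Paths

variable {d : ℕ}

/-- A functional with a Wasserstein gradient is differentiable along interpolations of finitely
supported plans: short displacements of finitely many atoms are optimal even where atoms meet,
because each displaced atom stays closest to its origin. -/
theorem differentiableAt_interp {φ : Measure (E d) → ℝ} {γ : Measure (E d × E d)}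
    [IsProbabilityMeasure γ] {S : Set (E d × E d)} (hS : S.Finite) (hγ : ∀ᵐ z ∂γ, z ∈ S) {t₀ : ℝ}
    {ξ : E d → E d} (hsub : InSubdiff φ (interp γ t₀) ξ)
    (hsup : InSuperdiff φ (interp γ t₀) ξ) :
    DifferentiableAt ℝ (fun s => φ (interp γ s)) t₀ := by
  set ℓ : ℝ → E d × E d → E d := fun s z => (1 - s) • z.1 + s • z.2 with hℓ
  have hℓm : ∀ s, Measurable (ℓ s) := measurable_interp
  have hdiff : ∀ s z, ℓ s z - ℓ t₀ z = (s - t₀) • (z.2 - z.1) := fun s z => by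
    simp only [hℓ]; module
  have hℓc : ∀ z, Continuous fun s => ℓ s z := fun z => by simp only [hℓ]; fun_prop
  set D := ∫ z, ‖z.1 - z.2‖ ^ 2 ∂γ with hD
  have hD0 : 0 ≤ D := integral_nonneg fun _ => by positivity
  set a := ∫ z, inner ℝ (ξ (ℓ t₀ z)) (z.2 - z.1) ∂γ with ha
  -- Close to `t₀` the displacement of the atoms is the only optimal plan
  have hopt : ∀ᶠ s in 𝓝 t₀, optPlans (interp γ t₀) (interp γ s) =
      {γ.map (fun z => (ℓ t₀ z, ℓ s z))} := by
    have : ∀ᶠ s in 𝓝 t₀, ∀ x ∈ S, ∀ y ∈ S, ℓ t₀ x ≠ ℓ t₀ y →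
        ‖ℓ t₀ x - ℓ s x‖ < ‖ℓ t₀ y - ℓ s x‖ := by
      refine (eventually_all_finite hS).2 fun x _ => (eventually_all_finite hS).2 fun y _ => ?_
      by_cases hxy : ℓ t₀ x = ℓ t₀ y
      · exact Eventually.of_forall fun s h => absurd hxy h
      · have h1 : ContinuousAt (fun s => ‖ℓ t₀ x - ℓ s x‖) t₀ :=
          (continuous_const.sub (hℓc x)).norm.continuousAt
        have h2 : ContinuousAt (fun s => ‖ℓ t₀ y - ℓ s x‖) t₀ :=
          (continuous_const.sub (hℓc x)).norm.continuousAt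
        have h3 : ‖ℓ t₀ x - ℓ t₀ x‖ < ‖ℓ t₀ y - ℓ t₀ x‖ := by
          rw [sub_self, norm_zero, norm_pos_iff, sub_ne_zero]
          exact fun h => hxy h.symm
        filter_upwards [h1.eventually_lt h2 h3] with s hs _ using hs
    filter_upwards [this] with s hs
    exact optPlans_eq_singleton hS hγ (hℓm t₀) (hℓm s) hs
  have hfat : ∀ᶠ s in 𝓝 t₀, ProbOn (fattening (interp γ t₀) 1) (interp γ s) := by
    have : ∀ᶠ s in 𝓝 t₀, ∀ x ∈ S, ‖ℓ s x - ℓ t₀ x‖ < 1 := by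
      refine (eventually_all_finite hS).2 fun x _ => ?_
      have h1 : ContinuousAt (fun s => ‖ℓ s x - ℓ t₀ x‖) t₀ :=
        ((hℓc x).sub continuous_const).norm.continuousAt
      exact h1.eventually_lt continuousAt_const (by simp)
    filter_upwards [this] with s hs
    refine ⟨Measure.isProbabilityMeasure_map (hℓm s).aemeasurable, ?_⟩
    have hsupp : ∀ᵐ z ∂γ, ℓ t₀ z ∈ (interp γ t₀).support :=
      ae_of_ae_map (hℓm t₀).aemeasurable Measure.support_mem_ae
    have h2 : ∀ᵐ x ∂(interp γ s), x ∈ ℓ s '' {z | z ∈ S ∧ ℓ t₀ z ∈ (interp γ t₀).support} := by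
      refine (ae_map_iff (hℓm s).aemeasurable
        ((hS.subset fun z hz => hz.1).image _).measurableSet).2 ?_
      filter_upwards [hγ, hsupp] with z h1 h2 using ⟨z, ⟨h1, h2⟩, rfl⟩
    have h3 : ∀ᵐ x ∂(interp γ s), x ∈ fattening (interp γ t₀) 1 := by
      filter_upwards [h2]
      rintro x ⟨z, ⟨hz, hz'⟩, rfl⟩
      refine mem_iUnion₂.2 ⟨_, hz', ?_⟩
      rw [Metric.mem_closedBall, dist_eq_norm]
      exact (hs z hz).le
    exact h3
  have hwass : ∀ᶠ s in 𝓝 t₀, wass 2 (interp γ t₀) (interp γ s) = |s - t₀| * √D := by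
    obtain ⟨C, hC⟩ : ∃ C : ℝ, ∀ z ∈ S, ‖z.1‖ + ‖z.2‖ ≤ C := by
      obtain ⟨C, hC⟩ := (hS.image fun z => ‖z.1‖ + ‖z.2‖).bddAbove
      exact ⟨C, fun a ha => hC ⟨a, ha, rfl⟩⟩
    have hpr : ∀ s, ProbOn (ball0 d (|1 - s| * C + |s| * C)) (interp γ s) := fun s => by
      refine probOn_map (measurable_interp s) ?_
      filter_upwards [hγ] with z hz
      have h0 := hC z hz
      have h1 := norm_nonneg z.1
      have h2 := norm_nonneg z.2
      refine (norm_add_le _ _).trans ?_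
      rw [norm_smul, norm_smul, Real.norm_eq_abs, Real.norm_eq_abs]
      gcongr <;> linarith
    filter_upwards [hopt] with s hs
    have hmem : γ.map (fun z => (ℓ t₀ z, ℓ s z)) ∈ optPlans (interp γ t₀) (interp γ s) := by
      rw [hs]; rfl
    rw [wass_two_eq_of_optPlan ((hpr t₀).mono_radius (le_max_left _ _))
      ((hpr s).mono_radius (le_max_right _ _)) hmem, wassPlan,
      integral_map ((hℓm t₀).prodMk (hℓm s)).aemeasurable
        (Continuous.aestronglyMeasurable (by fun_prop))]
    have : ∀ z, ‖ℓ t₀ z - ℓ s z‖ ^ 2 = (s - t₀) ^ 2 * ‖z.1 - z.2‖ ^ 2 := fun z => by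
      rw [norm_sub_rev, hdiff, norm_smul, mul_pow, norm_sub_rev z.1, Real.norm_eq_abs, sq_abs]
    simp_rw [this]
    rw [integral_const_mul, Real.sqrt_mul (sq_nonneg _), Real.sqrt_sq_eq_abs]
  have hinf : ∀ (η : E d → E d), AEStronglyMeasurable η (interp γ t₀) →
      ∀ᶠ s in 𝓝 t₀, (⨅ γ' : optPlans (interp γ t₀) (interp γ s),
        ∫ z, inner ℝ (η z.1) (z.2 - z.1) ∂(γ' : Measure (E d × E d))) =
          (s - t₀) * ∫ z, inner ℝ (η (ℓ t₀ z)) (z.2 - z.1) ∂γ := by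
    intro η hη
    filter_upwards [hopt] with s hs
    rw [hs, ciInf_unique]
    change ∫ z, inner ℝ (η z.1) (z.2 - z.1) ∂(γ.map fun z => (ℓ t₀ z, ℓ s z)) = _
    have hm := (hℓm t₀).prodMk (hℓm s)
    have hη' : AEStronglyMeasurable (fun z : E d × E d => inner ℝ (η z.1) (z.2 - z.1))
        (γ.map fun z => (ℓ t₀ z, ℓ s z)) := by
      refine AEStronglyMeasurable.inner (𝕜 := ℝ) ?_ (Continuous.aestronglyMeasurable (by fun_prop))
      refine AEStronglyMeasurable.comp_measurable (f := Prod.fst) ?_ measurable_fst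
      rwa [(map_mem_plans (hℓm t₀) (hℓm s)).1]
    rw [integral_map hm.aemeasurable hη', ← integral_const_mul]
    congr 1
    ext z
    simp only [hdiff, inner_smul_right]
  -- Along the only optimal plan the lower and upper gradient inequalities bracket the increment of
  -- `φ` by the same linear function.
  refine HasDerivAt.differentiableAt (f' := a) ?_
  rw [hasDerivAt_iff_isLittleO, Asymptotics.isLittleO_iff]
  intro c hc
  set ε := c / (√D + 1) with hε
  have hsD : 0 ≤ √D := Real.sqrt_nonneg D
  have hε0 : 0 < ε := by positivity
  have hεD : ε * √D ≤ c := by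
    rw [hε, div_mul_eq_mul_div, div_le_iff₀ (by positivity)]
    nlinarith
  obtain ⟨δ₁, hδ₁, h1⟩ := hsub.2 1 one_pos ε hε0
  obtain ⟨δ₂, hδ₂, h2⟩ := hsup.2 1 one_pos ε hε0
  have hsmall : ∀ δ > 0, ∀ᶠ s in 𝓝 t₀, |s - t₀| * √D < δ := fun δ hδ => by
    have : ContinuousAt (fun s => |s - t₀| * √D) t₀ := by fun_prop
    exact this.eventually_lt continuousAt_const (by simpa using hδ)
  filter_upwards [hfat, hwass, hinf ξ hsub.1.1, hinf _ hsup.1.1, hsmall δ₁ hδ₁, hsmall δ₂ hδ₂]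
    with s hs1 hs2 hs3 hs4 hs5 hs6
  have h3 := h1 _ hs1 (by rwa [hs2])
  have h4 := h2 _ hs1 (by rwa [hs2])
  rw [hs2, hs3] at h3
  rw [hs2, hs4] at h4
  simp only [inner_neg_left, integral_neg] at h4
  rw [Real.norm_eq_abs, Real.norm_eq_abs, smul_eq_mul, abs_le]
  have h5 : ε * (|s - t₀| * √D) ≤ c * |s - t₀| := by
    calc ε * (|s - t₀| * √D) = (ε * √D) * |s - t₀| := by ring
      _ ≤ _ := by gcongr
  constructor <;> linarith

theorem interp_zero {μ ν : Measure (E d)} {γ : Measure (E d × E d)} (h : γ ∈ plans μ ν) :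
    interp γ 0 = μ := by
  simpa [interp] using h.1

theorem interp_one {μ ν : Measure (E d)} {γ : Measure (E d × E d)} (h : γ ∈ plans μ ν) :
    interp γ 1 = ν := by
  simpa [interp] using h.2

end Paths

end WassersteinControl

namespace WassersteinControl

section StrongFromGeodesic

variable {d : ℕ}

theorem wassPlan_map_interp_sq (γ : Measure (E d × E d)) (s t : ℝ) :
    wassPlan (γ.map fun z => ((1 - s) • z.1 + s • z.2, (1 - t) • z.1 + t • z.2)) ^ 2 =
      (t - s) ^ 2 * wassPlan γ ^ 2 := by
  rw [wassPlan_sq, wassPlan_sq, integral_map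
    ((measurable_interp s).prodMk (measurable_interp t)).aemeasurable
      (Continuous.aestronglyMeasurable (by fun_prop)), ← integral_const_mul]
  congr 1
  ext z
  have : (1 - s) • z.1 + s • z.2 - ((1 - t) • z.1 + t • z.2) = (t - s) • (z.1 - z.2) := by module
  simp only [this, norm_smul, mul_pow, Real.norm_eq_abs, sq_abs]

theorem wass_one_interp_le {γ : Measure (E d × E d)} [IsProbabilityMeasure γ] {R : ℝ}
    (hγ : ∀ᵐ z ∂γ, ‖z.1‖ ≤ R ∧ ‖z.2‖ ≤ R) (s t : ℝ) :
    wass 1 (interp γ s) (interp γ t) ≤ |s - t| * (2 * R) := by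
  refine wass_one_map_le_of_bound (measurable_interp s) (measurable_interp t) ?_
  filter_upwards [hγ] with z hz
  have : (1 - s) • z.1 + s • z.2 - ((1 - t) • z.1 + t • z.2) = (s - t) • (z.2 - z.1) := by module
  rw [this, norm_smul, Real.norm_eq_abs]
  gcongr
  linarith [norm_sub_le z.2 z.1]

/-- Semiconcavity along optimal plans gives semiconcavity along plans of finite support. Along such
a plan, the displacement between two close times is optimal unless atoms meet in between; at the
finitely many meeting times differentiability is enough. -/
theorem semiconcave_along_finite_plan {R C : ℝ} {F : Measure (E d) → E d → ℝ}
    (hlip : ∃ L : ℝ, ∀ μ ν, ProbOn (ball0 d R) μ → ProbOn (ball0 d R) ν →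
      ∀ x ∈ ball0 d R, ∀ y ∈ ball0 d R, |F μ x - F ν y| ≤ L * (wass 1 μ ν + ‖x - y‖))
    (hopt : ∀ μ₁ μ₂, ProbOn (ball0 d R) μ₁ → ProbOn (ball0 d R) μ₂ → ∀ γ ∈ optPlans μ₁ μ₂,
      ∀ x ∈ ball0 d R, ∀ y ∈ ball0 d R, ∀ lam ∈ Icc (0 : ℝ) 1,
        (1 - lam) * F μ₁ x + lam * F μ₂ y - F (interp γ lam) ((1 - lam) • x + lam • y)
          ≤ C * (lam * (1 - lam)) * (‖x - y‖ ^ 2 + wass 2 μ₁ μ₂ ^ 2))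
    {γ : Measure (E d × E d)} [IsProbabilityMeasure γ] {S : Set (E d × E d)} (hS : S.Finite)
    (hSR : ∀ z ∈ S, ‖z.1‖ ≤ R ∧ ‖z.2‖ ≤ R) (hγ : ∀ᵐ z ∂γ, z ∈ S)
    {x y : E d} (hx : x ∈ ball0 d R) (hy : y ∈ ball0 d R)
    (hdiff : ∀ t ∈ Ioo (0 : ℝ) 1,
      DifferentiableAt ℝ (fun s => F (interp γ s) ((1 - s) • x + s • y)) t)
    {lam : ℝ} (hlam : lam ∈ Icc (0 : ℝ) 1) :
    (1 - lam) * F (interp γ 0) x + lam * F (interp γ 1) y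
        - F (interp γ lam) ((1 - lam) • x + lam • y)
      ≤ C * (lam * (1 - lam)) * (‖x - y‖ ^ 2 + wassPlan γ ^ 2) := by
  have hγR : ∀ᵐ z ∂γ, ‖z.1‖ ≤ R ∧ ‖z.2‖ ≤ R := by
    filter_upwards [hγ] with z hz using hSR z hz
  have hx' : ‖x‖ ≤ R := by simpa using hx
  have hy' : ‖y‖ ≤ R := by simpa using hy
  have hR : 0 ≤ R := (norm_nonneg _).trans hx'
  have hxs : ∀ s ∈ Icc (0 : ℝ) 1, (1 - s) • x + s • y ∈ ball0 d R := fun s hs => by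
    simpa using norm_convexComb_le hs hx' hy'
  have hms : ∀ s ∈ Icc (0 : ℝ) 1, ProbOn (ball0 d R) (interp γ s) := fun s hs =>
    probOn_interp hs hγR
  set f : ℝ → ℝ := fun s => F (interp γ s) ((1 - s) • x + s • y) with hf
  have hfc : ContinuousOn f (Icc 0 1) := by
    obtain ⟨L, hL⟩ := hlip
    have hlip' : LipschitzOnWith (Real.toNNReal (|L| * (2 * R + ‖x - y‖))) f (Icc 0 1) := by
      refine LipschitzOnWith.of_dist_le_mul fun s hs t ht => ?_
      rw [Real.dist_eq, Real.dist_eq, Real.coe_toNNReal _ (by positivity)]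
      refine (hL _ _ (hms s hs) (hms t ht) _ (hxs s hs) _ (hxs t ht)).trans ?_
      have e : (1 - s) • x + s • y - ((1 - t) • x + t • y) = (t - s) • (x - y) := by module
      have h0 := wass_nonneg 1 (interp γ s) (interp γ t)
      calc L * (wass 1 (interp γ s) (interp γ t) + ‖(1 - s) • x + s • y - ((1 - t) • x + t • y)‖)
          ≤ |L| * (|s - t| * (2 * R) + |s - t| * ‖x - y‖) := by
            rw [e, norm_smul, Real.norm_eq_abs, abs_sub_comm t s]
            have := wass_one_interp_le hγR s t
            have := le_abs_self L
            gcongr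
        _ = _ := by ring
    exact hlip'.continuousOn
  -- The finitely many times at which two trajectories of atoms meet.
  set T : Set ℝ := ⋃ a ∈ S, ⋃ b ∈ S, {t : ℝ | a ≠ b ∧
    (1 - t) • a.1 + t • a.2 = (1 - t) • b.1 + t • b.2} with hT
  have hTf : T.Finite := by
    refine hS.biUnion fun a _ => hS.biUnion fun b _ => Set.Subsingleton.finite ?_
    rintro s ⟨hab, hs⟩ t ⟨-, ht⟩
    by_contra hst
    refine hab ?_
    have hst' : s - t ≠ 0 := sub_ne_zero.2 hst
    have h1 : (1 - s) • (a.1 - b.1) + s • (a.2 - b.2) = 0 := by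
      have := sub_eq_zero.2 hs
      rw [← this]; module
    have h2 : (1 - t) • (a.1 - b.1) + t • (a.2 - b.2) = 0 := by
      have := sub_eq_zero.2 ht
      rw [← this]; module
    have h3 : (s - t) • (a.1 - b.1) = 0 := by
      have : (s - t) • (a.1 - b.1) = s • ((1 - t) • (a.1 - b.1) + t • (a.2 - b.2)) -
        t • ((1 - s) • (a.1 - b.1) + s • (a.2 - b.2)) := by module
      rw [this, h1, h2]; simp
    have h4 : (s - t) • (a.2 - b.2) = 0 := by
      have : (s - t) • (a.2 - b.2) = (1 - t) • ((1 - s) • (a.1 - b.1) + s • (a.2 - b.2)) -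
        (1 - s) • ((1 - t) • (a.1 - b.1) + t • (a.2 - b.2)) := by module
      rw [this, h1, h2]; simp
    exact Prod.ext (sub_eq_zero.1 ((smul_eq_zero_iff_right hst').1 h3))
      (sub_eq_zero.1 ((smul_eq_zero_iff_right hst').1 h4))
  -- At the other times, close atoms of the displaced law come from the same atom, so that the
  -- displacement from `t - h` to `t + h` is optimal and the midpoint inequality is available.
  have key := semiconcave_of_local (c := C * (‖x - y‖ ^ 2 + wassPlan γ ^ 2)) hfc hTf
    (fun t _ ht => hdiff t ht) ?_ hlam
  · simp only [hf] at key
    simp only [sub_zero, one_smul, zero_smul, add_zero, sub_self, zero_add] at key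
    linarith
  intro t ht htT
  have hnear : ∀ᶠ h in 𝓝[>] (0 : ℝ), ∀ a ∈ S, ∀ b ∈ S,
      ‖((1 - (t - h)) • a.1 + (t - h) • a.2) - ((1 - (t + h)) • a.1 + (t + h) • a.2)‖ ≤
      ‖((1 - (t - h)) • a.1 + (t - h) • a.2) - ((1 - (t + h)) • b.1 + (t + h) • b.2)‖ := by
    refine (eventually_all_finite hS).2 fun a ha => (eventually_all_finite hS).2 fun b hb => ?_
    by_cases hab : a = b
    · rw [hab]; exact Eventually.of_forall fun _ => le_rfl
    have hne : (1 - t) • a.1 + t • a.2 ≠ (1 - t) • b.1 + t • b.2 := fun h =>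
      htT (mem_iUnion₂.2 ⟨a, ha, mem_iUnion₂.2 ⟨b, hb, hab, h⟩⟩)
    refine Filter.Eventually.filter_mono (f₂ := 𝓝 (0 : ℝ)) nhdsWithin_le_nhds ?_
    have h1 : ContinuousAt (fun h : ℝ => ‖((1 - (t - h)) • a.1 + (t - h) • a.2) -
      ((1 - (t + h)) • a.1 + (t + h) • a.2)‖) 0 := by fun_prop
    have h2 : ContinuousAt (fun h : ℝ => ‖((1 - (t - h)) • a.1 + (t - h) • a.2) -
      ((1 - (t + h)) • b.1 + (t + h) • b.2)‖) 0 := by fun_prop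
    filter_upwards [h1.eventually_lt h2 (by simpa [sub_eq_zero] using hne)] with h hh using hh.le
  have hI : ∀ᶠ h in 𝓝[>] (0 : ℝ), t - h ∈ Icc (0 : ℝ) 1 ∧ t + h ∈ Icc (0 : ℝ) 1 := by
    have hb : 0 < min t (1 - t) := lt_min ht.1 (by linarith [ht.2])
    filter_upwards [Ioo_mem_nhdsGT hb] with h hh
    have h1 := hh.2.trans_le (min_le_left _ _)
    have h2 := hh.2.trans_le (min_le_right _ _)
    have h3 := hh.1
    exact ⟨⟨by linarith, by linarith⟩, ⟨by linarith, by linarith⟩⟩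
  filter_upwards [hnear, hI] with h hh hI
  have hopt' := map_mem_optPlans hγ (measurable_interp (t - h)) (measurable_interp (t + h)) hh
  have hhalf := hopt _ _ (hms _ hI.1) (hms _ hI.2) _ hopt' _ (hxs _ hI.1) _ (hxs _ hI.2) (1 / 2)
    ⟨by norm_num, by norm_num⟩
  have e1 : interp (γ.map fun z => ((1 - (t - h)) • z.1 + (t - h) • z.2,
      (1 - (t + h)) • z.1 + (t + h) • z.2)) (1 / 2) = interp γ t := by
    rw [interp, Measure.map_map (measurable_interp _)
      ((measurable_interp _).prodMk (measurable_interp _)), interp]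
    congr 1
    ext1 z
    simp only [Function.comp]
    module
  have e2 : (1 - (1 / 2 : ℝ)) • ((1 - (t - h)) • x + (t - h) • y) +
      (1 / 2 : ℝ) • ((1 - (t + h)) • x + (t + h) • y) = (1 - t) • x + t • y := by module
  have e3 : ((1 - (t - h)) • x + (t - h) • y) - ((1 - (t + h)) • x + (t + h) • y) =
      (2 * h) • (x - y) := by module
  have e4 : wass 2 (interp γ (t - h)) (interp γ (t + h)) ^ 2 = (2 * h) ^ 2 * wassPlan γ ^ 2 := by
    rw [wass_two_eq_of_optPlan (hms _ hI.1) (hms _ hI.2) hopt', wassPlan_map_interp_sq]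
    ring
  change (1 - 1 / 2) * f (t - h) + 1 / 2 * f (t + h) - _ ≤ _ at hhalf
  rw [e1, e2, e3] at hhalf
  change (1 - 1 / 2) * f (t - h) + 1 / 2 * f (t + h) - f t ≤ C * (1 / 2 * (1 - 1 / 2)) *
    (‖(2 * h) • (x - y)‖ ^ 2 + wass 2 (interp γ (t - h)) (interp γ (t + h)) ^ 2) at hhalf
  rw [e4, norm_smul, mul_pow, Real.norm_eq_abs, sq_abs] at hhalf
  linarith

/-- Semiconcavity along optimal plans extends to arbitrary plans, by approximation with plans of
finite support. -/
theorem semiconcave_along_plan {R C : ℝ} {F : Measure (E d) → E d → ℝ}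
    (hlip : ∃ L : ℝ, ∀ μ ν, ProbOn (ball0 d R) μ → ProbOn (ball0 d R) ν →
      ∀ x ∈ ball0 d R, ∀ y ∈ ball0 d R, |F μ x - F ν y| ≤ L * (wass 1 μ ν + ‖x - y‖))
    (hopt : ∀ μ₁ μ₂, ProbOn (ball0 d R) μ₁ → ProbOn (ball0 d R) μ₂ → ∀ γ ∈ optPlans μ₁ μ₂,
      ∀ x ∈ ball0 d R, ∀ y ∈ ball0 d R, ∀ lam ∈ Icc (0 : ℝ) 1,
        (1 - lam) * F μ₁ x + lam * F μ₂ y - F (interp γ lam) ((1 - lam) • x + lam • y)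
          ≤ C * (lam * (1 - lam)) * (‖x - y‖ ^ 2 + wass 2 μ₁ μ₂ ^ 2))
    (hdiff : ∀ (γ : Measure (E d × E d)) [IsProbabilityMeasure γ] (S : Set (E d × E d)),
      S.Finite → (∀ z ∈ S, ‖z.1‖ ≤ R ∧ ‖z.2‖ ≤ R) → (∀ᵐ z ∂γ, z ∈ S) →
      ∀ x ∈ ball0 d R, ∀ y ∈ ball0 d R, ∀ t ∈ Ioo (0 : ℝ) 1,
      DifferentiableAt ℝ (fun s => F (interp γ s) ((1 - s) • x + s • y)) t)
    {μ₁ μ₂ : Measure (E d)} (hμ₁ : ProbOn (ball0 d R) μ₁) (hμ₂ : ProbOn (ball0 d R) μ₂)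
    {γ : Measure (E d × E d)} (hγ : γ ∈ plans μ₁ μ₂)
    {x y : E d} (hx : x ∈ ball0 d R) (hy : y ∈ ball0 d R)
    {lam : ℝ} (hlam : lam ∈ Icc (0 : ℝ) 1) :
    (1 - lam) * F μ₁ x + lam * F μ₂ y - F (interp γ lam) ((1 - lam) • x + lam • y)
      ≤ C * (lam * (1 - lam)) * (‖x - y‖ ^ 2 + wassPlan γ ^ 2) := by
  have := hμ₁.1
  have := isProbabilityMeasure_of_plan hγ
  have hγR := ae_mem_of_plan hμ₁ hμ₂ hγ
  have hR : 0 ≤ R := (norm_nonneg x).trans (by simpa using hx)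
  set K : Set (E d × E d) := ball0 d R ×ˢ ball0 d R with hK
  have hKmem : ∀ z, z ∈ K ↔ ‖z.1‖ ≤ R ∧ ‖z.2‖ ≤ R := fun z => by simp [hK, mem_prod]
  have h0K : (0 : E d × E d) ∈ K := by simp [hKmem, hR]
  -- Simple functions converging to the identity push the plan to plans of finite support.
  let q : ℕ → SimpleFunc (E d × E d) (E d × E d) :=
    SimpleFunc.approxOn id measurable_id K 0 h0K
  have hqK : ∀ n z, ‖(q n z).1‖ ≤ R ∧ ‖(q n z).2‖ ≤ R := fun n z =>
    (hKmem _).1 (SimpleFunc.approxOn_mem measurable_id h0K n z)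
  have hqt : ∀ᵐ z ∂γ, Tendsto (fun n => q n z) atTop (𝓝 z) := by
    filter_upwards [hγR] with z hz
    exact SimpleFunc.tendsto_approxOn measurable_id h0K (subset_closure ((hKmem z).2 hz))
  have hqm : ∀ n, Measurable (q n) := fun n => (q n).measurable
  have hP : ∀ n, IsProbabilityMeasure (γ.map (q n)) := fun n =>
    Measure.isProbabilityMeasure_map (hqm n).aemeasurable
  have hfin : ∀ n, _ := fun n => semiconcave_along_finite_plan (R := R) (C := C) (γ := γ.map (q n))
    hlip hopt (S := range (q n)) (SimpleFunc.finite_range _)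
    (by rintro _ ⟨z, rfl⟩; exact hqK n z)
    ((ae_map_iff (hqm n).aemeasurable (SimpleFunc.finite_range _).measurableSet).2
      (ae_of_all _ fun z => ⟨z, rfl⟩)) hx hy
    (hdiff _ (range (q n)) (SimpleFunc.finite_range _)
      (by rintro _ ⟨z, rfl⟩; exact hqK n z)
      ((ae_map_iff (hqm n).aemeasurable (SimpleFunc.finite_range _).measurableSet).2
        (ae_of_all _ fun z => ⟨z, rfl⟩)) x hx y hy) hlam
  have hqR : ∀ n, ∀ᵐ z ∂(γ.map (q n)), ‖z.1‖ ≤ R ∧ ‖z.2‖ ≤ R := fun n => by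
    refine (ae_map_iff (hqm n).aemeasurable ?_).2 (ae_of_all _ (hqK n))
    have h1 : IsClosed {z : E d × E d | ‖z.1‖ ≤ R} := isClosed_le (by fun_prop) (by fun_prop)
    have h2 : IsClosed {z : E d × E d | ‖z.2‖ ≤ R} := isClosed_le (by fun_prop) (by fun_prop)
    exact (h1.inter h2).measurableSet
  have hW : Tendsto (fun n => wassPlan (γ.map (q n)) ^ 2) atTop (𝓝 (wassPlan γ ^ 2)) := by
    simp_rw [wassPlan_sq]
    have hc : Continuous fun z : E d × E d => ‖z.1 - z.2‖ ^ 2 := by fun_prop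
    have : ∀ n, ∫ z, ‖z.1 - z.2‖ ^ 2 ∂(γ.map (q n)) = ∫ z, ‖(q n z).1 - (q n z).2‖ ^ 2 ∂γ :=
      fun n => integral_map (hqm n).aemeasurable hc.aestronglyMeasurable
    simp_rw [this]
    refine tendsto_integral_of_dominated_convergence (fun _ => (R + R) ^ 2)
      (fun n => (hc.measurable.comp (hqm n)).aestronglyMeasurable) (integrable_const _)
      (fun n => ae_of_all _ fun z => ?_) ?_
    · rw [Real.norm_of_nonneg (by positivity)]
      have := (norm_sub_le _ _).trans (add_le_add (hqK n z).1 (hqK n z).2)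
      gcongr
    · filter_upwards [hqt] with z hz
      exact (hc.tendsto z).comp hz
  have hw : ∀ s, Tendsto (fun n => wass 1 (interp (γ.map (q n)) s) (interp γ s)) atTop (𝓝 0) := by
    intro s
    have hc : Continuous fun z : E d × E d => (1 - s) • z.1 + s • z.2 := by fun_prop
    have e : ∀ n, interp (γ.map (q n)) s = γ.map (fun z => (1 - s) • (q n z).1 + s • (q n z).2) :=
      fun n => by rw [interp, Measure.map_map hc.measurable (hqm n)]; rfl
    have hm : ∀ n, Measurable fun z => (1 - s) • (q n z).1 + s • (q n z).2 := fun n =>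
      hc.measurable.comp (hqm n)
    have hb : ∀ z : E d × E d, ‖z.1‖ ≤ R ∧ ‖z.2‖ ≤ R →
        ‖(1 - s) • z.1 + s • z.2‖ ≤ |1 - s| * R + |s| * R := fun z hz => by
      refine (norm_add_le _ _).trans ?_
      rw [norm_smul, norm_smul, Real.norm_eq_abs, Real.norm_eq_abs]
      have := hz.1
      have := hz.2
      gcongr
    have hbd : ∀ n, ∀ᵐ z ∂γ, ‖‖(1 - s) • (q n z).1 + s • (q n z).2 -
        ((1 - s) • z.1 + s • z.2)‖‖ ≤ 2 * (|1 - s| * R + |s| * R) := fun n => by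
      filter_upwards [hγR] with z hz
      rw [norm_norm]
      refine (norm_sub_le _ _).trans ?_
      linarith [hb _ (hqK n z), hb z hz]
    have hmm : ∀ n, AEStronglyMeasurable (fun z : E d × E d => ‖(1 - s) • (q n z).1 +
        s • (q n z).2 - ((1 - s) • z.1 + s • z.2)‖) γ := fun n =>
      ((hm n).sub hc.measurable).norm.aestronglyMeasurable
    have hlim : Tendsto (fun n => ∫ z, ‖(1 - s) • (q n z).1 + s • (q n z).2 -
        ((1 - s) • z.1 + s • z.2)‖ ∂γ) atTop (𝓝 (∫ _, (0 : ℝ) ∂γ)) := by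
      refine tendsto_integral_of_dominated_convergence (fun _ => 2 * (|1 - s| * R + |s| * R))
        hmm (integrable_const _) hbd ?_
      filter_upwards [hqt] with z hz
      have : Tendsto (fun n => ‖(1 - s) • (q n z).1 + s • (q n z).2 -
        ((1 - s) • z.1 + s • z.2)‖) atTop (𝓝 ‖(1 - s) • z.1 + s • z.2 -
        ((1 - s) • z.1 + s • z.2)‖) :=
        (((hc.tendsto z).comp hz).sub_const _).norm
      simpa using this
    rw [integral_zero] at hlim
    refine squeeze_zero (fun n => wass_nonneg _ _ _) (fun n => ?_) hlim
    rw [e n]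
    exact wass_one_map_le (hm n) hc.measurable (integrable_of_ae_norm_le (hmm n) (hbd n))
  have hF : ∀ s ∈ Icc (0 : ℝ) 1, ∀ w ∈ ball0 d R,
      Tendsto (fun n => F (interp (γ.map (q n)) s) w) atTop (𝓝 (F (interp γ s) w)) := by
    intro s hs w hw'
    obtain ⟨L, hL⟩ := hlip
    rw [tendsto_iff_dist_tendsto_zero]
    have h1 : Tendsto (fun n => L * wass 1 (interp (γ.map (q n)) s) (interp γ s)) atTop (𝓝 0) := by
      simpa using (hw s).const_mul L
    refine squeeze_zero (fun n => dist_nonneg) (fun n => ?_) h1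
    rw [Real.dist_eq]
    simpa using hL _ _ (probOn_interp hs (hqR n)) (probOn_interp hs hγR) w hw' w hw'
  have hxl : (1 - lam) • x + lam • y ∈ ball0 d R := by
    simpa using norm_convexComb_le hlam (R := R) (by simpa using hx) (by simpa using hy)
  have hl := ((((hF 0 ⟨le_rfl, zero_le_one⟩ x hx).const_mul (1 - lam)).add
    ((hF 1 ⟨zero_le_one, le_rfl⟩ y hy).const_mul lam)).sub (hF lam hlam _ hxl))
  have hr := (hW.const_add (‖x - y‖ ^ 2)).const_mul (C * (lam * (1 - lam)))
  have := le_of_tendsto_of_tendsto' hl hr hfin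
  rwa [interp_zero hγ, interp_one hγ] at this

/-- A differentiable, locally Lipschitz functional that is semiconcave along optimal plans is
semiconcave along all plans. -/
theorem StrongSemiconcave.of_geodesic {φ : Measure (E d) → ℝ} (hφ : CostOCP φ)
    (hg : GeodesicSemiconcave φ) : StrongSemiconcave φ := by
  intro R hR
  obtain ⟨C, hC, hCg⟩ := hg R hR
  refine ⟨C, hC, fun μ₁ μ₂ hμ₁ hμ₂ γ hγ lam hlam => ?_⟩
  obtain ⟨L, hL0, hL⟩ := hφ.1 R hR
  have h0 : (0 : E d) ∈ ball0 d R := by simp [hR.le]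
  have := semiconcave_along_plan (R := R) (C := C) (F := fun μ _ => φ μ)
    ⟨L, fun μ ν hμ hν x _ y _ => (hL μ ν hμ hν).trans (by
      have := norm_nonneg (x - y)
      gcongr
      linarith)⟩
    (fun μ₁ μ₂ h₁ h₂ γ hγ x _ y _ lam hlam => (hCg μ₁ μ₂ h₁ h₂ γ hγ lam hlam).trans (by
      have := hlam.1
      have : 0 ≤ 1 - lam := by linarith [hlam.2]
      have := sq_nonneg ‖x - y‖
      gcongr
      linarith)) ?_ hμ₁ hμ₂ hγ h0 h0 hlam
  · simpa using this
  · intro γ _ S hS hSR hγS x _ y _ t ht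
    have hγR : ∀ᵐ z ∂γ, ‖z.1‖ ≤ R ∧ ‖z.2‖ ≤ R := by
      filter_upwards [hγS] with z hz using hSR z hz
    obtain ⟨ξ, -, -, h1, h2⟩ := hφ.2 _ (probOn_interp (Ioo_subset_Icc_self ht) hγR).isPc
    exact differentiableAt_interp hS hγS h1 h2

end StrongFromGeodesic

end WassersteinControl

namespace WassersteinControl

/-! ### Regularity of the velocity at every time -/

section Regular

variable {d : ℕ} {U : Type*}

/-- The consequences of hypotheses (R) that hold at every time of `[0,T]`: sublinear growth,
Lipschitz regularity in time, measure and space, and continuity in the control. -/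
structure RegularVelocity [TopologicalSpace U] (T : ℝ) (v : ℝ → Measure (E d) → U → E d → E d)
    (m : ℝ) : Prop where
  growth : ∀ u, ∀ t ∈ Icc 0 T, ∀ μ, IsPc μ → ∀ x, ‖v t μ u x‖ ≤ m * (1 + ‖x‖ + moment1 μ)
  lip : ∀ R > 0, ∃ l > 0, ∀ u, ∀ t ∈ Icc 0 T, ∀ τ ∈ Icc 0 T,
    ∀ μ ν, ProbOn (ball0 d R) μ → ProbOn (ball0 d R) ν →
    ∀ x ∈ ball0 d R, ∀ y ∈ ball0 d R,
      ‖v t μ u x - v τ ν u y‖ ≤ l * (|t - τ| + wass 1 μ ν + ‖x - y‖)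
  cont : ∀ t ∈ Icc 0 T, ∀ μ, IsPc μ → ∀ x, Continuous fun u => v t μ u x

theorem AETime.exists_seq {T : ℝ} (hT : 0 < T) {P : ℝ → Prop} (h : AETime T P) {t : ℝ}
    (ht : t ∈ Icc 0 T) :
    ∃ s : ℕ → ℝ, (∀ n, s n ∈ Icc 0 T ∧ P (s n)) ∧ Tendsto s atTop (𝓝 t) := by
  have hd : Dense {s | s ∈ Icc 0 T → P s} :=
    Measure.dense_of_ae ((ae_restrict_iff' measurableSet_Icc).1 h)
  have hcl : t ∈ closure (Ioo 0 T ∩ {s | s ∈ Icc 0 T → P s}) := by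
    have := closure_minimal (hd.open_subset_closure_inter (isOpen_Ioo (a := (0 : ℝ)) (b := T)))
      isClosed_closure
    rw [closure_Ioo hT.ne] at this
    exact this ht
  obtain ⟨s, hs, hst⟩ := mem_closure_iff_seq_limit.1 hcl
  exact ⟨s, fun n => ⟨Ioo_subset_Icc_self (hs n).1, (hs n).2 (Ioo_subset_Icc_self (hs n).1)⟩, hst⟩

theorem ProbOn.wass_one_self {R : ℝ} {μ : Measure (E d)} (h : ProbOn (ball0 d R) μ) :
    wass 1 μ μ = 0 := by
  have := h.1
  refine le_antisymm ?_ (wass_nonneg _ _ _)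
  have := wass_one_map_le_of_bound (P := μ) (f := id) (g := id) measurable_id measurable_id (C := 0)
    (by simp)
  simpa using this

/-- Points and compactly supported measures can be placed in a common ball. -/
theorem IsPc.exists_ball {μ : Measure (E d)} (h : IsPc μ) (x : E d) :
    ∃ R > 0, ProbOn (ball0 d R) μ ∧ x ∈ ball0 d R := by
  obtain ⟨R, hR, hμ⟩ := h.exists_probOn
  refine ⟨max R ‖x‖, lt_max_of_lt_left hR, hμ.mono_radius (le_max_left _ _), ?_⟩
  simp

theorem lipschitz_in_time {v : ℝ → Measure (E d) → U → E d → E d} {T R l : ℝ}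
    (h : ∀ u, ∀ t ∈ Icc 0 T, ∀ τ ∈ Icc 0 T,
    ∀ μ ν, ProbOn (ball0 d R) μ → ProbOn (ball0 d R) ν →
    ∀ x ∈ ball0 d R, ∀ y ∈ ball0 d R,
      ‖v t μ u x - v τ ν u y‖ ≤ l * (|t - τ| + wass 1 μ ν + ‖x - y‖)) (u : U) {μ : Measure (E d)}
    (hμ : ProbOn (ball0 d R) μ) {x : E d} (hx : x ∈ ball0 d R) {t τ : ℝ} (ht : t ∈ Icc 0 T)
    (hτ : τ ∈ Icc 0 T) : ‖v t μ u x - v τ μ u x‖ ≤ l * |t - τ| := by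
  simpa [hμ.wass_one_self] using h u t ht τ hτ μ μ hμ hμ x hx x hx

/-- Growth and continuity in the control, required at almost every time only, extend to every time
because such times are dense and the velocity is Lipschitz in time, uniformly in the control. -/
theorem HypR.regularVelocity [TopologicalSpace U] {T : ℝ} (hT : 0 < T)
    {v : ℝ → Measure (E d) → U → E d → E d} (h : HypR T v) :
    ∃ m > 0, VelocityOCP T v (fun _ => m) ∧ RegularVelocity T v m := by
  obtain ⟨⟨m, hm, hv⟩, hlip⟩ := h
  have htime : ∀ μ, IsPc μ → ∀ x, ∃ l > 0, ∀ u, ∀ t ∈ Icc 0 T, ∀ τ ∈ Icc 0 T,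
      ‖v t μ u x - v τ μ u x‖ ≤ l * |t - τ| := fun μ hμ x => by
    obtain ⟨R, hR, hμR, hxR⟩ := hμ.exists_ball x
    obtain ⟨l, hl, hl'⟩ := hlip R hR
    exact ⟨l, hl, fun u t ht τ hτ => lipschitz_in_time hl' u hμR hxR ht hτ⟩
  refine ⟨m, hm, hv, fun u t ht μ hμ x => ?_, hlip, fun t ht μ hμ x => ?_⟩
  · obtain ⟨l, hl, hl'⟩ := htime μ hμ x
    obtain ⟨s, hs, hst⟩ := (hv.2.1 u).2.exists_seq hT ht
    have h1 : Tendsto (fun n => m * (1 + ‖x‖ + moment1 μ) + l * |t - s n|) atTop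
        (𝓝 (m * (1 + ‖x‖ + moment1 μ) + l * |t - t|)) :=
      (((tendsto_const_nhds.sub hst).abs).const_mul l).const_add _
    refine ge_of_tendsto' (by simpa using h1) fun n => ?_
    have h2 := (hs n).2 μ hμ x
    have h3 := hl' u t ht (s n) (hs n).1
    calc ‖v t μ u x‖ = ‖v (s n) μ u x + (v t μ u x - v (s n) μ u x)‖ := by congr 1; abel
      _ ≤ _ := (norm_add_le _ _).trans (add_le_add h2 h3)
  · obtain ⟨l, hl, hl'⟩ := htime μ hμ x
    obtain ⟨s, hs, hst⟩ := hv.2.2.2.2.2.exists_seq hT ht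
    have hu : TendstoUniformly (fun n u => v (s n) μ u x) (fun u => v t μ u x) atTop := by
      rw [Metric.tendstoUniformly_iff]
      intro ε hε
      have h1 : Tendsto (fun n => l * |t - s n|) atTop (𝓝 0) := by
        simpa using (((tendsto_const_nhds (x := t)).sub hst).abs).const_mul l
      filter_upwards [h1.eventually_lt_const hε] with n hn u
      rw [dist_eq_norm]
      exact (hl' u t ht _ (hs n).1).trans_lt hn
    exact hu.continuous (Frequently.of_forall fun n => (hs n).2 μ hμ x)

/-- An inequality between a continuous function and multiples of an integrable function that holds
almost everywhere holds at every point at which the primitive of the latter is differentiable with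
the expected derivative. The exceptional null set depends only on the integrable function. -/
theorem aeTime_forall_le {T : ℝ} {C : ℝ → ℝ} (hC : IntegrableOn C (Icc 0 T)) :
    AETime T fun t => ∀ (F : ℝ → ℝ) (q : ℝ), ContinuousOn F (Icc 0 T) →
      (AETime T fun s => F s ≤ C s * q) → F t ≤ C t * q := by
  rcases le_or_gt T 0 with hT | hT
  · have : volume (Icc 0 T) = 0 := by simp [hT]
    simp [AETime, Measure.restrict_eq_zero.2 this]
  have hCi : IntervalIntegrable C volume 0 T :=
    (intervalIntegrable_iff_integrableOn_Icc_of_le hT.le).2 hC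
  rw [AETime, ae_restrict_iff' measurableSet_Icc]
  have h0 : ∀ᵐ t : ℝ, t ≠ T := by simp [ae_iff, measure_singleton]
  filter_upwards [hCi.ae_hasDerivAt_integral, h0] with t ht h0 htI F q hF hle
  have htT : t < T := lt_of_le_of_ne htI.2 h0
  have hderiv := ht (by rwa [uIcc_of_le hT.le]) t (by rwa [uIcc_of_le hT.le])
  have hsub : ∀ s ∈ Ioo t T, Icc t s ⊆ Icc 0 T := fun s hs => Icc_subset_Icc htI.1 hs.2.le
  have hlim1 : Tendsto (fun s => (s - t)⁻¹ * ∫ r in t..s, C r * q) (𝓝[>] t) (𝓝 (C t * q)) := by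
    have := hasDerivWithinAt_iff_tendsto_slope.1 (hderiv.hasDerivWithinAt (s := Ioi t))
    simp only [slope_fun_def, vsub_eq_sub, intervalIntegral.integral_same, sub_zero,
      smul_eq_mul] at this
    have h2 := this.mul_const q
    rw [show Ioi t \ {t} = Ioi t from by simp] at h2
    refine h2.congr fun s => ?_
    rw [intervalIntegral.integral_mul_const]
    ring
  have hlim2 : Tendsto (fun s => (s - t)⁻¹ * ∫ r in t..s, F r) (𝓝[>] t) (𝓝 (F t)) := by
    have hFi : IntervalIntegrable F volume t T :=
      (hF.mono (by rw [uIcc_of_le htI.2]; exact Icc_subset_Icc_left htI.1)).intervalIntegrable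
    have hd := intervalIntegral.integral_hasDerivWithinAt_right (a := t) (b := t) (s := Ici t)
      (t := Ioi t) (f := F) (by simp)
      ⟨Ioo t T, by exact Ioo_mem_nhdsGT htT,
        ((hF.mono fun s hs => ⟨htI.1.trans hs.1.le, hs.2.le⟩).aestronglyMeasurable
          measurableSet_Ioo)⟩
      ((hF t htI).mono_of_mem_nhdsWithin (by
        refine mem_of_superset (Ioo_mem_nhdsGT htT) fun s hs => ⟨htI.1.trans hs.1.le, hs.2.le⟩))
    have := hasDerivWithinAt_iff_tendsto_slope.1 hd
    simp only [slope_fun_def, vsub_eq_sub, intervalIntegral.integral_same, sub_zero,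
      smul_eq_mul] at this
    rwa [Ici_sdiff_left] at this
  refine le_of_tendsto_of_tendsto hlim2 hlim1 ?_
  filter_upwards [Ioo_mem_nhdsGT htT] with s hs
  have hts : t ≤ s := hs.1.le
  have hpos : 0 ≤ (s - t)⁻¹ := inv_nonneg.2 (by linarith)
  refine mul_le_mul_of_nonneg_left ?_ hpos
  refine intervalIntegral.integral_mono_ae_restrict hts ?_ ?_ ?_
  · exact (hF.mono (by rw [uIcc_of_le hts]; exact hsub s hs)).intervalIntegrable
  · refine IntervalIntegrable.mul_const ?_ q
    exact hCi.mono_set (by rw [uIcc_of_le hts, uIcc_of_le hT.le]; exact hsub s hs)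
  · exact ae_restrict_of_ae_restrict_of_subset (hsub s hs) hle

/-- Strong semiconcavity of the velocity, with an exceptional set of times that does not depend on
the control value, the plan and the points. -/
def StrongVelocitySC (T : ℝ) (v : ℝ → Measure (E d) → U → E d → E d) (R : ℝ) (C : ℝ → ℝ) : Prop :=
  AETime T fun t => ∀ u, ∀ μ₁ μ₂, ProbOn (ball0 d R) μ₁ → ProbOn (ball0 d R) μ₂ →
    ∀ γ ∈ plans μ₁ μ₂, ∀ x ∈ ball0 d R, ∀ y ∈ ball0 d R, ∀ lam ∈ Icc (0 : ℝ) 1,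
      ‖(1 - lam) • v t μ₁ u x + lam • v t μ₂ u y
          - v t (interp γ lam) u ((1 - lam) • x + lam • y)‖
        ≤ C t * (lam * (1 - lam)) * (‖x - y‖ ^ 2 + wassPlan γ ^ 2)

/-- The semiconcavity estimate of the velocity for one class of plans and for almost every time
holds for almost every time simultaneously for all data. -/
theorem aeTime_velocitySC_of_forall [TopologicalSpace U] {T m : ℝ}
    {v : ℝ → Measure (E d) → U → E d → E d} (hv : RegularVelocity T v m) {R : ℝ} (hR : 0 < R)
    {G : Measure (E d) → Measure (E d) → Set (Measure (E d × E d))}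
    (hG : ∀ μ ν, G μ ν ⊆ plans μ ν) {Q : Measure (E d × E d) → ℝ}
    {C : ℝ → ℝ} (hC : IsL1Pos T C)
    (h : ∀ u, ∀ μ₁ μ₂, ProbOn (ball0 d R) μ₁ → ProbOn (ball0 d R) μ₂ →
    ∀ γ ∈ G μ₁ μ₂, ∀ x ∈ ball0 d R, ∀ y ∈ ball0 d R,
      AETime T fun t => ∀ lam ∈ Icc (0 : ℝ) 1,
        ‖(1 - lam) • v t μ₁ u x + lam • v t μ₂ u y
            - v t (interp γ lam) u ((1 - lam) • x + lam • y)‖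
          ≤ C t * (lam * (1 - lam)) * (‖x - y‖ ^ 2 + Q γ)) :
    AETime T fun t => ∀ u, ∀ μ₁ μ₂, ProbOn (ball0 d R) μ₁ → ProbOn (ball0 d R) μ₂ →
    ∀ γ ∈ G μ₁ μ₂, ∀ x ∈ ball0 d R, ∀ y ∈ ball0 d R, ∀ lam ∈ Icc (0 : ℝ) 1,
      ‖(1 - lam) • v t μ₁ u x + lam • v t μ₂ u y
          - v t (interp γ lam) u ((1 - lam) • x + lam • y)‖
        ≤ C t * (lam * (1 - lam)) * (‖x - y‖ ^ 2 + Q γ) := by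
  refine (aeTime_forall_le hC.1).mono fun t ht u μ₁ μ₂ h₁ h₂ γ hγ x hx y hy lam hlam => ?_
  obtain ⟨l, hl, hlip⟩ := hv.lip R hR
  have := h₁.1
  have := isProbabilityMeasure_of_plan (hG _ _ hγ)
  have h₃ : ProbOn (ball0 d R) (interp γ lam) :=
    probOn_interp hlam (ae_mem_of_plan h₁ h₂ (hG _ _ hγ))
  have hz : (1 - lam) • x + lam • y ∈ ball0 d R := by
    simpa using norm_convexComb_le hlam (R := R) (by simpa using hx) (by simpa using hy)
  have hcont : ∀ μ, ProbOn (ball0 d R) μ → ∀ w ∈ ball0 d R,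
      ContinuousOn (fun t => v t μ u w) (Icc 0 T) := fun μ hμ w hw => by
    have : LipschitzOnWith (Real.toNNReal l) (fun t => v t μ u w) (Icc 0 T) :=
      LipschitzOnWith.of_dist_le_mul fun s hs t ht => by
        rw [dist_eq_norm, Real.dist_eq, Real.coe_toNNReal _ hl.le]
        exact lipschitz_in_time hlip u hμ hw hs ht
    exact this.continuousOn
  have hF : ContinuousOn (fun t => ‖(1 - lam) • v t μ₁ u x + lam • v t μ₂ u y
      - v t (interp γ lam) u ((1 - lam) • x + lam • y)‖) (Icc 0 T) := by
    have h1 := hcont _ h₁ _ hx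
    have h2 := hcont _ h₂ _ hy
    have h3 := hcont _ h₃ _ hz
    fun_prop
  rw [mul_assoc]
  refine ht _ _ hF ((h u μ₁ μ₂ h₁ h₂ γ hγ x hx y hy).mono fun s hs => ?_)
  rw [← mul_assoc]
  exact hs lam hlam

theorem SC2.strongVelocitySC [TopologicalSpace U] {T m : ℝ}
    {v : ℝ → Measure (E d) → U → E d → E d} {φ : Measure (E d) → ℝ} (hv : RegularVelocity T v m)
    (h : SC2 T v φ) {R : ℝ} (hR : 0 < R) : ∃ C, IsL1Pos T C ∧ StrongVelocitySC T v R C := by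
  obtain ⟨C, hC, hC'⟩ := h.1 R hR
  exact ⟨C, hC, aeTime_velocitySC_of_forall hv hR (G := plans) (Q := fun γ => wassPlan γ ^ 2)
    (fun _ _ => subset_rfl) hC hC'⟩

/-- The velocity is differentiable along interpolations of finitely supported plans, jointly with a
moving point. -/
theorem differentiableAt_velocity_interp {R : ℝ} {w : Measure (E d) → E d → E d}
    (hw : ∀ μ, IsPc μ → Differentiable ℝ (w μ))
    (hcont : ∀ μ, ProbOn (ball0 d R) μ → ∀ x ∈ ball0 d R, ∀ ε > 0, ∃ δ > 0,
      ∀ ν, ProbOn (ball0 d R) ν → ∀ x' ∈ ball0 d R, wass 1 μ ν < δ → ‖x - x'‖ < δ →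
        ‖fderiv ℝ (w μ) x - fderiv ℝ (w ν) x'‖ < ε)
    (hgrad : ∀ i : Fin d, ∀ μ, IsPc μ → ∀ x, ∃ ξ, IsWassGradient (fun ν => (w ν x) i) μ ξ)
    {γ : Measure (E d × E d)} [IsProbabilityMeasure γ] {S : Set (E d × E d)} (hS : S.Finite)
    (hSR : ∀ z ∈ S, ‖z.1‖ ≤ R ∧ ‖z.2‖ ≤ R) (hγ : ∀ᵐ z ∂γ, z ∈ S)
    {x y : E d} (hx : x ∈ ball0 d R) (hy : y ∈ ball0 d R) {t : ℝ} (ht : t ∈ Ioo (0 : ℝ) 1) :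
    DifferentiableAt ℝ (fun s => w (interp γ s) ((1 - s) • x + s • y)) t := by
  have hγR : ∀ᵐ z ∂γ, ‖z.1‖ ≤ R ∧ ‖z.2‖ ≤ R := by
    filter_upwards [hγ] with z hz using hSR z hz
  have hx' : ‖x‖ ≤ R := by simpa using hx
  have hy' : ‖y‖ ≤ R := by simpa using hy
  set p : ℝ → E d := fun s => (1 - s) • x + s • y with hp
  have hps : ∀ s ∈ Icc (0 : ℝ) 1, p s ∈ ball0 d R := fun s hs => by
    simpa using norm_convexComb_le hs hx' hy'
  have hms : ∀ s ∈ Icc (0 : ℝ) 1, ProbOn (ball0 d R) (interp γ s) := fun s hs =>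
    probOn_interp hs hγR
  have ht' := Ioo_subset_Icc_self ht
  have h1 : DifferentiableAt ℝ (fun s => w (interp γ s) (p t)) t := by
    rw [differentiableAt_euclidean]
    intro i
    obtain ⟨ξ, -, h1, h2⟩ := hgrad i _ (hms t ht').isPc (p t)
    exact differentiableAt_interp hS hγ h1 h2
  -- The increment in the moving point is controlled by the mean value inequality, uniformly in the
  -- measure because the spatial derivative is jointly continuous.
  have h2 : HasDerivAt (fun s => w (interp γ s) (p s) - w (interp γ s) (p t))
      (fderiv ℝ (w (interp γ t)) (p t) (y - x)) t := by
    rw [hasDerivAt_iff_isLittleO, Asymptotics.isLittleO_iff]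
    intro c hc
    set ε := c / (‖y - x‖ + 1) with hε
    have hn := norm_nonneg (y - x)
    have hε0 : 0 < ε := by positivity
    have hεD : ε * ‖y - x‖ ≤ c := by
      rw [hε, div_mul_eq_mul_div, div_le_iff₀ (by positivity)]
      nlinarith
    obtain ⟨δ, hδ, hδ'⟩ := hcont _ (hms t ht') _ (hps t ht') ε hε0
    have e1 : ∀ s, p s - p t = (s - t) • (y - x) := fun s => by simp only [hp]; module
    have hI : ∀ᶠ s in 𝓝 t, s ∈ Icc (0 : ℝ) 1 := Icc_mem_nhds ht.1 ht.2
    have hW : ∀ᶠ s in 𝓝 t, |t - s| * (2 * R) < δ := by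
      have : ContinuousAt (fun s => |t - s| * (2 * R)) t := by fun_prop
      exact this.eventually_lt continuousAt_const (by simpa using hδ)
    have hN : ∀ᶠ s in 𝓝 t, ‖p s - p t‖ < δ := by
      have : ContinuousAt (fun s => ‖p s - p t‖) t := by simp only [hp]; fun_prop
      exact this.eventually_lt continuousAt_const (by simpa using hδ)
    filter_upwards [hI, hW, hN] with s hsI hsW hsN
    have hmv := (convex_segment (𝕜 := ℝ) (p t) (p s)).norm_image_sub_le_of_norm_hasFDerivWithin_le'
      (f := w (interp γ s)) (f' := fderiv ℝ (w (interp γ s)))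
      (φ := fderiv ℝ (w (interp γ t)) (p t)) (C := ε)
      (fun z _ => (hw _ (hms s hsI).isPc z).hasFDerivAt.hasFDerivWithinAt)
      (fun z hz => by
        have hzR : z ∈ ball0 d R :=
          (convex_closedBall (0 : E d) R).segment_subset (hps t ht') (hps s hsI) hz
        rw [norm_sub_rev]
        refine (hδ' _ (hms s hsI) z hzR ((wass_one_interp_le hγR t s).trans_lt hsW) ?_).le
        refine lt_of_le_of_lt ?_ hsN
        rw [← dist_eq_norm, ← dist_eq_norm, dist_comm (p s)]
        obtain ⟨a, b, ha, hb, hab, rfl⟩ := hz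
        rw [dist_eq_norm, dist_eq_norm]
        have : p t - (a • p t + b • p s) = b • (p t - p s) := by
          rw [← eq_sub_iff_add_eq] at hab
          rw [hab]; module
        rw [this, norm_smul, Real.norm_of_nonneg hb]
        exact mul_le_of_le_one_left (norm_nonneg _) (by linarith))
      (left_mem_segment ℝ _ _) (right_mem_segment ℝ _ _)
    rw [e1, map_smul] at hmv
    simp only [sub_self, sub_zero]
    refine hmv.trans ?_
    rw [norm_smul]
    calc ε * (‖s - t‖ * ‖y - x‖) = (ε * ‖y - x‖) * ‖s - t‖ := by ring
      _ ≤ c * ‖s - t‖ := by gcongr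
  have := h1.add h2.differentiableAt
  refine this.congr_of_eventuallyEq (Eventually.of_forall fun s => ?_)
  simp [hp]

/-- Semiconcavity of the velocity along optimal plans implies semiconcavity along all plans: at almost
every time the velocity is differentiable in the measure and in space, so the scalar statement
applies to its components. -/
theorem SC1.strongVelocitySC [TopologicalSpace U] [TopologicalSpace.SeparableSpace U] [Nonempty U]
    {T m m' : ℝ} {v : ℝ → Measure (E d) → U → E d → E d} {φ : Measure (E d) → ℝ}
    (hv : RegularVelocity T v m) (hv' : VelocityOCP T v fun _ => m')
    (h : SC1 T v φ) {R : ℝ} (hR : 0 < R) : ∃ C, IsL1Pos T C ∧ StrongVelocitySC T v R C := by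
  obtain ⟨C, hC, hC'⟩ := h.1 R hR
  refine ⟨C, hC, ?_⟩
  have hopt := aeTime_velocitySC_of_forall hv hR (G := fun μ ν => {γ | γ ∈ optPlans μ ν ∧
      ProbOn (ball0 d R) μ ∧ ProbOn (ball0 d R) ν})
    (Q := fun γ => wassPlan γ ^ 2) (fun _ _ γ hγ => hγ.1.1) hC
    (fun u μ₁ μ₂ h₁ h₂ γ hγ x hx y hy => by
      have := hC' u μ₁ μ₂ h₁ h₂ γ hγ.1 x hx y hy
      rwa [wass_two_eq_of_optPlan h₁ h₂ hγ.1] at this)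
  have h3 : AETime T fun t => ∀ n, _ := ae_all_iff.2 fun n =>
    hv'.2.2.2.1 R hR (TopologicalSpace.denseSeq U n)
  have h4 : AETime T fun t => ∀ n, _ := ae_all_iff.2 fun n =>
    hv'.2.2.2.2.1 R hR (TopologicalSpace.denseSeq U n)
  have hI : AETime T fun t => t ∈ Icc 0 T := ae_restrict_mem measurableSet_Icc
  filter_upwards [hopt, h3, h4, hI] with t hopt h3 h4 hI u μ₁ μ₂ h₁ h₂ γ hγ x hx y hy lam hlam
  have := h₁.1
  have := isProbabilityMeasure_of_plan hγ
  have hx' : ‖x‖ ≤ R := by simpa using hx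
  have hy' : ‖y‖ ≤ R := by simpa using hy
  obtain ⟨l, hl, hlip⟩ := hv.lip R hR
  -- By continuity it is enough to treat a dense sequence of control values
  revert u
  refine fun u => (TopologicalSpace.denseRange_denseSeq U).induction_on u ?_ ?_
  · refine isClosed_le ?_ continuous_const
    have h₃ : ProbOn (ball0 d R) (interp γ lam) := probOn_interp hlam (ae_mem_of_plan h₁ h₂ hγ)
    have e1 := hv.cont t hI _ h₁.isPc x
    have e2 := hv.cont t hI _ h₂.isPc y
    have e3 := hv.cont t hI _ h₃.isPc ((1 - lam) • x + lam • y)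
    fun_prop
  intro n
  set un := TopologicalSpace.denseSeq U n
  set r := (1 - lam) • v t μ₁ un x + lam • v t μ₂ un y
            - v t (interp γ lam) un ((1 - lam) • x + lam • y) with hr
  have hCt : 0 ≤ C t := hC.2 t hI
  have hlam0 : 0 ≤ lam * (1 - lam) := mul_nonneg hlam.1 (by linarith [hlam.2])
  -- Apply the scalar result to the component of the velocity in the direction of the defect `r`
  have key := semiconcave_along_plan (R := R) (C := C t * ‖r‖)
    (F := fun μ x => inner ℝ r (v t μ un x))
    ⟨‖r‖ * l, fun μ ν hμ hν x hx y hy => by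
      rw [← inner_sub_right]
      refine (abs_real_inner_le_norm _ _).trans ?_
      rw [mul_assoc]
      gcongr
      simpa using hlip un t hI t hI μ ν hμ hν x hx y hy⟩
    (fun μ₁ μ₂ h₁ h₂ γ hγ x hx y hy lam hlam => by
      have h5 := hopt un μ₁ μ₂ h₁ h₂ γ ⟨hγ, h₁, h₂⟩ x hx y hy lam hlam
      rw [wass_two_eq_of_optPlan h₁ h₂ hγ, ← real_inner_smul_right, ← real_inner_smul_right,
        ← inner_add_right, ← inner_sub_right]
      refine (real_inner_le_norm _ _).trans ?_
      calc ‖r‖ * _ ≤ ‖r‖ * (C t * (lam * (1 - lam)) * (‖x - y‖ ^ 2 + wassPlan γ ^ 2)) := by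
            gcongr
        _ = _ := by ring)
    (fun γ _ S hS hSR hγS x hx y hy s hs => by
      obtain ⟨G, hG, -⟩ := h4 n
      have hd := differentiableAt_velocity_interp (w := fun μ x => v t μ un x)
        (h3 n).1 (h3 n).2 (fun i μ hμ x => ⟨_, hG i μ hμ x⟩) hS hSR hγS hx hy hs
      exact (differentiableAt_const r).inner ℝ hd) h₁ h₂ hγ hx hy hlam
  rw [← real_inner_smul_right, ← real_inner_smul_right, ← inner_add_right, ← inner_sub_right, ← hr,
    real_inner_self_eq_norm_sq] at key
  rcases (norm_nonneg r).eq_or_lt with h0 | h0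
  · rw [← h0]
    positivity
  · refine le_of_mul_le_mul_left ?_ h0
    calc ‖r‖ * ‖r‖ = ‖r‖ ^ 2 := by ring
      _ ≤ _ := key
      _ = _ := by ring

end Regular

end WassersteinControl

namespace WassersteinControl

/-! ### Integral inequalities of Grönwall type -/

section Gronwall

theorem le_mul_exp_of_le_add_integral {f : ℝ → ℝ} {A K a b : ℝ} (hK : 0 ≤ K)
    (hf : ContinuousOn f (Icc a b))
    (h : ∀ t ∈ Icc a b, f t ≤ A + K * ∫ s in a..t, f s) :
    ∀ t ∈ Icc a b, f t ≤ A * Real.exp (K * (t - a)) := by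
  intro t ht
  have hab : a ≤ b := ht.1.trans ht.2
  set g : ℝ → ℝ := fun t => A + K * ∫ s in a..t, f s with hg
  have hfi : IntervalIntegrable f volume a b :=
    (hf.mono (by rw [uIcc_of_le hab])).intervalIntegrable
  have hgc : ContinuousOn g (Icc a b) := by
    have := intervalIntegral.continuousOn_primitive_interval'
      (f := f) (a := a) (b₁ := a) (b₂ := b) hfi (by simp)
    rw [uIcc_of_le hab] at this
    exact continuousOn_const.add (continuousOn_const.mul this)
  have hd : ∀ x ∈ Ico a b, HasDerivWithinAt g (K * f x) (Ici x) x := fun x hx => by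
    have h1 := intervalIntegral.integral_hasDerivWithinAt_right (a := a) (b := x) (s := Ici x)
      (t := Ioi x) (f := f)
      (hfi.mono_set (by
        rw [uIcc_of_le hab, uIcc_of_le hx.1]; exact Icc_subset_Icc_right hx.2.le))
      ⟨Ioo x b, Ioo_mem_nhdsGT hx.2,
        ((hf.mono fun s hs => ⟨hx.1.trans hs.1.le, hs.2.le⟩).aestronglyMeasurable
          measurableSet_Ioo)⟩
      ((hf x ⟨hx.1, hx.2.le⟩).mono_of_mem_nhdsWithin
        (mem_of_superset (Ioo_mem_nhdsGT hx.2) fun s hs => ⟨hx.1.trans hs.1.le, hs.2.le⟩))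
    exact (h1.const_mul K).const_add A
  have := le_gronwallBound_of_liminf_deriv_right_le (δ := A) (K := K) (ε := 0) hgc
    (fun x hx r hr => (hd x hx).liminf_right_slope_le hr) (by simp [hg])
    (fun x hx => by
      rw [add_zero]
      exact mul_le_mul_of_nonneg_left (h x ⟨hx.1, hx.2.le⟩) hK) t ht
  rw [gronwallBound_ε0] at this
  exact (h t ht).trans this

/-- The constant of the Grönwall inequality for families coupled through their mean. -/
noncomputable def gronwallConst (ℓ S : ℝ) : ℝ :=
  2 * (Real.exp (ℓ * S) * (1 + ℓ * S * (Real.exp (ℓ * S) *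
    Real.exp (Real.exp (ℓ * S) * ℓ * S))))

theorem one_le_gronwallConst {ℓ S : ℝ} (hℓ : 0 ≤ ℓ) (hS : 0 ≤ S) : 1 ≤ gronwallConst ℓ S := by
  have h1 : 1 ≤ Real.exp (ℓ * S) := Real.one_le_exp (by positivity)
  have h2 : 0 ≤ ℓ * S * (Real.exp (ℓ * S) * Real.exp (Real.exp (ℓ * S) * ℓ * S)) := by positivity
  unfold gronwallConst
  nlinarith

/-- Grönwall's inequality for a family of functions coupled through their mean value: first each
member is estimated in terms of the mean, then the mean is estimated by the average of these
estimates. -/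
theorem gronwall_mean {Ω : Type*} [MeasurableSpace Ω] {P : Measure Ω} [IsProbabilityMeasure P]
    {G : Set Ω} (hG : ∀ᵐ ω ∂P, ω ∈ G) {f : ℝ → Ω → ℝ} {g : Ω → ℝ} {ℓ a b S B : ℝ} (hℓ : 0 ≤ ℓ)
    (hS : b - a ≤ S) (hg : Integrable g P) (hg0 : ∀ ω ∈ G, 0 ≤ g ω)
    (hf0 : ∀ t ∈ Icc a b, ∀ ω ∈ G, 0 ≤ f t ω) (hfB : ∀ t ∈ Icc a b, ∀ ω ∈ G, f t ω ≤ B)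
    (hfm : ∀ t ∈ Icc a b, AEStronglyMeasurable (f t) P)
    (hfc : ∀ ω ∈ G, ContinuousOn (fun t => f t ω) (Icc a b))
    (h : ∀ t ∈ Icc a b, ∀ ω ∈ G,
      f t ω ≤ g ω + ℓ * ∫ s in a..t, ((∫ ω', f s ω' ∂P) + f s ω)) :
    ∀ t ∈ Icc a b, (∫ ω, f t ω ∂P ≤ gronwallConst ℓ S * ∫ ω, g ω ∂P) ∧
      ∀ ω ∈ G, f t ω ≤ gronwallConst ℓ S * (g ω + ∫ ω', g ω' ∂P) := by
  intro t ht
  have hab : a ≤ b := ht.1.trans ht.2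
  have hS0 : 0 ≤ S := by linarith
  set gm := ∫ ω, g ω ∂P with hgm
  set m : ℝ → ℝ := fun s => ∫ ω, f s ω ∂P with hm
  have hgm0 : 0 ≤ gm := integral_nonneg_of_ae (by filter_upwards [hG] with ω hω using hg0 ω hω)
  have hm0 : ∀ s ∈ Icc a b, 0 ≤ m s := fun s hs =>
    integral_nonneg_of_ae (by filter_upwards [hG] with ω hω using hf0 s hs ω hω)
  have hbd : ∀ s ∈ Icc a b, ∀ᵐ ω ∂P, ‖f s ω‖ ≤ B := fun s hs => by
    filter_upwards [hG] with ω hω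
    rw [Real.norm_of_nonneg (hf0 s hs ω hω)]
    exact hfB s hs ω hω
  have hfi : ∀ s ∈ Icc a b, Integrable (f s) P := fun s hs =>
    integrable_of_ae_norm_le (hfm s hs) (hbd s hs)
  have hmc : ContinuousOn m (Icc a b) :=
    continuousOn_of_dominated (bound := fun _ => B) hfm hbd (integrable_const _)
      (by filter_upwards [hG] with ω hω using hfc ω hω)
  have hmi : ∀ s ∈ Icc a b, IntervalIntegrable m volume a s := fun s hs =>
    (hmc.mono (by rw [uIcc_of_le hs.1]; exact Icc_subset_Icc_right hs.2)).intervalIntegrable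
  set κ := Real.exp (ℓ * S) with hκ
  have hκ1 : 1 ≤ κ := Real.one_le_exp (by positivity)
  have hκ0 : 0 < κ := Real.exp_pos _
  have hI0 : ∀ s ∈ Icc a b, 0 ≤ ∫ r in a..s, m r := fun s hs =>
    intervalIntegral.integral_nonneg hs.1 fun r hr => hm0 r ⟨hr.1, hr.2.trans hs.2⟩
  -- For fixed `ω`, the mean is a source term.
  have hstep : ∀ s ∈ Icc a b, ∀ ω ∈ G, f s ω ≤ κ * (g ω + ℓ * ∫ r in a..s, m r) := by
    intro s hs ω hω
    have hsub : Icc a s ⊆ Icc a b := Icc_subset_Icc_right hs.2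
    have h1 := le_mul_exp_of_le_add_integral (A := g ω + ℓ * ∫ r in a..s, m r) hℓ
      ((hfc ω hω).mono hsub) (fun r hr => by
        have hr' := hsub hr
        refine (h r hr' ω hω).trans ?_
        have hfω : IntervalIntegrable (fun q => f q ω) volume a r :=
          ((hfc ω hω).mono (by
            rw [uIcc_of_le hr.1]; exact Icc_subset_Icc_right hr'.2)).intervalIntegrable
        rw [intervalIntegral.integral_add (hmi r hr') hfω]
        have hle : ∫ q in a..r, m q ≤ ∫ q in a..s, m q := by
          rw [← intervalIntegral.integral_add_adjacent_intervals (c := s) (hmi r hr')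
            ((hmi s hs).mono_set (by
              rw [uIcc_of_le hr.2, uIcc_of_le hs.1]; exact Icc_subset_Icc_left hr.1))]
          have := intervalIntegral.integral_nonneg (f := m) (μ := volume) hr.2 fun q hq =>
            hm0 q ⟨hr.1.trans hq.1, hq.2.trans hs.2⟩
          linarith
        nlinarith) s ⟨hs.1, le_rfl⟩
    refine h1.trans ?_
    rw [mul_comm]
    have h2 : 0 ≤ g ω + ℓ * ∫ r in a..s, m r :=
      add_nonneg (hg0 ω hω) (mul_nonneg hℓ (hI0 s hs))
    have h3 : s - a ≤ S := by linarith [hs.2]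
    have h4 : Real.exp (ℓ * (s - a)) ≤ κ := by
      rw [hκ]; gcongr
    gcongr
  -- Averaging `hstep` gives a closed integral inequality for the mean.
  have hmean : ∀ s ∈ Icc a b, m s ≤ κ * gm + κ * ℓ * ∫ r in a..s, m r := by
    intro s hs
    have h1 : m s ≤ ∫ ω, κ * (g ω + ℓ * ∫ r in a..s, m r) ∂P :=
      integral_mono_ae (hfi s hs) ((hg.add (integrable_const _)).const_mul κ)
        (by filter_upwards [hG] with ω hω using hstep s hs ω hω)
    rw [integral_const_mul, integral_add hg (integrable_const _)] at h1
    simp only [integral_const, probReal_univ, one_smul, ← hgm] at h1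
    linarith
  have hm' := le_mul_exp_of_le_add_integral (by positivity) hmc hmean
  set κ' := Real.exp (κ * ℓ * S) with hκ'
  have hm'' : ∀ s ∈ Icc a b, m s ≤ κ * gm * κ' := fun s hs => by
    refine (hm' s hs).trans ?_
    have h3 : s - a ≤ S := by linarith [hs.2]
    rw [hκ']
    gcongr
  have hIle : ∫ r in a..t, m r ≤ S * (κ * gm * κ') := by
    have h1 := intervalIntegral.integral_mono_on ht.1 (hmi t ht)
      (intervalIntegrable_const (c := κ * gm * κ')) fun r hr => hm'' r ⟨hr.1, hr.2.trans ht.2⟩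
    rw [intervalIntegral.integral_const, smul_eq_mul] at h1
    refine h1.trans ?_
    have h3 : t - a ≤ S := by linarith [ht.2]
    gcongr
  have hC : gronwallConst ℓ S = 2 * (κ * (1 + ℓ * S * (κ * κ'))) := rfl
  have hpt : ∀ ω ∈ G, f t ω ≤ κ * (1 + ℓ * S * (κ * κ')) * (g ω + gm) := fun ω hω => by
    refine (hstep t ht ω hω).trans ?_
    have h0 := hg0 ω hω
    rw [mul_assoc]
    refine mul_le_mul_of_nonneg_left ?_ hκ0.le
    have h1 : ℓ * ∫ r in a..t, m r ≤ ℓ * (S * (κ * gm * κ')) := by gcongr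
    have h2 : 0 ≤ ℓ * S * (κ * κ') * g ω := by positivity
    nlinarith
  have hc0 : 0 ≤ κ * (1 + ℓ * S * (κ * κ')) := by positivity
  constructor
  · have h1 : m t ≤ ∫ ω, κ * (1 + ℓ * S * (κ * κ')) * (g ω + gm) ∂P :=
      integral_mono_ae (hfi t ht) ((hg.add (integrable_const _)).const_mul _)
        (by filter_upwards [hG] with ω hω using hpt ω hω)
    rw [integral_const_mul, integral_add hg (integrable_const _)] at h1
    simp only [integral_const, probReal_univ, one_smul, ← hgm] at h1
    rw [hC]
    linarith
  · intro ω hω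
    refine (hpt ω hω).trans ?_
    have := hg0 ω hω
    rw [hC]
    have h2 : 0 ≤ κ * (1 + ℓ * S * (κ * κ')) * (g ω + gm) := by positivity
    linarith

end Gronwall

/-! ### Carathéodory differential equations -/

section ODE

/-- Global existence for a bounded differential equation that is measurable in time and Lipschitz in
space, by the contraction principle in an exponentially weighted norm. -/
theorem exists_caratheodory_solution {Z : Type*} [NormedAddCommGroup Z] [NormedSpace ℝ Z]
    [CompleteSpace Z] {F : ℝ → Z → Z} {L B τ T : ℝ} (hL : 0 ≤ L) (hτT : τ ≤ T)
    (hF : ∀ t y y', ‖F t y - F t y'‖ ≤ L * ‖y - y'‖) (hB : ∀ t y, ‖F t y‖ ≤ B)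
    (hm : ∀ Y : ℝ → Z, Continuous Y → AEStronglyMeasurable (fun t => F t (Y t)) volume) (y₀ : Z) :
    ∃ Y : ℝ → Z, Continuous Y ∧ ∀ t ∈ Icc τ T, Y t = y₀ + ∫ s in τ..t, F s (Y s) := by
  have : Nonempty (Icc τ T) := ⟨⟨τ, le_rfl, hτT⟩⟩
  -- With this weight the fixed point operator contracts by the factor `L / k ≤ 1 / 2`.
  set k := 2 * L + 1 with hk
  have hk0 : 0 < k := by positivity
  -- The curve represented by a weighted continuous function on `[τ,T]`
  set Φ : C(Icc τ T, Z) → ℝ → Z := fun y s => Real.exp (k * s) • y (projIcc τ T hτT s) with hΦ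
  have hΦc : ∀ y, Continuous (Φ y) := fun y => by
    have : Continuous fun s => y (projIcc τ T hτT s) := y.continuous.comp continuous_projIcc
    simp only [hΦ]
    fun_prop
  have hint : ∀ Y : ℝ → Z, Continuous Y → ∀ a b,
      IntervalIntegrable (fun s => F s (Y s)) volume a b := fun Y hY a b => by
    rw [intervalIntegrable_iff]
    exact Measure.integrableOn_of_bounded (M := B) (by simp)
      (hm Y hY) (ae_of_all _ fun t => hB t _)
  let P : C(Icc τ T, Z) → C(Icc τ T, Z) := fun y =>
    ⟨fun t => Real.exp (-(k * (t : ℝ))) • (y₀ + ∫ s in τ..(t : ℝ), F s (Φ y s)), by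
      have h1 : Continuous fun t : ℝ => ∫ s in τ..t, F s (Φ y s) :=
        intervalIntegral.continuous_primitive (hint _ (hΦc y)) τ
      have h2 : Continuous fun t : Icc τ T => ∫ s in τ..(t : ℝ), F s (Φ y s) :=
        h1.comp continuous_subtype_val
      fun_prop⟩
  have hP : ContractingWith (1 / 2) P := by
    refine ⟨by norm_num, LipschitzWith.of_dist_le_mul fun y y' => ?_⟩
    rw [ContinuousMap.dist_le (by positivity)]
    intro t
    have e : P y t - P y' t =
        Real.exp (-(k * (t : ℝ))) • ∫ s in τ..(t : ℝ), (F s (Φ y s) - F s (Φ y' s)) := by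
      rw [intervalIntegral.integral_sub (hint _ (hΦc y) _ _) (hint _ (hΦc y') _ _)]
      simp only [P, ContinuousMap.coe_mk]
      rw [← smul_sub]
      congr 1
      abel
    have hb : ‖∫ s in τ..(t : ℝ), (F s (Φ y s) - F s (Φ y' s))‖ ≤
        ∫ s in τ..(t : ℝ), L * dist y y' * Real.exp (k * s) := by
      refine intervalIntegral.norm_integral_le_of_norm_le t.2.1 (ae_of_all _ fun s hs => ?_)
        (Continuous.intervalIntegrable (by fun_prop) _ _)
      refine (hF s _ _).trans ?_
      have : Φ y s - Φ y' s = Real.exp (k * s) •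
          (y (projIcc τ T hτT s) - y' (projIcc τ T hτT s)) := by
        simp only [hΦ, smul_sub]
      rw [this, norm_smul, Real.norm_of_nonneg (Real.exp_pos _).le, ← dist_eq_norm, mul_assoc,
        mul_comm (Real.exp _)]
      gcongr
      exact ContinuousMap.dist_apply_le_dist _
    have hI : ∫ s in τ..(t : ℝ), L * dist y y' * Real.exp (k * s) ≤
        L * dist y y' * (Real.exp (k * t) / k) := by
      rw [intervalIntegral.integral_const_mul]
      have h1 : ∫ s in τ..(t : ℝ), Real.exp (k * s) =
          Real.exp (k * t) / k - Real.exp (k * τ) / k := by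
        refine intervalIntegral.integral_eq_sub_of_hasDerivAt (f := fun s => Real.exp (k * s) / k)
          (fun s _ => ?_) (Continuous.intervalIntegrable (by fun_prop) _ _)
        have := (((hasDerivAt_id s).const_mul k).exp).div_const k
        simpa [hk0.ne'] using this
      rw [h1]
      have : 0 ≤ Real.exp (k * τ) / k := by positivity
      gcongr
      linarith
    rw [dist_eq_norm, e, norm_smul, Real.norm_of_nonneg (Real.exp_pos _).le]
    calc Real.exp (-(k * (t : ℝ))) * ‖∫ s in τ..(t : ℝ), (F s (Φ y s) - F s (Φ y' s))‖
        ≤ Real.exp (-(k * (t : ℝ))) * (L * dist y y' * (Real.exp (k * t) / k)) := by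
          gcongr
          exact hb.trans hI
      _ = L / k * dist y y' := by
          rw [Real.exp_neg]
          have := (Real.exp_pos (k * (t : ℝ))).ne'
          field_simp
      _ ≤ _ := by
          have : L / k ≤ 1 / 2 := by
            rw [div_le_div_iff₀ hk0 two_pos, hk]
            linarith
          have h2 : ((1 / 2 : NNReal) : ℝ) = 1 / 2 := by push_cast; ring
          rw [h2]
          gcongr
  set y := hP.fixedPoint with hy
  have hfix : P y = y := hP.fixedPoint_isFixedPt
  refine ⟨Φ y, hΦc y, fun t ht => ?_⟩
  have h1 : Φ y t = Real.exp (k * t) • (P y) ⟨t, ht⟩ := by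
    rw [hfix]
    simp only [hΦ]
    rw [projIcc_of_mem hτT ht]
  rw [h1]
  simp only [P, ContinuousMap.coe_mk]
  rw [smul_smul, ← Real.exp_add]
  simp

end ODE

end WassersteinControl

namespace WassersteinControl

/-! ### Lagrangian flows -/

section Flows

variable {d : ℕ} {U : Type*}

/-- The nearest point of `[τ,T]`. -/
def clamp (τ T t : ℝ) : ℝ := max τ (min T t)

theorem clamp_mem {τ T : ℝ} (h : τ ≤ T) (t : ℝ) : clamp τ T t ∈ Icc τ T :=
  ⟨le_max_left _ _, max_le h (min_le_left _ _)⟩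

theorem clamp_of_mem {τ T t : ℝ} (h : t ∈ Icc τ T) : clamp τ T t = t := by
  rw [clamp, min_eq_right h.2, max_eq_right h.1]

theorem continuous_clamp (τ T : ℝ) : Continuous (clamp τ T) := by
  unfold clamp; fun_prop

/-- A `W₁`-continuous curve of probability measures on a fixed ball. -/
structure MeasureCurve (τ T R : ℝ) (c : ℝ → Measure (E d)) : Prop where
  probOn : ∀ t ∈ Icc τ T, ProbOn (ball0 d R) (c t)
  tendsto : ∀ t ∈ Icc τ T, Tendsto (fun s => wass 1 (c s) (c t)) (𝓝[Icc τ T] t) (𝓝 0)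

theorem MeasureCurve.mono {τ T R R' : ℝ} {c : ℝ → Measure (E d)} (h : MeasureCurve τ T R c)
    (hR : R ≤ R') : MeasureCurve τ T R' c :=
  ⟨fun t ht => (h.probOn t ht).mono_radius hR, h.tendsto⟩

theorem tendsto_wass_clamp {τ T : ℝ} (hτT : τ ≤ T) {c : ℝ → Measure (E d)}
    (h : ∀ t ∈ Icc τ T, Tendsto (fun s => wass 1 (c s) (c t)) (𝓝[Icc τ T] t) (𝓝 0)) (t : ℝ) :
    Tendsto (fun s => wass 1 (c (clamp τ T s)) (c (clamp τ T t))) (𝓝 t) (𝓝 0) := by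
  have h1 : Tendsto (clamp τ T) (𝓝 t) (𝓝[Icc τ T] (clamp τ T t)) :=
    tendsto_nhdsWithin_of_tendsto_nhds_of_eventually_within _ ((continuous_clamp τ T).tendsto t)
      (Eventually.of_forall fun s => clamp_mem hτT s)
  exact (h _ (clamp_mem hτT t)).comp h1

theorem RegularVelocity.continuous_comp [TopologicalSpace U] {T m : ℝ}
    {v : ℝ → Measure (E d) → U → E d → E d} (hv : RegularVelocity T v m) {R : ℝ} (hR : 0 < R)
    {X : Type*} [TopologicalSpace X] {t : X → ℝ} {μ : X → Measure (E d)} {w : X → U} {p : X → E d}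
    (ht : Continuous t) (htI : ∀ x, t x ∈ Icc 0 T) (hμ : ∀ x, ProbOn (ball0 d R) (μ x))
    (hμc : ∀ x₀, Tendsto (fun x => wass 1 (μ x) (μ x₀)) (𝓝 x₀) (𝓝 0)) (hw : Continuous w)
    (hp : Continuous p) (hpR : ∀ x, p x ∈ ball0 d R) :
    Continuous fun x => v (t x) (μ x) (w x) (p x) := by
  obtain ⟨l, hl, hlip⟩ := hv.lip R hR
  rw [continuous_iff_continuousAt]
  intro x₀
  rw [ContinuousAt, tendsto_iff_norm_sub_tendsto_zero]
  have h1 : Tendsto (fun x => ‖v (t x₀) (μ x₀) (w x) (p x₀) - v (t x₀) (μ x₀) (w x₀) (p x₀)‖)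
      (𝓝 x₀) (𝓝 0) := by
    rw [← tendsto_iff_norm_sub_tendsto_zero]
    exact ((hv.cont _ (htI x₀) _ (hμ x₀).isPc (p x₀)).comp hw).tendsto x₀
  have h2 : Tendsto (fun x => l * (|t x - t x₀| + wass 1 (μ x) (μ x₀) + ‖p x - p x₀‖))
      (𝓝 x₀) (𝓝 0) := by
    have e1 : Tendsto (fun x => |t x - t x₀|) (𝓝 x₀) (𝓝 0) := by
      have : Continuous fun x => |t x - t x₀| := by fun_prop
      simpa using this.tendsto x₀
    have e2 : Tendsto (fun x => ‖p x - p x₀‖) (𝓝 x₀) (𝓝 0) := by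
      have : Continuous fun x => ‖p x - p x₀‖ := by fun_prop
      simpa using this.tendsto x₀
    simpa using ((e1.add (hμc x₀)).add e2).const_mul l
  refine squeeze_zero (fun _ => norm_nonneg _) (fun x => ?_) (by simpa using h2.add h1)
  have := hlip (w x) _ (htI x) _ (htI x₀) _ _ (hμ x) (hμ x₀) _ (hpR x) _ (hpR x₀)
  refine le_trans ?_ (add_le_add_left this _)
  exact norm_sub_le_norm_sub_add_norm_sub _ _ _

/-- The velocity field seen along a curve of measures, extended by projection in time and space from
`[τ,T] × B(0,R)`. -/
noncomputable def truncField (v : ℝ → Measure (E d) → U → E d → E d) (c : ℝ → Measure (E d))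
    (τ T R : ℝ) (t : ℝ) (w : U) (x : E d) : E d :=
  v (clamp τ T t) (c (clamp τ T t)) w (retract R x)

theorem truncField_eq {v : ℝ → Measure (E d) → U → E d → E d} {c : ℝ → Measure (E d)}
    {τ T R t : ℝ} (hR : 0 < R) (ht : t ∈ Icc τ T) (w : U) {x : E d} (hx : ‖x‖ ≤ R) :
    truncField v c τ T R t w x = v t (c t) w x := by
  rw [truncField, clamp_of_mem ht, retract_of_norm_le hR hx]

theorem Icc_sub_Icc_zero {τ T t : ℝ} (hτ : 0 ≤ τ) (ht : t ∈ Icc τ T) : t ∈ Icc 0 T :=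
  ⟨hτ.trans ht.1, ht.2⟩

section Trunc

variable [TopologicalSpace U] {T m : ℝ} {v : ℝ → Measure (E d) → U → E d → E d}

theorem continuous_truncField (hv : RegularVelocity T v m) {τ R : ℝ} (hR : 0 < R) (hτ : 0 ≤ τ)
    (hτT : τ ≤ T) {c : ℝ → Measure (E d)} (hc : MeasureCurve τ T R c) :
    Continuous fun q : ℝ × U × E d => truncField v c τ T R q.1 q.2.1 q.2.2 := by
  refine hv.continuous_comp hR ((continuous_clamp τ T).comp continuous_fst)
    (fun q => Icc_sub_Icc_zero hτ (clamp_mem hτT _)) (fun q => hc.probOn _ (clamp_mem hτT _))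
    (fun q => (tendsto_wass_clamp hτT hc.tendsto q.1).comp (continuous_fst.tendsto q))
    (by fun_prop) ((continuous_retract hR).comp (by fun_prop)) (fun q => ?_)
  simpa using norm_retract_le hR q.2.2

theorem norm_truncField_le (hv : RegularVelocity T v m) (hm : 0 ≤ m) {τ R : ℝ} (hR : 0 < R)
    (hτ : 0 ≤ τ) (hτT : τ ≤ T) {c : ℝ → Measure (E d)} (hc : MeasureCurve τ T R c) (t : ℝ) (w : U)
    (x : E d) : ‖truncField v c τ T R t w x‖ ≤ m * (1 + R + R) := by
  have h := hc.probOn _ (clamp_mem hτT t)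
  refine (hv.growth w _ (Icc_sub_Icc_zero hτ (clamp_mem hτT t)) _ h.isPc _).trans ?_
  gcongr
  · exact norm_retract_le hR x
  · exact h.moment1_le

theorem exists_truncField_lipschitz (hv : RegularVelocity T v m) {τ R : ℝ} (hR : 0 < R)
    (hτ : 0 ≤ τ) (hτT : τ ≤ T) {c : ℝ → Measure (E d)} (hc : MeasureCurve τ T R c) :
    ∃ L > 0, ∀ t w x y,
      ‖truncField v c τ T R t w x - truncField v c τ T R t w y‖ ≤ L * ‖x - y‖ := by
  obtain ⟨l, hl, hlip⟩ := hv.lip R hR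
  refine ⟨l * 2, by positivity, fun t w x y => ?_⟩
  have ht := Icc_sub_Icc_zero hτ (clamp_mem hτT t)
  have h := hc.probOn _ (clamp_mem hτT t)
  have := hlip w _ ht _ ht _ _ h h (retract R x) (by simpa using norm_retract_le hR x)
    (retract R y) (by simpa using norm_retract_le hR y)
  rw [h.wass_one_self] at this
  refine this.trans ?_
  have := norm_retract_sub_le hR x y
  rw [mul_assoc]
  gcongr
  simpa using this

end Trunc

/-- The retraction onto the closed ball, with values in the subtype. -/
noncomputable def toBall {r : ℝ} (hr : 0 < r) : C(E d, Metric.closedBall (0 : E d) r) :=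
  ⟨fun x => ⟨retract r x, mem_closedBall_zero_iff.2 (norm_retract_le hr x)⟩,
    Continuous.subtype_mk (continuous_retract hr) _⟩

theorem toBall_of_mem {r : ℝ} (hr : 0 < r) (x : Metric.closedBall (0 : E d) r) :
    toBall hr (x : E d) = x :=
  Subtype.ext (retract_of_norm_le hr (mem_closedBall_zero_iff.1 x.2))

/-- The inclusion of the closed ball. -/
def inclBall (d : ℕ) (r : ℝ) : C(Metric.closedBall (0 : E d) r, E d) :=
  ⟨Subtype.val, continuous_subtype_val⟩

theorem norm_inclBall_le {r : ℝ} (hr : 0 < r) : ‖inclBall d r‖ ≤ r :=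
  (ContinuousMap.norm_le _ hr.le).2 fun x => mem_closedBall_zero_iff.1 x.2

/-- The velocity field, extended by projection from `[0,T] × B(0,R)`, acts continuously on spaces of
continuous functions. -/
theorem RegularVelocity.exists_superposition [TopologicalSpace U] {T m : ℝ}
    {v : ℝ → Measure (E d) → U → E d → E d} (hv : RegularVelocity T v m) (hT : 0 ≤ T) {R : ℝ}
    (hR0 : 0 < R) {B : Type*} [TopologicalSpace B] [CompactSpace B]
    {M : ℝ → C(B, E d) → Measure (E d)} (hMP : ∀ t Y, ProbOn (ball0 d R) (M t Y))
    (hMc : ∀ q : ℝ × C(B, E d),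
      Tendsto (fun p : ℝ × C(B, E d) => wass 1 (M p.1 p.2) (M q.1 q.2)) (𝓝 q) (𝓝 0)) :
    ∃ V : ℝ × U × C(B, E d) → C(B, E d), Continuous V ∧ ∀ t w Y x,
      V (t, w, Y) x = v (clamp 0 T t) (M t Y) w (retract R (Y x)) := by
  have hball : ∀ x : E d, retract R x ∈ ball0 d R := fun x =>
    mem_closedBall_zero_iff.2 (norm_retract_le hR0 x)
  have hev : Continuous fun q : (ℝ × U × C(B, E d)) × B => q.1.2.2 q.2 := by fun_prop
  have hcl : Continuous fun q : (ℝ × U × C(B, E d)) × B => clamp 0 T q.1.1 :=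
    (continuous_clamp 0 T).comp (by fun_prop)
  have hr : Continuous fun q : (ℝ × U × C(B, E d)) × B => retract R (q.1.2.2 q.2) :=
    (continuous_retract hR0).comp hev
  have hw : Continuous fun q : (ℝ × U × C(B, E d)) × B => q.1.2.1 := by fun_prop
  have hp : Continuous fun q : (ℝ × U × C(B, E d)) × B => (q.1.1, q.1.2.2) := by fun_prop
  have hVc : Continuous fun q : (ℝ × U × C(B, E d)) × B =>
      v (clamp 0 T q.1.1) (M q.1.1 q.1.2.2) q.1.2.1 (retract R (q.1.2.2 q.2)) := by
    have hμ : ∀ q₀ : (ℝ × U × C(B, E d)) × B, Tendsto (fun q : (ℝ × U × C(B, E d)) × B =>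
        wass 1 (M q.1.1 q.1.2.2) (M q₀.1.1 q₀.1.2.2)) (𝓝 q₀) (𝓝 0) := fun q₀ => by
      have h1 := hMc (q₀.1.1, q₀.1.2.2)
      have h2 := hp.tendsto q₀
      have h3 := h1.comp h2
      exact h3
    exact hv.continuous_comp (t := fun q : (ℝ × U × C(B, E d)) × B => clamp 0 T q.1.1)
      (μ := fun q => M q.1.1 q.1.2.2) (w := fun q => q.1.2.1)
      (p := fun q => retract R (q.1.2.2 q.2)) hR0 hcl
      (fun q => clamp_mem hT q.1.1) (fun q => hMP _ _) hμ hw hr (fun q => hball _)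
  refine ⟨fun q => ⟨fun x => v (clamp 0 T q.1) (M q.1 q.2.2) q.2.1 (retract R (q.2.2 x)), ?_⟩,
    ?_, fun _ _ _ _ => rfl⟩
  · have h : Continuous fun x : B => (q, x) := by fun_prop
    exact hVc.comp h
  · exact ContinuousMap.continuous_of_continuous_uncurry _ hVc

/-- Existence of a flow for a velocity field that may depend on a law `M` computed from the flow
itself: a differential equation in the Banach space of continuous functions on the set of starting
points. Both the law of the flow and a prescribed curve of measures are covered; `A` bounds the part
of the first moment that does not come from the flow. -/
theorem exists_flow_map [TopologicalSpace U] [MeasurableSpace U] [BorelSpace U]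
    [SecondCountableTopology U] [TopologicalSpace.PseudoMetrizableSpace U] {T m : ℝ}
    {v : ℝ → Measure (E d) → U → E d → E d} (hv : RegularVelocity T v m) (hm : 0 ≤ m)
    {B : Type*} [TopologicalSpace B] [CompactSpace B] (ι : C(B, E d))
    {τ r A R : ℝ} (hτ : 0 ≤ τ) (hτT : τ ≤ T) (hr : 0 < r) (hι : ‖ι‖ ≤ r) (hA : 0 ≤ A)
    (hR : (1 + A + 2 * r) * Real.exp (2 * m * T) ≤ R) {u : ℝ → U} (hu : Measurable u)
    {M : ℝ → C(B, E d) → Measure (E d)}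
    (hMP : ∀ t Y, ProbOn (ball0 d R) (M t Y))
    (hML : ∀ t Y Y', wass 1 (M t Y) (M t Y') ≤ 2 * ‖Y - Y'‖)
    (hMc : ∀ q : ℝ × C(B, E d),
      Tendsto (fun p : ℝ × C(B, E d) => wass 1 (M p.1 p.2) (M q.1 q.2)) (𝓝 q) (𝓝 0))
    (hMm : ∀ t Y, moment1 (M t Y) ≤ ‖Y‖ + A) :
    ∃ Y : ℝ → C(B, E d), Continuous Y ∧
      (∀ t ∈ Icc τ T, ‖Y t‖ ≤ R) ∧
      ∀ t ∈ Icc τ T, ∀ x : B, Y t x = ι x + ∫ s in τ..t, v s (M s (Y s)) (u s) (Y s x) := by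
  have hT : 0 ≤ T := hτ.trans hτT
  have hR0 : 0 < R := by
    refine lt_of_lt_of_le ?_ hR
    positivity
  obtain ⟨l, hl, hlip⟩ := hv.lip R hR0
  have hball : ∀ x : E d, retract R x ∈ ball0 d R := fun x =>
    mem_closedBall_zero_iff.2 (norm_retract_le hR0 x)
  have hcl : ∀ t, clamp 0 T t ∈ Icc 0 T := clamp_mem hT
  obtain ⟨V, hV, hVx⟩ := hv.exists_superposition hT hR0 hMP hMc
  have hVL : ∀ t w Y Y', ‖V (t, w, Y) - V (t, w, Y')‖ ≤ 4 * l * ‖Y - Y'‖ := by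
    intro t w Y Y'
    rw [ContinuousMap.norm_le _ (by positivity)]
    intro x
    rw [ContinuousMap.sub_apply, hVx, hVx]
    have h1 := hlip w _ (hcl t) _ (hcl t) _ _ (hMP t Y) (hMP t Y') _ (hball (Y x)) _ (hball (Y' x))
    have h2 := hML t Y Y'
    have h3 := norm_retract_sub_le hR0 (Y x) (Y' x)
    have h4 : ‖Y x - Y' x‖ ≤ ‖Y - Y'‖ := (Y - Y').norm_coe_le_norm x
    rw [sub_self, abs_zero] at h1
    refine h1.trans ?_
    calc _ ≤ l * (0 + 2 * ‖Y - Y'‖ + 2 * ‖Y - Y'‖) := by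
          gcongr
          linarith
      _ = _ := by ring
  have hVB : ∀ t w Y, ‖V (t, w, Y)‖ ≤ m * (1 + R + R) := by
    intro t w Y
    rw [ContinuousMap.norm_le _ (by positivity)]
    intro x
    rw [hVx]
    refine (hv.growth _ _ (hcl t) _ (hMP t Y).isPc _).trans ?_
    gcongr
    · exact norm_retract_le hR0 _
    · exact (hMP t Y).moment1_le
  have hVm : ∀ Y : ℝ → C(B, E d), Continuous Y →
      AEStronglyMeasurable (fun t => V (t, u t, Y t)) volume := by
    intro Y hY
    have h : AEStronglyMeasurable (fun t => (t, u t, Y t)) volume :=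
      aestronglyMeasurable_id.prodMk
        (hu.stronglyMeasurable.aestronglyMeasurable.prodMk hY.aestronglyMeasurable)
    exact hV.comp_aestronglyMeasurable h
  obtain ⟨Y, hY, hYeq⟩ := exists_caratheodory_solution (F := fun t Y => V (t, u t, Y))
    (L := 4 * l) (B := m * (1 + R + R)) (by positivity) hτT
    (fun t Y Y' => hVL t (u t) Y Y') (fun t Y => hVB t (u t) Y) hVm ι
  have hVi : ∀ a b, IntervalIntegrable (fun s => V (s, u s, Y s)) volume a b := fun a b => by
    rw [intervalIntegrable_iff]
    exact Measure.integrableOn_of_bounded (M := m * (1 + R + R)) (by simp) (hVm Y hY)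
      (ae_of_all _ fun t => hVB _ _ _)
  have heq : ∀ t ∈ Icc τ T, ∀ x : B,
      Y t x = ι x + ∫ s in τ..t, v (clamp 0 T s) (M s (Y s)) (u s) (retract R (Y s x)) := by
    intro t ht x
    have h1 := congrArg (fun Z : C(B, E d) => Z x) (hYeq t ht)
    have h2 := (ContinuousMap.evalCLM ℝ x).intervalIntegral_comp_comm (hVi τ t)
    simp only [ContinuousMap.evalCLM_apply, hVx] at h2
    simp only [ContinuousMap.add_apply] at h1
    rw [h1, h2]
  -- The growth condition keeps the solution inside the ball on which the field is unchanged
  have hbound : ∀ t ∈ Icc τ T, ‖Y t‖ ≤ R := by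
    intro t ht
    have hf : ContinuousOn (fun t => 1 + A + 2 * ‖Y t‖) (Icc τ T) := by fun_prop
    have := le_mul_exp_of_le_add_integral (A := 1 + A + 2 * r) (K := 2 * m) (by positivity) hf
      (fun t ht => by
        have hi0 : 0 ≤ ∫ s in τ..t, (1 + A + 2 * ‖Y s‖) :=
          intervalIntegral.integral_nonneg ht.1 fun s _ => by positivity
        have : ‖Y t‖ ≤ r + m * ∫ s in τ..t, (1 + A + 2 * ‖Y s‖) := by
          rw [ContinuousMap.norm_le _ (by positivity)]
          intro x
          rw [heq t ht x]
          refine (norm_add_le _ _).trans (add_le_add ((ι.norm_coe_le_norm x).trans hι) ?_)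
          rw [← intervalIntegral.integral_const_mul]
          refine intervalIntegral.norm_integral_le_of_norm_le ht.1 (ae_of_all _ fun s _ => ?_)
            (Continuous.intervalIntegrable (by fun_prop) _ _)
          refine (hv.growth _ _ (hcl s) _ (hMP s _).isPc _).trans ?_
          have h1 := (norm_retract_le_norm hR0 (Y s x)).trans ((Y s).norm_coe_le_norm x)
          have h2 := hMm s (Y s)
          calc m * (1 + ‖retract R (Y s x)‖ + moment1 (M s (Y s)))
              ≤ m * (1 + ‖Y s‖ + (‖Y s‖ + A)) := by gcongr
            _ = m * (1 + A + 2 * ‖Y s‖) := by ring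
        linarith) t ht
    have h2 : Real.exp (2 * m * (t - τ)) ≤ Real.exp (2 * m * T) := by
      have : t - τ ≤ T := by linarith [ht.2]
      gcongr
    have h3 : (1 + A + 2 * r) * Real.exp (2 * m * (t - τ)) ≤ R := by
      refine le_trans ?_ hR
      gcongr
    have := norm_nonneg (Y t)
    linarith
  refine ⟨Y, hY, hbound, fun t ht x => ?_⟩
  rw [heq t ht x]
  congr 1
  refine intervalIntegral.integral_congr fun s hs => ?_
  rw [uIcc_of_le ht.1] at hs
  have hs' : s ∈ Icc τ T := ⟨hs.1, hs.2.trans ht.2⟩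
  rw [clamp_of_mem (Icc_sub_Icc_zero hτ hs'),
    retract_of_norm_le hR0 (((Y s).norm_coe_le_norm x).trans (hbound s hs'))]

/-- `X` is a flow, on the time interval `[τ,T]` and for the starting points in `B(0,r)`, of the
velocity field seen along the curve `c`, and `c` is the curve of the laws of this flow when the
starting point has law `μ`. -/
structure IsFlow (T : ℝ) (v : ℝ → Measure (E d) → U → E d → E d) (u : ℝ → U) (τ r R : ℝ)
    (μ : Measure (E d)) (c : ℝ → Measure (E d)) (X : ℝ → E d → E d) : Prop where
  cont : Continuous fun q : ℝ × E d => X q.1 q.2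
  bound : ∀ t ∈ Icc τ T, ∀ x ∈ ball0 d r, ‖X t x‖ ≤ R
  ode : ∀ x ∈ ball0 d r, ∀ t ∈ Icc τ T, X t x = x + ∫ s in τ..t, v s (c s) (u s) (X s x)
  law : ∀ t ∈ Icc τ T, c t = μ.map (X t)

theorem IsFlow.measurable {T : ℝ} {v : ℝ → Measure (E d) → U → E d → E d} {u : ℝ → U}
    {τ r R : ℝ} {μ : Measure (E d)} {c : ℝ → Measure (E d)} {X : ℝ → E d → E d}
    (h : IsFlow T v u τ r R μ c X) (t : ℝ) : Measurable (X t) :=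
  (h.cont.comp (by fun_prop : Continuous fun x : E d => (t, x))).measurable

theorem IsFlow.continuous_time {T : ℝ} {v : ℝ → Measure (E d) → U → E d → E d} {u : ℝ → U}
    {τ r R : ℝ} {μ : Measure (E d)} {c : ℝ → Measure (E d)} {X : ℝ → E d → E d}
    (h : IsFlow T v u τ r R μ c X) (x : E d) : Continuous fun t => X t x :=
  h.cont.comp (by fun_prop : Continuous fun t : ℝ => (t, x))

theorem IsFlow.measureCurve {T : ℝ} {v : ℝ → Measure (E d) → U → E d → E d} {u : ℝ → U}
    {τ r R : ℝ} {μ : Measure (E d)} {c : ℝ → Measure (E d)} {X : ℝ → E d → E d}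
    (hμ : ProbOn (ball0 d r) μ)
    (h : IsFlow T v u τ r R μ c X) : MeasureCurve τ T R c := by
  have := hμ.1
  refine ⟨fun t ht => ?_, fun t ht => ?_⟩
  · rw [h.law t ht]
    refine probOn_map (h.measurable t) ?_
    filter_upwards [hμ.ae_mem] with x hx using h.bound t ht x hx
  · have hbd : ∀ s ∈ Icc τ T, ∀ᵐ x ∂μ, ‖‖X s x - X t x‖‖ ≤ R + R := fun s hs => by
      filter_upwards [hμ.ae_mem] with x hx
      rw [norm_norm]
      exact (norm_sub_le _ _).trans (add_le_add (h.bound s hs x hx) (h.bound t ht x hx))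
    have hmeas : ∀ s, AEStronglyMeasurable (fun x => ‖X s x - X t x‖) μ := fun s =>
      ((h.measurable s).sub (h.measurable t)).norm.aestronglyMeasurable
    have hlim : Tendsto (fun s => ∫ x, ‖X s x - X t x‖ ∂μ) (𝓝[Icc τ T] t)
        (𝓝 (∫ _, (0 : ℝ) ∂μ)) := by
      refine tendsto_integral_filter_of_dominated_convergence (fun _ => R + R)
        (Eventually.of_forall hmeas) ?_ (integrable_const _) (ae_of_all _ fun x => ?_)
      · filter_upwards [self_mem_nhdsWithin] with s hs using hbd s hs
      · have hX := h.continuous_time x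
        have : Continuous fun s => ‖X s x - X t x‖ := by fun_prop
        have := this.tendsto t
        rw [sub_self, norm_zero] at this
        exact this.mono_left nhdsWithin_le_nhds
    rw [integral_zero] at hlim
    refine squeeze_zero' (Eventually.of_forall fun s => wass_nonneg _ _ _) ?_ hlim
    filter_upwards [self_mem_nhdsWithin] with s hs
    rw [h.law s hs, h.law t ht]
    exact wass_one_map_le (h.measurable s) (h.measurable t)
      (integrable_of_ae_norm_le (hmeas s) (hbd s hs))

section Existence

variable [TopologicalSpace U] [MeasurableSpace U] [BorelSpace U]
    [SecondCountableTopology U] [TopologicalSpace.PseudoMetrizableSpace U] {T m : ℝ}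
    {v : ℝ → Measure (E d) → U → E d → E d}

/-- Existence for the non-local equation, in Lagrangian form. -/
theorem exists_flow (hv : RegularVelocity T v m) (hm : 0 ≤ m)
    {τ r : ℝ} (hτ : 0 ≤ τ) (hτT : τ ≤ T) (hr : 0 < r) {u : ℝ → U} (hu : Measurable u)
    {μ : Measure (E d)} (hμ : ProbOn (ball0 d r) μ) :
    ∃ (c : ℝ → Measure (E d)) (X : ℝ → E d → E d) (R : ℝ), 0 < R ∧ IsFlow T v u τ r R μ c X := by
  have := hμ.1
  set R := (1 + 0 + 2 * r) * Real.exp (2 * m * T) with hR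
  have hR0 : 0 < R := by positivity
  -- The law of the flow, read off from the flow as a continuous function on the ball.
  let M : ℝ → C(Metric.closedBall (0 : E d) r, E d) → Measure (E d) := fun _ Y =>
    μ.map fun x => retract R (Y (toBall hr x))
  have hMm : ∀ Y : C(Metric.closedBall (0 : E d) r, E d),
      Measurable fun x => retract R (Y (toBall hr x)) := fun Y =>
    ((continuous_retract hR0).comp (Y.continuous.comp (toBall hr).continuous)).measurable
  have hML : ∀ t Y Y', wass 1 (M t Y) (M t Y') ≤ 2 * ‖Y - Y'‖ := fun t Y Y' => by
    refine wass_one_map_le_of_bound (hMm Y) (hMm Y') (ae_of_all _ fun x => ?_)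
    have h4 := (Y - Y').norm_coe_le_norm (toBall hr x)
    rw [ContinuousMap.sub_apply] at h4
    exact (norm_retract_sub_le hR0 _ _).trans (by gcongr)
  obtain ⟨Y, hY, hYR, hYeq⟩ := exists_flow_map hv hm (inclBall d r) hτ hτT hr
    (norm_inclBall_le hr) le_rfl hR.ge hu (M := M)
    (fun t Y => probOn_map (hMm Y) (ae_of_all _ fun x => norm_retract_le hR0 _)) hML
    (fun q => by
      have h1 : Tendsto (fun p : ℝ × C(Metric.closedBall (0 : E d) r, E d) => 2 * ‖p.2 - q.2‖)
          (𝓝 q) (𝓝 0) := by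
        have : Continuous fun p : ℝ × C(Metric.closedBall (0 : E d) r, E d) =>
          2 * ‖p.2 - q.2‖ := by fun_prop
        simpa using this.tendsto q
      exact squeeze_zero (fun _ => wass_nonneg _ _ _) (fun p => hML p.1 p.2 q.2) h1)
    (fun t Y => by
      rw [add_zero]
      refine (probOn_map (R := ‖Y‖) (hMm Y) (ae_of_all _ fun x => ?_)).moment1_le
      exact (norm_retract_le_norm hR0 _).trans (Y.norm_coe_le_norm _))
  have hlaw : ∀ t ∈ Icc τ T, M t (Y t) = μ.map fun x => Y (clamp τ T t) (toBall hr x) := by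
    intro t ht
    simp only [M]
    congr 1
    ext1 x
    rw [clamp_of_mem ht, retract_of_norm_le hR0]
    exact ((Y t).norm_coe_le_norm _).trans (hYR t ht)
  refine ⟨fun t => M t (Y t), fun t x => Y (clamp τ T t) (toBall hr x), R, hR0, ?_, ?_, ?_, hlaw⟩
  · have h1 : Continuous fun q : ℝ × E d => Y (clamp τ T q.1) :=
      hY.comp ((continuous_clamp τ T).comp continuous_fst)
    have h2 : Continuous fun q : ℝ × E d => toBall hr q.2 :=
      (toBall hr).continuous.comp continuous_snd
    exact h1.eval h2
  · intro t ht x _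
    exact ((Y _).norm_coe_le_norm _).trans (hYR _ (clamp_mem hτT t))
  · intro x hx t ht
    rw [clamp_of_mem ht, toBall_of_mem hr ⟨x, hx⟩, hYeq t ht ⟨x, hx⟩]
    congr 1
    refine intervalIntegral.integral_congr fun s hs => ?_
    rw [uIcc_of_le ht.1] at hs
    rw [clamp_of_mem ⟨hs.1, hs.2.trans ht.2⟩]

/-- Existence of the flow of the velocity field seen along a given curve of measures. -/
theorem exists_flow_along (hv : RegularVelocity T v m) (hm : 0 ≤ m)
    {τ r Rc : ℝ} (hτ : 0 ≤ τ) (hτT : τ ≤ T) (hr : 0 < r) (hRc : 0 ≤ Rc) {u : ℝ → U}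
    (hu : Measurable u) {c : ℝ → Measure (E d)} (hc : MeasureCurve τ T Rc c) :
    ∃ (X : ℝ → E d → E d) (R : ℝ), 0 < R ∧ Rc ≤ R ∧
      (Continuous fun q : ℝ × E d => X q.1 q.2) ∧
      (∀ t ∈ Icc τ T, ∀ x ∈ ball0 d r, ‖X t x‖ ≤ R) ∧
      ∀ x ∈ ball0 d r, ∀ t ∈ Icc τ T, X t x = x + ∫ s in τ..t, v s (c s) (u s) (X s x) := by
  set R := (1 + Rc + 2 * r) * Real.exp (2 * m * T) with hR
  have hR0 : 0 < R := by positivity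
  have hT : 0 ≤ T := hτ.trans hτT
  have hexp : 1 ≤ Real.exp (2 * m * T) := Real.one_le_exp (by positivity)
  have hRcR : Rc ≤ R := by
    rw [hR]
    nlinarith
  obtain ⟨Y, hY, hYR, hYeq⟩ := exists_flow_map hv hm (inclBall d r) hτ hτT hr
    (norm_inclBall_le hr) hRc hR.ge hu
    (M := fun t _ => c (clamp τ T t))
    (fun t Y => (hc.probOn _ (clamp_mem hτT t)).mono_radius hRcR)
    (fun t Y Y' => by
      rw [(hc.probOn _ (clamp_mem hτT t)).wass_one_self]
      positivity)
    (fun q => (tendsto_wass_clamp hτT hc.tendsto q.1).comp (continuous_fst.tendsto q))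
    (fun t Y => by
      have := (hc.probOn _ (clamp_mem hτT t)).moment1_le
      have := norm_nonneg Y
      linarith)
  refine ⟨fun t x => Y (clamp τ T t) (toBall hr x), R, hR0, hRcR, ?_, ?_, ?_⟩
  · have h1 : Continuous fun q : ℝ × E d => Y (clamp τ T q.1) :=
      hY.comp ((continuous_clamp τ T).comp continuous_fst)
    have h2 : Continuous fun q : ℝ × E d => toBall hr q.2 :=
      (toBall hr).continuous.comp continuous_snd
    exact h1.eval h2
  · intro t ht x _
    exact ((Y _).norm_coe_le_norm _).trans (hYR _ (clamp_mem hτT t))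
  · intro x hx t ht
    simp only
    rw [clamp_of_mem ht, toBall_of_mem hr ⟨x, hx⟩, hYeq t ht ⟨x, hx⟩]
    congr 1
    refine intervalIntegral.integral_congr fun s hs => ?_
    rw [uIcc_of_le ht.1] at hs
    rw [clamp_of_mem ⟨hs.1, hs.2.trans ht.2⟩]

end Existence

end Flows

end WassersteinControl

namespace WassersteinControl

/-! ### Flows solve the continuity equation -/

section FlowTrajectory

variable {d : ℕ} {U : Type*}

/-- The chain rule, in integrated form, along a curve that is the primitive of a bounded function. -/
theorem integral_fderiv_along {ξ : ℝ × E d → ℝ} (hξ : ContDiff ℝ (⊤ : ℕ∞) ξ)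
    (hξc : HasCompactSupport ξ) {a b B : ℝ} (hab : a ≤ b) {Y g : ℝ → E d}
    (hg : IntervalIntegrable g volume a b) (hB : ∀ t, ‖g t‖ ≤ B)
    (hY : ∀ t ∈ Icc a b, Y t = Y a + ∫ s in a..t, g s) :
    ∫ t in a..b, fderiv ℝ ξ (t, Y t) ((1 : ℝ), g t) = ξ (b, Y b) - ξ (a, Y a) := by
  obtain ⟨K, hK⟩ := hξ.lipschitzWith_of_hasCompactSupport hξc (by simp)
  have hYL : ∀ s ∈ Icc a b, ∀ t ∈ Icc a b, ‖Y s - Y t‖ ≤ B * |s - t| := by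
    intro s hs t ht
    have h1 : IntervalIntegrable g volume a s :=
      hg.mono_set (by rw [uIcc_of_le hab, uIcc_of_le hs.1]; exact Icc_subset_Icc_right hs.2)
    have h2 : IntervalIntegrable g volume a t :=
      hg.mono_set (by rw [uIcc_of_le hab, uIcc_of_le ht.1]; exact Icc_subset_Icc_right ht.2)
    rw [hY s hs, hY t ht, add_sub_add_left_eq_sub,
      intervalIntegral.integral_interval_sub_left h1 h2]
    exact intervalIntegral.norm_integral_le_of_norm_le_const fun _ _ => hB _
  have hL : LipschitzOnWith (K * Real.toNNReal (max 1 B)) (fun t => ξ (t, Y t)) (uIcc a b) := by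
    rw [uIcc_of_le hab]
    refine LipschitzOnWith.of_dist_le_mul fun s hs t ht => ?_
    refine (hK.dist_le_mul _ _).trans ?_
    rw [NNReal.coe_mul, mul_assoc, Real.coe_toNNReal _ (by positivity)]
    gcongr
    rw [Prod.dist_eq, Real.dist_eq, dist_eq_norm]
    refine max_le ?_ ((hYL s hs t ht).trans ?_)
    · exact le_mul_of_one_le_left (abs_nonneg _) (le_max_left _ _)
    · gcongr
      exact le_max_right _ _
  rw [← hL.absolutelyContinuousOnInterval.integral_deriv_eq_sub]
  have hb : ∀ᵐ t : ℝ, t ≠ b := by simp [ae_iff, measure_singleton]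
  refine intervalIntegral.integral_congr_ae ?_
  filter_upwards [hg.ae_hasDerivAt_integral, hb] with t ht htb htI
  rw [uIoc_of_le hab] at htI
  rw [uIcc_of_le hab] at ht
  have h1 := ht (Ioc_subset_Icc_self htI) a (left_mem_Icc.2 hab)
  have h2 : HasDerivAt Y (g t) t := by
    refine (h1.const_add (Y a)).congr_of_eventuallyEq ?_
    filter_upwards [Icc_mem_nhds htI.1 (lt_of_le_of_ne htI.2 htb)] with s hs using hY s hs
  have h3 : HasFDerivAt ξ (fderiv ℝ ξ (t, Y t)) (t, Y t) :=
    (hξ.differentiable (by simp) _).hasFDerivAt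
  have h4 : HasDerivAt (fun s => (s, Y s)) ((1 : ℝ), g t) t := (hasDerivAt_id t).prodMk h2
  exact (h3.comp_hasDerivAt t h4).deriv.symm

/-- The sublinear growth of the velocity confines all flows issued from a ball to a ball that
depends only on the data. -/
theorem IsFlow.norm_le [TopologicalSpace U] {T m : ℝ}
    {v : ℝ → Measure (E d) → U → E d → E d} (hv : RegularVelocity T v m) (hm : 0 ≤ m) {τ r R : ℝ}
    (hr : 0 ≤ r) (hτ : 0 ≤ τ) {u : ℝ → U} {μ : Measure (E d)}
    (hμ : ProbOn (ball0 d r) μ) {c : ℝ → Measure (E d)} {X : ℝ → E d → E d}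
    (h : IsFlow T v u τ r R μ c X) : ∀ t ∈ Icc τ T, ∀ x ∈ ball0 d r,
      ‖X t x‖ ≤ gronwallConst m T * (2 * (1 + r)) := by
  have := hμ.1
  have hc := h.measureCurve hμ
  have hcont : Continuous fun q : ℝ × E d => 1 + ‖X q.1 q.2‖ := by
    have := h.cont
    fun_prop
  have hmom : ∀ t ∈ Icc τ T, moment1 (c t) = ∫ x, ‖X t x‖ ∂μ := fun t ht => by
    rw [moment1, h.law t ht, integral_map (h.measurable t).aemeasurable
      continuous_norm.aestronglyMeasurable]
  have hint : ∀ t ∈ Icc τ T, Integrable (fun x => ‖X t x‖) μ := fun t ht => by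
    refine integrable_of_ae_norm_le (C := R) (h.measurable t).norm.aestronglyMeasurable ?_
    filter_upwards [hμ.ae_mem] with x hx
    simpa using h.bound t ht x hx
  have key := gronwall_mean (P := μ) (G := ball0 d r) hμ.ae_mem
    (f := fun t x => 1 + ‖X t x‖) (g := fun _ => 1 + r) (ℓ := m) (a := τ) (b := T) (S := T)
    (B := 1 + R) hm (by linarith) (integrable_const _) (fun _ _ => by positivity)
    (fun _ _ _ _ => by positivity) (fun t ht x hx => by simpa using h.bound t ht x hx)
    (fun t _ => ((h.measurable t).norm.const_add 1).aestronglyMeasurable)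
    (fun x _ => (hcont.comp (by fun_prop : Continuous fun t : ℝ => (t, x))).continuousOn)
    (fun t ht x hx => by
      rw [add_assoc]
      gcongr
      rw [h.ode x hx t ht]
      refine (norm_add_le _ _).trans (add_le_add (by simpa using hx) ?_)
      rw [← intervalIntegral.integral_const_mul]
      have hX := h.continuous_time x
      have hM : ContinuousOn (fun s => ∫ x, (1 + ‖X s x‖) ∂μ) (Icc τ T) := by
        refine continuousOn_of_dominated (bound := fun _ => 1 + R)
          (fun s _ => ((h.measurable s).norm.const_add 1).aestronglyMeasurable)
          (fun s hs => ?_) (integrable_const _) (ae_of_all _ fun x => ?_)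
        · filter_upwards [hμ.ae_mem] with x hx
          rw [Real.norm_of_nonneg (by positivity)]
          simpa using h.bound s hs x hx
        · exact (hcont.comp (by fun_prop : Continuous fun t : ℝ => (t, x))).continuousOn
      refine intervalIntegral.norm_integral_le_of_norm_le ht.1 (ae_of_all _ fun s hs => ?_) ?_
      · have hs' : s ∈ Icc τ T := ⟨hs.1.le, hs.2.trans ht.2⟩
        refine (hv.growth _ s (Icc_sub_Icc_zero hτ hs') _ (hc.probOn s hs').isPc _).trans ?_
        rw [hmom s hs', integral_add (integrable_const _) (hint s hs')]
        rw [integral_const, probReal_univ, one_smul]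
        refine mul_le_mul_of_nonneg_left ?_ hm
        linarith [norm_nonneg (X s x)]
      · rw [intervalIntegrable_iff_integrableOn_Icc_of_le ht.1]
        refine ContinuousOn.integrableOn_Icc ?_
        have h1 : ContinuousOn (fun s => 1 + ‖X s x‖) (Icc τ t) := by fun_prop
        exact ((hM.mono (Icc_subset_Icc_right ht.2)).add h1).const_mul m)
  intro t ht x hx
  have h1 := (key t ht).2 x hx
  simp only [integral_const, probReal_univ, one_smul] at h1
  calc ‖X t x‖ ≤ 1 + ‖X t x‖ := by linarith
    _ ≤ _ := h1
    _ = _ := by ring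

variable [TopologicalSpace U] [MeasurableSpace U] [BorelSpace U]
    [SecondCountableTopology U] {T m : ℝ}
    {v : ℝ → Measure (E d) → U → E d → E d}

theorem measurable_truncField (hv : RegularVelocity T v m) {τ R : ℝ} (hR : 0 < R) (hτ : 0 ≤ τ)
    (hτT : τ ≤ T) {c : ℝ → Measure (E d)} (hc : MeasureCurve τ T R c) {u : ℝ → U}
    (hu : Measurable u) :
    Measurable fun q : ℝ × E d => truncField v c τ T R q.1 (u q.1) q.2 := by
  have h1 := (continuous_truncField hv hR hτ hτT hc).measurable
  have h2 : Measurable fun q : ℝ × E d => (q.1, u q.1, q.2) :=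
    measurable_fst.prodMk ((hu.comp measurable_fst).prodMk measurable_snd)
  exact h1.comp h2

/-- The laws of a flow solve the continuity equation: the weak formulation is the integral, over the
starting points, of the derivative of the test function along the curves of the flow. -/
theorem IsFlow.isTrajectory (hv : RegularVelocity T v m) (hm : 0 ≤ m) {τ r R : ℝ} (hR : 0 < R)
    (hτ : 0 ≤ τ) (hτT : τ ≤ T) {u : ℝ → U} (hu : Measurable u) {μ : Measure (E d)}
    (hμ : ProbOn (ball0 d r) μ) {c : ℝ → Measure (E d)} {X : ℝ → E d → E d}
    (h : IsFlow T v u τ r R μ c X) : IsTrajectory T v u τ μ c := by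
  have := hμ.1
  have hc := h.measureCurve hμ
  have hτI : τ ∈ Icc τ T := left_mem_Icc.2 hτT
  have hX0 : ∀ x ∈ ball0 d r, X τ x = x := fun x hx => by
    rw [h.ode x hx τ hτI, intervalIntegral.integral_same, add_zero]
  refine ⟨fun t ht => (hc.probOn t ht).isPc, hc.tendsto, ?_, ?_⟩
  · rw [h.law τ hτI]
    have h1 : X τ =ᵐ[μ] id := by
      filter_upwards [hμ.ae_mem] with x hx using hX0 x hx
    rw [Measure.map_congr h1, Measure.map_id]
  intro ξ hξ hξc hξs
  set b : ℝ → E d → E d := fun t x => truncField v c τ T R t (u t) x with hb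
  have hbm : Measurable fun q : ℝ × E d => b q.1 q.2 := measurable_truncField hv hR hτ hτT hc hu
  have hbB : ∀ t x, ‖b t x‖ ≤ m * (1 + R + R) := fun t x =>
    norm_truncField_le hv hm hR hτ hτT hc t _ x
  have hDc : Continuous (fderiv ℝ ξ) := hξ.continuous_fderiv (by simp)
  obtain ⟨K, hK⟩ := (hξc.fderiv ℝ).exists_bound_of_continuous hDc
  have hap : Measurable fun q : (ℝ × E d) × ℝ × E d => fderiv ℝ ξ q.1 q.2 := by
    have : Continuous fun q : (ℝ × E d) × ℝ × E d => fderiv ℝ ξ q.1 q.2 :=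
      (hDc.comp continuous_fst).clm_apply continuous_snd
    exact this.measurable
  have hkm : Measurable fun q : ℝ × E d => fderiv ℝ ξ q ((1 : ℝ), b q.1 q.2) := by
    have h2 : Measurable fun q : ℝ × E d => (q, ((1 : ℝ), b q.1 q.2)) :=
      measurable_id.prodMk (measurable_const.prodMk hbm)
    exact hap.comp h2
  have hXm : Measurable fun q : ℝ × E d => (q.1, X q.1 q.2) :=
    measurable_fst.prodMk h.cont.measurable
  have hk2 : Measurable fun q : ℝ × E d =>
      fderiv ℝ ξ (q.1, X q.1 q.2) ((1 : ℝ), b q.1 (X q.1 q.2)) := hkm.comp hXm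
  have hstep : ∫ t in τ..T, ∫ x, fderiv ℝ ξ (t, x) ((1 : ℝ), v t (c t) (u t) x) ∂(c t) =
      ∫ t in τ..T, ∫ x, fderiv ℝ ξ (t, X t x) ((1 : ℝ), b t (X t x)) ∂μ := by
    refine intervalIntegral.integral_congr fun t ht => ?_
    rw [uIcc_of_le hτT] at ht
    have h1 : ∫ x, fderiv ℝ ξ (t, x) ((1 : ℝ), v t (c t) (u t) x) ∂(c t) =
        ∫ x, fderiv ℝ ξ (t, x) ((1 : ℝ), b t x) ∂(c t) := by
      refine integral_congr_ae ?_
      filter_upwards [(hc.probOn t ht).ae_norm_le] with x hx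
      rw [hb]
      simp only
      rw [truncField_eq hR ht _ hx]
    have h2 : Measurable fun x => fderiv ℝ ξ (t, x) ((1 : ℝ), b t x) :=
      hkm.comp measurable_prodMk_left
    rw [h1, h.law t ht, integral_map (h.measurable t).aemeasurable h2.aestronglyMeasurable]
  rw [hstep, intervalIntegral_integral_swap]
  · rw [integral_eq_zero_of_ae]
    filter_upwards [hμ.ae_mem] with x hx
    have h1 : Measurable fun t => b t (X t x) := by
      have : Measurable fun t : ℝ => (t, X t x) := hXm.comp measurable_prodMk_right
      exact hbm.comp this
    have h2 := integral_fderiv_along hξ hξc hτT (Y := fun t => X t x)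
      (g := fun t => b t (X t x)) (B := m * (1 + R + R)) (by
        rw [intervalIntegrable_iff]
        exact Measure.integrableOn_of_bounded (M := m * (1 + R + R)) (by simp)
          h1.aestronglyMeasurable (ae_of_all _ fun t => hbB _ _)) (fun t => hbB _ _)
      (fun t ht => by
        rw [h.ode x hx t ht, hX0 x hx]
        congr 1
        refine intervalIntegral.integral_congr fun s hs => ?_
        rw [uIcc_of_le ht.1] at hs
        have hs' : s ∈ Icc τ T := ⟨hs.1, hs.2.trans ht.2⟩
        exact (truncField_eq hR hs' _ (h.bound s hs' x hx)).symm)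
    have h3 : ∀ t ∉ Ioo τ T, ∀ y, ξ (t, y) = 0 := fun t ht y =>
      image_eq_zero_of_notMem_tsupport fun hmem => ht (hξs hmem).1
    rw [h2, h3 T (by simp), h3 τ (by simp), sub_zero, Pi.zero_apply]
  · have : IsFiniteMeasure (volume.restrict (uIoc τ T)) := ⟨by
      rw [Measure.restrict_apply_univ, uIoc_of_le hτT]
      exact measure_Ioc_lt_top⟩
    refine Integrable.of_bound (C := K * max 1 (m * (1 + R + R))) hk2.aestronglyMeasurable
      (ae_of_all _ fun q => ?_)
    refine (ContinuousLinearMap.le_opNorm _ _).trans ?_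
    refine mul_le_mul (hK _) ?_ (norm_nonneg _) ((norm_nonneg _).trans (hK 0))
    rw [Prod.norm_def, norm_one]
    exact max_le_max le_rfl (hbB _ _)

end FlowTrajectory

end WassersteinControl

namespace WassersteinControl

/-! ### The du Bois-Reymond lemma -/

section DuBoisReymond

variable {a b : ℝ}

/-- A smooth function with compact support in `(a,b)` and vanishing integral has a primitive of the
same kind. -/
theorem exists_compact_primitive (hab : a < b) {g : ℝ → ℝ} (hg : ContDiff ℝ (⊤ : ℕ∞) g)
    (hgc : HasCompactSupport g) (hgs : tsupport g ⊆ Ioo a b) (hg0 : ∫ t in a..b, g t = 0) :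
    ∃ η : ℝ → ℝ, ContDiff ℝ (⊤ : ℕ∞) η ∧ HasCompactSupport η ∧ tsupport η ⊆ Ioo a b ∧
      deriv η = g := by
  have hgi : ∀ x y, IntervalIntegrable g volume x y := fun x y =>
    hg.continuous.intervalIntegrable _ _
  obtain ⟨a', b', ha, hb, hsub⟩ : ∃ a' b', a < a' ∧ b' < b ∧ tsupport g ⊆ Icc a' b' := by
    rcases (tsupport g).eq_empty_or_nonempty with h | h
    · exact ⟨b, a, hab, hab, by simp [h]⟩
    · refine ⟨sInf (tsupport g), sSup (tsupport g), ?_, ?_, fun x hx => ⟨?_, ?_⟩⟩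
      · exact (hgs (hgc.isCompact.sInf_mem h)).1
      · exact (hgs (hgc.isCompact.sSup_mem h)).2
      · exact csInf_le hgc.isCompact.bddBelow hx
      · exact le_csSup hgc.isCompact.bddAbove hx
  have hz : ∀ t ∉ Icc a' b', g t = 0 := fun t ht =>
    image_eq_zero_of_notMem_tsupport fun h => ht (hsub h)
  have hder : ∀ t, HasDerivAt (fun t => ∫ s in a..t, g s) (g t) t := fun t =>
    intervalIntegral.integral_hasDerivAt_right (hgi a t)
      hg.continuous.aestronglyMeasurable.stronglyMeasurableAtFilter hg.continuous.continuousAt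
  have hd : deriv (fun t => ∫ s in a..t, g s) = g := funext fun t => (hder t).deriv
  have hs : Function.support (fun t => ∫ s in a..t, g s) ⊆ Icc a' b' := by
    intro t ht
    by_contra hcon
    apply ht
    rcases not_and_or.1 hcon with h | h
    · push Not at h
      refine (intervalIntegral.integral_congr (g := fun _ => (0 : ℝ)) fun s hs => ?_).trans
        (by simp)
      refine hz s fun hs' => ?_
      have : s ≤ max a t := hs.2
      have := hs'.1
      have : max a t < a' := max_lt ha h
      linarith
    · push Not at h
      have h1 := intervalIntegral.integral_add_adjacent_intervals (hgi a b) (hgi b t)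
      have h2 : ∫ s in b..t, g s = 0 := by
        refine (intervalIntegral.integral_congr (g := fun _ => (0 : ℝ)) fun s hs => ?_).trans
          (by simp)
        refine hz s fun hs' => ?_
        have : min b t ≤ s := hs.1
        have := hs'.2
        have : b' < min b t := lt_min hb h
        linarith
      simp only
      rw [← h1, hg0, h2, add_zero]
  have hts : tsupport (fun t => ∫ s in a..t, g s) ⊆ Icc a' b' := closure_minimal hs isClosed_Icc
  refine ⟨_, ?_, isCompact_Icc.of_isClosed_subset (isClosed_tsupport _) hts,
    hts.trans (fun x hx => ⟨ha.trans_le hx.1, hx.2.trans_lt hb⟩), hd⟩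
  exact contDiff_infty_iff_deriv.2 ⟨fun t => (hder t).differentiableAt, by rwa [hd]⟩

/-- A continuous function with vanishing distributional derivative is constant. -/
theorem eqOn_const_of_integral_deriv_mul_eq_zero (hab : a < b) {w : ℝ → ℝ}
    (hw : ContinuousOn w (Icc a b))
    (h : ∀ η : ℝ → ℝ, ContDiff ℝ (⊤ : ℕ∞) η → HasCompactSupport η → tsupport η ⊆ Ioo a b →
      ∫ t in a..b, deriv η t * w t = 0) : ∃ C, ∀ t ∈ Icc a b, w t = C := by
  have hwi : ∀ ψ : ℝ → ℝ, Continuous ψ → IntervalIntegrable (fun t => ψ t * w t) volume a b :=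
    fun ψ hψ => ContinuousOn.intervalIntegrable (by
      rw [uIcc_of_le hab.le]
      exact hψ.continuousOn.mul hw)
  let β : ContDiffBump ((a + b) / 2) := ⟨(b - a) / 8, (b - a) / 4, by linarith, by linarith⟩
  set ρ : ℝ → ℝ := β.normed volume with hρ
  have hρd : ContDiff ℝ (⊤ : ℕ∞) ρ := β.contDiff_normed
  have hρc : HasCompactSupport ρ := β.hasCompactSupport_normed
  have hρs : tsupport ρ ⊆ Ioo a b := by
    rw [hρ, β.tsupport_normed_eq, Real.closedBall_eq_Icc]
    intro x hx
    have h1 : (a + b) / 2 - (b - a) / 4 ≤ x := hx.1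
    have h2 : x ≤ (a + b) / 2 + (b - a) / 4 := hx.2
    exact ⟨by linarith, by linarith⟩
  have hint : ∀ ψ : ℝ → ℝ, tsupport ψ ⊆ Ioo a b → ∫ t in a..b, ψ t = ∫ t, ψ t := by
    intro ψ hψ
    refine intervalIntegral.integral_eq_integral_of_support_subset ?_
    exact (subset_tsupport ψ).trans (hψ.trans Ioo_subset_Ioc_self)
  have hρ1 : ∫ t in a..b, ρ t = 1 := by
    rw [hint ρ hρs]
    exact β.integral_normed
  refine ⟨∫ t in a..b, ρ t * w t, ?_⟩
  set C := ∫ t in a..b, ρ t * w t with hC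
  have key : ∀ᵐ t, t ∈ Ioo a b → w t - C = 0 := by
    refine isOpen_Ioo.ae_eq_zero_of_integral_contDiff_smul_eq_zero ?_ fun ψ hψ hψc hψs => ?_
    · refine ContinuousOn.locallyIntegrableOn ?_ measurableSet_Ioo
      exact (hw.mono Ioo_subset_Icc_self).sub continuousOn_const
    -- Subtracting a multiple of `ρ` makes the integral of `ψ` vanish, so that the difference is the
    -- derivative of a test function.
    · set I := ∫ t in a..b, ψ t with hI
      have hgs : tsupport (fun t => ψ t - I * ρ t) ⊆ Ioo a b := by
        have h1 : tsupport (fun t => ψ t - I * ρ t) ⊆ tsupport ψ ∪ tsupport ρ := by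
          refine closure_minimal (fun t ht => ?_)
            ((isClosed_tsupport _).union (isClosed_tsupport _))
          by_contra hcon
          rw [mem_union, not_or] at hcon
          apply ht
          simp [image_eq_zero_of_notMem_tsupport hcon.1, image_eq_zero_of_notMem_tsupport hcon.2]
        exact h1.trans (union_subset hψs hρs)
      have hgd : ContDiff ℝ (⊤ : ℕ∞) (fun t => ψ t - I * ρ t) := hψ.sub (contDiff_const.mul hρd)
      have hgc : HasCompactSupport (fun t => ψ t - I * ρ t) := hψc.sub hρc.mul_left
      have i1 : IntervalIntegrable ψ volume a b := hψ.continuous.intervalIntegrable _ _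
      have i2 : IntervalIntegrable ρ volume a b := hρd.continuous.intervalIntegrable _ _
      obtain ⟨η, h1, h2, h3, h4⟩ := exists_compact_primitive hab hgd hgc hgs (by
        rw [intervalIntegral.integral_sub i1 (i2.const_mul I), intervalIntegral.integral_const_mul,
          hρ1, mul_one, sub_self])
      have h5 := h η h1 h2 h3
      rw [h4] at h5
      have h6 : ∫ t in a..b, ψ t * w t = I * C := by
        have e : ∀ t, (ψ t - I * ρ t) * w t = ψ t * w t - I * (ρ t * w t) := fun t => by ring
        simp only [e] at h5
        rw [intervalIntegral.integral_sub (hwi ψ hψ.continuous)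
          ((hwi ρ hρd.continuous).const_mul I), intervalIntegral.integral_const_mul] at h5
        linarith
      have h7 : tsupport (fun t => ψ t • (w t - C)) ⊆ Ioo a b := by
        refine subset_trans ?_ hψs
        exact closure_mono fun t ht h0 => ht (by simp [h0])
      rw [← hint _ h7]
      simp only [smul_eq_mul, mul_sub]
      rw [intervalIntegral.integral_sub (hwi ψ hψ.continuous) (i1.mul_const C),
        intervalIntegral.integral_mul_const, h6, sub_self]
  have h8 : w =ᵐ[volume.restrict (Icc a b)] fun _ => C := by
    rw [← restrict_Ioo_eq_restrict_Icc, EventuallyEq, ae_restrict_iff' measurableSet_Ioo]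
    filter_upwards [key] with t ht hI using sub_eq_zero.1 (ht hI)
  exact Measure.eqOn_Icc_of_ae_eq volume hab.ne h8 hw continuousOn_const

/-- A continuous function whose distributional derivative is integrable is the primitive of it. -/
theorem eq_add_integral_of_weak_deriv {P D : ℝ → ℝ} (hP : ContinuousOn P (Icc a b))
    (hD : IntervalIntegrable D volume a b)
    (h : ∀ η : ℝ → ℝ, ContDiff ℝ (⊤ : ℕ∞) η → HasCompactSupport η → tsupport η ⊆ Ioo a b →
      ∫ t in a..b, (deriv η t * P t + η t * D t) = 0) {t : ℝ} (ht : t ∈ Icc a b) :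
    P t = P a + ∫ s in a..t, D s := by
  rcases (ht.1.trans ht.2).eq_or_lt with rfl | hab
  · obtain rfl : t = a := le_antisymm ht.2 ht.1
    simp
  have hQ := hD.absolutelyContinuousOnInterval_intervalIntegral (c := a) left_mem_uIcc
  have hQc : ContinuousOn (fun x => ∫ s in a..x, D s) (Icc a b) := by
    have := hQ.continuousOn
    rwa [uIcc_of_le hab.le] at this
  obtain ⟨C, hC⟩ := eqOn_const_of_integral_deriv_mul_eq_zero hab (hP.sub hQc)
    fun η hη hηc hηs => by
      obtain ⟨K, hK⟩ := hη.lipschitzWith_of_hasCompactSupport hηc (by simp)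
      have hηa : AbsolutelyContinuousOnInterval η a b :=
        (hK.lipschitzOnWith (s := uIcc a b)).absolutelyContinuousOnInterval
      have hη0 : ∀ t ∉ Ioo a b, η t = 0 := fun t ht =>
        image_eq_zero_of_notMem_tsupport fun hmem => ht (hηs hmem)
      have h1 := hQ.integral_mul_deriv_eq_deriv_mul hηa
      have h2 : ∫ x in a..b, deriv (fun x => ∫ s in a..x, D s) x * η x =
          ∫ x in a..b, η x * D x := by
        refine intervalIntegral.integral_congr_ae ?_
        filter_upwards [hD.ae_hasDerivAt_integral] with x hx hxI
        rw [(hx (uIoc_subset_uIcc hxI) a left_mem_uIcc).deriv, mul_comm]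
      rw [h2, hη0 a (by simp), hη0 b (by simp)] at h1
      have h3 := h η hη hηc hηs
      have hdc : Continuous (deriv η) := hη.continuous_deriv (by simp)
      have i1 : IntervalIntegrable (fun t => deriv η t * P t) volume a b :=
        ContinuousOn.intervalIntegrable (by
          rw [uIcc_of_le hab.le]
          exact hdc.continuousOn.mul hP)
      have i2 : IntervalIntegrable (fun t => deriv η t * ∫ s in a..t, D s) volume a b :=
        ContinuousOn.intervalIntegrable (by
          rw [uIcc_of_le hab.le]
          exact hdc.continuousOn.mul hQc)
      have i3 : IntervalIntegrable (fun t => η t * D t) volume a b :=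
        hD.continuousOn_mul hη.continuous.continuousOn
      rw [intervalIntegral.integral_add i1 i3] at h3
      simp only [Pi.sub_apply, mul_sub]
      rw [intervalIntegral.integral_sub i1 i2]
      have h4 : ∫ x in a..b, (∫ s in a..x, D s) * deriv η x =
          ∫ t in a..b, deriv η t * ∫ s in a..t, D s :=
        intervalIntegral.integral_congr fun x _ => mul_comm _ _
      rw [h4] at h1
      linarith
  have h1 := hC t ht
  have h2 := hC a (left_mem_Icc.2 hab.le)
  simp only [Pi.sub_apply, intervalIntegral.integral_same, sub_zero] at h1 h2
  linarith

end DuBoisReymond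

end WassersteinControl

namespace WassersteinControl

/-! ### Trajectories tested against functions that need not vanish at the end times -/

section WeakFormulation

variable {d : ℕ} {U : Type*}

theorem IsPc.exists_common {μ ν : Measure (E d)} (hμ : IsPc μ) (hν : IsPc ν) :
    ∃ R > 0, ProbOn (ball0 d R) μ ∧ ProbOn (ball0 d R) ν := by
  obtain ⟨R, hR, h⟩ := hμ.exists_probOn
  obtain ⟨R', _, h'⟩ := hν.exists_probOn
  exact ⟨max R R', lt_max_of_lt_left hR, h.mono_radius (le_max_left _ _),
    h'.mono_radius (le_max_right _ _)⟩

/-- Integrals of Lipschitz kernels against a curve of measures are continuous. -/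
theorem continuous_integral_curve [TopologicalSpace U] [FirstCountableTopology U] {τ T R K : ℝ}
    (hτT : τ ≤ T) {c : ℝ → Measure (E d)} (hc : MeasureCurve τ T R c)
    {k : ℝ × U × E d → ℝ} (hk : Continuous k) (hK : 0 ≤ K)
    (hkL : ∀ t w x y, ‖k (t, w, x) - k (t, w, y)‖ ≤ K * ‖x - y‖) :
    Continuous fun q : ℝ × U => ∫ x, k (q.1, q.2, x) ∂(c (clamp τ T q.1)) := by
  rw [continuous_iff_continuousAt]
  intro q₀
  have hP : ∀ t, ProbOn (ball0 d R) (c (clamp τ T t)) := fun t => hc.probOn _ (clamp_mem hτT t)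
  have hkx : ∀ q : ℝ × U, Continuous fun x => k (q.1, q.2, x) := fun q => by fun_prop
  have h1 : Tendsto (fun q : ℝ × U => ∫ x, k (q.1, q.2, x) ∂(c (clamp τ T q₀.1))) (𝓝 q₀)
      (𝓝 (∫ x, k (q₀.1, q₀.2, x) ∂(c (clamp τ T q₀.1)))) := by
    have := (hP q₀.1).1
    have hk0 : Continuous fun q : ℝ × U => ‖k (q.1, q.2, 0)‖ := by fun_prop
    refine tendsto_integral_filter_of_dominated_convergence
      (fun _ => ‖k (q₀.1, q₀.2, 0)‖ + 1 + K * R)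
      (Eventually.of_forall fun q => (hkx q).aestronglyMeasurable) ?_ (integrable_const _)
      (ae_of_all _ fun x => ?_)
    · filter_upwards [hk0.tendsto q₀ (Iio_mem_nhds (lt_add_one _))] with q hq
      filter_upwards [(hP q₀.1).ae_norm_le] with x hx
      have h2 := hkL q.1 q.2 x 0
      rw [sub_zero] at h2
      have h3 := norm_le_norm_add_norm_sub' (k (q.1, q.2, x)) (k (q.1, q.2, 0))
      have h4 : ‖k (q.1, q.2, 0)‖ < ‖k (q₀.1, q₀.2, 0)‖ + 1 := hq
      have h5 : K * ‖x‖ ≤ K * R := by gcongr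
      linarith
    · have : Continuous fun q : ℝ × U => k (q.1, q.2, x) := by fun_prop
      exact this.tendsto q₀
  have h2 : Tendsto (fun q : ℝ × U => K * wass 1 (c (clamp τ T q.1)) (c (clamp τ T q₀.1)))
      (𝓝 q₀) (𝓝 0) := by
    have := (tendsto_wass_clamp hτT hc.tendsto q₀.1).comp (continuous_fst.tendsto q₀)
    simpa using this.const_mul K
  have h3 : Tendsto (fun q : ℝ × U => ∫ x, k (q.1, q.2, x) ∂(c (clamp τ T q.1)) -
      ∫ x, k (q.1, q.2, x) ∂(c (clamp τ T q₀.1))) (𝓝 q₀) (𝓝 0) :=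
    squeeze_zero_norm (fun q => norm_integral_sub_le_wass (hP _) (hP _) (hkx q) hK
      fun x _ y _ => hkL _ _ x y) h2
  have h4 := h3.add h1
  simp only [sub_add_cancel, zero_add] at h4
  exact h4

theorem measureCurve_map_retract {τ T n : ℝ} (hn : 0 < n) {c : ℝ → Measure (E d)}
    (hp : ∀ t ∈ Icc τ T, IsPc (c t))
    (hc : ∀ t ∈ Icc τ T, Tendsto (fun s => wass 1 (c s) (c t)) (𝓝[Icc τ T] t) (𝓝 0)) :
    MeasureCurve τ T n fun t => (c t).map (retract n) := by
  refine ⟨fun t ht => ?_, fun t ht => ?_⟩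
  · have := (hp t ht).1
    exact probOn_map (continuous_retract hn).measurable
      (ae_of_all _ fun x => norm_retract_le hn x)
  · have h2 : Tendsto (fun s => 2 * wass 1 (c s) (c t)) (𝓝[Icc τ T] t) (𝓝 0) := by
      simpa using (hc t ht).const_mul 2
    refine squeeze_zero' (Eventually.of_forall fun s => wass_nonneg _ _ _) ?_ h2
    filter_upwards [self_mem_nhdsWithin] with s hs
    obtain ⟨R, _, h, h'⟩ := (hp s hs).exists_common (hp t ht)
    exact wass_one_map_le_mul two_pos h h' (continuous_retract hn) (norm_retract_sub_le hn)

theorem map_retract_of_probOn {R n : ℝ} (hn : 0 < n) (hRn : R ≤ n) {μ : Measure (E d)}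
    (hμ : ProbOn (ball0 d R) μ) : μ.map (retract n) = μ := by
  have h1 : retract n =ᵐ[μ] id := by
    filter_upwards [hμ.ae_norm_le] with x hx using retract_of_norm_le hn (hx.trans hRn)
  rw [Measure.map_congr h1, Measure.map_id]

theorem abs_moment1_sub_le {μ ν : Measure (E d)} (hμ : IsPc μ) (hν : IsPc ν) :
    |moment1 μ - moment1 ν| ≤ wass 1 μ ν := by
  obtain ⟨R, _, h, h'⟩ := hμ.exists_common hν
  have := norm_integral_sub_le_wass h h' continuous_norm zero_le_one
    (fun x _ y _ => by simpa using abs_norm_sub_norm_le x y)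
  simpa [moment1] using this

theorem exists_moment1_le {τ T : ℝ} {c : ℝ → Measure (E d)}
    (hp : ∀ t ∈ Icc τ T, IsPc (c t))
    (hc : ∀ t ∈ Icc τ T, Tendsto (fun s => wass 1 (c s) (c t)) (𝓝[Icc τ T] t) (𝓝 0)) :
    ∃ A, 0 ≤ A ∧ ∀ t ∈ Icc τ T, moment1 (c t) ≤ A := by
  have h : ContinuousOn (fun t => moment1 (c t)) (Icc τ T) := fun t ht => by
    rw [ContinuousWithinAt, tendsto_iff_norm_sub_tendsto_zero]
    refine squeeze_zero' (Eventually.of_forall fun s => norm_nonneg _) ?_ (hc t ht)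
    filter_upwards [self_mem_nhdsWithin] with s hs using abs_moment1_sub_le (hp s hs) (hp t ht)
  obtain ⟨A, hA⟩ := isCompact_Icc.exists_bound_of_continuousOn h
  refine ⟨max A 0, le_max_right _ _, fun t ht => ?_⟩
  exact (le_abs_self _).trans ((hA t ht).trans (le_max_left _ _))

variable [TopologicalSpace U] {T m : ℝ} {v : ℝ → Measure (E d) → U → E d → E d}

/-- The integrand of the weak formulation for a curve of measures on a fixed ball. -/
theorem continuous_weak_kernel (hv : RegularVelocity T v m) {τ R : ℝ} (hR : 0 < R)
    (hτ : 0 ≤ τ) (hτT : τ ≤ T) {c : ℝ → Measure (E d)} (hc : MeasureCurve τ T R c)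
    {ξ : ℝ × E d → ℝ} (hξ : ContDiff ℝ (⊤ : ℕ∞) ξ) :
    Continuous fun q : ℝ × U × E d =>
      fderiv ℝ ξ (q.1, q.2.2) ((1 : ℝ), truncField v c τ T R q.1 q.2.1 q.2.2) := by
  have hDc : Continuous (fderiv ℝ ξ) := hξ.continuous_fderiv (by simp)
  have h1 := continuous_truncField hv hR hτ hτT hc
  have h2 : Continuous fun q : ℝ × U × E d => fderiv ℝ ξ (q.1, q.2.2) :=
    hDc.comp (by fun_prop)
  have h3 : Continuous fun q : ℝ × U × E d =>
      ((1 : ℝ), truncField v c τ T R q.1 q.2.1 q.2.2) := continuous_const.prodMk h1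
  exact h2.clm_apply h3

theorem norm_one_prod_le {x : E d} {B : ℝ} (h : ‖x‖ ≤ B) : ‖((1 : ℝ), x)‖ ≤ max 1 B := by
  rw [Prod.norm_def, norm_one]
  exact max_le_max le_rfl h

theorem exists_lipschitz_weak_kernel (hv : RegularVelocity T v m) (hm : 0 ≤ m) {τ R : ℝ}
    (hR : 0 < R) (hτ : 0 ≤ τ) (hτT : τ ≤ T) {c : ℝ → Measure (E d)} (hc : MeasureCurve τ T R c)
    {ξ : ℝ × E d → ℝ} (hξ : ContDiff ℝ (⊤ : ℕ∞) ξ) (hξc : HasCompactSupport ξ) :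
    ∃ M, 0 ≤ M ∧ ∀ t w x y,
      ‖fderiv ℝ ξ (t, x) ((1 : ℝ), truncField v c τ T R t w x) -
        fderiv ℝ ξ (t, y) ((1 : ℝ), truncField v c τ T R t w y)‖ ≤ M * ‖x - y‖ := by
  have hDc : Continuous (fderiv ℝ ξ) := hξ.continuous_fderiv (by simp)
  obtain ⟨K, hK⟩ := (hξc.fderiv ℝ).exists_bound_of_continuous hDc
  have hK0 : 0 ≤ K := (norm_nonneg _).trans (hK 0)
  have hDd : ContDiff ℝ (⊤ : ℕ∞) (fderiv ℝ ξ) := hξ.fderiv_right (by simp)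
  obtain ⟨K', hK'⟩ := hDd.lipschitzWith_of_hasCompactSupport (hξc.fderiv ℝ) (by simp)
  obtain ⟨L, hL, hlip⟩ := exists_truncField_lipschitz hv hR hτ hτT hc
  set B := m * (1 + R + R) with hB
  have hbd := norm_truncField_le hv hm hR hτ hτT hc
  refine ⟨K' * max 1 B + K * L, by positivity, fun t w x y => ?_⟩
  generalize hbx : truncField v c τ T R t w x = bx
  generalize hby : truncField v c τ T R t w y = bb
  have hlip' : ‖bx - bb‖ ≤ L * ‖x - y‖ := by rw [← hbx, ← hby]; exact hlip t w x y
  have hbd' : ‖bx‖ ≤ B := by rw [← hbx]; exact hbd t w x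
  have e : fderiv ℝ ξ (t, x) ((1 : ℝ), bx) - fderiv ℝ ξ (t, y) ((1 : ℝ), bb) =
      (fderiv ℝ ξ (t, x) - fderiv ℝ ξ (t, y)) ((1 : ℝ), bx) +
        fderiv ℝ ξ (t, y) ((0 : ℝ), bx - bb) := by
    have : ((0 : ℝ), bx - bb) = ((1 : ℝ), bx) - ((1 : ℝ), bb) := by simp
    rw [this, map_sub, sub_apply]
    ring
  rw [e]
  refine (norm_add_le _ _).trans ?_
  have h1 : ‖(fderiv ℝ ξ (t, x) - fderiv ℝ ξ (t, y)) ((1 : ℝ), bx)‖ ≤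
      (K' * ‖x - y‖) * max 1 B := by
    refine (ContinuousLinearMap.le_opNorm _ _).trans ?_
    have h2 : ‖fderiv ℝ ξ (t, x) - fderiv ℝ ξ (t, y)‖ ≤ K' * ‖x - y‖ := by
      have := hK'.dist_le_mul (t, x) (t, y)
      rw [dist_eq_norm, Prod.dist_eq, dist_self, max_eq_right dist_nonneg, dist_eq_norm] at this
      exact this
    exact mul_le_mul h2 (norm_one_prod_le hbd') (norm_nonneg _) (by positivity)
  have h2 : ‖fderiv ℝ ξ (t, y) ((0 : ℝ), bx - bb)‖ ≤ K * (L * ‖x - y‖) := by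
    refine (ContinuousLinearMap.le_opNorm _ _).trans ?_
    refine mul_le_mul (hK _) ?_ (norm_nonneg _) hK0
    rw [Prod.norm_def, norm_zero, max_eq_right (norm_nonneg _)]
    exact hlip'
  calc _ ≤ (K' * ‖x - y‖) * max 1 B + K * (L * ‖x - y‖) := add_le_add h1 h2
    _ = _ := by ring

variable [MeasurableSpace U] [BorelSpace U] [SecondCountableTopology U]

theorem measurable_integral_weak_kernel (hv : RegularVelocity T v m) (hm : 0 ≤ m) {τ R : ℝ}
    (hR : 0 < R) (hτ : 0 ≤ τ) (hτT : τ ≤ T) {u : ℝ → U} (hu : Measurable u)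
    {c : ℝ → Measure (E d)} (hc : MeasureCurve τ T R c)
    {ξ : ℝ × E d → ℝ} (hξ : ContDiff ℝ (⊤ : ℕ∞) ξ) (hξc : HasCompactSupport ξ) :
    Measurable fun t => ∫ x, fderiv ℝ ξ (t, x) ((1 : ℝ), truncField v c τ T R t (u t) x)
      ∂(c (clamp τ T t)) := by
  obtain ⟨M, hM, hML⟩ := exists_lipschitz_weak_kernel hv hm hR hτ hτT hc hξ hξc
  have h1 := (continuous_integral_curve hτT hc (continuous_weak_kernel hv hR hτ hτT hc hξ)
    hM hML).measurable
  have h2 : Measurable fun t => (t, u t) := measurable_id.prodMk hu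
  exact h1.comp h2

/-- The integral over space in the weak formulation is a bounded measurable function of time. As
nothing is known beforehand about the supports of the measures `c t` together, measurability is
obtained from the images of these measures under the projections onto balls. -/
theorem intervalIntegrable_weak (hv : RegularVelocity T v m) (hm : 0 ≤ m) {τ : ℝ}
    (hτ : 0 ≤ τ) (hτT : τ ≤ T) {u : ℝ → U} (hu : Measurable u) {c : ℝ → Measure (E d)}
    (hp : ∀ t ∈ Icc τ T, IsPc (c t))
    (hc : ∀ t ∈ Icc τ T, Tendsto (fun s => wass 1 (c s) (c t)) (𝓝[Icc τ T] t) (𝓝 0))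
    {ξ : ℝ × E d → ℝ} (hξ : ContDiff ℝ (⊤ : ℕ∞) ξ) (hξc : HasCompactSupport ξ) :
    IntervalIntegrable (fun t => ∫ x, fderiv ℝ ξ (t, x) ((1 : ℝ), v t (c t) (u t) x) ∂(c t))
      volume τ T := by
  have hDc : Continuous (fderiv ℝ ξ) := hξ.continuous_fderiv (by simp)
  obtain ⟨K, hK⟩ := (hξc.fderiv ℝ).exists_bound_of_continuous hDc
  have hK0 : 0 ≤ K := (norm_nonneg _).trans (hK 0)
  obtain ⟨A, hA0, hA⟩ := exists_moment1_le hp hc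
  obtain ⟨ρ, hρ⟩ : ∃ ρ, ∀ q ∈ tsupport ξ, ‖q‖ ≤ ρ := by
    obtain ⟨ρ, hρ⟩ := hξc.isCompact.isBounded.exists_norm_le
    exact ⟨ρ, hρ⟩
  rw [intervalIntegrable_iff, uIoc_of_le hτT]
  refine Integrable.of_bound (μ := volume.restrict (Ioc τ T))
    (C := K * max 1 (m * (1 + ρ + A))) ?_ ?_
  swap
  · rw [ae_restrict_iff' measurableSet_Ioc]
    refine ae_of_all _ fun t ht => ?_
    have htI := Ioc_subset_Icc_self ht
    have := (hp t htI).1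
    refine (norm_integral_le_of_norm_le_const (C := K * max 1 (m * (1 + ρ + A)))
      (ae_of_all _ fun x => ?_)).trans (by simp)
    by_cases hx : (t, x) ∈ tsupport ξ
    · refine (ContinuousLinearMap.le_opNorm _ _).trans ?_
      refine mul_le_mul (hK _) ?_ (norm_nonneg _) hK0
      refine norm_one_prod_le
        ((hv.growth _ t (Icc_sub_Icc_zero hτ htI) _ (hp t htI) x).trans ?_)
      have h1 : ‖x‖ ≤ ρ := (norm_snd_le (t, x)).trans (hρ _ hx)
      have h2 := hA t htI
      gcongr
    · have : fderiv ℝ ξ (t, x) = 0 :=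
        image_eq_zero_of_notMem_tsupport fun h => hx (tsupport_fderiv_subset ℝ h)
      rw [this]
      rw [zero_apply, norm_zero]
      positivity
  set cn : ℕ → ℝ → Measure (E d) := fun n t => (c t).map (retract (n + 1)) with hcn
  have hn : ∀ n : ℕ, (0 : ℝ) < n + 1 := fun n => by positivity
  have hcurve : ∀ n : ℕ, MeasureCurve τ T (n + 1) (cn n) := fun n =>
    measureCurve_map_retract (hn n) hp hc
  refine aestronglyMeasurable_of_tendsto_ae (u := (atTop : Filter ℕ))
    (f := fun n t => ∫ x, fderiv ℝ ξ (t, x)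
      ((1 : ℝ), truncField v (cn n) τ T (n + 1) t (u t) x) ∂(cn n (clamp τ T t)))
    (fun n => (measurable_integral_weak_kernel hv hm (hn n) hτ hτT hu (hcurve n) hξ
      hξc).aestronglyMeasurable) ?_
  rw [ae_restrict_iff' measurableSet_Ioc]
  refine ae_of_all _ fun t ht => ?_
  have htI := Ioc_subset_Icc_self ht
  obtain ⟨R, hR, hRp⟩ := (hp t htI).exists_probOn
  refine tendsto_const_nhds.congr' ?_
  filter_upwards [eventually_ge_atTop ⌈R⌉₊] with n hnR
  have hRn : R ≤ n + 1 := (Nat.le_of_ceil_le hnR).trans (by simp)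
  have h1 : cn n t = c t := map_retract_of_probOn (hn n) hRn hRp
  rw [clamp_of_mem htI, h1]
  refine integral_congr_ae ?_
  filter_upwards [hRp.ae_norm_le] with x hx
  rw [truncField_eq (hn n) htI _ (hx.trans hRn), h1]

/-- The weak formulation tested against functions that need not vanish at the end times. -/
theorem IsTrajectory.integral_eq (hv : RegularVelocity T v m) (hm : 0 ≤ m) {τ : ℝ}
    (hτ : 0 ≤ τ) (hτT : τ ≤ T) {u : ℝ → U} (hu : Measurable u) {μ : Measure (E d)}
    {c : ℝ → Measure (E d)} (h : IsTrajectory T v u τ μ c)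
    {ξ : ℝ × E d → ℝ} (hξ : ContDiff ℝ (⊤ : ℕ∞) ξ) (hξc : HasCompactSupport ξ) {t : ℝ}
    (ht : t ∈ Icc τ T) :
    ∫ x, ξ (t, x) ∂(c t) = ∫ x, ξ (τ, x) ∂(c τ) +
      ∫ s in τ..t, ∫ x, fderiv ℝ ξ (s, x) ((1 : ℝ), v s (c s) (u s) x) ∂(c s) := by
  obtain ⟨hp, hc, -, hw⟩ := h
  have hD := intervalIntegrable_weak hv hm hτ hτT hu hp hc hξ hξc
  obtain ⟨K, hK⟩ := hξ.lipschitzWith_of_hasCompactSupport hξc (by simp)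
  have hξx : ∀ t, Continuous fun x => ξ (t, x) := fun t => hξ.continuous.comp (by fun_prop)
  have hP : ContinuousOn (fun t => ∫ x, ξ (t, x) ∂(c t)) (Icc τ T) := fun t ht => by
    rw [ContinuousWithinAt, tendsto_iff_norm_sub_tendsto_zero]
    have hlim : Tendsto (fun s => K * |s - t| + K * wass 1 (c s) (c t)) (𝓝[Icc τ T] t) (𝓝 0) := by
      have h1 : Tendsto (fun s => (K : ℝ) * |s - t|) (𝓝[Icc τ T] t) (𝓝 0) := by
        have : Continuous fun s => (K : ℝ) * |s - t| := by fun_prop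
        have := this.tendsto t
        simp only [sub_self, abs_zero, mul_zero] at this
        exact this.mono_left nhdsWithin_le_nhds
      simpa using h1.add ((hc t ht).const_mul (K : ℝ))
    refine squeeze_zero' (Eventually.of_forall fun s => norm_nonneg _) ?_ hlim
    filter_upwards [self_mem_nhdsWithin] with s hs
    obtain ⟨R, _, hRs, hRt⟩ := (hp s hs).exists_common (hp t ht)
    have := hRs.1
    have h1 : ‖∫ x, ξ (s, x) ∂(c s) - ∫ x, ξ (t, x) ∂(c s)‖ ≤ K * |s - t| := by
      rw [← integral_sub (hRs.integrable (hξx s)) (hRs.integrable (hξx t))]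
      refine (norm_integral_le_of_norm_le_const (C := K * |s - t|)
        (ae_of_all _ fun x => ?_)).trans (by simp)
      have := hK.dist_le_mul (s, x) (t, x)
      rw [dist_eq_norm, Prod.dist_eq, dist_self, max_eq_left dist_nonneg, Real.dist_eq] at this
      exact this
    have h2 : ‖∫ x, ξ (t, x) ∂(c s) - ∫ x, ξ (t, x) ∂(c t)‖ ≤ K * wass 1 (c s) (c t) := by
      refine norm_integral_sub_le_wass hRs hRt (hξx t) K.2 fun x _ y _ => ?_
      have := hK.dist_le_mul (t, x) (t, y)
      rw [dist_eq_norm, Prod.dist_eq, dist_self, max_eq_right dist_nonneg, dist_eq_norm] at this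
      exact this
    exact (norm_sub_le_norm_sub_add_norm_sub _ _ _).trans (add_le_add h1 h2)
  refine eq_add_integral_of_weak_deriv hP hD (fun η hη hηc hηs => ?_) ht
  -- Multiplication by a cut-off in time turns `ξ` into an admissible test function.
  have hprod : ContDiff ℝ (⊤ : ℕ∞) fun q : ℝ × E d => η q.1 * ξ q :=
    (hη.comp contDiff_fst).mul hξ
  have hsub : tsupport (fun q : ℝ × E d => η q.1 * ξ q) ⊆ tsupport η ×ˢ univ := by
    refine closure_minimal (fun q hq => ⟨subset_tsupport _ fun h0 => hq ?_, trivial⟩)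
      ((isClosed_tsupport η).prod isClosed_univ)
    simp [h0]
  have h1 := hw _ hprod hξc.mul_left (hsub.trans (prod_mono_left hηs))
  rw [← h1]
  refine intervalIntegral.integral_congr fun s hs => ?_
  rw [uIcc_of_le hτT] at hs
  have hsp := hp s hs
  obtain ⟨R, hR, hRs⟩ := hsp.exists_probOn
  have hder : ∀ x w, fderiv ℝ (fun q : ℝ × E d => η q.1 * ξ q) (s, x) ((1 : ℝ), w) =
      deriv η s * ξ (s, x) + η s * fderiv ℝ ξ (s, x) ((1 : ℝ), w) := by
    intro x w
    have e1 : HasFDerivAt (fun q : ℝ × E d => η q.1)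
        ((ContinuousLinearMap.toSpanSingleton ℝ (deriv η s)).comp
          (ContinuousLinearMap.fst ℝ ℝ (E d))) (s, x) :=
      HasFDerivAt.comp (s, x) (g := η) (f := Prod.fst)
        ((hη.differentiable (by simp) s).hasDerivAt.hasFDerivAt) hasFDerivAt_fst
    have e2 : HasFDerivAt ξ (fderiv ℝ ξ (s, x)) (s, x) :=
      (hξ.differentiable (by simp) _).hasFDerivAt
    have e3 : HasFDerivAt (fun q : ℝ × E d => η q.1 * ξ q) _ (s, x) := e1.mul e2
    rw [e3.fderiv]
    simp
    ring
  simp only [hder]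
  have hDc : Continuous (fderiv ℝ ξ) := hξ.continuous_fderiv (by simp)
  obtain ⟨l, hl, hlip⟩ := hv.lip R hR
  have hsT := Icc_sub_Icc_zero hτ hs
  -- The velocity is only known to be continuous on balls
  have hvi : Integrable (fun x => fderiv ℝ ξ (s, x) ((1 : ℝ), v s (c s) (u s) x)) (c s) := by
    have hcont : Continuous fun x => v s (c s) (u s) (retract R x) := by
      refine hv.continuous_comp (t := fun _ => s) (μ := fun _ => c s) (w := fun _ => u s)
        (p := retract R) hR continuous_const (fun _ => hsT) (fun _ => hRs) (fun _ => ?_)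
        continuous_const (continuous_retract hR)
        (fun x => mem_closedBall_zero_iff.2 (norm_retract_le hR x))
      rw [hRs.wass_one_self]
      exact tendsto_const_nhds
    have hcc : Continuous fun x => fderiv ℝ ξ (s, x) ((1 : ℝ), v s (c s) (u s) (retract R x)) := by
      have h2 : Continuous fun x => fderiv ℝ ξ (s, x) := hDc.comp (by fun_prop)
      exact h2.clm_apply (continuous_const.prodMk hcont)
    refine (hRs.integrable hcc).congr ?_
    filter_upwards [hRs.ae_norm_le] with x hx
    rw [retract_of_norm_le hR hx]
  rw [integral_add ((hRs.integrable (hξx s)).const_mul _) (hvi.const_mul _),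
    integral_const_mul, integral_const_mul]

end WeakFormulation

end WassersteinControl

namespace WassersteinControl

/-! ### Propagation of the support -/

section Support

variable {d : ℕ} {U : Type*}

/-- The barrier `1 - S(e^{-kt} (1 + |x|²) - M)`, with a smooth step `S` from `0` on `(-∞,0]` to `1`
on `[1,∞)`, cut off in time by `χ`. -/
noncomputable def barrier (χ : ℝ → ℝ) (k M : ℝ) (q : ℝ × E d) : ℝ :=
  χ q.1 * (1 - Real.smoothTransition (Real.exp (-k * q.1) * (1 + ‖q.2‖ ^ 2) - M))

theorem contDiff_barrier {χ : ℝ → ℝ} (hχ : ContDiff ℝ (⊤ : ℕ∞) χ) (k M : ℝ) :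
    ContDiff ℝ (⊤ : ℕ∞) (barrier χ k M : ℝ × E d → ℝ) := by
  have h1 : ContDiff ℝ (⊤ : ℕ∞) fun q : ℝ × E d => Real.exp (-k * q.1) * (1 + ‖q.2‖ ^ 2) - M := by
    have : ContDiff ℝ (⊤ : ℕ∞) fun q : ℝ × E d => ‖q.2‖ ^ 2 := contDiff_snd.norm_sq ℝ
    exact ((Real.contDiff_exp.comp (contDiff_const.mul contDiff_fst)).mul
      (contDiff_const.add this)).sub contDiff_const
  exact (hχ.comp contDiff_fst).mul (contDiff_const.sub (Real.smoothTransition.contDiff.comp h1))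

theorem hasCompactSupport_barrier {χ : ℝ → ℝ} (hχ : HasCompactSupport χ) {k M : ℝ} (hk : 0 ≤ k)
    (hM : 0 ≤ M) : HasCompactSupport (barrier χ k M : ℝ × E d → ℝ) := by
  obtain ⟨ρ, hρ⟩ := hχ.isCompact.isBounded.exists_norm_le
  refine HasCompactSupport.intro (K := tsupport χ ×ˢ
    Metric.closedBall (0 : E d) ((M + 1) * Real.exp (k * ρ)))
    (hχ.isCompact.prod (isCompact_closedBall _ _)) fun q hq => ?_
  rw [mem_prod, not_and_or] at hq
  by_cases ht : q.1 ∈ tsupport χ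
  · have hx : (M + 1) * Real.exp (k * ρ) < ‖q.2‖ := by
      simpa using hq.resolve_left (not_not.2 ht)
    have h1 : q.1 ≤ ρ := (le_abs_self _).trans (hρ _ ht)
    have h2 : Real.exp (-(k * ρ)) ≤ Real.exp (-k * q.1) := by
      refine Real.exp_le_exp.2 ?_
      nlinarith
    have h3 : M + 1 ≤ Real.exp (-k * q.1) * (1 + ‖q.2‖ ^ 2) := by
      calc M + 1 = Real.exp (-(k * ρ)) * ((M + 1) * Real.exp (k * ρ)) := by
            rw [mul_left_comm, ← Real.exp_add, neg_add_cancel, Real.exp_zero, mul_one]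
        _ ≤ Real.exp (-k * q.1) * (1 + ‖q.2‖ ^ 2) := by
            refine mul_le_mul h2 ?_ (by positivity) (by positivity)
            nlinarith [sq_nonneg (‖q.2‖ - 1)]
    rw [barrier, Real.smoothTransition.one_of_one_le (by linarith), sub_self, mul_zero]
  · rw [barrier, image_eq_zero_of_notMem_tsupport ht, zero_mul]

/-- The barrier does not decrease along a velocity of sublinear growth. -/
theorem fderiv_barrier_nonneg {χ : ℝ → ℝ} (hχ : ContDiff ℝ (⊤ : ℕ∞) χ) {k M t : ℝ}
    (h1 : χ =ᶠ[𝓝 t] 1) {x w : E d} (hw : 2 * inner ℝ x w ≤ k * (1 + ‖x‖ ^ 2)) :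
    0 ≤ fderiv ℝ (barrier χ k M) (t, x) ((1 : ℝ), w) := by
  have hline : HasDerivAt (fun s : ℝ => (t + s, x + s • w)) ((1 : ℝ), w) 0 := by
    have e1 : HasDerivAt (fun s : ℝ => t + s) 1 0 := (hasDerivAt_id 0).const_add t
    have e2 : HasDerivAt (fun s : ℝ => x + s • w) w 0 := by
      simpa using ((hasDerivAt_id (0 : ℝ)).smul_const w).const_add x
    exact e1.prodMk e2
  have hF : HasFDerivAt (barrier χ k M) (fderiv ℝ (barrier χ k M) (t, x))
      ((fun s : ℝ => (t + s, x + s • w)) 0) := by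
    have := ((contDiff_barrier (d := d) hχ k M).differentiable (by simp) (t, x)).hasFDerivAt
    simpa using this
  have hd1 := hF.comp_hasDerivAt 0 hline
  -- The same derivative, computed from the formula for the barrier near `t`
  have hsq : HasDerivAt (fun s : ℝ => ‖x + s • w‖ ^ 2) (2 * inner ℝ x w) 0 := by
    have e2 : HasDerivAt (fun s : ℝ => x + s • w) w 0 := by
      simpa using ((hasDerivAt_id (0 : ℝ)).smul_const w).const_add x
    simpa using e2.norm_sq
  have hexp : HasDerivAt (fun s : ℝ => Real.exp (-k * (t + s))) (-k * Real.exp (-k * t)) 0 := by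
    have e1 : HasDerivAt (fun s : ℝ => -k * (t + s)) (-k) 0 := by
      simpa using ((hasDerivAt_id (0 : ℝ)).const_add t).const_mul (-k)
    have := e1.exp
    rw [add_zero, mul_comm] at this
    exact this
  have hQ := (hexp.mul (hsq.const_add 1)).sub_const M
  have hS : HasDerivAt Real.smoothTransition
      (deriv Real.smoothTransition (Real.exp (-k * t) * (1 + ‖x‖ ^ 2) - M))
      (Real.exp (-k * t) * (1 + ‖x‖ ^ 2) - M) :=
    ((Real.smoothTransition.contDiff (n := 1)).differentiable (by simp) _).hasDerivAt
  have hd2 := (HasDerivAt.comp_of_eq 0 hS hQ (by simp)).const_sub 1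
  have heq : (barrier χ k M ∘ fun s : ℝ => (t + s, x + s • w)) =ᶠ[𝓝 0]
      fun s => 1 - (Real.smoothTransition ∘ ((fun s : ℝ => Real.exp (-k * (t + s))) *
        (fun s : ℝ => 1 + ‖x + s • w‖ ^ 2) - fun _ => M)) s := by
    have hc : Tendsto (fun s : ℝ => t + s) (𝓝 0) (𝓝 t) := by
      have : Continuous fun s : ℝ => t + s := by fun_prop
      simpa using this.tendsto 0
    filter_upwards [hc.eventually h1] with s hs
    simp only [Function.comp_apply, barrier, hs, Pi.one_apply, one_mul, Pi.sub_apply, Pi.mul_apply]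
  have h2 := hd1.unique ((hd2.congr_of_eventuallyEq heq))
  rw [h2]
  have h3 : 0 ≤ deriv Real.smoothTransition (Real.exp (-k * t) * (1 + ‖x‖ ^ 2) - M) :=
    Real.smoothTransition.monotone.deriv_nonneg
  have h4 : 0 < Real.exp (-k * t) := Real.exp_pos _
  rw [neg_nonneg]
  refine mul_nonpos_of_nonneg_of_nonpos h3 ?_
  simp only [zero_smul, add_zero]
  nlinarith

variable [TopologicalSpace U] [MeasurableSpace U] [BorelSpace U]
    [SecondCountableTopology U] {T m : ℝ} {v : ℝ → Measure (E d) → U → E d → E d}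

/-- The measures of a trajectory are concentrated on a common ball: by sublinear growth, the
integral of a barrier cannot decrease. -/
theorem IsTrajectory.exists_measureCurve (hv : RegularVelocity T v m) (hm : 0 ≤ m) {τ r : ℝ}
    (hτ : 0 ≤ τ) (hτT : τ ≤ T) {u : ℝ → U} (hu : Measurable u) {μ : Measure (E d)}
    (hμ : ProbOn (ball0 d r) μ) {c : ℝ → Measure (E d)} (h : IsTrajectory T v u τ μ c) :
    ∃ R > 0, MeasureCurve τ T R c := by
  have hp := h.1
  have hc := h.2.1
  have hcτ := h.2.2.1
  obtain ⟨A, hA0, hA⟩ := exists_moment1_le hp hc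
  set k := m * (3 + A) with hk
  have hk0 : 0 ≤ k := by positivity
  -- With this level the barrier equals `1` on the support of the initial measure.
  set M := Real.exp (-k * τ) * (1 + r ^ 2) with hM
  have hM0 : 0 ≤ M := by positivity
  let χ : ContDiffBump ((τ + T) / 2) := ⟨T - τ + 1, T - τ + 2, by linarith, by linarith⟩
  have hχ1 : ∀ t ∈ Icc τ T, (χ : ℝ → ℝ) =ᶠ[𝓝 t] 1 := fun t ht => by
    refine χ.eventuallyEq_one_of_mem_ball ?_
    rw [Metric.mem_ball, Real.dist_eq, abs_lt]
    change -(T - τ + 1) < _ ∧ _ < T - τ + 1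
    exact ⟨by linarith [ht.1, ht.2], by linarith [ht.1, ht.2]⟩
  have hχc : ContDiff ℝ (⊤ : ℕ∞) (χ : ℝ → ℝ) := χ.contDiff
  have hval : ∀ t ∈ Icc τ T, ∀ x : E d, barrier χ k M (t, x) =
      1 - Real.smoothTransition (Real.exp (-k * t) * (1 + ‖x‖ ^ 2) - M) := fun t ht x => by
    simp [barrier, (hχ1 t ht).eq_of_nhds]
  have hb := contDiff_barrier (d := d) hχc k M
  have hbc := hasCompactSupport_barrier (d := d) χ.hasCompactSupport hk0 hM0
  refine ⟨Real.exp (k * T) * (1 + r ^ 2), by positivity, fun t ht => ⟨(hp t ht).1, ?_⟩, hc⟩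
  have hpt := (hp t ht).1
  have hmain := h.integral_eq hv hm hτ hτT hu hb hbc ht
  have h0 : ∫ x, barrier χ k M (τ, x) ∂(c τ) = 1 := by
    rw [hcτ]
    have := hμ.1
    rw [integral_congr_ae (g := fun _ => (1 : ℝ))]
    · simp
    · filter_upwards [hμ.ae_norm_le] with x hx
      rw [hval τ (left_mem_Icc.2 hτT), Real.smoothTransition.zero_of_nonpos, sub_zero]
      have : ‖x‖ ^ 2 ≤ r ^ 2 := by gcongr
      have h4 : 0 < Real.exp (-k * τ) := Real.exp_pos _
      rw [hM]
      nlinarith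
  have hpos : 0 ≤ ∫ s in τ..t, ∫ x, fderiv ℝ (barrier χ k M) (s, x)
      ((1 : ℝ), v s (c s) (u s) x) ∂(c s) := by
    refine intervalIntegral.integral_nonneg ht.1 fun s hs => integral_nonneg fun x => ?_
    have hs' : s ∈ Icc τ T := ⟨hs.1, hs.2.trans ht.2⟩
    refine fderiv_barrier_nonneg hχc (hχ1 s hs') ?_
    have h1 := hv.growth (u s) s (Icc_sub_Icc_zero hτ hs') _ (hp s hs') x
    have h2 := hA s hs'
    have h3 := real_inner_le_norm x (v s (c s) (u s) x)
    have h4 : ‖v s (c s) (u s) x‖ ≤ m * (1 + ‖x‖ + A) := h1.trans (by gcongr)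
    have h5 : ‖x‖ * ‖v s (c s) (u s) x‖ ≤ ‖x‖ * (m * (1 + ‖x‖ + A)) := by gcongr
    have h6 : 2 * (‖x‖ * (1 + ‖x‖ + A)) ≤ (3 + A) * (1 + ‖x‖ ^ 2) := by
      nlinarith [sq_nonneg (‖x‖ - 1), mul_nonneg hA0 (sq_nonneg (‖x‖ - 1))]
    calc 2 * inner ℝ x (v s (c s) (u s) x) ≤ m * (2 * (‖x‖ * (1 + ‖x‖ + A))) := by linarith
      _ ≤ m * ((3 + A) * (1 + ‖x‖ ^ 2)) := by gcongr
      _ = k * (1 + ‖x‖ ^ 2) := by rw [hk]; ring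
  obtain ⟨R', _, hR'⟩ := (hp t ht).exists_probOn
  have hbt : Continuous fun x => barrier χ k M (t, x) := hb.continuous.comp (by fun_prop)
  have hle : ∀ x : E d, 0 ≤ 1 - barrier χ k M (t, x) := fun x => by
    rw [hval t ht, sub_sub_cancel]
    exact Real.smoothTransition.nonneg _
  have hi : Integrable (fun x => 1 - barrier χ k M (t, x)) (c t) := hR'.integrable (by fun_prop)
  have hz : ∫ x, (1 - barrier χ k M (t, x)) ∂(c t) = 0 := by
    refine le_antisymm ?_ (integral_nonneg hle)
    rw [integral_sub (integrable_const _) (hR'.integrable hbt), integral_const, probReal_univ,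
      one_smul, hmain, h0]
    linarith
  -- The barrier is at most `1` and its integral is at least `1`, hence it equals `1` almost
  -- everywhere, which bounds the support.
  rw [integral_eq_zero_iff_of_nonneg hle hi] at hz
  change ∀ᵐ x ∂(c t), x ∈ ball0 d (Real.exp (k * T) * (1 + r ^ 2))
  filter_upwards [hz] with x hx
  rw [hval t ht, sub_sub_cancel, Pi.zero_apply, Real.smoothTransition.zero_iff_nonpos] at hx
  rw [mem_closedBall_zero_iff]
  have h1 : Real.exp (k * t) * (Real.exp (-k * t) * (1 + ‖x‖ ^ 2)) = 1 + ‖x‖ ^ 2 := by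
    rw [← mul_assoc, ← Real.exp_add]
    simp
  have h2 : Real.exp (k * t) * M = Real.exp (k * (t - τ)) * (1 + r ^ 2) := by
    rw [hM, ← mul_assoc, ← Real.exp_add]
    ring_nf
  have h3 : Real.exp (k * (t - τ)) ≤ Real.exp (k * T) := by
    have : t - τ ≤ T := by linarith [ht.2]
    gcongr
  have h4 : Real.exp (k * t) * (Real.exp (-k * t) * (1 + ‖x‖ ^ 2)) ≤ Real.exp (k * t) * M := by
    gcongr
    linarith
  have h5 : Real.exp (k * (t - τ)) * (1 + r ^ 2) ≤ Real.exp (k * T) * (1 + r ^ 2) := by gcongr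
  nlinarith [sq_nonneg (‖x‖ - 1)]

/-- The weak formulation tested against smooth functions of the space variable. -/
theorem IsTrajectory.integral_sub_eq (hv : RegularVelocity T v m) (hm : 0 ≤ m) {τ R : ℝ}
    (hτ : 0 ≤ τ) (hτT : τ ≤ T) (hR : 0 < R) {u : ℝ → U} (hu : Measurable u) {μ : Measure (E d)}
    {c : ℝ → Measure (E d)} (h : IsTrajectory T v u τ μ c) (hc : MeasureCurve τ T R c)
    {g : E d → ℝ} (hg : ContDiff ℝ (⊤ : ℕ∞) g) {s t : ℝ} (hs : s ∈ Icc τ T) (ht : t ∈ Icc τ T) :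
    IntervalIntegrable (fun r => ∫ x, fderiv ℝ g x (truncField v c τ T R r (u r) x) ∂(c r))
      volume s t ∧
    ∫ x, g x ∂(c t) - ∫ x, g x ∂(c s) =
      ∫ r in s..t, ∫ x, fderiv ℝ g x (truncField v c τ T R r (u r) x) ∂(c r) := by
  let χ : ContDiffBump ((τ + T) / 2) := ⟨T - τ + 1, T - τ + 2, by linarith, by linarith⟩
  let β : ContDiffBump (0 : E d) := ⟨R + 1, R + 2, by linarith, by linarith⟩
  have hχ1 : ∀ t ∈ Icc τ T, (χ : ℝ → ℝ) =ᶠ[𝓝 t] 1 := fun t ht => by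
    refine χ.eventuallyEq_one_of_mem_ball ?_
    rw [Metric.mem_ball, Real.dist_eq, abs_lt]
    change -(T - τ + 1) < _ ∧ _ < T - τ + 1
    exact ⟨by linarith [ht.1, ht.2], by linarith [ht.1, ht.2]⟩
  have hβ1 : ∀ x : E d, ‖x‖ ≤ R → (β : E d → ℝ) =ᶠ[𝓝 x] 1 := fun x hx => by
    refine β.eventuallyEq_one_of_mem_ball ?_
    rw [mem_ball_zero_iff]
    change ‖x‖ < R + 1
    linarith
  -- The cut-offs are equal to `1` near `[τ,T] × B(0,R)`, which carries the trajectory.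
  set ξ : ℝ × E d → ℝ := fun q => χ q.1 * (β q.2 * g q.2) with hξ
  have hξd : ContDiff ℝ (⊤ : ℕ∞) ξ :=
    ((χ.contDiff : ContDiff ℝ (⊤ : ℕ∞) (χ : ℝ → ℝ)).comp contDiff_fst).mul
      (((β.contDiff : ContDiff ℝ (⊤ : ℕ∞) (β : E d → ℝ)).mul hg).comp contDiff_snd)
  have hξc : HasCompactSupport ξ := by
    refine HasCompactSupport.intro (K := tsupport χ ×ˢ tsupport β)
      (χ.hasCompactSupport.isCompact.prod β.hasCompactSupport.isCompact) fun q hq => ?_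
    rw [mem_prod, not_and_or] at hq
    rcases hq with hq | hq
    · simp [hξ, image_eq_zero_of_notMem_tsupport hq]
    · simp [hξ, image_eq_zero_of_notMem_tsupport hq]
  have hval : ∀ t ∈ Icc τ T, ∀ x : E d, ‖x‖ ≤ R → ξ =ᶠ[𝓝 (t, x)] fun q => g q.2 := by
    intro t ht x hx
    have e1 := (continuous_fst.tendsto (t, x)).eventually (hχ1 t ht)
    have e2 := (continuous_snd.tendsto (t, x)).eventually (hβ1 x hx)
    filter_upwards [e1, e2] with q h1 h2
    simp only [hξ, h1, h2, Pi.one_apply, one_mul]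
  have hder : ∀ t ∈ Icc τ T, ∀ x : E d, ‖x‖ ≤ R → ∀ w,
      fderiv ℝ ξ (t, x) ((1 : ℝ), w) = fderiv ℝ g x w := by
    intro t ht x hx w
    rw [(hval t ht x hx).fderiv_eq]
    have e : HasFDerivAt (fun q : ℝ × E d => g q.2)
        ((fderiv ℝ g x).comp (ContinuousLinearMap.snd ℝ ℝ (E d))) (t, x) :=
      HasFDerivAt.comp (t, x) (g := g) (f := Prod.snd)
        (hg.differentiable (by simp) x).hasFDerivAt hasFDerivAt_snd
    rw [e.fderiv]
    simp
  have hint : ∀ t ∈ Icc τ T, ∫ x, ξ (t, x) ∂(c t) = ∫ x, g x ∂(c t) := fun t ht => by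
    refine integral_congr_ae ?_
    filter_upwards [(hc.probOn t ht).ae_norm_le] with x hx using (hval t ht x hx).eq_of_nhds
  have hI := intervalIntegrable_weak hv hm hτ hτT hu h.1 h.2.1 hξd hξc
  have hsub : ∀ t ∈ Icc τ T, uIcc τ t ⊆ uIcc τ T := fun t ht => by
    rw [uIcc_of_le hτT, uIcc_of_le ht.1]
    exact Icc_subset_Icc_right ht.2
  have e1 := h.integral_eq hv hm hτ hτT hu hξd hξc ht
  have e2 := h.integral_eq hv hm hτ hτT hu hξd hξc hs
  have heq : ∀ q ∈ uIcc s t, ∫ x, fderiv ℝ ξ (q, x) ((1 : ℝ), v q (c q) (u q) x) ∂(c q) =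
      ∫ x, fderiv ℝ g x (truncField v c τ T R q (u q) x) ∂(c q) := by
    intro q hq
    have hq' : q ∈ Icc τ T := uIcc_subset_Icc hs ht hq
    refine integral_congr_ae ?_
    filter_upwards [(hc.probOn q hq').ae_norm_le] with x hx
    rw [hder q hq' x hx, truncField_eq hR hq' _ hx]
  constructor
  · have h1 : uIcc s t ⊆ uIcc τ T := by
      rw [uIcc_of_le hτT]
      exact uIcc_subset_Icc hs ht
    exact (hI.mono_set h1).congr fun q hq => heq q (uIoc_subset_uIcc hq)
  · rw [← hint t ht, ← hint s hs, e1, e2, add_sub_add_left_eq_sub,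
      intervalIntegral.integral_interval_sub_left (hI.mono_set (hsub t ht))
        (hI.mono_set (hsub s hs))]
    exact intervalIntegral.integral_congr heq

end Support

end WassersteinControl

namespace WassersteinControl

/-! ### Integral curves of Lipschitz fields -/

section IntegralCurves

variable {d : ℕ}

/-- A bounded time-dependent vector field that is measurable and Lipschitz in space. -/
structure LipschitzField (b : ℝ → E d → E d) (B L : ℝ) : Prop where
  meas : Measurable fun q : ℝ × E d => b q.1 q.2
  bound : ∀ t x, ‖b t x‖ ≤ B
  lip : ∀ t x y, ‖b t x - b t y‖ ≤ L * ‖x - y‖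
  nonneg : 0 ≤ L

/-- `Y` is an integral curve of `b` on `[a,T]`. -/
structure IsCurve (b : ℝ → E d → E d) (a T : ℝ) (Y : ℝ → E d) : Prop where
  cont : ContinuousOn Y (Icc a T)
  eq : ∀ t ∈ Icc a T, Y t = Y a + ∫ s in a..t, b s (Y s)

variable {b : ℝ → E d → E d} {B L : ℝ}

theorem LipschitzField.bound_nonneg (hb : LipschitzField b B L) : 0 ≤ B :=
  (norm_nonneg _).trans (hb.bound 0 0)

theorem LipschitzField.exists_curve (hb : LipschitzField b B L) {a T : ℝ} (haT : a ≤ T) (x : E d) :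
    ∃ Y : ℝ → E d, Y a = x ∧ IsCurve b a T Y := by
  obtain ⟨Y, hY, h⟩ := exists_caratheodory_solution (F := b) hb.nonneg haT hb.lip hb.bound
    (fun Y hY => (hb.meas.comp (measurable_id.prodMk hY.measurable)).aestronglyMeasurable) x
  have h0 : Y a = x := by simpa using h a (left_mem_Icc.2 haT)
  exact ⟨Y, h0, hY.continuousOn, fun t ht => by rw [h t ht, h0]⟩

theorem IsCurve.intervalIntegrable (hb : LipschitzField b B L) {a T : ℝ} {Y : ℝ → E d}
    (hY : IsCurve b a T Y) {s t : ℝ} (hs : s ∈ Icc a T) (ht : t ∈ Icc a T) :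
    IntervalIntegrable (fun r => b r (Y r)) volume s t := by
  have hsub : uIoc s t ⊆ Icc a T :=
    uIoc_subset_uIcc.trans (uIcc_subset_Icc hs ht)
  rw [intervalIntegrable_iff]
  have hYm : AEMeasurable Y (volume.restrict (uIoc s t)) :=
    (hY.cont.mono hsub).aemeasurable measurableSet_uIoc
  have : IsFiniteMeasure (volume.restrict (uIoc s t)) := ⟨by simp [uIoc]⟩
  exact Integrable.of_bound (C := B)
    (hb.meas.comp_aemeasurable (aemeasurable_id.prodMk hYm)).aestronglyMeasurable
    (ae_of_all _ fun r => hb.bound _ _)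

theorem IsCurve.sub_eq (hb : LipschitzField b B L) {a T : ℝ} {Y : ℝ → E d}
    (hY : IsCurve b a T Y) {s t : ℝ} (hs : s ∈ Icc a T) (ht : t ∈ Icc a T) :
    Y t = Y s + ∫ r in s..t, b r (Y r) := by
  have ha : a ∈ Icc a T := left_mem_Icc.2 (hs.1.trans hs.2)
  rw [hY.eq t ht, hY.eq s hs, add_assoc, intervalIntegral.integral_add_adjacent_intervals
    (hY.intervalIntegrable hb ha hs) (hY.intervalIntegrable hb hs ht)]

theorem IsCurve.restart (hb : LipschitzField b B L) {a T : ℝ} {Y : ℝ → E d}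
    (hY : IsCurve b a T Y) {s : ℝ} (hs : s ∈ Icc a T) : IsCurve b s T Y :=
  ⟨hY.cont.mono (Icc_subset_Icc_left hs.1), fun _ ht => hY.sub_eq hb hs ⟨hs.1.trans ht.1, ht.2⟩⟩

theorem IsCurve.norm_sub_le (hb : LipschitzField b B L) {a T : ℝ} {Y : ℝ → E d}
    (hY : IsCurve b a T Y) {t : ℝ} (ht : t ∈ Icc a T) : ‖Y t - Y a‖ ≤ B * (t - a) := by
  rw [hY.eq t ht, add_sub_cancel_left]
  have := intervalIntegral.norm_integral_le_of_norm_le_const (a := a) (b := t) (C := B)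
    (f := fun r => b r (Y r)) fun _ _ => hb.bound _ _
  rwa [abs_of_nonneg (sub_nonneg.2 ht.1)] at this

/-- Displacements along two integral curves differ by the integral of the distance. -/
theorem IsCurve.norm_displacement_sub_le (hb : LipschitzField b B L) {a T : ℝ} {Y Y' : ℝ → E d}
    (hY : IsCurve b a T Y) (hY' : IsCurve b a T Y') {t : ℝ} (ht : t ∈ Icc a T) :
    ‖(Y t - Y a) - (Y' t - Y' a)‖ ≤ L * ∫ s in a..t, ‖Y s - Y' s‖ := by
  have ha : a ∈ Icc a T := left_mem_Icc.2 (ht.1.trans ht.2)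
  rw [hY.eq t ht, hY'.eq t ht, add_sub_cancel_left, add_sub_cancel_left,
    ← intervalIntegral.integral_sub (hY.intervalIntegrable hb ha ht)
      (hY'.intervalIntegrable hb ha ht), ← intervalIntegral.integral_const_mul]
  refine intervalIntegral.norm_integral_le_of_norm_le ht.1 (ae_of_all _ fun s _ => hb.lip _ _ _) ?_
  refine ContinuousOn.intervalIntegrable ?_
  rw [uIcc_of_le ht.1]
  exact (((hY.cont.sub hY'.cont).norm).const_mul L).mono (Icc_subset_Icc_right ht.2)

theorem IsCurve.dist_le (hb : LipschitzField b B L) {a T : ℝ} {Y Y' : ℝ → E d}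
    (hY : IsCurve b a T Y) (hY' : IsCurve b a T Y') {t : ℝ} (ht : t ∈ Icc a T) :
    ‖Y t - Y' t‖ ≤ ‖Y a - Y' a‖ * Real.exp (L * (t - a)) := by
  refine le_mul_exp_of_le_add_integral (f := fun t => ‖Y t - Y' t‖) hb.nonneg
    (hY.cont.sub hY'.cont).norm (fun t ht => ?_) t ht
  have h1 := hY.norm_displacement_sub_le hb hY' ht
  have h2 : Y t - Y' t = (Y a - Y' a) + ((Y t - Y a) - (Y' t - Y' a)) := by abel
  rw [h2]
  exact (norm_add_le _ _).trans (add_le_add le_rfl h1)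

theorem IsCurve.eq_of_eq (hb : LipschitzField b B L) {a T : ℝ} {Y Y' : ℝ → E d}
    (hY : IsCurve b a T Y) (hY' : IsCurve b a T Y') (h : Y a = Y' a) {t : ℝ} (ht : t ∈ Icc a T) :
    Y t = Y' t := by
  have := hY.dist_le hb hY' ht
  rw [h, sub_self, norm_zero, zero_mul] at this
  exact sub_eq_zero.1 (norm_le_zero_iff.1 this)

theorem IsCurve.norm_displacement_sub_le' (hb : LipschitzField b B L) {a T S : ℝ}
    {Y Y' : ℝ → E d} (hY : IsCurve b a T Y) (hY' : IsCurve b a T Y') (hS : T - a ≤ S) {t : ℝ}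
    (ht : t ∈ Icc a T) :
    ‖(Y t - Y a) - (Y' t - Y' a)‖ ≤ (t - a) * (L * Real.exp (L * S) * ‖Y a - Y' a‖) := by
  have hL := hb.nonneg
  refine (hY.norm_displacement_sub_le hb hY' ht).trans ?_
  have h1 : ∫ s in a..t, ‖Y s - Y' s‖ ≤ ∫ _ in a..t, ‖Y a - Y' a‖ * Real.exp (L * S) := by
    refine intervalIntegral.integral_mono_on ht.1 ?_ (by simp) fun s hs => ?_
    · refine ContinuousOn.intervalIntegrable ?_
      rw [uIcc_of_le ht.1]
      exact ((hY.cont.sub hY'.cont).norm).mono (Icc_subset_Icc_right ht.2)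
    · refine (hY.dist_le hb hY' ⟨hs.1, hs.2.trans ht.2⟩).trans ?_
      have : s - a ≤ S := by linarith [hs.2, ht.2]
      gcongr
  rw [intervalIntegral.integral_const, smul_eq_mul] at h1
  calc L * ∫ s in a..t, ‖Y s - Y' s‖ ≤ L * ((t - a) * (‖Y a - Y' a‖ * Real.exp (L * S))) := by
        gcongr
    _ = _ := by ring

end IntegralCurves

/-! ### Mollification -/

section Mollification

-- The derivatives of convolutions live in iterated spaces of continuous linear maps, for which the
-- default depth of instance search is too small.
set_option maxSynthPendingDepth 3

variable {V : Type*} [NormedAddCommGroup V] [MeasureSpace V]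

theorem norm_convolution_le {F G : Type*} [NormedAddCommGroup F] [NormedSpace ℝ F]
    [NormedAddCommGroup G] [NormedSpace ℝ G] {κ : V → F} (hκ : Integrable κ)
    (Λ : F →L[ℝ] ℝ →L[ℝ] G) {f : V → ℝ} {M : ℝ} (hf : ∀ x, ‖f x‖ ≤ M) (x : V) :
    ‖(convolution κ f Λ volume) x‖ ≤ ‖Λ‖ * M * ∫ z, ‖κ z‖ := by
  rw [convolution, ← integral_const_mul]
  refine norm_integral_le_of_norm_le (hκ.norm.const_mul _) (ae_of_all _ fun z => ?_)
  refine (Λ.le_opNorm₂ _ _).trans ?_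
  have := hf (x - z)
  calc ‖Λ‖ * ‖κ z‖ * ‖f (x - z)‖ ≤ ‖Λ‖ * ‖κ z‖ * M := by gcongr
    _ = _ := by ring

variable [BorelSpace V]

/-- Averages against a mollifier at scale `ε` of two functions that are `C`-close on the ball of
radius `ε` are `C`-close. -/
theorem norm_integral_mollifier_sub_le [IsFiniteMeasureOnCompacts (volume : Measure V)]
    {ρ : V → ℝ} (hρ : Continuous ρ) (hρc : HasCompactSupport ρ) (hρ0 : ∀ z, 0 ≤ ρ z) (hρ1 : ∫ z, ρ z = 1)
    {ε C : ℝ} (hρε : ∀ z, ρ z ≠ 0 → ‖z‖ ≤ ε)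
    {f g : V → ℝ} (hf : Continuous f) (hg : Continuous g)
    (h : ∀ z, ‖z‖ ≤ ε → ‖f z - g z‖ ≤ C) :
    ‖(∫ z, ρ z * f z) - ∫ z, ρ z * g z‖ ≤ C := by
  have hi : ∀ f : V → ℝ, Continuous f → Integrable fun z => ρ z * f z := fun f hf =>
    (hρ.mul hf).integrable_of_hasCompactSupport hρc.mul_right
  have hρi : Integrable ρ := hρ.integrable_of_hasCompactSupport hρc
  rw [← integral_sub (hi f hf) (hi g hg)]
  have h1 : ∫ z, ρ z * C = C := by rw [integral_mul_const, hρ1, one_mul]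
  rw [← h1]
  refine norm_integral_le_of_norm_le (hρi.mul_const C) (ae_of_all _ fun z => ?_)
  rw [← mul_sub, norm_mul, Real.norm_of_nonneg (hρ0 z)]
  by_cases hz : ρ z = 0
  · simp [hz]
  · exact mul_le_mul_of_nonneg_left (h z (hρε z hz)) (hρ0 z)

variable [(volume : Measure V).IsAddHaarMeasure] [InnerProductSpace ℝ V] [FiniteDimensional ℝ V]

theorem hasFDerivAt_convolution_of_bounded {F G : Type*} [NormedAddCommGroup F] [NormedSpace ℝ F]
    [NormedAddCommGroup G] [NormedSpace ℝ G] {κ : V → F} (hκ : ContDiff ℝ (⊤ : ℕ∞) κ)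
    (hκc : HasCompactSupport κ) (Λ : F →L[ℝ] ℝ →L[ℝ] G) {M : ℝ} {f : V → ℝ} (hf : Continuous f)
    (hfM : ∀ x, ‖f x‖ ≤ M) (x : V) :
    HasFDerivAt (convolution κ f Λ volume)
      (convolution (fderiv ℝ κ) f (Λ.precompL V) volume x) x ∧
    ‖convolution (fderiv ℝ κ) f (Λ.precompL V) volume x‖ ≤
      ‖Λ.precompL V‖ * M * ∫ z, ‖fderiv ℝ κ z‖ :=
  ⟨hκc.hasFDerivAt_convolution_left Λ (hκ.of_le (by simp)) hf.locallyIntegrable x,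
    norm_convolution_le ((hκ.continuous_fderiv (by simp)).integrable_of_hasCompactSupport
      (hκc.fderiv ℝ)) _ hfM x⟩

/-- A mollifier at scale `ε`: mollified bounded functions have derivatives that are bounded and
Lipschitz, uniformly in terms of the bound. -/
theorem exists_mollifier {ε M : ℝ} (hε : 0 < ε) (hM : 0 ≤ M) :
    ∃ ρ : V → ℝ, Continuous ρ ∧ HasCompactSupport ρ ∧ (∀ z, 0 ≤ ρ z) ∧ ∫ z, ρ z = 1 ∧
      (∀ z, ρ z ≠ 0 → ‖z‖ ≤ ε) ∧ ∃ C, 0 ≤ C ∧ ∀ f : V → ℝ, Continuous f → (∀ x, ‖f x‖ ≤ M) →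
        ContDiff ℝ (⊤ : ℕ∞) (fun x => ∫ z, ρ z * f (x - z)) ∧
        (∀ x, ‖fderiv ℝ (fun x => ∫ z, ρ z * f (x - z)) x‖ ≤ C) ∧
        ∀ x y, ‖fderiv ℝ (fun x => ∫ z, ρ z * f (x - z)) x -
          fderiv ℝ (fun x => ∫ z, ρ z * f (x - z)) y‖ ≤ C * ‖x - y‖ := by
  let β : ContDiffBump (0 : V) := ⟨ε / 2, ε, by linarith, by linarith⟩
  set ρ : V → ℝ := β.normed volume with hρ
  have hρd : ContDiff ℝ (⊤ : ℕ∞) ρ := β.contDiff_normed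
  have hρc : HasCompactSupport ρ := β.hasCompactSupport_normed
  set Λ := ContinuousLinearMap.lsmul ℝ ℝ (E := ℝ) with hΛ
  have hD1 : ContDiff ℝ (⊤ : ℕ∞) (fderiv ℝ ρ) := hρd.fderiv_right (by simp)
  have hD1c : HasCompactSupport (fderiv ℝ ρ) := hρc.fderiv ℝ
  set Λ1 := Λ.precompL V with hΛ1
  set Λ2 := Λ1.precompL V with hΛ2
  set C1 := ‖Λ1‖ * M * ∫ z, ‖fderiv ℝ ρ z‖ with hC1
  set C2 := ‖Λ2‖ * M * ∫ z, ‖fderiv ℝ (fderiv ℝ ρ) z‖ with hC2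
  refine ⟨ρ, hρd.continuous, hρc, fun z => β.nonneg_normed z, β.integral_normed, fun z hz => ?_,
    max C1 C2, ?_, fun f hf hfM => ?_⟩
  · have h1 : z ∈ Function.support ρ := hz
    rw [hρ, β.support_normed_eq] at h1
    exact (mem_ball_zero_iff.1 h1).le
  · refine le_max_of_le_left ?_
    have : 0 ≤ ∫ z, ‖fderiv ℝ ρ z‖ := integral_nonneg fun z => norm_nonneg _
    positivity
  have hfl : LocallyIntegrable f volume := hf.locallyIntegrable
  have hconv : (fun x => ∫ z, ρ z * f (x - z)) = convolution ρ f Λ volume := by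
    ext x
    simp [convolution, hΛ]
  rw [hconv]
  have hder : fderiv ℝ (convolution ρ f Λ volume) = convolution (fderiv ℝ ρ) f Λ1 volume :=
    funext fun x => (hasFDerivAt_convolution_of_bounded hρd hρc Λ hf hfM x).1.fderiv
  refine ⟨hρc.contDiff_convolution_left Λ hρd hfl, fun x => ?_, fun x y => ?_⟩
  · rw [hder]
    exact (hasFDerivAt_convolution_of_bounded hρd hρc Λ hf hfM x).2.trans (le_max_left _ _)
  · rw [hder]
    have h1 := hasFDerivAt_convolution_of_bounded hD1 hD1c Λ1 hf hfM
    exact convex_univ.norm_image_sub_le_of_norm_hasFDerivWithin_le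
      (fun x _ => (h1 x).1.hasFDerivWithinAt)
      (fun x _ => (h1 x).2.trans (le_max_right _ _)) (mem_univ y) (mem_univ x)

end Mollification

end WassersteinControl

namespace WassersteinControl

/-! ### Uniqueness for the continuity equation -/

section Uniqueness

variable {d : ℕ} {b : ℝ → E d → E d} {B L : ℝ}

theorem LipschitzField.intervalIntegrable (hb : LipschitzField b B L) (x : E d) (s t : ℝ) :
    IntervalIntegrable (fun r => b r x) volume s t := by
  rw [intervalIntegrable_iff]
  exact Measure.integrableOn_of_bounded (M := B) (by simp [uIoc])
    (hb.meas.comp measurable_prodMk_right).aestronglyMeasurable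
    (ae_of_all _ fun r => hb.bound _ _)

theorem LipschitzField.norm_integral_sub_le (hb : LipschitzField b B L) {s t : ℝ} (hst : s ≤ t)
    (x y : E d) : ‖(∫ r in s..t, b r x) - ∫ r in s..t, b r y‖ ≤ (t - s) * L * ‖x - y‖ := by
  rw [← intervalIntegral.integral_sub (hb.intervalIntegrable x s t) (hb.intervalIntegrable y s t)]
  refine (intervalIntegral.norm_integral_le_of_norm_le_const
    fun r _ => hb.lip r x y).trans_eq ?_
  rw [abs_of_nonneg (sub_nonneg.2 hst)]
  ring

/-- First-order expansion of a smooth function along an integral curve. -/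
theorem IsCurve.taylor_le (hb : LipschitzField b B L) {s T C : ℝ} {Y : ℝ → E d}
    (hY : IsCurve b s T Y) {g : E d → ℝ} (hg : Differentiable ℝ g) (hC : 0 ≤ C)
    (hg1 : ∀ x, ‖fderiv ℝ g x‖ ≤ C) (hg2 : ∀ x y, ‖fderiv ℝ g x - fderiv ℝ g y‖ ≤ C * ‖x - y‖)
    {t : ℝ} (ht : t ∈ Icc s T) :
    ‖g (Y t) - g (Y s) - fderiv ℝ g (Y s) (∫ r in s..t, b r (Y s))‖ ≤
      (t - s) * (C * (B + L) * B * (t - s)) := by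
  have hs : s ∈ Icc s T := left_mem_Icc.2 (ht.1.trans ht.2)
  have hB := hb.bound_nonneg
  have hL := hb.nonneg
  have hts : 0 ≤ t - s := sub_nonneg.2 ht.1
  have h1 := hY.norm_sub_le hb ht
  have h2 : ‖g (Y t) - g (Y s) - fderiv ℝ g (Y s) (Y t - Y s)‖ ≤
      C * (B * (t - s)) * (B * (t - s)) := by
    refine ((convex_segment (Y s) (Y t)).norm_image_sub_le_of_norm_fderiv_le' (𝕜 := ℝ)
      (C := C * (B * (t - s))) (fun x _ => hg x) (fun x hx => ?_) (left_mem_segment _ _ _)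
      (right_mem_segment _ _ _)).trans ?_
    · refine (hg2 x (Y s)).trans ?_
      have : ‖x - Y s‖ ≤ ‖Y t - Y s‖ := norm_sub_le_of_mem_segment hx
      gcongr
      exact this.trans h1
    · gcongr
  have h3 : ‖(Y t - Y s) - ∫ r in s..t, b r (Y s)‖ ≤ L * (B * (t - s)) * (t - s) := by
    have e : Y t - Y s = ∫ r in s..t, b r (Y r) := by rw [hY.eq t ht, add_sub_cancel_left]
    rw [e, ← intervalIntegral.integral_sub (hY.intervalIntegrable hb hs ht)
      (hb.intervalIntegrable _ _ _)]
    refine (intervalIntegral.norm_integral_le_of_norm_le_const (C := L * (B * (t - s)))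
      fun r hr => ?_).trans_eq (by rw [abs_of_nonneg hts])
    rw [uIoc_of_le ht.1] at hr
    refine (hb.lip r _ _).trans ?_
    have h4 := hY.norm_sub_le hb (t := r) ⟨hr.1.le, hr.2.trans ht.2⟩
    have h5 : B * (r - s) ≤ B * (t - s) := by
      gcongr
      exact hr.2
    gcongr
    exact h4.trans h5
  have e : g (Y t) - g (Y s) - fderiv ℝ g (Y s) (∫ r in s..t, b r (Y s)) =
      (g (Y t) - g (Y s) - fderiv ℝ g (Y s) (Y t - Y s)) +
        fderiv ℝ g (Y s) ((Y t - Y s) - ∫ r in s..t, b r (Y s)) := by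
    rw [map_sub (fderiv ℝ g (Y s)) (Y t - Y s)]
    ring
  have h6 : ‖fderiv ℝ g (Y s) ((Y t - Y s) - ∫ r in s..t, b r (Y s))‖ ≤
      C * (L * (B * (t - s)) * (t - s)) := by
    refine (ContinuousLinearMap.le_opNorm _ _).trans ?_
    gcongr
    exact hg1 _
  rw [e]
  refine (norm_add_le _ _).trans ((add_le_add h2 h6).trans_eq ?_)
  ring

/-- Over a short time interval, the weak formulation may be evaluated with the initial measure. -/
theorem norm_integral_sub_initial_le (hb : LipschitzField b B L) {R C ω s t : ℝ}
    {c : ℝ → Measure (E d)} (hst : s ≤ t) (hc : ∀ r ∈ Icc s t, ProbOn (ball0 d R) (c r))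
    (hω : ∀ r ∈ Icc s t, wass 1 (c r) (c s) ≤ ω) {g : E d → ℝ} (hg : ContDiff ℝ (⊤ : ℕ∞) g)
    (hC : 0 ≤ C) (hg1 : ∀ x, ‖fderiv ℝ g x‖ ≤ C)
    (hg2 : ∀ x y, ‖fderiv ℝ g x - fderiv ℝ g y‖ ≤ C * ‖x - y‖)
    (hi : IntervalIntegrable (fun r => ∫ x, fderiv ℝ g x (b r x) ∂(c r)) volume s t) :
    ‖(∫ r in s..t, ∫ x, fderiv ℝ g x (b r x) ∂(c r)) -
      ∫ x, fderiv ℝ g x (∫ r in s..t, b r x) ∂(c s)‖ ≤ (t - s) * (C * (B + L) * ω) := by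
  have hB := hb.bound_nonneg
  have hL := hb.nonneg
  have hcs := hc s (left_mem_Icc.2 hst)
  have := hcs.1
  have hDc : Continuous (fderiv ℝ g) := hg.continuous_fderiv (by simp)
  have hm : Measurable fun q : ℝ × E d => fderiv ℝ g q.2 (b q.1 q.2) := by
    have h1 : Continuous fun q : E d × E d => fderiv ℝ g q.1 q.2 :=
      (hDc.comp continuous_fst).clm_apply continuous_snd
    exact h1.measurable.comp (measurable_snd.prodMk hb.meas)
  have hbd : ∀ q : ℝ × E d, ‖fderiv ℝ g q.2 (b q.1 q.2)‖ ≤ C * B := fun q =>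
    (ContinuousLinearMap.le_opNorm _ _).trans (mul_le_mul (hg1 _) (hb.bound _ _) (norm_nonneg _) hC)
  have hprod : Integrable (fun q : ℝ × E d => fderiv ℝ g q.2 (b q.1 q.2))
      ((volume.restrict (uIoc s t)).prod (c s)) := by
    have : IsFiniteMeasure (volume.restrict (uIoc s t)) := ⟨by simp [uIoc]⟩
    exact Integrable.of_bound hm.aestronglyMeasurable (C * B) (ae_of_all _ hbd)
  have hswap : ∫ x, fderiv ℝ g x (∫ r in s..t, b r x) ∂(c s) =
      ∫ r in s..t, ∫ x, fderiv ℝ g x (b r x) ∂(c s) := by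
    rw [intervalIntegral_integral_swap hprod]
    congr 1
    ext x
    exact ((fderiv ℝ g x).intervalIntegral_comp_comm (hb.intervalIntegrable x s t)).symm
  have hi2 : IntervalIntegrable (fun r => ∫ x, fderiv ℝ g x (b r x) ∂(c s)) volume s t := by
    rw [intervalIntegrable_iff]
    exact hprod.integral_prod_left
  rw [hswap, ← intervalIntegral.integral_sub hi hi2]
  refine (intervalIntegral.norm_integral_le_of_norm_le_const (C := C * (B + L) * ω)
    fun r hr => ?_).trans_eq (by rw [abs_of_nonneg (sub_nonneg.2 hst), mul_comm])
  rw [uIoc_of_le hst] at hr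
  have hr' : r ∈ Icc s t := Ioc_subset_Icc_self hr
  have hbr : Continuous (b r) :=
    (LipschitzWith.of_dist_le_mul (K := ⟨L, hL⟩) fun x y => by
      rw [dist_eq_norm, dist_eq_norm]
      exact hb.lip r x y).continuous
  have hcont : Continuous fun x => fderiv ℝ g x (b r x) := hDc.clm_apply hbr
  have h1 := norm_integral_sub_le_wass (hc r hr') hcs hcont (K := C * (B + L)) (by positivity)
    fun x _ y _ => by
      have e : fderiv ℝ g x (b r x) - fderiv ℝ g y (b r y) =
          (fderiv ℝ g x - fderiv ℝ g y) (b r x) + fderiv ℝ g y (b r x - b r y) := by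
        rw [map_sub, sub_apply]
        ring
      rw [e]
      have h2 : ‖(fderiv ℝ g x - fderiv ℝ g y) (b r x)‖ ≤ (C * ‖x - y‖) * B :=
        (ContinuousLinearMap.le_opNorm _ _).trans
          (mul_le_mul (hg2 x y) (hb.bound _ _) (norm_nonneg _) (by positivity))
      have h3 : ‖fderiv ℝ g y (b r x - b r y)‖ ≤ C * (L * ‖x - y‖) :=
        (ContinuousLinearMap.le_opNorm _ _).trans
          (mul_le_mul (hg1 y) (hb.lip _ _ _) (norm_nonneg _) hC)
      refine (norm_add_le _ _).trans ((add_le_add h2 h3).trans_eq ?_)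
      ring
  refine h1.trans ?_
  have := hω r hr'
  gcongr

/-- A function whose increments over short intervals are at most `K` times the length of the
interval, up to an arbitrarily small relative error, is `K`-Lipschitz. -/
theorem sub_le_of_local_sub_le {G : ℝ → ℝ} {a t₁ K : ℝ} (hat : a ≤ t₁)
    (hG : ContinuousOn G (Icc a t₁))
    (h : ∀ s ∈ Ico a t₁, ∀ e > 0, ∃ δ > 0, ∀ t ∈ Ioc s t₁, t - s < δ →
      |G t - G s| ≤ (t - s) * (K + e)) : |G t₁ - G a| ≤ K * (t₁ - a) := by
  have key : ∀ F : ℝ → ℝ, ContinuousOn F (Icc a t₁) →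
      (∀ s ∈ Ico a t₁, ∀ e > 0, ∃ δ > 0, ∀ t ∈ Ioc s t₁, t - s < δ →
        |F t - F s| ≤ (t - s) * (K + e)) → F t₁ - F a ≤ K * (t₁ - a) := by
    intro F hF hloc
    have hB : ∀ x, HasDerivAt (fun t => F a + K * (t - a)) K x := fun x => by
      simpa using ((hasDerivAt_id x).sub_const a).const_mul K |>.const_add (F a)
    have := image_le_of_liminf_slope_right_le_deriv_boundary hF
      (B := fun t => F a + K * (t - a)) (B' := fun _ => K) (by simp)
      (fun x _ => (hB x).continuousAt.continuousWithinAt) (fun x _ => (hB x).hasDerivWithinAt)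
      (fun s hs r hr => by
        obtain ⟨δ, hδ, hδs⟩ := hloc s hs ((r - K) / 2) (by linarith)
        refine Eventually.frequently ?_
        have h1 : Ioo s (min t₁ (s + δ)) ∈ 𝓝[>] s :=
          Ioo_mem_nhdsGT (lt_min hs.2 (by linarith))
        filter_upwards [h1] with t ht
        have ht2 := lt_min_iff.1 ht.2
        have h2 := (le_abs_self _).trans (hδs t ⟨ht.1, ht2.1.le⟩ (by linarith [ht2.2]))
        rw [slope_def_field, div_lt_iff₀ (sub_pos.2 ht.1)]
        nlinarith [sub_pos.2 ht.1]) (right_mem_Icc.2 hat)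
    linarith
  rw [abs_le']
  refine ⟨key G hG h, ?_⟩
  have := key (fun t => -G t) hG.neg fun s hs e he => by
    obtain ⟨δ, hδ, hδs⟩ := h s hs e he
    refine ⟨δ, hδ, fun t ht hts => ?_⟩
    rw [neg_sub_neg, abs_sub_comm]
    exact hδs t ht hts
  linarith

/-- Duality: along a weak solution, the integral of the solution `f s x = ψ (Φ s x t₁)` of the
backward transport equation with final value `ψ` is constant. As `f` is only Lipschitz, it is
mollified in space at scale `ε`; the commutator of mollification and transport is of order `ε`. -/
theorem integral_eq_integral_curves (hb : LipschitzField b B L) {τ T R : ℝ}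
    {c : ℝ → Measure (E d)} (hc : MeasureCurve τ T R c)
    (hW : ∀ g : E d → ℝ, ContDiff ℝ (⊤ : ℕ∞) g → ∀ s ∈ Icc τ T, ∀ t ∈ Icc τ T,
      IntervalIntegrable (fun r => ∫ x, fderiv ℝ g x (b r x) ∂(c r)) volume s t ∧
      ∫ x, g x ∂(c t) - ∫ x, g x ∂(c s) = ∫ r in s..t, ∫ x, fderiv ℝ g x (b r x) ∂(c r))
    {Φ : ℝ → E d → ℝ → E d} (hΦ0 : ∀ s ∈ Icc τ T, ∀ x, Φ s x s = x)
    (hΦ : ∀ s ∈ Icc τ T, ∀ x, IsCurve b s T (Φ s x)) {t₁ : ℝ} (ht₁ : t₁ ∈ Icc τ T)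
    {ψ : E d → ℝ} {M K : ℝ} (hM : 0 ≤ M) (hK : 0 ≤ K) (hψM : ∀ x, ‖ψ x‖ ≤ M)
    (hψK : ∀ x y, ‖ψ x - ψ y‖ ≤ K * ‖x - y‖) :
    ∫ x, ψ x ∂(c t₁) = ∫ x, ψ (Φ τ x t₁) ∂(c τ) := by
  have hB := hb.bound_nonneg
  have hL := hb.nonneg
  set S := T - τ with hS
  set Q := Real.exp (L * S) with hQ
  have hψc : Continuous ψ := (LipschitzWith.of_dist_le_mul (K := ⟨K, hK⟩) fun x y => by
    rw [dist_eq_norm, dist_eq_norm]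
    exact hψK x y).continuous
  have hI : ∀ {s t}, τ ≤ s → s ≤ t → t ≤ t₁ → s ∈ Icc τ T ∧ t ∈ Icc s T := fun h1 h2 h3 =>
    ⟨⟨h1, h2.trans (h3.trans ht₁.2)⟩, ⟨h2, h3.trans ht₁.2⟩⟩
  have hΦL : ∀ s t, τ ≤ s → s ≤ t → t ≤ t₁ → ∀ x y, ‖Φ s x t - Φ s y t‖ ≤ Q * ‖x - y‖ := by
    intro s t h1 h2 h3 x y
    obtain ⟨hs, ht⟩ := hI h1 h2 h3
    have h4 := (hΦ s hs x).dist_le hb (hΦ s hs y) ht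
    rw [hΦ0 s hs, hΦ0 s hs, mul_comm] at h4
    refine h4.trans ?_
    have : t - s ≤ S := by linarith [ht.2]
    have h5 : Real.exp (L * (t - s)) ≤ Q := Real.exp_le_exp.2 (mul_le_mul_of_nonneg_left this hL)
    gcongr
  have hΦc : ∀ s t, τ ≤ s → s ≤ t → t ≤ t₁ → Continuous fun x => Φ s x t := fun s t h1 h2 h3 =>
    (LipschitzWith.of_dist_le_mul (K := ⟨Q, (Real.exp_pos _).le⟩) fun x y => by
      rw [dist_eq_norm, dist_eq_norm]
      exact hΦL s t h1 h2 h3 x y).continuous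
  set f : ℝ → E d → ℝ := fun s x => ψ (Φ s x t₁) with hf
  have hfM : ∀ s x, ‖f s x‖ ≤ M := fun s x => hψM _
  have hfL : ∀ s, τ ≤ s → s ≤ t₁ → ∀ x y, ‖f s x - f s y‖ ≤ K * Q * ‖x - y‖ := by
    intro s h1 h2 x y
    refine (hψK _ _).trans ?_
    rw [mul_assoc]
    gcongr
    exact hΦL s t₁ h1 h2 le_rfl x y
  have hfc : ∀ s, τ ≤ s → s ≤ t₁ → Continuous (f s) := fun s h1 h2 =>
    hψc.comp (hΦc s t₁ h1 h2 le_rfl)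
  have hsemi : ∀ s t, τ ≤ s → s ≤ t → t ≤ t₁ → ∀ x, f s x = f t (Φ s x t) := by
    intro s t h1 h2 h3 x
    obtain ⟨hs, ht⟩ := hI h1 h2 h3
    have ht' : t ∈ Icc τ T := ⟨h1.trans h2, ht.2⟩
    simp only [hf]
    rw [((hΦ s hs x).restart hb ht).eq_of_eq hb (hΦ t ht' _) (by rw [hΦ0 t ht']) ⟨h3, ht₁.2⟩]
  -- It suffices to prove the identity up to an error proportional to `ε`
  suffices hε : ∀ ε > 0, |∫ x, ψ x ∂(c t₁) - ∫ x, ψ (Φ τ x t₁) ∂(c τ)| ≤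
      ε * (K * Q * (Q * L) * S + 2 * (K * Q)) by
    have h1 : Tendsto (fun ε : ℝ => ε * (K * Q * (Q * L) * S + 2 * (K * Q))) (𝓝[>] 0) (𝓝 0) := by
      have : Continuous fun ε : ℝ => ε * (K * Q * (Q * L) * S + 2 * (K * Q)) := by fun_prop
      have := this.tendsto 0
      rw [zero_mul] at this
      exact this.mono_left nhdsWithin_le_nhds
    have h2 := ge_of_tendsto h1 (by filter_upwards [self_mem_nhdsWithin] with ε hε' using hε ε hε')
    exact sub_eq_zero.1 (abs_nonpos_iff.1 h2)
  intro ε hε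
  obtain ⟨ρ, hρ, hρc, hρ0, hρ1, hρε, C, hC, hmol⟩ := exists_mollifier (V := E d) hε hM
  set g : ℝ → E d → ℝ := fun s x => ∫ z, ρ z * f s (x - z) with hg
  have hgC : ∀ s, τ ≤ s → s ≤ t₁ → ContDiff ℝ (⊤ : ℕ∞) (g s) ∧ (∀ x, ‖fderiv ℝ (g s) x‖ ≤ C) ∧
      ∀ x y, ‖fderiv ℝ (g s) x - fderiv ℝ (g s) y‖ ≤ C * ‖x - y‖ := fun s h1 h2 =>
    hmol (f s) (hfc s h1 h2) (hfM s)
  have hQ0 : 0 ≤ Q := (Real.exp_pos _).le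
  have hgf : ∀ s, τ ≤ s → s ≤ t₁ → ∀ x, ‖g s x - f s x‖ ≤ K * Q * ε := by
    intro s h1 h2 x
    have e : ∫ z, ρ z * f s x = f s x := by rw [integral_mul_const, hρ1, one_mul]
    rw [← e]
    have hcf := hfc s h1 h2
    refine norm_integral_mollifier_sub_le hρ hρc hρ0 hρ1 hρε (by fun_prop) continuous_const
      fun z hz => (hfL s h1 h2 _ _).trans ?_
    rw [sub_sub_cancel_left, norm_neg]
    gcongr
  -- The commutator estimate: mollification and transport along the curves nearly commute, because
  -- curves issued from points at distance `ε` have displacements that differ by `O(ε (t - s))`.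
  have hcomm : ∀ s t, τ ≤ s → s ≤ t → t ≤ t₁ → ∀ x,
      ‖g t (Φ s x t) - g s x‖ ≤ K * Q * ((t - s) * (L * Q * ε)) := by
    intro s t h1 h2 h3 x
    obtain ⟨hs, ht⟩ := hI h1 h2 h3
    have hcf := hfc t (h1.trans h2) h3
    have hcf' := hfc s h1 (h2.trans h3)
    refine norm_integral_mollifier_sub_le hρ hρc hρ0 hρ1 hρε (by fun_prop) (by fun_prop)
      fun z hz => ?_
    rw [hsemi s t h1 h2 h3]
    refine (hfL t (h1.trans h2) h3 _ _).trans ?_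
    have h4 := (hΦ s hs x).norm_displacement_sub_le' hb (hΦ s hs (x - z)) (S := S)
      (by linarith) ht
    rw [hΦ0 s hs, hΦ0 s hs, sub_sub_cancel] at h4
    have e : Φ s x t - z - Φ s (x - z) t = Φ s x t - x - (Φ s (x - z) t - (x - z)) := by abel
    rw [e]
    have hts : 0 ≤ t - s := sub_nonneg.2 h2
    gcongr
    refine h4.trans ?_
    gcongr
  set G : ℝ → ℝ := fun s => ∫ x, g s x ∂(c s) with hG
  set D := C * (B + L) * (B + 1) with hD
  have hD0 : 0 ≤ D := by positivity
  -- Increments of the mollified integral: the weak formulation with test function `g t` at frozen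
  -- measure `c s`, Taylor expansion along the curves, and the commutator estimate.
  have hstep : ∀ s t ω, τ ≤ s → s ≤ t → t ≤ t₁ → (∀ r ∈ Icc s t, wass 1 (c r) (c s) ≤ ω) →
      |G t - G s| ≤ (t - s) * (K * Q * (Q * L) * ε + D * ((t - s) + ω)) := by
    intro s t ω h1 h2 h3 hω
    obtain ⟨hs, ht⟩ := hI h1 h2 h3
    have ht' : t ∈ Icc τ T := ⟨h1.trans h2, ht.2⟩
    have hts : 0 ≤ t - s := sub_nonneg.2 h2
    have hω0 : 0 ≤ ω := (wass_nonneg _ _ _).trans (hω s (left_mem_Icc.2 h2))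
    have hcs := hc.probOn s hs
    have := hcs.1
    obtain ⟨hgd, hg1, hg2⟩ := hgC t (h1.trans h2) h3
    obtain ⟨hgd', -, -⟩ := hgC s h1 (h2.trans h3)
    obtain ⟨hi, hweq⟩ := hW (g t) hgd s hs t ht'
    have hinit := norm_integral_sub_initial_le hb h2
      (fun r hr => hc.probOn r ⟨h1.trans hr.1, hr.2.trans ht.2⟩) hω hgd hC hg1 hg2 hi
    have hJ : Continuous fun x => ∫ r in s..t, b r x :=
      (LipschitzWith.of_dist_le_mul (K := ⟨(t - s) * L, by positivity⟩) fun x y => by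
        rw [dist_eq_norm, dist_eq_norm]
        exact hb.norm_integral_sub_le h2 x y).continuous
    have hDJ : Continuous fun x => fderiv ℝ (g t) x (∫ r in s..t, b r x) :=
      (hgd.continuous_fderiv (by simp)).clm_apply hJ
    have hP : ∀ x, ‖g t x + fderiv ℝ (g t) x (∫ r in s..t, b r x) - g s x‖ ≤
        (t - s) * (C * (B + L) * B * (t - s)) + K * Q * ((t - s) * (L * Q * ε)) := by
      intro x
      have h5 := (hΦ s hs x).taylor_le hb (hgd.differentiable (by simp)) hC hg1 hg2 ht
      rw [hΦ0 s hs] at h5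
      have e : g t x + fderiv ℝ (g t) x (∫ r in s..t, b r x) - g s x =
          (g t (Φ s x t) - g s x) -
            (g t (Φ s x t) - g t x - fderiv ℝ (g t) x (∫ r in s..t, b r x)) := by ring
      rw [e, add_comm]
      exact (norm_sub_le _ _).trans (add_le_add (hcomm s t h1 h2 h3 x) h5)
    have hI1 : ‖∫ x, (g t x + fderiv ℝ (g t) x (∫ r in s..t, b r x) - g s x) ∂(c s)‖ ≤
        (t - s) * (C * (B + L) * B * (t - s)) + K * Q * ((t - s) * (L * Q * ε)) :=
      (norm_integral_le_of_norm_le_const (ae_of_all _ hP)).trans (by simp)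
    have i1 : Integrable (g t) (c s) := hcs.integrable hgd.continuous
    have i2 : Integrable (fun x => fderiv ℝ (g t) x (∫ r in s..t, b r x)) (c s) :=
      hcs.integrable hDJ
    have i3 : Integrable (g s) (c s) := hcs.integrable hgd'.continuous
    have i4 : Integrable (fun x => g t x + fderiv ℝ (g t) x (∫ r in s..t, b r x)) (c s) :=
      i1.add i2
    rw [integral_sub i4 i3, integral_add i1 i2] at hI1
    rw [← hweq] at hinit
    have e : G t - G s = ((∫ x, g t x ∂(c t)) - (∫ x, g t x ∂(c s)) -
        ∫ x, fderiv ℝ (g t) x (∫ r in s..t, b r x) ∂(c s)) +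
        ((∫ x, g t x ∂(c s)) + (∫ x, fderiv ℝ (g t) x (∫ r in s..t, b r x) ∂(c s)) -
          ∫ x, g s x ∂(c s)) := by
      simp only [hG]
      ring
    rw [e]
    refine (abs_add_le _ _).trans ((add_le_add hinit hI1).trans ?_)
    have h6 : C * (B + L) * ω + C * (B + L) * B * (t - s) ≤ D * ((t - s) + ω) := by
      have h7 : 0 ≤ C * (B + L) := by positivity
      rw [hD]
      have h8 : 0 ≤ C * (B + L) * B * ω := by positivity
      have h9 : 0 ≤ C * (B + L) * (t - s) := by positivity
      linarith
    have := mul_le_mul_of_nonneg_left h6 hts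
    linarith
  have hR2 : ∀ r ∈ Icc τ T, ∀ s ∈ Icc τ T, wass 1 (c r) (c s) ≤ 2 * R := fun r hr s hs =>
    wass_one_le_of_probOn (hc.probOn r hr) (hc.probOn s hs)
  have hR0 : 0 ≤ 2 * R := (wass_nonneg _ _ _).trans (hR2 _ ht₁ _ ht₁)
  have hGc : ContinuousOn G (Icc τ t₁) := by
    set N := K * Q * (Q * L) * ε + D * (S + 2 * R) with hN
    have hS0 : 0 ≤ S := by linarith [ht₁.1, ht₁.2]
    have hN0 : 0 ≤ N := by positivity
    have h1 : ∀ s ∈ Icc τ t₁, ∀ t ∈ Icc τ t₁, s ≤ t → |G t - G s| ≤ N * |t - s| := by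
      intro s hs t ht hst
      have h2 := hstep s t (2 * R) hs.1 hst ht.2 fun r hr =>
        hR2 r ⟨hs.1.trans hr.1, hr.2.trans (ht.2.trans ht₁.2)⟩ s ⟨hs.1, hs.2.trans ht₁.2⟩
      refine h2.trans ?_
      rw [abs_of_nonneg (sub_nonneg.2 hst), mul_comm]
      have h3 : t - s ≤ S := by linarith [hs.1, ht.2, ht₁.2]
      have h4 : 0 ≤ t - s := sub_nonneg.2 hst
      rw [hN]
      gcongr
    refine (LipschitzOnWith.of_dist_le_mul (K := ⟨N, hN0⟩) fun s hs t ht => ?_).continuousOn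
    rw [Real.dist_eq, Real.dist_eq]
    rcases le_total s t with hst | hst
    · rw [abs_sub_comm, abs_sub_comm s]
      exact h1 s hs t ht hst
    · exact h1 t ht s hs hst
  -- The terms with the factor `D`, which is unbounded as `ε → 0`, disappear as the time step tends
  -- to zero for fixed `ε`.
  have hmain : |G t₁ - G τ| ≤ K * Q * (Q * L) * ε * (t₁ - τ) := by
    refine sub_le_of_local_sub_le ht₁.1 hGc fun s hs e he => ?_
    set e' := e / (2 * (D + 1)) with he'
    have he0 : 0 < e' := by positivity
    have hsI : s ∈ Icc τ T := ⟨hs.1, hs.2.le.trans ht₁.2⟩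
    obtain ⟨δ, hδ, hδs⟩ := Metric.tendsto_nhdsWithin_nhds.1 (hc.tendsto s hsI) e' he0
    refine ⟨min δ e', lt_min hδ he0, fun t ht hts => ?_⟩
    have h2 := hstep s t e' hs.1 ht.1.le ht.2 fun r hr => by
      have hrI : r ∈ Icc τ T := ⟨hs.1.trans hr.1, hr.2.trans (ht.2.trans ht₁.2)⟩
      have h3 := hδs hrI (by
        rw [Real.dist_eq, abs_of_nonneg (sub_nonneg.2 hr.1)]
        have := lt_min_iff.1 hts
        linarith [hr.2])
      rw [Real.dist_eq, sub_zero] at h3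
      exact (le_abs_self _).trans h3.le
    refine h2.trans ?_
    have h4 : 0 ≤ t - s := sub_nonneg.2 ht.1.le
    have h5 : t - s ≤ e' := (lt_min_iff.1 hts).2.le
    have h6 : D * ((t - s) + e') ≤ e := by
      calc D * ((t - s) + e') ≤ (D + 1) * (e' + e') := by gcongr; linarith
        _ = e := by rw [he']; field_simp; ring
    gcongr
  have hcτ := hc.probOn τ (left_mem_Icc.2 (ht₁.1.trans ht₁.2))
  have hct := hc.probOn t₁ ht₁
  have hend : ∀ s, τ ≤ s → s ≤ t₁ → |∫ x, f s x ∂(c s) - G s| ≤ K * Q * ε := by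
    intro s h1 h2
    have hcs := hc.probOn s ⟨h1, h2.trans ht₁.2⟩
    have := hcs.1
    simp only [hG]
    rw [← integral_sub (hcs.integrable (hfc s h1 h2))
      (hcs.integrable (hgC s h1 h2).1.continuous)]
    have h3 := norm_integral_le_of_norm_le_const (μ := c s) (C := K * Q * ε)
      (ae_of_all _ fun x => (norm_sub_rev (f s x) _).trans_le (hgf s h1 h2 x))
    rwa [probReal_univ, mul_one] at h3
  have h1 := hend t₁ ht₁.1 le_rfl
  have h2 := hend τ le_rfl ht₁.1
  have h3 : ∫ x, f t₁ x ∂(c t₁) = ∫ x, ψ x ∂(c t₁) := by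
    congr 1
    ext x
    change ψ (Φ t₁ x t₁) = ψ x
    rw [hΦ0 t₁ ht₁]
  rw [h3] at h1
  have h4 : K * Q * (Q * L) * ε * (t₁ - τ) ≤ K * Q * (Q * L) * ε * S := by
    have : t₁ - τ ≤ S := by linarith [ht₁.2]
    gcongr
  have h5 : ∫ x, ψ x ∂(c t₁) - ∫ x, ψ (Φ τ x t₁) ∂(c τ) =
      (∫ x, ψ x ∂(c t₁) - G t₁) + (G t₁ - G τ) - (∫ x, f τ x ∂(c τ) - G τ) := by
    simp only [hf]
    ring
  rw [h5]
  refine (abs_sub _ _).trans ?_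
  have := abs_add_le (∫ x, ψ x ∂(c t₁) - G t₁) (G t₁ - G τ)
  linarith

end Uniqueness

end WassersteinControl

/-! ### Weak solutions are transported by their characteristics -/

namespace WassersteinControl

variable {d : ℕ} {U : Type*}

section

variable [TopologicalSpace U] [MeasurableSpace U] [BorelSpace U] [SecondCountableTopology U]
  [TopologicalSpace.PseudoMetrizableSpace U] {T m : ℝ}
  {v : ℝ → Measure (E d) → U → E d → E d}

/-- Bounded Lipschitz functions determine the measure, since they include the real and imaginary
parts of characters. -/
theorem ProbOn.eq_map_of_integral_eq {r R : ℝ} {μ ν : Measure (E d)} (hμ : ProbOn (ball0 d r) μ)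
    (hν : ProbOn (ball0 d R) ν) {f : E d → E d} (hf : Continuous f)
    (h : ∀ ψ : E d → ℝ, ∀ K : ℝ, 0 ≤ K → (∀ x, ‖ψ x‖ ≤ 1) → (∀ x y, ‖ψ x - ψ y‖ ≤ K * ‖x - y‖) →
      ∫ x, ψ x ∂ν = ∫ x, ψ (f x) ∂μ) : ν = μ.map f := by
  have := hμ.1
  have := hν.1
  have := Measure.isProbabilityMeasure_map (μ := μ) hf.measurable.aemeasurable
  refine Measure.ext_of_charFun ?_
  ext ξ
  rw [charFun_apply, charFun_apply,
    integral_map hf.measurable.aemeasurable (by fun_prop)]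
  have hin : ∀ x y : E d, |inner ℝ x ξ - inner ℝ y ξ| ≤ ‖ξ‖ * ‖x - y‖ := fun x y => by
    rw [← inner_sub_left, mul_comm]
    exact abs_real_inner_le_norm _ _
  have hc := h (fun x => Real.cos (inner ℝ x ξ)) ‖ξ‖ (norm_nonneg _)
    (fun x => Real.abs_cos_le_one _) fun x y =>
      (Real.abs_cos_sub_cos_le _ _).trans (hin x y)
  have hs := h (fun x => Real.sin (inner ℝ x ξ)) ‖ξ‖ (norm_nonneg _)
    (fun x => Real.abs_sin_le_one _) fun x y =>
      (Real.abs_sin_sub_sin_le _ _).trans (hin x y)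
  have key : ∀ (P : Measure (E d)) [IsProbabilityMeasure P] (g : E d → E d), Continuous g →
      ∫ x, Complex.exp (↑(inner ℝ (g x) ξ : ℝ) * Complex.I) ∂P =
        ((∫ x, Real.cos (inner ℝ (g x) ξ) ∂P : ℝ) : ℂ) +
          ((∫ x, Real.sin (inner ℝ (g x) ξ) ∂P : ℝ) : ℂ) * Complex.I := by
    intro P _ g hg
    have h1 : Integrable (fun x => Real.cos (inner ℝ (g x) ξ)) P :=
      Integrable.of_bound (by fun_prop) 1 (ae_of_all _ fun x => Real.abs_cos_le_one _)
    have h2 : Integrable (fun x => Real.sin (inner ℝ (g x) ξ)) P :=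
      Integrable.of_bound (by fun_prop) 1 (ae_of_all _ fun x => Real.abs_sin_le_one _)
    rw [← integral_complex_ofReal, ← integral_complex_ofReal, ← integral_mul_const,
      ← integral_add h1.ofReal (h2.ofReal.mul_const _)]
    congr 1
    ext x
    rw [Complex.exp_mul_I, Complex.ofReal_cos, Complex.ofReal_sin]
  have h1 := key ν id continuous_id
  simp only [id] at h1
  rw [h1, key μ f hf, hc, hs]

/-- Every distributional solution of the non-local continuity equation is the image of its initial
measure under the characteristic flow of the velocity field that it generates. -/
theorem IsTrajectory.exists_isFlow (hv : RegularVelocity T v m) (hm : 0 ≤ m) {τ r : ℝ}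
    (hτ : 0 ≤ τ) (hτT : τ ≤ T) (hr : 0 < r) {u : ℝ → U} (hu : Measurable u) {μ : Measure (E d)}
    (hμ : ProbOn (ball0 d r) μ) {c : ℝ → Measure (E d)} (h : IsTrajectory T v u τ μ c) :
    ∃ (X : ℝ → E d → E d) (R : ℝ), 0 < R ∧ IsFlow T v u τ r R μ c X := by
  obtain ⟨Rc, hRc, hc⟩ := h.exists_measureCurve hv hm hτ hτT hu hμ
  obtain ⟨X, R, hR, hRR, hX, hXR, hXode⟩ := exists_flow_along hv hm hτ hτT hr hRc.le hu hc
  have hc := hc.mono hRR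
  refine ⟨X, R, hR, hX, hXR, hXode, fun t ht => ?_⟩
  obtain ⟨L, hL, hlip⟩ := exists_truncField_lipschitz hv hR hτ hτT hc
  -- The truncated field has global characteristics, which extend those issued from `B(0,r)`.
  have hb : LipschitzField (fun t x => truncField v c τ T R t (u t) x) (m * (1 + R + R)) L :=
    ⟨measurable_truncField hv hR hτ hτT hc hu,
      fun t x => norm_truncField_le hv hm hR hτ hτT hc t _ x, fun t x y => hlip t _ x y, hL.le⟩
  have hcurve : ∀ s x, ∃ Y : ℝ → E d, s ∈ Icc τ T → Y s = x ∧
      IsCurve (fun t x => truncField v c τ T R t (u t) x) s T Y := fun s x => by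
    by_cases hs : s ∈ Icc τ T
    · obtain ⟨Y, hY⟩ := hb.exists_curve hs.2 x
      exact ⟨Y, fun _ => hY⟩
    · exact ⟨0, fun h => absurd h hs⟩
  choose Φ hΦ using hcurve
  have hτI : τ ∈ Icc τ T := left_mem_Icc.2 hτT
  have hX0 : ∀ x ∈ ball0 d r, X τ x = x := fun x hx => by
    rw [hXode x hx τ hτI, intervalIntegral.integral_same, add_zero]
  have hΦX : ∀ x ∈ ball0 d r, Φ τ x t = X t x := fun x hx => by
    refine (hΦ τ x hτI).2.eq_of_eq (Y' := fun s => X s x) hb ⟨?_, fun s hs => ?_⟩ ?_ ht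
    · exact (by fun_prop : Continuous fun s => X s x).continuousOn
    · rw [hX0 x hx, hXode x hx s hs]
      congr 1
      refine intervalIntegral.integral_congr fun q hq => ?_
      rw [uIcc_of_le hs.1] at hq
      have hq' : q ∈ Icc τ T := ⟨hq.1, hq.2.trans hs.2⟩
      exact (truncField_eq hR hq' _ (hXR q hq' x hx)).symm
    · rw [(hΦ τ x hτI).1, hX0 x hx]
  refine hμ.eq_map_of_integral_eq (hc.probOn t ht) (by fun_prop) fun ψ K hK hψ1 hψK => ?_
  rw [integral_eq_integral_curves hb hc
    (fun g hg s hs t ht => h.integral_sub_eq hv hm hτ hτT hR hu hc hg hs ht)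
    (fun s hs x => (hΦ s x hs).1) (fun s hs x => (hΦ s x hs).2) ht zero_le_one hK hψ1 hψK,
    h.2.2.1]
  refine integral_congr_ae ?_
  filter_upwards [hμ.ae_mem] with x hx
  rw [hΦX x hx]

end

end WassersteinControl

/-! ### Lagrangian comparison of trajectories -/

namespace WassersteinControl

variable {d : ℕ} {U : Type*}

section Lagrangian

variable {Ω : Type*} [MeasurableSpace Ω]

/-- A Lagrangian representation of the trajectory `c` on `[a,T]`: random curves `t ↦ Z t ω` in
`B(0,R)`, for `ω` in a set `G` meant to be of full probability, which follow the velocity field and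
have law `c t` at time `t`. Trajectories that start from different measures are compared by
representing them on the same probability space. -/
structure Lagrangian (v : ℝ → Measure (E d) → U → E d → E d) (u : ℝ → U) (a T R : ℝ)
    (P : Measure Ω) (G : Set Ω) (c : ℝ → Measure (E d)) (Z : ℝ → Ω → E d) : Prop where
  meas : ∀ t, Measurable (Z t)
  cont : ∀ ω ∈ G, ContinuousOn (fun t => Z t ω) (Icc a T)
  bound : ∀ t ∈ Icc a T, ∀ ω ∈ G, ‖Z t ω‖ ≤ R
  law : ∀ t ∈ Icc a T, c t = P.map (Z t)
  integrable : ∀ ω ∈ G, IntervalIntegrable (fun t => v t (c t) (u t) (Z t ω)) volume a T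
  ode : ∀ ω ∈ G, ∀ s ∈ Icc a T, ∀ t ∈ Icc a T,
    Z t ω - Z s ω = ∫ q in s..t, v q (c q) (u q) (Z q ω)

theorem IsFlow.lagrangian [TopologicalSpace U] [MeasurableSpace U] [BorelSpace U]
    [SecondCountableTopology U] [TopologicalSpace.PseudoMetrizableSpace U] {T m : ℝ}
    {v : ℝ → Measure (E d) → U → E d → E d} (hv : RegularVelocity T v m) (hm : 0 ≤ m)
    {τ r R : ℝ} (hR : 0 < R) (hτ : 0 ≤ τ) (hτT : τ ≤ T) {u : ℝ → U} (hu : Measurable u)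
    {μ : Measure (E d)} (hμ : ProbOn (ball0 d r) μ) {c : ℝ → Measure (E d)} {X : ℝ → E d → E d}
    (h : IsFlow T v u τ r R μ c X) {P : Measure Ω} {G : Set Ω} {f : Ω → E d} (hf : Measurable f)
    (hfμ : μ = P.map f) (hfG : ∀ ω ∈ G, ‖f ω‖ ≤ r) :
    Lagrangian v u τ T R P G c fun t ω => X t (f ω) := by
  have hc := h.measureCurve hμ
  have hG : ∀ ω ∈ G, f ω ∈ ball0 d r := fun ω hω => by simpa using hfG ω hω
  have hint : ∀ ω ∈ G, ∀ s ∈ Icc τ T, ∀ t ∈ Icc τ T,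
      IntervalIntegrable (fun t => v t (c t) (u t) (X t (f ω))) volume s t := by
    intro ω hω s hs t ht
    have h1 : Measurable fun t => truncField v c τ T R t (u t) (X t (f ω)) :=
      (measurable_truncField hv hR hτ hτT hc hu).comp
        (measurable_id.prodMk (h.continuous_time (f ω)).measurable)
    have h2 : IntervalIntegrable (fun t => truncField v c τ T R t (u t) (X t (f ω)))
        volume s t := by
      rw [intervalIntegrable_iff]
      have : IsFiniteMeasure (volume.restrict (uIoc s t)) := ⟨by simp [uIoc]⟩
      exact integrable_of_ae_norm_le h1.aestronglyMeasurable
        (ae_of_all _ fun t => norm_truncField_le hv hm hR hτ hτT hc t _ _)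
    refine h2.congr fun q hq => ?_
    have hq' : q ∈ Icc τ T := ⟨(le_min hs.1 ht.1).trans hq.1.le, hq.2.trans (max_le hs.2 ht.2)⟩
    exact truncField_eq hR hq' _ (h.bound q hq' _ (hG ω hω))
  have hτI : τ ∈ Icc τ T := left_mem_Icc.2 hτT
  refine ⟨fun t => (h.measurable t).comp hf, fun ω _ => (h.continuous_time _).continuousOn,
    fun t ht ω hω => h.bound t ht _ (hG ω hω), fun t ht => ?_,
    fun ω hω => hint ω hω τ hτI T (right_mem_Icc.2 hτT), fun ω hω s hs t ht => ?_⟩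
  · rw [h.law t ht, hfμ, Measure.map_map (h.measurable t) hf]
    rfl
  · rw [h.ode _ (hG ω hω) t ht, h.ode _ (hG ω hω) s hs, add_sub_add_left_eq_sub,
      intervalIntegral.integral_interval_sub_left (hint ω hω τ hτI t ht) (hint ω hω τ hτI s hs)]

section Lemmas

variable {v : ℝ → Measure (E d) → U → E d → E d} {u : ℝ → U} {a T R : ℝ} {P : Measure Ω}
  {G : Set Ω} {c : ℝ → Measure (E d)} {Z : ℝ → Ω → E d}

theorem Lagrangian.restrict (h : Lagrangian v u a T R P G c Z) {a' : ℝ} (ha : a' ∈ Icc a T)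
    {u' : ℝ → U} (hu : ∀ t ∈ Icc a' T, u t = u' t) : Lagrangian v u' a' T R P G c Z := by
  have hI : Icc a' T ⊆ Icc a T := Icc_subset_Icc_left ha.1
  refine ⟨h.meas, fun ω hω => (h.cont ω hω).mono hI, fun t ht => h.bound t (hI ht),
    fun t ht => h.law t (hI ht), fun ω hω => ?_, fun ω hω s hs t ht => ?_⟩
  · have h1 := (h.integrable ω hω).mono_set (c := a') (d := T) (by
      rw [uIcc_of_le ha.2, uIcc_of_le (ha.1.trans ha.2)]
      exact hI)
    refine h1.congr fun q hq => ?_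
    rw [uIoc_of_le ha.2] at hq
    simp only [hu q ⟨hq.1.le, hq.2⟩]
  · rw [h.ode ω hω s (hI hs) t (hI ht)]
    refine intervalIntegral.integral_congr fun q hq => ?_
    have hq' : q ∈ Icc a' T := uIcc_subset_Icc hs ht hq
    simp only [hu q hq']

theorem Lagrangian.probOn [IsProbabilityMeasure P] (h : Lagrangian v u a T R P G c Z)
    (hG : ∀ᵐ ω ∂P, ω ∈ G) {t : ℝ} (ht : t ∈ Icc a T) : ProbOn (ball0 d R) (c t) := by
  rw [h.law t ht]
  refine probOn_map (h.meas t) ?_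
  filter_upwards [hG] with ω hω using h.bound t ht ω hω

theorem Lagrangian.intervalIntegrable (h : Lagrangian v u a T R P G c Z) {ω : Ω} (hω : ω ∈ G)
    {s t : ℝ} (hs : s ∈ Icc a T) (ht : t ∈ Icc a T) :
    IntervalIntegrable (fun t => v t (c t) (u t) (Z t ω)) volume s t :=
  (h.integrable ω hω).mono_set (by
    rw [uIcc_of_le (hs.1.trans hs.2)]
    exact uIcc_subset_Icc hs ht)

/-- The velocity `v` is `ℓ`-Lipschitz in time, measure and space on `B(0,R)`, uniformly in the
control value. -/
def LipschitzVelocity (T : ℝ) (v : ℝ → Measure (E d) → U → E d → E d) (R ℓ : ℝ) : Prop :=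
  ∀ u, ∀ t ∈ Icc 0 T, ∀ τ ∈ Icc 0 T,
    ∀ μ ν, ProbOn (ball0 d R) μ → ProbOn (ball0 d R) ν →
    ∀ x ∈ ball0 d R, ∀ y ∈ ball0 d R,
      ‖v t μ u x - v τ ν u y‖ ≤ ℓ * (|t - τ| + wass 1 μ ν + ‖x - y‖)

theorem LipschitzVelocity.norm_sub_le_of_map [IsProbabilityMeasure P] {ℓ : ℝ} (hℓ : 0 ≤ ℓ)
    (hl : LipschitzVelocity T v R ℓ) (hG : ∀ᵐ ω ∂P, ω ∈ G) {f g : Ω → E d} (hf : Measurable f)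
    (hg : Measurable g) (hfR : ∀ ω ∈ G, ‖f ω‖ ≤ R) (hgR : ∀ ω ∈ G, ‖g ω‖ ≤ R) {s t : ℝ}
    (hs : s ∈ Icc 0 T) (ht : t ∈ Icc 0 T) (w : U) {ω : Ω} (hω : ω ∈ G) :
    ‖v s (P.map f) w (f ω) - v t (P.map g) w (g ω)‖ ≤
      ℓ * (|s - t| + ∫ ω', ‖f ω' - g ω'‖ ∂P + ‖f ω - g ω‖) := by
  have hi : Integrable (fun ω => ‖f ω - g ω‖) P := by
    refine integrable_of_ae_norm_le (hf.sub hg).norm.aestronglyMeasurable (C := R + R) ?_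
    filter_upwards [hG] with ω hω
    rw [norm_norm]
    exact (norm_sub_le _ _).trans (add_le_add (hfR ω hω) (hgR ω hω))
  refine (hl w s hs t ht _ _ (probOn_map hf ?_) (probOn_map hg ?_) _ (by simpa using hfR ω hω) _
    (by simpa using hgR ω hω)).trans ?_
  · filter_upwards [hG] with ω hω using hfR ω hω
  · filter_upwards [hG] with ω hω using hgR ω hω
  · have := wass_one_map_le hf hg hi
    gcongr

end Lemmas

/-- The mean Grönwall inequality for random curves `Y` that are driven by `F`, with an initial and
a source term that are dominated by `g`. -/
theorem gronwall_mean_of_integral {P : Measure Ω} [IsProbabilityMeasure P] {G : Set Ω}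
    (hG : ∀ᵐ ω ∂P, ω ∈ G) {Y F : ℝ → Ω → E d} {g h : Ω → ℝ} {k : ℝ → ℝ} {ℓ a b S B : ℝ}
    (hℓ : 0 ≤ ℓ) (hab : a ≤ b) (hS : b - a ≤ S) (hk : IntervalIntegrable k volume a b)
    (hk0 : ∀ s ∈ Icc a b, 0 ≤ k s) (hh : ∀ ω ∈ G, 0 ≤ h ω)
    (hYm : ∀ t ∈ Icc a b, Measurable (Y t))
    (hYc : ∀ ω ∈ G, ContinuousOn (fun t => Y t ω) (Icc a b))
    (hYB : ∀ t ∈ Icc a b, ∀ ω ∈ G, ‖Y t ω‖ ≤ B)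
    (hY : ∀ ω ∈ G, ∀ t ∈ Icc a b, Y t ω - Y a ω = ∫ s in a..t, F s ω)
    (hF : ∀ ω ∈ G, ∀ᵐ s ∂(volume.restrict (Icc a b)),
      ‖F s ω‖ ≤ k s * h ω + ℓ * ((∫ ω', ‖Y s ω'‖ ∂P) + ‖Y s ω‖))
    (hg : Integrable g P) (hgY : ∀ ω ∈ G, ‖Y a ω‖ + (∫ s in a..b, k s) * h ω ≤ g ω) :
    ∀ t ∈ Icc a b, (∫ ω, ‖Y t ω‖ ∂P ≤ gronwallConst ℓ S * ∫ ω, g ω ∂P) ∧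
      ∀ ω ∈ G, ‖Y t ω‖ ≤ gronwallConst ℓ S * (g ω + ∫ ω', g ω' ∂P) := by
  have hmean : ContinuousOn (fun s => ∫ ω, ‖Y s ω‖ ∂P) (Icc a b) := by
    refine continuousOn_of_dominated (bound := fun _ => B)
      (fun t ht => (hYm t ht).norm.aestronglyMeasurable) (fun t ht => ?_) (integrable_const _) ?_
    · filter_upwards [hG] with ω hω
      rw [norm_norm]
      exact hYB t ht ω hω
    · filter_upwards [hG] with ω hω using (hYc ω hω).norm
  have hkI : 0 ≤ ∫ s in a..b, k s := intervalIntegral.integral_nonneg hab hk0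
  refine gronwall_mean hG hℓ hS hg (fun ω hω => ?_) (fun _ _ _ _ => norm_nonneg _) hYB
    (fun t ht => (hYm t ht).norm.aestronglyMeasurable) (fun ω hω => (hYc ω hω).norm)
    fun t ht ω hω => ?_
  · have := mul_nonneg hkI (hh ω hω)
    linarith [hgY ω hω, norm_nonneg (Y a ω)]
  · have hIc : Icc a t ⊆ Icc a b := Icc_subset_Icc_right ht.2
    have hu : uIcc a t ⊆ uIcc a b := by rwa [uIcc_of_le ht.1, uIcc_of_le hab]
    have i1 : IntervalIntegrable (fun s => k s * h ω) volume a t := (hk.mono_set hu).mul_const _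
    have i2 : IntervalIntegrable (fun s => ℓ * ((∫ ω', ‖Y s ω'‖ ∂P) + ‖Y s ω‖)) volume a t := by
      refine (ContinuousOn.intervalIntegrable ?_)
      rw [uIcc_of_le ht.1]
      exact (continuousOn_const.mul (hmean.add (hYc ω hω).norm)).mono hIc
    have h1 : ‖∫ s in a..t, F s ω‖ ≤
        ∫ s in a..t, (k s * h ω + ℓ * ((∫ ω', ‖Y s ω'‖ ∂P) + ‖Y s ω‖)) := by
      refine intervalIntegral.norm_integral_le_of_norm_le ht.1 ?_ (i1.add i2)
      filter_upwards [(ae_restrict_iff' measurableSet_Icc).1 (hF ω hω)] with s hs hst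
      exact hs (hIc ⟨hst.1.le, hst.2⟩)
    rw [intervalIntegral.integral_add i1 i2, intervalIntegral.integral_mul_const,
      intervalIntegral.integral_const_mul] at h1
    have h2 : ∫ s in a..t, k s ≤ ∫ s in a..b, k s := by
      refine intervalIntegral.integral_mono_interval le_rfl ht.1 ht.2 ?_ hk
      refine (ae_restrict_iff' measurableSet_Ioc).2 (ae_of_all _ fun s hs => hk0 s ⟨hs.1.le, hs.2⟩)
    have h3 := mul_le_mul_of_nonneg_right h2 (hh ω hω)
    have h4 : ‖Y t ω‖ ≤ ‖Y a ω‖ + ‖Y t ω - Y a ω‖ := by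
      simpa using norm_add_le (Y a ω) (Y t ω - Y a ω)
    rw [hY ω hω t ht] at h4
    linarith [hgY ω hω]

section Estimates

variable {v : ℝ → Measure (E d) → U → E d → E d} {u : ℝ → U} {a T R ℓ : ℝ} {P : Measure Ω}
  {G : Set Ω} {c c₁ c₂ : ℝ → Measure (E d)} {Z Z₁ Z₂ : ℝ → Ω → E d}

/-- Stability of trajectories driven by the same control. -/
theorem Lagrangian.norm_sub_le [IsProbabilityMeasure P] (hG : ∀ᵐ ω ∂P, ω ∈ G) (hℓ : 0 ≤ ℓ)
    (hl : LipschitzVelocity T v R ℓ) (ha : a ∈ Icc 0 T) (h₁ : Lagrangian v u a T R P G c₁ Z₁)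
    (h₂ : Lagrangian v u a T R P G c₂ Z₂) {g : Ω → ℝ} (hg : Integrable g P)
    (hgZ : ∀ ω ∈ G, ‖Z₁ a ω - Z₂ a ω‖ ≤ g ω) : ∀ t ∈ Icc a T, ∀ ω ∈ G,
      ‖Z₁ t ω - Z₂ t ω‖ ≤ gronwallConst ℓ T * (g ω + ∫ ω', g ω' ∂P) := by
  have hI : ∀ t ∈ Icc a T, t ∈ Icc 0 T := fun t ht => Icc_sub_Icc_zero ha.1 ht
  have haI : a ∈ Icc a T := left_mem_Icc.2 ha.2
  intro t ht
  refine (gronwall_mean_of_integral (Y := fun t ω => Z₁ t ω - Z₂ t ω)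
    (F := fun t ω => v t (c₁ t) (u t) (Z₁ t ω) - v t (c₂ t) (u t) (Z₂ t ω))
    (h := fun _ => 0) (k := fun _ => 0) (B := R + R) hG hℓ ha.2 (by linarith [ha.1])
    intervalIntegrable_const (fun _ _ => le_rfl) (fun _ _ => le_rfl)
    (fun t _ => (h₁.meas t).sub (h₂.meas t)) (fun ω hω => (h₁.cont ω hω).sub (h₂.cont ω hω))
    (fun t ht ω hω => (_root_.norm_sub_le _ _).trans
      (add_le_add (h₁.bound t ht ω hω) (h₂.bound t ht ω hω)))
    (fun ω hω t ht => ?_) (fun ω hω => ?_) hg (fun ω hω => by simpa using hgZ ω hω) t ht).2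
  · rw [intervalIntegral.integral_sub (h₁.intervalIntegrable hω haI ht)
      (h₂.intervalIntegrable hω haI ht), ← h₁.ode ω hω a haI t ht, ← h₂.ode ω hω a haI t ht]
    abel
  · refine (ae_restrict_iff' measurableSet_Icc).2 (ae_of_all _ fun s hs => ?_)
    have := hl.norm_sub_le_of_map hℓ hG (h₁.meas s) (h₂.meas s) (h₁.bound s hs) (h₂.bound s hs)
      (hI s hs) (hI s hs) (u s) hω
    rw [← h₁.law s hs, ← h₂.law s hs, sub_self, abs_zero, zero_add] at this
    simpa using this

/-- The velocities of a trajectory and of a convex combination of two others, all driven by the same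
control, differ by the semiconcavity defect of `v` and by a Lipschitz term. -/
theorem Lagrangian.norm_convexComb_velocity_sub_le [IsProbabilityMeasure P]
    (hG : ∀ᵐ ω ∂P, ω ∈ G) (hℓ : 0 ≤ ℓ) (hl : LipschitzVelocity T v R ℓ) (ha : 0 ≤ a)
    {C : ℝ} (hC : 0 ≤ C)
    (h₁ : Lagrangian v u a T R P G c₁ Z₁) (h₂ : Lagrangian v u a T R P G c₂ Z₂)
    (h : Lagrangian v u a T R P G c Z) {lam : ℝ} (hlam : lam ∈ Icc (0 : ℝ) 1) {s : ℝ}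
    (hs : s ∈ Icc a T)
    (hsc : ∀ u, ∀ μ₁ μ₂, ProbOn (ball0 d R) μ₁ → ProbOn (ball0 d R) μ₂ →
      ∀ γ ∈ plans μ₁ μ₂, ∀ x ∈ ball0 d R, ∀ y ∈ ball0 d R, ∀ lam ∈ Icc (0 : ℝ) 1,
        ‖(1 - lam) • v s μ₁ u x + lam • v s μ₂ u y
            - v s (interp γ lam) u ((1 - lam) • x + lam • y)‖
          ≤ C * (lam * (1 - lam)) * (‖x - y‖ ^ 2 + wassPlan γ ^ 2))
    {ω : Ω} (hω : ω ∈ G) {H : ℝ}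
    (hH : ‖Z₁ s ω - Z₂ s ω‖ ^ 2 + ∫ ω', ‖Z₁ s ω' - Z₂ s ω'‖ ^ 2 ∂P ≤ H) :
    ‖(1 - lam) • v s (c₁ s) (u s) (Z₁ s ω) + lam • v s (c₂ s) (u s) (Z₂ s ω) -
        v s (c s) (u s) (Z s ω)‖ ≤ C * (lam * (1 - lam) * H) +
      ℓ * ((∫ ω', ‖(1 - lam) • Z₁ s ω' + lam • Z₂ s ω' - Z s ω'‖ ∂P) +
        ‖(1 - lam) • Z₁ s ω + lam • Z₂ s ω - Z s ω‖) := by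
  have hll : 0 ≤ lam * (1 - lam) := mul_nonneg hlam.1 (by linarith [hlam.2])
  have hI := Icc_sub_Icc_zero ha hs
  have hm : Measurable fun ω => (1 - lam) • Z₁ s ω + lam • Z₂ s ω :=
    (measurable_interp lam).comp ((h₁.meas s).prodMk (h₂.meas s))
  have hb : ∀ ω ∈ G, ‖(1 - lam) • Z₁ s ω + lam • Z₂ s ω‖ ≤ R := fun ω hω =>
    norm_convexComb_le hlam (h₁.bound s hs ω hω) (h₂.bound s hs ω hω)
  have hpl := map_mem_plans (P := P) (h₁.meas s) (h₂.meas s)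
  rw [← h₁.law s hs, ← h₂.law s hs] at hpl
  have h3 := hsc (u s) _ _ (h₁.probOn hG hs) (h₂.probOn hG hs) _ hpl
    (Z₁ s ω) (by simpa using h₁.bound s hs ω hω)
    (Z₂ s ω) (by simpa using h₂.bound s hs ω hω) lam hlam
  have hint : interp (P.map fun ω => (Z₁ s ω, Z₂ s ω)) lam =
      P.map fun ω => (1 - lam) • Z₁ s ω + lam • Z₂ s ω := by
    rw [interp, Measure.map_map (measurable_interp lam) ((h₁.meas s).prodMk (h₂.meas s))]
    rfl
  have hw : wassPlan (P.map fun ω => (Z₁ s ω, Z₂ s ω)) ^ 2 =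
      ∫ ω', ‖Z₁ s ω' - Z₂ s ω'‖ ^ 2 ∂P := by
    rw [wassPlan_sq, integral_map ((h₁.meas s).prodMk (h₂.meas s)).aemeasurable
      (Continuous.aestronglyMeasurable (by fun_prop))]
  rw [hint, hw] at h3
  have h4 := hl.norm_sub_le_of_map hℓ hG hm (h.meas s) hb (h.bound s hs) hI hI (u s) hω
  rw [← h.law s hs, sub_self, abs_zero, zero_add] at h4
  have h5 : C * (lam * (1 - lam)) * (‖Z₁ s ω - Z₂ s ω‖ ^ 2 +
      ∫ ω', ‖Z₁ s ω' - Z₂ s ω'‖ ^ 2 ∂P) ≤ C * (lam * (1 - lam) * H) := by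
    rw [mul_assoc]
    gcongr
  refine (norm_sub_le_norm_sub_add_norm_sub _ (v s
    (P.map fun ω => (1 - lam) • Z₁ s ω + lam • Z₂ s ω) (u s)
      ((1 - lam) • Z₁ s ω + lam • Z₂ s ω)) _).trans ?_
  exact add_le_add (h3.trans h5) h4

theorem Lagrangian.convexComb_sub_eq (ha : a ≤ T)
    (h₁ : Lagrangian v u a T R P G c₁ Z₁) (h₂ : Lagrangian v u a T R P G c₂ Z₂)
    (h : Lagrangian v u a T R P G c Z) (lam : ℝ) {ω : Ω} (hω : ω ∈ G) {t : ℝ} (ht : t ∈ Icc a T) :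
    ((1 - lam) • Z₁ t ω + lam • Z₂ t ω - Z t ω) - ((1 - lam) • Z₁ a ω + lam • Z₂ a ω - Z a ω) =
      ∫ s in a..t, ((1 - lam) • v s (c₁ s) (u s) (Z₁ s ω) + lam • v s (c₂ s) (u s) (Z₂ s ω) -
        v s (c s) (u s) (Z s ω)) := by
  have haI : a ∈ Icc a T := left_mem_Icc.2 ha
  have i₁ : IntervalIntegrable (fun s => (1 - lam) • v s (c₁ s) (u s) (Z₁ s ω)) volume a t :=
    (h₁.intervalIntegrable hω haI ht).smul (1 - lam)
  have i₂ : IntervalIntegrable (fun s => lam • v s (c₂ s) (u s) (Z₂ s ω)) volume a t :=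
    (h₂.intervalIntegrable hω haI ht).smul lam
  rw [intervalIntegral.integral_sub (i₁.add i₂) (h.intervalIntegrable hω haI ht),
    intervalIntegral.integral_add i₁ i₂, intervalIntegral.integral_smul,
    intervalIntegral.integral_smul, ← h₁.ode ω hω a haI t ht, ← h₂.ode ω hω a haI t ht,
    ← h.ode ω hω a haI t ht]
  module

/-- Comparison of a trajectory with the convex combination of two others, all driven by the same
control: the source term in the Grönwall estimate is the semiconcavity defect of the velocity. -/
theorem Lagrangian.integral_norm_convexComb_sub_le [IsProbabilityMeasure P]
    (hG : ∀ᵐ ω ∂P, ω ∈ G) (hℓ : 0 ≤ ℓ) (hl : LipschitzVelocity T v R ℓ) (ha : a ∈ Icc 0 T)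
    {C : ℝ → ℝ} (hC : IsL1Pos T C) (hsc : StrongVelocitySC T v R C)
    (h₁ : Lagrangian v u a T R P G c₁ Z₁) (h₂ : Lagrangian v u a T R P G c₂ Z₂)
    (h : Lagrangian v u a T R P G c Z) {lam : ℝ} (hlam : lam ∈ Icc (0 : ℝ) 1) {H g : Ω → ℝ}
    (hH0 : ∀ ω ∈ G, 0 ≤ H ω)
    (hH : ∀ t ∈ Icc a T, ∀ ω ∈ G,
      ‖Z₁ t ω - Z₂ t ω‖ ^ 2 + ∫ ω', ‖Z₁ t ω' - Z₂ t ω'‖ ^ 2 ∂P ≤ H ω)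
    (hg : Integrable g P)
    (hgZ : ∀ ω ∈ G, ‖(1 - lam) • Z₁ a ω + lam • Z₂ a ω - Z a ω‖ +
      (∫ s in (0)..T, C s) * (lam * (1 - lam) * H ω) ≤ g ω) {t : ℝ} (ht : t ∈ Icc a T) :
      ∫ ω, ‖(1 - lam) • Z₁ t ω + lam • Z₂ t ω - Z t ω‖ ∂P ≤ gronwallConst ℓ T * ∫ ω, g ω ∂P := by
  have hI : Icc a T ⊆ Icc 0 T := Icc_subset_Icc_left ha.1
  have hT : 0 ≤ T := ha.1.trans ha.2
  have hll : 0 ≤ lam * (1 - lam) := mul_nonneg hlam.1 (by linarith [hlam.2])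
  have hCi : IntervalIntegrable C volume 0 T := by
    rw [intervalIntegrable_iff_integrableOn_Icc_of_le hT]
    exact hC.1
  have hCa : IntervalIntegrable C volume a T :=
    hCi.mono_set (by rwa [uIcc_of_le ha.2, uIcc_of_le hT])
  have hsc' : ∀ ω ∈ G, ∀ᵐ s ∂(volume.restrict (Icc a T)),
      ‖(1 - lam) • v s (c₁ s) (u s) (Z₁ s ω) + lam • v s (c₂ s) (u s) (Z₂ s ω) -
        v s (c s) (u s) (Z s ω)‖ ≤ C s * (lam * (1 - lam) * H ω) +
      ℓ * ((∫ ω', ‖(1 - lam) • Z₁ s ω' + lam • Z₂ s ω' - Z s ω'‖ ∂P) +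
        ‖(1 - lam) • Z₁ s ω + lam • Z₂ s ω - Z s ω‖) := fun ω hω => by
    have h3 := ae_restrict_of_ae_restrict_of_subset hI hsc
    filter_upwards [h3, ae_restrict_mem measurableSet_Icc] with s hsc hs
    exact Lagrangian.norm_convexComb_velocity_sub_le hG hℓ hl ha.1 (hC.2 s (hI hs)) h₁ h₂ h hlam hs
      hsc hω (hH s hs ω hω)
  have hgY : ∀ ω ∈ G, ‖(1 - lam) • Z₁ a ω + lam • Z₂ a ω - Z a ω‖ +
      (∫ s in a..T, C s) * (lam * (1 - lam) * H ω) ≤ g ω := fun ω hω => by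
    have h3 : ∫ s in a..T, C s ≤ ∫ s in (0)..T, C s := by
      refine intervalIntegral.integral_mono_interval ha.1 ha.2 le_rfl ?_ hCi
      exact (ae_restrict_iff' measurableSet_Ioc).2
        (ae_of_all _ fun s hs => hC.2 s ⟨hs.1.le, hs.2⟩)
    have h4 := mul_le_mul_of_nonneg_right h3 (mul_nonneg hll (hH0 ω hω))
    linarith [hgZ ω hω]
  have hYm : ∀ t ∈ Icc a T,
      Measurable fun ω => (1 - lam) • Z₁ t ω + lam • Z₂ t ω - Z t ω := fun t _ =>
    ((measurable_interp lam).comp ((h₁.meas t).prodMk (h₂.meas t))).sub (h.meas t)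
  have hYc : ∀ ω ∈ G,
      ContinuousOn (fun t => (1 - lam) • Z₁ t ω + lam • Z₂ t ω - Z t ω) (Icc a T) :=
    fun ω hω => by
      have := h₁.cont ω hω
      have := h₂.cont ω hω
      have := h.cont ω hω
      fun_prop
  have hYB : ∀ t ∈ Icc a T, ∀ ω ∈ G,
      ‖(1 - lam) • Z₁ t ω + lam • Z₂ t ω - Z t ω‖ ≤ R + R := fun t ht ω hω =>
    (_root_.norm_sub_le _ _).trans (add_le_add
      (norm_convexComb_le hlam (h₁.bound t ht ω hω) (h₂.bound t ht ω hω)) (h.bound t ht ω hω))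
  exact (gronwall_mean_of_integral hG hℓ ha.2 (by linarith [ha.1]) hCa
    (fun s hs => hC.2 s (hI hs)) (fun ω hω => mul_nonneg hll (hH0 ω hω)) hYm hYc hYB
    (fun ω hω t ht => Lagrangian.convexComb_sub_eq ha.2 h₁ h₂ h lam hω ht) hsc' hg hgY t ht).1

end Estimates

end Lagrangian

end WassersteinControl

/-! ### Comparison of trajectories with different initial times -/

namespace WassersteinControl

variable {d : ℕ} {U : Type*}

/-- The affine change of time which fixes `τ` and contracts by the factor `1 - lam`. It maps
`[τ₁,τ]` onto `[(1 - lam) τ₁ + lam τ, τ]`. -/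
def reparam (lam τ s : ℝ) : ℝ := (1 - lam) * s + lam * τ

theorem reparam_self (lam τ : ℝ) : reparam lam τ τ = τ := by
  unfold reparam; ring

theorem reparam_mem {lam τ₁ τ₂ s : ℝ} (hlam : lam ∈ Icc (0 : ℝ) 1) (hs : s ∈ Icc τ₁ τ₂) :
    reparam lam τ₂ s ∈ Icc (reparam lam τ₂ τ₁) τ₂ := by
  have h1 : 0 ≤ 1 - lam := by linarith [hlam.2]
  unfold reparam
  constructor
  · have := mul_le_mul_of_nonneg_left hs.1 h1
    linarith
  · have := mul_le_mul_of_nonneg_left hs.2 h1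
    linarith

theorem le_reparam {lam τ₁ τ₂ : ℝ} (hlam : lam ∈ Icc (0 : ℝ) 1) (h : τ₁ ≤ τ₂) :
    τ₁ ≤ reparam lam τ₂ τ₁ := by
  have := mul_le_mul_of_nonneg_left h hlam.1
  unfold reparam
  linarith

theorem abs_sub_reparam_le {lam τ₁ τ₂ s : ℝ} (hlam : 0 ≤ lam) (hs : s ∈ Icc τ₁ τ₂) :
    |s - reparam lam τ₂ s| ≤ lam * (τ₂ - τ₁) := by
  have : s - reparam lam τ₂ s = -(lam * (τ₂ - s)) := by unfold reparam; ring
  rw [this, abs_neg, abs_of_nonneg (mul_nonneg hlam (by linarith [hs.2]))]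
  exact mul_le_mul_of_nonneg_left (by linarith [hs.1]) hlam

theorem intervalIntegrable_comp_reparam {f : ℝ → E d} {lam τ a b : ℝ} (hlam : lam < 1)
    (hf : IntervalIntegrable f volume (reparam lam τ a) (reparam lam τ b)) :
    IntervalIntegrable (fun s => f (reparam lam τ s)) volume a b := by
  have h0 : 1 - lam ≠ 0 := by linarith
  have h := (hf.comp_add_right (lam * τ)).comp_mul_left (c := 1 - lam)
  simpa [reparam, h0] using h

section Lagrangian

variable {Ω : Type*} [MeasurableSpace Ω] {v : ℝ → Measure (E d) → U → E d → E d} {u u₁ : ℝ → U}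
  {T R ℓ M : ℝ} {P : Measure Ω} {G : Set Ω} {c c₁ : ℝ → Measure (E d)} {Z Z₁ : ℝ → Ω → E d}
  {τ₁ τ₂ lam : ℝ}

theorem Lagrangian.sub_eq_of_reparam (hlam : lam ∈ Ioo (0 : ℝ) 1)
    (hτ₂ : τ₂ ≤ T) (h : Lagrangian v u (reparam lam τ₂ τ₁) T R P G c Z) {ω : Ω} (hω : ω ∈ G)
    {t : ℝ} (ht : t ∈ Icc τ₁ τ₂) :
    IntervalIntegrable (fun s => v (reparam lam τ₂ s) (c (reparam lam τ₂ s))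
      (u (reparam lam τ₂ s)) (Z (reparam lam τ₂ s) ω)) volume τ₁ t ∧
    Z (reparam lam τ₂ t) ω - Z (reparam lam τ₂ τ₁) ω =
      (1 - lam) • ∫ s in τ₁..t, v (reparam lam τ₂ s) (c (reparam lam τ₂ s))
        (u (reparam lam τ₂ s)) (Z (reparam lam τ₂ s) ω) := by
  have hl : lam ∈ Icc (0 : ℝ) 1 := ⟨hlam.1.le, hlam.2.le⟩
  have hmem : ∀ s ∈ Icc τ₁ τ₂, reparam lam τ₂ s ∈ Icc (reparam lam τ₂ τ₁) T := fun s hs =>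
    Icc_subset_Icc_right hτ₂ (reparam_mem hl hs)
  have h1 : τ₁ ∈ Icc τ₁ τ₂ := left_mem_Icc.2 (ht.1.trans ht.2)
  refine ⟨intervalIntegrable_comp_reparam
    (f := fun s => v s (c s) (u s) (Z s ω)) hlam.2
    (h.intervalIntegrable hω (hmem _ h1) (hmem _ ht)), ?_⟩
  rw [h.ode ω hω _ (hmem _ h1) _ (hmem _ ht)]
  exact (intervalIntegral.smul_integral_comp_mul_add (fun s => v s (c s) (u s) (Z s ω))
    (1 - lam) (lam * τ₂)).symm

/-- The velocities at time `s` and at the reparametrised time, with the same control value. -/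
theorem Lagrangian.norm_velocity_sub_reparam_le [IsProbabilityMeasure P] (hG : ∀ᵐ ω ∂P, ω ∈ G)
    (hℓ : 0 ≤ ℓ) (hl : LipschitzVelocity T v R ℓ) (hlam : lam ∈ Ioo (0 : ℝ) 1) (hτ₁ : 0 ≤ τ₁)
    (hτ : τ₁ ≤ τ₂) (hτ₂ : τ₂ ≤ T) (h₁ : Lagrangian v u₁ τ₁ T R P G c₁ Z₁)
    (h : Lagrangian v u (reparam lam τ₂ τ₁) T R P G c Z)
    (hu : ∀ s ∈ Icc τ₁ τ₂, u₁ s = u (reparam lam τ₂ s)) {ω : Ω} (hω : ω ∈ G) {s : ℝ}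
    (hs : s ∈ Icc τ₁ τ₂) :
    ‖v s (c₁ s) (u₁ s) (Z₁ s ω) - v (reparam lam τ₂ s) (c (reparam lam τ₂ s))
        (u (reparam lam τ₂ s)) (Z (reparam lam τ₂ s) ω)‖ ≤
      ℓ * (lam * (τ₂ - τ₁) + ∫ ω', ‖Z₁ s ω' - Z (reparam lam τ₂ s) ω'‖ ∂P +
        ‖Z₁ s ω - Z (reparam lam τ₂ s) ω‖) := by
  have hl' : lam ∈ Icc (0 : ℝ) 1 := ⟨hlam.1.le, hlam.2.le⟩
  have hmem := Icc_subset_Icc_right hτ₂ (reparam_mem hl' hs)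
  have hsT : s ∈ Icc τ₁ T := ⟨hs.1, hs.2.trans hτ₂⟩
  have h0 : reparam lam τ₂ s ∈ Icc 0 T :=
    Icc_sub_Icc_zero (hτ₁.trans (le_reparam hl' hτ)) hmem
  have := hl.norm_sub_le_of_map hℓ hG (h₁.meas s) (h.meas (reparam lam τ₂ s)) (h₁.bound s hsT)
    (h.bound _ hmem) (Icc_sub_Icc_zero hτ₁ hsT) h0 (u₁ s) hω
  rw [← h₁.law s hsT, ← h.law _ hmem] at this
  rw [← hu s hs]
  refine this.trans ?_
  have := abs_sub_reparam_le hlam.1.le hs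
  gcongr

/-- Up to time `τ₂`, a trajectory that starts at `τ₁` and uses the reparametrised control stays at
distance of order `lam` from the reparametrised trajectory. -/
theorem Lagrangian.norm_sub_reparam_le [IsProbabilityMeasure P] (hG : ∀ᵐ ω ∂P, ω ∈ G)
    (hℓ : 0 ≤ ℓ) (hl : LipschitzVelocity T v R ℓ)
    (hM : ∀ w, ∀ t ∈ Icc 0 T, ∀ μ, ProbOn (ball0 d R) μ → ∀ x ∈ ball0 d R, ‖v t μ w x‖ ≤ M)
    (hlam : lam ∈ Ioo (0 : ℝ) 1) (hτ₁ : 0 ≤ τ₁)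
    (hτ : τ₁ ≤ τ₂) (hτ₂ : τ₂ ≤ T) (h₁ : Lagrangian v u₁ τ₁ T R P G c₁ Z₁)
    (h : Lagrangian v u (reparam lam τ₂ τ₁) T R P G c Z)
    (hu : ∀ s ∈ Icc τ₁ τ₂, u₁ s = u (reparam lam τ₂ s)) (hM0 : 0 ≤ M) {g : Ω → ℝ}
    (hg : Integrable g P)
    (hgZ : ∀ ω ∈ G, ‖Z₁ τ₁ ω - Z (reparam lam τ₂ τ₁) ω‖ +
      (τ₂ - τ₁) * (lam * (M + ℓ * (τ₂ - τ₁))) ≤ g ω) {t : ℝ} (ht : t ∈ Icc τ₁ τ₂) :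
    (∫ ω, ‖Z₁ t ω - Z (reparam lam τ₂ t) ω‖ ∂P ≤ gronwallConst ℓ T * ∫ ω, g ω ∂P) ∧
      ∀ ω ∈ G, ‖Z₁ t ω - Z (reparam lam τ₂ t) ω‖ ≤
        gronwallConst ℓ T * (g ω + ∫ ω', g ω' ∂P) := by
  have hl' : lam ∈ Icc (0 : ℝ) 1 := ⟨hlam.1.le, hlam.2.le⟩
  have hmem : ∀ s ∈ Icc τ₁ τ₂, reparam lam τ₂ s ∈ Icc (reparam lam τ₂ τ₁) T := fun s hs =>
    Icc_subset_Icc_right hτ₂ (reparam_mem hl' hs)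
  have hI : Icc τ₁ τ₂ ⊆ Icc τ₁ T := Icc_subset_Icc_right hτ₂
  have h1I : τ₁ ∈ Icc τ₁ T := left_mem_Icc.2 (hτ.trans hτ₂)
  have hΔ : 0 ≤ τ₂ - τ₁ := sub_nonneg.2 hτ
  have hrc : Continuous (reparam lam τ₂) := by unfold reparam; fun_prop
  have hYc : ∀ ω ∈ G, ContinuousOn (fun t => Z₁ t ω - Z (reparam lam τ₂ t) ω) (Icc τ₁ τ₂) :=
    fun ω hω => by
      have h2 := (h.cont ω hω).comp hrc.continuousOn hmem
      exact ((h₁.cont ω hω).mono hI).sub h2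
  have hY : ∀ ω ∈ G, ∀ t ∈ Icc τ₁ τ₂, (Z₁ t ω - Z (reparam lam τ₂ t) ω) -
      (Z₁ τ₁ ω - Z (reparam lam τ₂ τ₁) ω) = ∫ s in τ₁..t, (v s (c₁ s) (u₁ s) (Z₁ s ω) -
        (1 - lam) • v (reparam lam τ₂ s) (c (reparam lam τ₂ s))
        (u (reparam lam τ₂ s)) (Z (reparam lam τ₂ s) ω)) := fun ω hω t ht => by
    obtain ⟨hi, he⟩ := Lagrangian.sub_eq_of_reparam hlam hτ₂ h hω ht
    have hi' : IntervalIntegrable (fun s => (1 - lam) • v (reparam lam τ₂ s)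
      (c (reparam lam τ₂ s)) (u (reparam lam τ₂ s)) (Z (reparam lam τ₂ s) ω)) volume τ₁ t :=
      hi.smul (1 - lam)
    rw [intervalIntegral.integral_sub (h₁.intervalIntegrable hω h1I (hI ht)) hi',
      intervalIntegral.integral_smul, ← he, ← h₁.ode ω hω τ₁ h1I t (hI ht)]
    abel
  have hF : ∀ ω ∈ G, ∀ᵐ s ∂(volume.restrict (Icc τ₁ τ₂)), ‖v s (c₁ s) (u₁ s) (Z₁ s ω) -
        (1 - lam) • v (reparam lam τ₂ s) (c (reparam lam τ₂ s))
        (u (reparam lam τ₂ s)) (Z (reparam lam τ₂ s) ω)‖ ≤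
      lam * (M + ℓ * (τ₂ - τ₁)) * 1 + ℓ * ((∫ ω', ‖Z₁ s ω' - Z (reparam lam τ₂ s) ω'‖ ∂P) +
        ‖Z₁ s ω - Z (reparam lam τ₂ s) ω‖) := fun ω hω => by
    refine (ae_restrict_iff' measurableSet_Icc).2 (ae_of_all _ fun s hs => ?_)
    have h2 := Lagrangian.norm_velocity_sub_reparam_le hG hℓ hl hlam hτ₁ hτ hτ₂ h₁ h hu hω hs
    have h3 := hM (u (reparam lam τ₂ s)) _
      (Icc_sub_Icc_zero (hτ₁.trans (le_reparam hl' hτ)) (hmem s hs)) _ (h.probOn hG (hmem s hs))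
      (Z (reparam lam τ₂ s) ω) (by simpa using h.bound _ (hmem s hs) ω hω)
    set V := v (reparam lam τ₂ s) (c (reparam lam τ₂ s)) (u (reparam lam τ₂ s))
      (Z (reparam lam τ₂ s) ω)
    set W := v s (c₁ s) (u₁ s) (Z₁ s ω)
    -- The factor `1 - lam` comes from the change of time.
    have h4 : W - (1 - lam) • V = (W - V) + lam • V := by module
    have h5 := norm_add_le (W - V) (lam • V)
    rw [norm_smul, Real.norm_of_nonneg hlam.1.le] at h5
    have h6 := mul_le_mul_of_nonneg_left h3 hlam.1.le
    rw [h4]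
    linarith
  have hll : 0 ≤ lam * (M + ℓ * (τ₂ - τ₁)) := mul_nonneg hlam.1.le (by positivity)
  exact gronwall_mean_of_integral (k := fun _ => lam * (M + ℓ * (τ₂ - τ₁))) (h := fun _ => 1)
    (B := R + R) hG hℓ hτ (by linarith) intervalIntegrable_const (fun _ _ => hll)
    (fun _ _ => zero_le_one) (fun t _ => (h₁.meas t).sub (h.meas _)) hYc
    (fun t ht ω hω => (_root_.norm_sub_le _ _).trans
      (add_le_add (h₁.bound t (hI ht) ω hω) (h.bound _ (hmem t ht) ω hω))) hY hF hg
    (fun ω hω => by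
      rw [intervalIntegral.integral_const, smul_eq_mul, mul_one]
      exact hgZ ω hω) t ht

/-- The second order estimate at time `τ₂`: the terms of first order in `lam` cancel, as the initial
point of `Z` is the corresponding convex combination. -/
theorem Lagrangian.norm_displacement_sub_reparam_le [IsProbabilityMeasure P]
    (hG : ∀ᵐ ω ∂P, ω ∈ G)
    (hℓ : 0 ≤ ℓ) (hl : LipschitzVelocity T v R ℓ) (hlam : lam ∈ Ioo (0 : ℝ) 1) (hτ₁ : 0 ≤ τ₁)
    (hτ : τ₁ ≤ τ₂) (hτ₂ : τ₂ ≤ T) (h₁ : Lagrangian v u₁ τ₁ T R P G c₁ Z₁)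
    (h : Lagrangian v u (reparam lam τ₂ τ₁) T R P G c Z)
    (hu : ∀ s ∈ Icc τ₁ τ₂, u₁ s = u (reparam lam τ₂ s)) {ω : Ω} (hω : ω ∈ G) {N : ℝ}
    (hN : ∀ s ∈ Icc τ₁ τ₂, ∫ ω', ‖Z₁ s ω' - Z (reparam lam τ₂ s) ω'‖ ∂P +
        ‖Z₁ s ω - Z (reparam lam τ₂ s) ω‖ ≤ N) :
    ‖(1 - lam) • (Z₁ τ₂ ω - Z₁ τ₁ ω) - (Z τ₂ ω - Z (reparam lam τ₂ τ₁) ω)‖ ≤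
      (1 - lam) * (ℓ * (lam * (τ₂ - τ₁) + N) * (τ₂ - τ₁)) := by
  have hτI : τ₂ ∈ Icc τ₁ τ₂ := right_mem_Icc.2 hτ
  obtain ⟨hi, he⟩ := Lagrangian.sub_eq_of_reparam hlam hτ₂ h hω hτI
  have h1I : τ₁ ∈ Icc τ₁ T := left_mem_Icc.2 (hτ.trans hτ₂)
  have h2I : τ₂ ∈ Icc τ₁ T := ⟨hτ, hτ₂⟩
  rw [reparam_self] at he
  rw [he, h₁.ode ω hω τ₁ h1I τ₂ h2I, ← smul_sub,
    ← intervalIntegral.integral_sub (h₁.intervalIntegrable hω h1I h2I) hi, norm_smul,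
    Real.norm_of_nonneg (by linarith [hlam.2])]
  refine mul_le_mul_of_nonneg_left ?_ (by linarith [hlam.2])
  have hb := intervalIntegral.norm_integral_le_of_norm_le_const (a := τ₁) (b := τ₂)
    (f := fun s => v s (c₁ s) (u₁ s) (Z₁ s ω) - v (reparam lam τ₂ s) (c (reparam lam τ₂ s))
        (u (reparam lam τ₂ s)) (Z (reparam lam τ₂ s) ω))
    (C := ℓ * (lam * (τ₂ - τ₁) + N)) fun s hs => by
      rw [uIoc_of_le hτ] at hs
      have hs' : s ∈ Icc τ₁ τ₂ := ⟨hs.1.le, hs.2⟩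
      refine (Lagrangian.norm_velocity_sub_reparam_le hG hℓ hl hlam hτ₁ hτ hτ₂ h₁ h hu hω
        hs').trans ?_
      rw [add_assoc]
      have := hN s hs'
      gcongr
  rwa [abs_of_nonneg (sub_nonneg.2 hτ)] at hb

end Lagrangian

end WassersteinControl

/-! ### Semiconcavity of the final cost along trajectories -/

namespace WassersteinControl

variable {d : ℕ} {U : Type*}

/-- The quantity `|x - y| + W_{2,γ} + Δ` which controls, up to constants, the distance of the
trajectories issued from `x` and `y` with initial times at distance `Δ`. -/
noncomputable def planGap (γ : Measure (E d × E d)) (Δ : ℝ) (z : E d × E d) : ℝ :=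
  ‖z.1 - z.2‖ + wassPlan γ + Δ

theorem wassPlan_nonneg (γ : Measure (E d × E d)) : 0 ≤ wassPlan γ := Real.sqrt_nonneg _

section PlanGap

variable {γ : Measure (E d × E d)} [IsProbabilityMeasure γ] {r : ℝ}

theorem integrable_of_continuous_of_ae_norm_le (hγ : ∀ᵐ z ∂γ, ‖z.1‖ ≤ r ∧ ‖z.2‖ ≤ r)
    {f : E d × E d → ℝ} (hf : Continuous f) : Integrable f γ := by
  obtain ⟨C, hC⟩ := ((isCompact_closedBall (0 : E d) r).prod
    (isCompact_closedBall (0 : E d) r)).exists_bound_of_continuousOn hf.continuousOn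
  refine integrable_of_ae_norm_le hf.aestronglyMeasurable (C := C) ?_
  filter_upwards [hγ] with z hz
  exact hC z ⟨by simpa using hz.1, by simpa using hz.2⟩

theorem integral_norm_sub_le_wassPlan (hγ : ∀ᵐ z ∂γ, ‖z.1‖ ≤ r ∧ ‖z.2‖ ≤ r) :
    ∫ z, ‖z.1 - z.2‖ ∂γ ≤ wassPlan γ :=
  (le_abs_self _).trans (Real.abs_le_sqrt (sq_integral_le
    (integrable_of_continuous_of_ae_norm_le hγ (by fun_prop))
    (integrable_of_continuous_of_ae_norm_le hγ (by fun_prop))))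

theorem integral_planGap_sq_le (hγ : ∀ᵐ z ∂γ, ‖z.1‖ ≤ r ∧ ‖z.2‖ ≤ r) (Δ : ℝ) :
    ∫ z, planGap γ Δ z ^ 2 ∂γ ≤ 6 * (Δ ^ 2 + wassPlan γ ^ 2) := by
  have h1 : ∫ z, planGap γ Δ z ^ 2 ∂γ ≤
      ∫ z, (3 * ‖z.1 - z.2‖ ^ 2 + (3 * wassPlan γ ^ 2 + 3 * Δ ^ 2)) ∂γ := by
    refine integral_mono
      (integrable_of_continuous_of_ae_norm_le hγ (by unfold planGap; fun_prop))
      (integrable_of_continuous_of_ae_norm_le hγ (by fun_prop)) fun z => ?_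
    change (‖z.1 - z.2‖ + wassPlan γ + Δ) ^ 2 ≤ _
    nlinarith [sq_nonneg (‖z.1 - z.2‖ - wassPlan γ), sq_nonneg (‖z.1 - z.2‖ - Δ),
      sq_nonneg (wassPlan γ - Δ)]
  rw [integral_add (integrable_of_continuous_of_ae_norm_le hγ (by fun_prop))
    (integrable_const _), integral_const_mul, ← wassPlan_sq, integral_const, probReal_univ,
    one_smul] at h1
  linarith [sq_nonneg Δ]

end PlanGap

/-- Three trajectories on the probability space `(ℝ^d × ℝ^d, γ)`: `Z₁` starts from `x` at time `τ₁`,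
`Z₂` from `y` at time `τ₂`, and `Z` from `(1 - lam) x + lam y` at time `(1 - lam) τ₁ + lam τ₂`.
The control of `Z` and `Z₂` is `u`. That of `Z₁` is the reparametrisation of `u` up to time `τ₂`,
and `u` afterwards. -/
structure CoupledTrajectories (v : ℝ → Measure (E d) → U → E d → E d) (u u₁ : ℝ → U)
    (τ₁ τ₂ lam T R : ℝ) (γ : Measure (E d × E d)) (G : Set (E d × E d))
    (c₁ c₂ c : ℝ → Measure (E d)) (Z₁ Z₂ Z : ℝ → E d × E d → E d) : Prop where
  lag₁ : Lagrangian v u₁ τ₁ T R γ G c₁ Z₁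
  lag₂ : Lagrangian v u τ₂ T R γ G c₂ Z₂
  lag : Lagrangian v u (reparam lam τ₂ τ₁) T R γ G c Z
  init₁ : ∀ z ∈ G, Z₁ τ₁ z = z.1
  init₂ : ∀ z ∈ G, Z₂ τ₂ z = z.2
  init : ∀ z ∈ G, Z (reparam lam τ₂ τ₁) z = (1 - lam) • z.1 + lam • z.2
  before : ∀ s ∈ Icc τ₁ τ₂, u₁ s = u (reparam lam τ₂ s)
  after : ∀ s ∈ Icc τ₂ T, u₁ s = u s
  pos : lam ∈ Ioo (0 : ℝ) 1
  nonneg : 0 ≤ τ₁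
  le : τ₁ ≤ τ₂
  le_T : τ₂ ≤ T

section Coupled

variable {v : ℝ → Measure (E d) → U → E d → E d} {u u₁ : ℝ → U} {τ₁ τ₂ lam T R ℓ M r : ℝ}
  {γ : Measure (E d × E d)} {G : Set (E d × E d)}
  {c₁ c₂ c : ℝ → Measure (E d)} {Z₁ Z₂ Z : ℝ → E d × E d → E d}

theorem CoupledTrajectories.gap_nonneg
    (h : CoupledTrajectories v u u₁ τ₁ τ₂ lam T R γ G c₁ c₂ c Z₁ Z₂ Z) (z : E d × E d) :
    0 ≤ planGap γ (τ₂ - τ₁) z := by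
  have := wassPlan_nonneg γ
  have := sub_nonneg.2 h.le
  unfold planGap
  positivity

variable [IsProbabilityMeasure γ]

/-- Before time `τ₂`, the trajectories `Z₁` and `Z` are at distance of order `lam`, up to the
reparametrisation of time. -/
theorem CoupledTrajectories.first_order (hG : ∀ᵐ z ∂γ, z ∈ G)
    (hγ : ∀ᵐ z ∂γ, ‖z.1‖ ≤ r ∧ ‖z.2‖ ≤ r) (hℓ : 0 ≤ ℓ) (hl : LipschitzVelocity T v R ℓ)
    (hM : ∀ w, ∀ t ∈ Icc 0 T, ∀ μ, ProbOn (ball0 d R) μ → ∀ x ∈ ball0 d R, ‖v t μ w x‖ ≤ M)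
    (hM0 : 0 ≤ M) (h : CoupledTrajectories v u u₁ τ₁ τ₂ lam T R γ G c₁ c₂ c Z₁ Z₂ Z)
    {t : ℝ} (ht : t ∈ Icc τ₁ τ₂) {z : E d × E d} (hz : z ∈ G) :
    ∫ z', ‖Z₁ t z' - Z (reparam lam τ₂ t) z'‖ ∂γ + ‖Z₁ t z - Z (reparam lam τ₂ t) z‖ ≤
      lam * (3 * gronwallConst ℓ T * (1 + M + ℓ * T)) * planGap γ (τ₂ - τ₁) z := by
  have hΔ := sub_nonneg.2 h.le
  have hΔT : τ₂ - τ₁ ≤ T := by linarith [h.nonneg, h.le_T]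
  have hT : 0 ≤ T := hΔ.trans hΔT
  have hlam := h.pos.1.le
  set κ := 1 + M + ℓ * T with hκ
  set Δ := τ₂ - τ₁ with hΔ'
  have hκ0 : 0 ≤ κ := by positivity
  have hg1 : 0 ≤ gronwallConst ℓ T := zero_le_one.trans (one_le_gronwallConst hℓ hT)
  have hi := integrable_of_continuous_of_ae_norm_le hγ
    (f := fun z : E d × E d => ‖z.1 - z.2‖) (by fun_prop)
  have hgi : ∫ z : E d × E d, lam * κ * (‖z.1 - z.2‖ + Δ) ∂γ ≤ lam * κ * (wassPlan γ + Δ) := by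
    rw [integral_const_mul, integral_add hi (integrable_const _), integral_const, probReal_univ,
      one_smul]
    have := integral_norm_sub_le_wassPlan hγ
    gcongr
  have hest := Lagrangian.norm_sub_reparam_le (g := fun z => lam * κ * (‖z.1 - z.2‖ + Δ))
    hG hℓ hl hM h.pos h.nonneg h.le h.le_T
    h.lag₁ h.lag h.before hM0 ((hi.add (integrable_const _)).const_mul _) (fun z hz => ?_) ht
  · have h1 := hest.1
    have h2 := hest.2 z hz
    have h3 := mul_le_mul_of_nonneg_left hgi hg1
    have hw := wassPlan_nonneg γ
    have h4 : 0 ≤ gronwallConst ℓ T * (lam * κ) := by positivity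
    have h5 : 2 * wassPlan γ + 3 * Δ + ‖z.1 - z.2‖ ≤ 3 * planGap γ Δ z := by
      unfold planGap
      linarith [norm_nonneg (z.1 - z.2)]
    have h6 := mul_le_mul_of_nonneg_left h5 h4
    linarith
  · rw [h.init₁ z hz, h.init z hz]
    have e : z.1 - ((1 - lam) • z.1 + lam • z.2) = lam • (z.1 - z.2) := by module
    rw [e, norm_smul, Real.norm_of_nonneg hlam]
    have h1 : ‖z.1 - z.2‖ ≤ κ * ‖z.1 - z.2‖ := by
      refine le_mul_of_one_le_left (norm_nonneg _) ?_
      have : 0 ≤ ℓ * T := by positivity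
      linarith
    have h2 : M + ℓ * Δ ≤ κ := by
      have := mul_le_mul_of_nonneg_left hΔT hℓ
      linarith
    have h3 := mul_le_mul_of_nonneg_left h1 hlam
    have h4 := mul_le_mul_of_nonneg_left h2 (mul_nonneg hlam hΔ)
    linarith

/-- At time `τ₂`, the trajectory `Z` is a convex combination of `Z₁` and `Z₂` up to an error with
the factor `lam (1 - lam)`. -/
theorem CoupledTrajectories.second_order (hG : ∀ᵐ z ∂γ, z ∈ G)
    (hγ : ∀ᵐ z ∂γ, ‖z.1‖ ≤ r ∧ ‖z.2‖ ≤ r) (hℓ : 0 ≤ ℓ) (hl : LipschitzVelocity T v R ℓ)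
    (hM : ∀ w, ∀ t ∈ Icc 0 T, ∀ μ, ProbOn (ball0 d R) μ → ∀ x ∈ ball0 d R, ‖v t μ w x‖ ≤ M)
    (hM0 : 0 ≤ M) (h : CoupledTrajectories v u u₁ τ₁ τ₂ lam T R γ G c₁ c₂ c Z₁ Z₂ Z)
    {z : E d × E d} (hz : z ∈ G) :
    ‖(1 - lam) • Z₁ τ₂ z + lam • Z₂ τ₂ z - Z τ₂ z‖ ≤
      lam * (1 - lam) * (ℓ * (1 + 3 * gronwallConst ℓ T * (1 + M + ℓ * T))) *
        planGap γ (τ₂ - τ₁) z ^ 2 := by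
  have hΔ := sub_nonneg.2 h.le
  have h1 := Lagrangian.norm_displacement_sub_reparam_le hG hℓ hl h.pos h.nonneg h.le h.le_T
    h.lag₁ h.lag h.before hz fun s hs => h.first_order hG hγ hℓ hl hM hM0 hs hz
  rw [h.init₁ z hz, h.init z hz] at h1
  rw [h.init₂ z hz]
  have e : (1 - lam) • Z₁ τ₂ z + lam • z.2 - Z τ₂ z =
      (1 - lam) • (Z₁ τ₂ z - z.1) - (Z τ₂ z - ((1 - lam) • z.1 + lam • z.2)) := by module
  rw [e]
  refine h1.trans ?_
  have hT : 0 ≤ T := h.nonneg.trans (h.le.trans h.le_T)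
  have hlam := h.pos.1.le
  have hlam' : 0 ≤ 1 - lam := by linarith [h.pos.2]
  have hg1 : 0 ≤ gronwallConst ℓ T := zero_le_one.trans (one_le_gronwallConst hℓ hT)
  set A := 3 * gronwallConst ℓ T * (1 + M + ℓ * T) with hA
  have hA0 : 0 ≤ A := by positivity
  have hQ0 := h.gap_nonneg z
  have hΔQ : τ₂ - τ₁ ≤ planGap γ (τ₂ - τ₁) z := by
    have := wassPlan_nonneg γ
    unfold planGap
    linarith [norm_nonneg (z.1 - z.2)]
  generalize planGap γ (τ₂ - τ₁) z = Q at *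
  calc (1 - lam) * (ℓ * (lam * (τ₂ - τ₁) + lam * A * Q) * (τ₂ - τ₁))
      ≤ (1 - lam) * (ℓ * (lam * Q + lam * A * Q) * Q) := by gcongr
    _ = _ := by ring

/-- After time `τ₂`, the outer trajectories use the same control and stay at a distance controlled by
their distance at time `τ₂`. -/
theorem CoupledTrajectories.norm_sub_le (hG : ∀ᵐ z ∂γ, z ∈ G)
    (hγ : ∀ᵐ z ∂γ, ‖z.1‖ ≤ r ∧ ‖z.2‖ ≤ r) (hℓ : 0 ≤ ℓ) (hl : LipschitzVelocity T v R ℓ)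
    (hM : ∀ w, ∀ t ∈ Icc 0 T, ∀ μ, ProbOn (ball0 d R) μ → ∀ x ∈ ball0 d R, ‖v t μ w x‖ ≤ M)
    (hM0 : 0 ≤ M) (h : CoupledTrajectories v u u₁ τ₁ τ₂ lam T R γ G c₁ c₂ c Z₁ Z₂ Z)
    {t : ℝ} (ht : t ∈ Icc τ₂ T) {z : E d × E d} (hz : z ∈ G) :
    ‖Z₁ t z - Z₂ t z‖ ≤ 2 * gronwallConst ℓ T * (1 + M) * planGap γ (τ₂ - τ₁) z := by
  have hΔ := sub_nonneg.2 h.le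
  have hT : 0 ≤ T := h.nonneg.trans (h.le.trans h.le_T)
  have hg1 : 0 ≤ gronwallConst ℓ T := zero_le_one.trans (one_le_gronwallConst hℓ hT)
  have h1I : τ₁ ∈ Icc τ₁ T := left_mem_Icc.2 (h.le.trans h.le_T)
  have h2I : τ₂ ∈ Icc τ₁ T := ⟨h.le, h.le_T⟩
  set Δ := τ₂ - τ₁ with hΔ'
  have hi := integrable_of_continuous_of_ae_norm_le hγ
    (f := fun z : E d × E d => ‖z.1 - z.2‖) (by fun_prop)
  have hgi : ∫ z : E d × E d, (1 + M) * (‖z.1 - z.2‖ + Δ) ∂γ ≤ (1 + M) * (wassPlan γ + Δ) := by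
    rw [integral_const_mul, integral_add hi (integrable_const _), integral_const, probReal_univ,
      one_smul]
    have := integral_norm_sub_le_wassPlan hγ
    gcongr
  have hest := Lagrangian.norm_sub_le (g := fun z => (1 + M) * (‖z.1 - z.2‖ + Δ)) hG hℓ hl
    (a := τ₂) ⟨h.nonneg.trans h.le, h.le_T⟩ (h.lag₁.restrict h2I h.after) h.lag₂
    ((hi.add (integrable_const _)).const_mul _) (fun z hz => ?_) t ht z hz
  · have h3 := mul_le_mul_of_nonneg_left hgi hg1
    have hw := wassPlan_nonneg γ
    have h5 : wassPlan γ + 2 * Δ + ‖z.1 - z.2‖ ≤ 2 * planGap γ Δ z := by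
      unfold planGap
      linarith [norm_nonneg (z.1 - z.2)]
    have h6 := mul_le_mul_of_nonneg_left h5 (by positivity : 0 ≤ gronwallConst ℓ T * (1 + M))
    linarith
  · have h3 : ‖Z₁ τ₂ z - Z₁ τ₁ z‖ ≤ M * Δ := by
      rw [h.lag₁.ode z hz τ₁ h1I τ₂ h2I]
      have := intervalIntegral.norm_integral_le_of_norm_le_const (a := τ₁) (b := τ₂) (C := M)
        (f := fun s => v s (c₁ s) (u₁ s) (Z₁ s z)) fun s hs => by
          rw [uIoc_of_le h.le] at hs
          have hs' : s ∈ Icc τ₁ T := ⟨hs.1.le, hs.2.trans h.le_T⟩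
          exact hM _ s (Icc_sub_Icc_zero h.nonneg hs') _ (h.lag₁.probOn hG hs') _
            (by simpa using h.lag₁.bound s hs' z hz)
      rwa [abs_of_nonneg hΔ] at this
    rw [h.init₁ z hz] at h3
    rw [h.init₂ z hz]
    have h4 := norm_sub_le_norm_sub_add_norm_sub (Z₁ τ₂ z) z.1 z.2
    have h5 : 0 ≤ M * ‖z.1 - z.2‖ := by positivity
    linarith

/-- Along coupled trajectories, the squared distance of the two outer ones is controlled by the
initial data, and the middle one is a convex combination of them up to an error with the
factor `lam (1 - lam)`. -/
theorem CoupledTrajectories.estimate (hG : ∀ᵐ z ∂γ, z ∈ G)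
    (hγ : ∀ᵐ z ∂γ, ‖z.1‖ ≤ r ∧ ‖z.2‖ ≤ r) (hℓ : 0 ≤ ℓ) (hl : LipschitzVelocity T v R ℓ)
    (hM : ∀ w, ∀ t ∈ Icc 0 T, ∀ μ, ProbOn (ball0 d R) μ → ∀ x ∈ ball0 d R, ‖v t μ w x‖ ≤ M)
    (hM0 : 0 ≤ M) {C : ℝ → ℝ} (hC : IsL1Pos T C) (hsc : StrongVelocitySC T v R C)
    (h : CoupledTrajectories v u u₁ τ₁ τ₂ lam T R γ G c₁ c₂ c Z₁ Z₂ Z) :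
    ∫ z, ‖Z₁ T z - Z₂ T z‖ ^ 2 ∂γ ≤ (2 * gronwallConst ℓ T * (1 + M)) ^ 2 *
      (6 * ((τ₂ - τ₁) ^ 2 + wassPlan γ ^ 2)) ∧
    ∫ z, ‖(1 - lam) • Z₁ T z + lam • Z₂ T z - Z T z‖ ∂γ ≤
      gronwallConst ℓ T * (ℓ * (1 + 3 * gronwallConst ℓ T * (1 + M + ℓ * T)) +
        2 * (∫ s in (0)..T, C s) * (2 * gronwallConst ℓ T * (1 + M)) ^ 2) * (lam * (1 - lam)) *
        (6 * ((τ₂ - τ₁) ^ 2 + wassPlan γ ^ 2)) := by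
  have hτ₂ : τ₂ ∈ Icc 0 T := ⟨h.nonneg.trans h.le, h.le_T⟩
  have hT : 0 ≤ T := hτ₂.1.trans hτ₂.2
  have h2I : τ₂ ∈ Icc τ₁ T := ⟨h.le, h.le_T⟩
  have hTI : T ∈ Icc τ₂ T := right_mem_Icc.2 h.le_T
  have hlam : lam ∈ Icc (0 : ℝ) 1 := ⟨h.pos.1.le, h.pos.2.le⟩
  have hll : 0 ≤ lam * (1 - lam) := mul_nonneg hlam.1 (by linarith [hlam.2])
  have hg1 : 0 ≤ gronwallConst ℓ T := zero_le_one.trans (one_le_gronwallConst hℓ hT)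
  have hI : 0 ≤ ∫ s in (0)..T, C s := intervalIntegral.integral_nonneg hT hC.2
  have hA := fun t ht z hz => h.norm_sub_le hG hγ hℓ hl hM hM0 (t := t) ht (z := z) hz
  have hS := fun z hz => h.second_order hG hγ hℓ hl hM hM0 (z := z) hz
  have hQi : Integrable (fun z => planGap γ (τ₂ - τ₁) z ^ 2) γ :=
    integrable_of_continuous_of_ae_norm_le hγ (by unfold planGap; fun_prop)
  have hQ := integral_planGap_sq_le hγ (τ₂ - τ₁)
  have hQ0 := h.gap_nonneg
  set K₁ := ℓ * (1 + 3 * gronwallConst ℓ T * (1 + M + ℓ * T)) with hK₁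
  set K₂ := 2 * gronwallConst ℓ T * (1 + M) with hK₂
  set I := ∫ s in (0)..T, C s with hI'
  set Q := planGap γ (τ₂ - τ₁) with hQ'
  have hK₁0 : 0 ≤ K₁ := by positivity
  have hA2 : ∀ t ∈ Icc τ₂ T, ∀ z ∈ G, ‖Z₁ t z - Z₂ t z‖ ^ 2 ≤ K₂ ^ 2 * Q z ^ 2 :=
    fun t ht z hz => by
      rw [← mul_pow]
      exact pow_le_pow_left₀ (norm_nonneg _) (hA t ht z hz) 2
  have hAi : ∀ t ∈ Icc τ₂ T, ∫ z, ‖Z₁ t z - Z₂ t z‖ ^ 2 ∂γ ≤ K₂ ^ 2 * ∫ z, Q z ^ 2 ∂γ :=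
    fun t ht => by
      rw [← integral_const_mul]
      refine integral_mono_of_nonneg (ae_of_all _ fun z => sq_nonneg _) (hQi.const_mul _) ?_
      filter_upwards [hG] with z hz using hA2 t ht z hz
  have hQI0 : 0 ≤ ∫ z, Q z ^ 2 ∂γ := integral_nonneg fun z => sq_nonneg _
  refine ⟨(hAi T hTI).trans (by gcongr), ?_⟩
  -- From time `τ₂` on, all three trajectories use the same control; the second order error at time
  -- `τ₂` is the initial term of the Grönwall estimate.
  have h1 := Lagrangian.integral_norm_convexComb_sub_le (a := τ₂)
    (H := fun z => K₂ ^ 2 * Q z ^ 2 + K₂ ^ 2 * ∫ z', Q z' ^ 2 ∂γ)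
    (g := fun z => lam * (1 - lam) * K₁ * Q z ^ 2 +
      I * (lam * (1 - lam) * (K₂ ^ 2 * Q z ^ 2 + K₂ ^ 2 * ∫ z', Q z' ^ 2 ∂γ))) hG hℓ hl hτ₂ hC
    hsc (h.lag₁.restrict h2I h.after) h.lag₂
    (h.lag.restrict ⟨(reparam_mem hlam (left_mem_Icc.2 h.le)).2, h.le_T⟩ fun _ _ => rfl) hlam
    (fun z _ => by positivity) (fun t ht z hz => add_le_add (hA2 t ht z hz) (hAi t ht))
    ((hQi.const_mul _).add ((((hQi.const_mul _).add (integrable_const _)).const_mul _).const_mul _))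
    (fun z hz => by linarith [hS z hz]) hTI
  have h2 : ∫ z, (lam * (1 - lam) * K₁ * Q z ^ 2 +
      I * (lam * (1 - lam) * (K₂ ^ 2 * Q z ^ 2 + K₂ ^ 2 * ∫ z', Q z' ^ 2 ∂γ))) ∂γ =
      (K₁ + 2 * I * K₂ ^ 2) * (lam * (1 - lam)) * ∫ z, Q z ^ 2 ∂γ := by
    have hJ : Integrable (fun z => K₂ ^ 2 * Q z ^ 2 + K₂ ^ 2 * ∫ z', Q z' ^ 2 ∂γ) γ :=
      (hQi.const_mul _).add (integrable_const _)
    rw [integral_add (hQi.const_mul _) ((hJ.const_mul _).const_mul _),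
      integral_const_mul, integral_const_mul, integral_const_mul, integral_add
      (hQi.const_mul _) (integrable_const _), integral_const_mul, integral_const, probReal_univ,
      one_smul]
    ring
  rw [h2] at h1
  refine h1.trans ?_
  rw [← mul_assoc, ← mul_assoc]
  gcongr

end Coupled

end WassersteinControl

/-! ### The value function -/

namespace WassersteinControl

variable {d : ℕ} {U : Type*}

theorem IsTrajectory.congr_control {T τ : ℝ} {v : ℝ → Measure (E d) → U → E d → E d}
    {u u' : ℝ → U} (hτ : 0 ≤ τ) (hτT : τ ≤ T) (hu : u =ᵐ[volume.restrict (Icc 0 T)] u')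
    {μ : Measure (E d)} {c : ℝ → Measure (E d)} (h : IsTrajectory T v u τ μ c) :
    IsTrajectory T v u' τ μ c := by
  refine ⟨h.1, h.2.1, h.2.2.1, fun ξ hξ hξc hξs => ?_⟩
  rw [← h.2.2.2 ξ hξ hξc hξs]
  refine intervalIntegral.integral_congr_ae ?_
  filter_upwards [(ae_restrict_iff' measurableSet_Icc).1 hu] with t ht htI
  rw [uIoc_of_le hτT] at htI
  rw [ht ⟨hτ.trans htI.1.le, htI.2⟩]

/-- A radius of a ball which contains all trajectories that start in `B(0,r)`. -/
noncomputable def reachRadius (m T r : ℝ) : ℝ := gronwallConst m T * (2 * (1 + r))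

theorem le_reachRadius {m T r : ℝ} (hm : 0 ≤ m) (hT : 0 ≤ T) (hr : 0 ≤ r) :
    r ≤ reachRadius m T r := by
  have := one_le_gronwallConst hm hT
  unfold reachRadius
  nlinarith

theorem interp_map_swap (γ : Measure (E d × E d)) (lam : ℝ) :
    interp (γ.map Prod.swap) (1 - lam) = interp γ lam := by
  rw [interp, interp, Measure.map_map (measurable_interp _) measurable_swap]
  congr 1
  ext z : 1
  simp only [Function.comp, Prod.fst_swap, Prod.snd_swap, sub_sub_cancel]
  exact add_comm _ _

theorem wassPlan_map_swap (γ : Measure (E d × E d)) : wassPlan (γ.map Prod.swap) = wassPlan γ := by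
  rw [wassPlan, wassPlan, integral_map measurable_swap.aemeasurable
    (Continuous.aestronglyMeasurable (by fun_prop))]
  simp only [Prod.fst_swap, Prod.snd_swap, norm_sub_rev]

theorem map_swap_mem_plans {μ ν : Measure (E d)} {γ : Measure (E d × E d)} (h : γ ∈ plans μ ν) :
    γ.map Prod.swap ∈ plans ν μ :=
  ⟨by rw [Measure.map_map measurable_fst measurable_swap]; exact h.2,
    by rw [Measure.map_map measurable_snd measurable_swap]; exact h.1⟩

section Value

variable [TopologicalSpace U] [MeasurableSpace U] [BorelSpace U] [SecondCountableTopology U]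
  [TopologicalSpace.PseudoMetrizableSpace U] {T m : ℝ}
  {v : ℝ → Measure (E d) → U → E d → E d} {φ : Measure (E d) → ℝ}

/-- Every measurable control has an admissible trajectory, which is carried by a flow in the ball of
radius `reachRadius m T r`. -/
theorem exists_flow_reachRadius (hv : RegularVelocity T v m) (hm : 0 ≤ m) {τ r : ℝ} (hτ : 0 ≤ τ)
    (hτT : τ ≤ T) (hr : 0 < r) {u : ℝ → U} (hu : Measurable u) {μ : Measure (E d)}
    (hμ : ProbOn (ball0 d r) μ) :
    ∃ (c : ℝ → Measure (E d)) (X : ℝ → E d → E d),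
      IsFlow T v u τ r (reachRadius m T r) μ c X ∧ φ (c T) ∈ admissibleCosts T v φ τ μ := by
  obtain ⟨c, X, R, hR, h⟩ := exists_flow hv hm hτ hτT hr hu hμ
  exact ⟨c, X, ⟨h.cont, h.norm_le hv hm hr.le hτ hμ, h.ode, h.law⟩, u, c, hu.aemeasurable,
    h.isTrajectory hv hm hR hτ hτT hu hμ, rfl⟩

/-- Every admissible cost is the cost of a flow. The control may be taken Borel measurable, since
controls that agree almost everywhere have the same trajectories. -/
theorem exists_flow_of_mem_admissibleCosts (hv : RegularVelocity T v m) (hm : 0 ≤ m) {τ r : ℝ}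
    (hτ : 0 ≤ τ) (hτT : τ ≤ T) (hr : 0 < r) {μ : Measure (E d)} (hμ : ProbOn (ball0 d r) μ)
    {ρ : ℝ} (hρ : ρ ∈ admissibleCosts T v φ τ μ) :
    ∃ (u : ℝ → U) (c : ℝ → Measure (E d)) (X : ℝ → E d → E d), Measurable u ∧
      IsFlow T v u τ r (reachRadius m T r) μ c X ∧ ρ = φ (c T) := by
  obtain ⟨u, c, hu, hc, rfl⟩ := hρ
  obtain ⟨X, R, -, h⟩ := (hc.congr_control hτ hτT hu.ae_eq_mk).exists_isFlow hv hm hτ hτT hr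
    hu.measurable_mk hμ
  exact ⟨_, c, X, hu.measurable_mk, ⟨h.cont, h.norm_le hv hm hr.le hτ hμ, h.ode, h.law⟩, rfl⟩

theorem admissibleCosts_nonempty [Nonempty U] (hv : RegularVelocity T v m) (hm : 0 ≤ m) {τ r : ℝ}
    (hτ : 0 ≤ τ) (hτT : τ ≤ T) (hr : 0 < r) {μ : Measure (E d)} (hμ : ProbOn (ball0 d r) μ) :
    (admissibleCosts T v φ τ μ).Nonempty := by
  obtain ⟨c, -, -, h⟩ := exists_flow_reachRadius (φ := φ) hv hm hτ hτT hr
    (measurable_const (a := Classical.arbitrary U)) hμ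
  exact ⟨_, h⟩

theorem admissibleCosts_bddBelow (hv : RegularVelocity T v m) (hm : 0 ≤ m) (hφ : CostOCP φ)
    {τ r : ℝ} (hτ : 0 ≤ τ) (hτT : τ ≤ T) (hr : 0 < r) {μ : Measure (E d)}
    (hμ : ProbOn (ball0 d r) μ) : BddBelow (admissibleCosts T v φ τ μ) := by
  have hrR := le_reachRadius hm (hτ.trans hτT) hr.le
  obtain ⟨L, hL, hLip⟩ := hφ.1 _ (hr.trans_le hrR)
  have hμR := hμ.mono_radius hrR
  refine ⟨φ μ - L * (2 * reachRadius m T r), fun ρ hρ => ?_⟩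
  obtain ⟨u, c, X, hu, h, rfl⟩ := exists_flow_of_mem_admissibleCosts hv hm hτ hτT hr hμ hρ
  have hcT := (h.measureCurve hμ).probOn T (right_mem_Icc.2 hτT)
  have h1 := (le_abs_self _).trans (hLip _ _ hμR hcT)
  have h2 := mul_le_mul_of_nonneg_left (wass_one_le_of_probOn hμR hcT) hL
  linarith

/-- The semiconcavity inequality for the value function when the first of the two trajectories
starts earlier: an admissible trajectory for the intermediate initial datum yields competitors for
the two outer ones. -/
theorem exists_value_convexComb_le (hT : 0 < T) (hv : RegularVelocity T v m) (hm : 0 ≤ m)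
    (hφ : CostOCP φ) (hφs : StrongSemiconcave φ)
    (hsc : ∀ R > 0, ∃ C, IsL1Pos T C ∧ StrongVelocitySC T v R C) {r : ℝ} (hr : 0 < r) :
    ∃ K > 0, ∀ τ₁ τ₂, 0 ≤ τ₁ → τ₁ ≤ τ₂ → τ₂ ≤ T → ∀ μ₁ μ₂, ProbOn (ball0 d r) μ₁ →
      ProbOn (ball0 d r) μ₂ → ∀ γ ∈ plans μ₁ μ₂, ∀ lam ∈ Ioo (0 : ℝ) 1,
      ∀ ρ ∈ admissibleCosts T v φ (reparam lam τ₂ τ₁) (interp γ lam),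
        (1 - lam) * value T v φ τ₁ μ₁ + lam * value T v φ τ₂ μ₂ - ρ ≤
          K * (lam * (1 - lam)) * ((τ₂ - τ₁) ^ 2 + wassPlan γ ^ 2) := by
  have hrR := le_reachRadius hm hT.le hr.le
  set R := reachRadius m T r with hR
  have hR0 : 0 < R := hr.trans_le hrR
  obtain ⟨ℓ, hℓ, hl⟩ := hv.lip R hR0
  obtain ⟨C, hC, hsc⟩ := hsc R hR0
  obtain ⟨L, hL, hLip⟩ := hφ.1 R hR0
  obtain ⟨Cφ, hCφ, hφs⟩ := hφs R hR0
  set M := m * (1 + R + R) with hM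
  have hM0 : 0 ≤ M := by positivity
  have hvM : ∀ w, ∀ t ∈ Icc 0 T, ∀ μ, ProbOn (ball0 d R) μ → ∀ x ∈ ball0 d R, ‖v t μ w x‖ ≤ M := by
    intro w t ht μ hμ x hx
    refine (hv.growth w t ht μ hμ.isPc x).trans ?_
    have := hμ.moment1_le
    have : ‖x‖ ≤ R := by simpa using hx
    exact mul_le_mul_of_nonneg_left (by linarith) hm
  have hg1 : 0 ≤ gronwallConst ℓ T := zero_le_one.trans (one_le_gronwallConst hℓ.le hT.le)
  have hI : 0 ≤ ∫ s in (0)..T, C s := intervalIntegral.integral_nonneg hT.le hC.2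
  set K₁ := (2 * gronwallConst ℓ T * (1 + M)) ^ 2 with hK₁
  set K₂ := gronwallConst ℓ T * (ℓ * (1 + 3 * gronwallConst ℓ T * (1 + M + ℓ * T)) +
        2 * (∫ s in (0)..T, C s) * (2 * gronwallConst ℓ T * (1 + M)) ^ 2) with hK₂
  have hK₂0 : 0 ≤ K₂ := by positivity
  refine ⟨Cφ * (K₁ * 6) + L * (K₂ * 6) + 1, by positivity, ?_⟩
  intro τ₁ τ₂ hτ₁ hτ hτ₂ μ₁ μ₂ hμ₁ hμ₂ γ hγ lam hlam ρ hρ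
  have hl' : lam ∈ Icc (0 : ℝ) 1 := ⟨hlam.1.le, hlam.2.le⟩
  have := hμ₁.1
  have := isProbabilityMeasure_of_plan hγ
  have hγr := ae_mem_of_plan hμ₁ hμ₂ hγ
  have hμ := probOn_interp hl' hγr
  have hτm := reparam_mem hl' (left_mem_Icc.2 hτ)
  have hτm0 : 0 ≤ reparam lam τ₂ τ₁ := hτ₁.trans (le_reparam hl' hτ)
  have hτmT : reparam lam τ₂ τ₁ ≤ T := hτm.2.trans hτ₂
  obtain ⟨u, c, X, hu, hX, rfl⟩ := exists_flow_of_mem_admissibleCosts hv hm hτm0 hτmT hr hμ hρ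
  -- The competitor for the earlier initial time runs through the control of the intermediate
  -- trajectory on `[reparam lam τ₂ τ₁, τ₂]` more slowly, and then follows it.
  let u₁ : ℝ → U := fun s => if s < τ₂ then u (reparam lam τ₂ s) else u s
  have hrm : Measurable (reparam lam τ₂) := by unfold reparam; fun_prop
  have hu₁ : Measurable u₁ := Measurable.ite measurableSet_Iio (hu.comp hrm) hu
  obtain ⟨c₁, X₁, hX₁, hc₁⟩ :=
    exists_flow_reachRadius (φ := φ) hv hm hτ₁ (hτ.trans hτ₂) hr hu₁ hμ₁
  obtain ⟨c₂, X₂, hX₂, hc₂⟩ :=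
    exists_flow_reachRadius (φ := φ) hv hm (hτ₁.trans hτ) hτ₂ hr hu hμ₂
  set G : Set (E d × E d) := {z | ‖z.1‖ ≤ r ∧ ‖z.2‖ ≤ r} with hG
  have hGp : ∀ z ∈ G, ‖(1 - lam) • z.1 + lam • z.2‖ ≤ r := fun z hz =>
    norm_convexComb_le hl' hz.1 hz.2
  have hinit : ∀ {u : ℝ → U} {τ μ c X}, τ ≤ T → IsFlow T v u τ r R μ c X → ∀ x, ‖x‖ ≤ r →
      X τ x = x := fun hτT h x hx => by
    rw [h.ode x (by simpa using hx) _ (left_mem_Icc.2 hτT), intervalIntegral.integral_same,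
      add_zero]
  have hcpl : CoupledTrajectories v u u₁ τ₁ τ₂ lam T R γ G c₁ c₂ c (fun t z => X₁ t z.1)
      (fun t z => X₂ t z.2) (fun t z => X t ((1 - lam) • z.1 + lam • z.2)) := {
    lag₁ := hX₁.lagrangian hv hm hR0 hτ₁ (hτ.trans hτ₂) hu₁ hμ₁ measurable_fst hγ.1.symm
      fun z hz => hz.1
    lag₂ := hX₂.lagrangian hv hm hR0 (hτ₁.trans hτ) hτ₂ hu hμ₂ measurable_snd hγ.2.symm
      fun z hz => hz.2
    lag := hX.lagrangian hv hm hR0 hτm0 hτmT hu hμ (measurable_interp lam) rfl hGp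
    init₁ := fun z hz => hinit (hτ.trans hτ₂) hX₁ _ hz.1
    init₂ := fun z hz => hinit hτ₂ hX₂ _ hz.2
    init := fun z hz => hinit hτmT hX _ (hGp z hz)
    before := fun s hs => by
      rcases hs.2.lt_or_eq with h | h
      · exact if_pos h
      · rw [h, reparam_self]
        exact if_neg (lt_irrefl _)
    after := fun s hs => if_neg (not_lt.2 hs.1)
    pos := hlam
    nonneg := hτ₁
    le := hτ
    le_T := hτ₂ }
  have hTI₁ : T ∈ Icc τ₁ T := right_mem_Icc.2 (hτ.trans hτ₂)
  have hTI₂ : T ∈ Icc τ₂ T := right_mem_Icc.2 hτ₂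
  have hTI : T ∈ Icc (reparam lam τ₂ τ₁) T := right_mem_Icc.2 hτmT
  obtain ⟨he₁, he₂⟩ := hcpl.estimate hγr hγr hℓ.le hl hvM hM0 hC hsc
  have hm₁ := hcpl.lag₁.meas T
  have hm₂ := hcpl.lag₂.meas T
  -- The plan between the final measures that is transported by the coupled trajectories need not be
  -- optimal, even if `γ` is.
  set γT : Measure (E d × E d) := γ.map fun z => (X₁ T z.1, X₂ T z.2) with hγT
  have hγTp : γT ∈ plans (c₁ T) (c₂ T) := by
    rw [hcpl.lag₁.law T hTI₁, hcpl.lag₂.law T hTI₂]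
    exact map_mem_plans hm₁ hm₂
  have hw : wassPlan γT ^ 2 = ∫ z, ‖X₁ T z.1 - X₂ T z.2‖ ^ 2 ∂γ := by
    rw [wassPlan_sq, hγT, integral_map (hm₁.prodMk hm₂).aemeasurable
      (Continuous.aestronglyMeasurable (by fun_prop))]
  have hP₁ := hcpl.lag₁.probOn hγr hTI₁
  have hP₂ := hcpl.lag₂.probOn hγr hTI₂
  have hP := hcpl.lag.probOn hγr hTI
  have h1 := hφs _ _ hP₁ hP₂ γT hγTp lam hl'
  rw [hw] at h1
  have hint : interp γT lam = γ.map fun z => (1 - lam) • X₁ T z.1 + lam • X₂ T z.2 := by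
    rw [interp, hγT, Measure.map_map (measurable_interp lam) (hm₁.prodMk hm₂)]
    rfl
  have hmc : Measurable fun z : E d × E d => (1 - lam) • X₁ T z.1 + lam • X₂ T z.2 :=
    (measurable_interp lam).comp (hm₁.prodMk hm₂)
  have hbc : ∀ z ∈ G, ‖(1 - lam) • X₁ T z.1 + lam • X₂ T z.2‖ ≤ R := fun z hz =>
    norm_convexComb_le hl' (hcpl.lag₁.bound T hTI₁ z hz) (hcpl.lag₂.bound T hTI₂ z hz)
  have hPi : ProbOn (ball0 d R) (interp γT lam) := by
    rw [hint]
    refine probOn_map hmc ?_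
    filter_upwards [hγr] with z hz using hbc z hz
  have hW : wass 1 (interp γT lam) (c T) ≤
      ∫ z, ‖(1 - lam) • X₁ T z.1 + lam • X₂ T z.2 - X T ((1 - lam) • z.1 + lam • z.2)‖ ∂γ := by
    rw [hint, hcpl.lag.law T hTI]
    refine wass_one_map_le hmc (hcpl.lag.meas T)
      (integrable_of_ae_norm_le (hmc.sub (hcpl.lag.meas T)).norm.aestronglyMeasurable
        (C := R + R) ?_)
    filter_upwards [hγr] with z hz
    rw [norm_norm]
    exact (norm_sub_le _ _).trans (add_le_add (hbc z hz) (hcpl.lag.bound T hTI z hz))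
  -- Semiconcavity of `φ` along `γT`, the Lipschitz bound for passing from the interpolation of `γT`
  -- to the final measure of the intermediate trajectory, and the definition of the value function.
  have h2 := (le_abs_self _).trans (hLip _ _ hPi hP)
  have h3 := mul_le_mul_of_nonneg_left (hW.trans he₂) hL
  have hll : 0 ≤ lam * (1 - lam) := mul_nonneg hl'.1 (by linarith [hl'.2])
  have h4 := mul_le_mul_of_nonneg_left he₁ (mul_nonneg hCφ.le hll)
  have h5 : value T v φ τ₁ μ₁ ≤ φ (c₁ T) :=
    csInf_le (admissibleCosts_bddBelow hv hm hφ hτ₁ (hτ.trans hτ₂) hr hμ₁) hc₁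
  have h6 : value T v φ τ₂ μ₂ ≤ φ (c₂ T) :=
    csInf_le (admissibleCosts_bddBelow hv hm hφ (hτ₁.trans hτ) hτ₂ hr hμ₂) hc₂
  have h7 := mul_le_mul_of_nonneg_left h5 (by linarith [hl'.2] : 0 ≤ 1 - lam)
  have h8 := mul_le_mul_of_nonneg_left h6 hl'.1
  have h9 : 0 ≤ lam * (1 - lam) * ((τ₂ - τ₁) ^ 2 + wassPlan γ ^ 2) := by positivity
  linarith

/-- The value function is semiconcave in time and measure jointly, along all plans. Exchanging the
two data reduces the case `τ₂ < τ₁` to the case `τ₁ ≤ τ₂`. -/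
theorem value_strongSemiconcave [Nonempty U] (hT : 0 < T) (hv : RegularVelocity T v m)
    (hm : 0 ≤ m) (hφ : CostOCP φ) (hφs : StrongSemiconcave φ)
    (hsc : ∀ R > 0, ∃ C, IsL1Pos T C ∧ StrongVelocitySC T v R C) {r : ℝ} (hr : 0 < r) :
    ∃ K > 0, ∀ τ₁ ∈ Icc 0 T, ∀ τ₂ ∈ Icc 0 T, ∀ μ₁ μ₂ : Measure (E d), ProbOn (ball0 d r) μ₁ →
      ProbOn (ball0 d r) μ₂ → ∀ γ ∈ plans μ₁ μ₂, ∀ lam ∈ Icc (0 : ℝ) 1,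
        (1 - lam) * value T v φ τ₁ μ₁ + lam * value T v φ τ₂ μ₂ -
            value T v φ ((1 - lam) * τ₁ + lam * τ₂) (interp γ lam) ≤
          K * (lam * (1 - lam)) * (|τ₁ - τ₂| ^ 2 + wassPlan γ ^ 2) := by
  obtain ⟨K, hK, h⟩ := exists_value_convexComb_le hT hv hm hφ hφs hsc hr
  have hord : ∀ τ₁ τ₂, 0 ≤ τ₁ → τ₁ ≤ τ₂ → τ₂ ≤ T → ∀ μ₁ μ₂, ProbOn (ball0 d r) μ₁ →
      ProbOn (ball0 d r) μ₂ → ∀ γ ∈ plans μ₁ μ₂, ∀ lam ∈ Ioo (0 : ℝ) 1,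
        (1 - lam) * value T v φ τ₁ μ₁ + lam * value T v φ τ₂ μ₂ -
            value T v φ ((1 - lam) * τ₁ + lam * τ₂) (interp γ lam) ≤
          K * (lam * (1 - lam)) * (|τ₁ - τ₂| ^ 2 + wassPlan γ ^ 2) := by
    intro τ₁ τ₂ hτ₁ hτ hτ₂ μ₁ μ₂ hμ₁ hμ₂ γ hγ lam hlam
    have hl' : lam ∈ Icc (0 : ℝ) 1 := ⟨hlam.1.le, hlam.2.le⟩
    have := hμ₁.1
    have := isProbabilityMeasure_of_plan hγ
    have hμ := probOn_interp hl' (ae_mem_of_plan hμ₁ hμ₂ hγ)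
    have hne := admissibleCosts_nonempty (φ := φ) hv hm (hτ₁.trans (le_reparam hl' hτ))
      ((reparam_mem hl' (left_mem_Icc.2 hτ)).2.trans hτ₂) hr hμ
    rw [sq_abs, ← neg_sub τ₂ τ₁, neg_sq, sub_le_comm]
    refine le_csInf hne fun ρ hρ => ?_
    rw [sub_le_comm]
    exact h τ₁ τ₂ hτ₁ hτ hτ₂ μ₁ μ₂ hμ₁ hμ₂ γ hγ lam hlam ρ hρ
  refine ⟨K, hK, fun τ₁ hτ₁ τ₂ hτ₂ μ₁ μ₂ hμ₁ hμ₂ γ hγ lam hlam => ?_⟩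
  rcases hlam.1.eq_or_lt with rfl | h0
  · rw [interp_zero hγ]
    simp
  rcases hlam.2.eq_or_lt with rfl | h1
  · rw [interp_one hγ]
    simp
  rcases le_total τ₁ τ₂ with hτ | hτ
  · exact hord τ₁ τ₂ hτ₁.1 hτ hτ₂.2 μ₁ μ₂ hμ₁ hμ₂ γ hγ lam ⟨h0, h1⟩
  · have h2 := hord τ₂ τ₁ hτ₂.1 hτ hτ₁.2 μ₂ μ₁ hμ₂ hμ₁ _ (map_swap_mem_plans hγ) (1 - lam)
      ⟨by linarith, by linarith⟩
    rw [interp_map_swap, wassPlan_map_swap, sub_sub_cancel, abs_sub_comm, mul_comm (1 - lam) lam,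
      add_comm (lam * value T v φ τ₂ μ₂), add_comm (lam * τ₂)] at h2
    exact h2

end Value

end WassersteinControl

theorem mainTheorem3 {d : ℕ} (hd : 1 ≤ d) {T : ℝ} (hT : 0 < T)
    {U : Type*} [MetricSpace U] [CompactSpace U] [Nonempty U] [MeasurableSpace U] [BorelSpace U]
    (v : ℝ → Measure (WassersteinControl.E d) → U →
      WassersteinControl.E d → WassersteinControl.E d)
    (φ : Measure (WassersteinControl.E d) → ℝ)
    (hOCP : WassersteinControl.OCP T v φ) (hR : WassersteinControl.HypR T v) :
    -- the value function is a genuine infimum: over a nonempty set bounded from below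
    (∀ τ ∈ Icc 0 T, ∀ μ, WassersteinControl.IsPc μ →
      (WassersteinControl.admissibleCosts T v φ τ μ).Nonempty ∧
      BddBelow (WassersteinControl.admissibleCosts T v φ τ μ)) ∧
    (WassersteinControl.SC1 T v φ →
      ∀ r > 0, ∃ C > 0, ∀ τ₁ ∈ Icc 0 T, ∀ τ₂ ∈ Icc 0 T,
        ∀ μ₁ μ₂ : Measure (WassersteinControl.E d),
        WassersteinControl.ProbOn (WassersteinControl.ball0 d r) μ₁ →
        WassersteinControl.ProbOn (WassersteinControl.ball0 d r) μ₂ →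
        ∀ γ ∈ WassersteinControl.optPlans μ₁ μ₂, ∀ lam ∈ Icc (0 : ℝ) 1,
          (1 - lam) * WassersteinControl.value T v φ τ₁ μ₁
              + lam * WassersteinControl.value T v φ τ₂ μ₂
              - WassersteinControl.value T v φ ((1 - lam) * τ₁ + lam * τ₂)
                  (WassersteinControl.interp γ lam)
            ≤ C * (lam * (1 - lam))
                * (|τ₁ - τ₂| ^ 2 + WassersteinControl.wass 2 μ₁ μ₂ ^ 2)) ∧
    (WassersteinControl.SC2 T v φ →
      ∀ r > 0, ∃ C > 0, ∀ τ₁ ∈ Icc 0 T, ∀ τ₂ ∈ Icc 0 T,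
        ∀ μ₁ μ₂ : Measure (WassersteinControl.E d),
        WassersteinControl.ProbOn (WassersteinControl.ball0 d r) μ₁ →
        WassersteinControl.ProbOn (WassersteinControl.ball0 d r) μ₂ →
        ∀ γ ∈ WassersteinControl.plans μ₁ μ₂, ∀ lam ∈ Icc (0 : ℝ) 1,
          (1 - lam) * WassersteinControl.value T v φ τ₁ μ₁
              + lam * WassersteinControl.value T v φ τ₂ μ₂
              - WassersteinControl.value T v φ ((1 - lam) * τ₁ + lam * τ₂)
                  (WassersteinControl.interp γ lam)
            ≤ C * (lam * (1 - lam))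
                * (|τ₁ - τ₂| ^ 2 + WassersteinControl.wassPlan γ ^ 2)) := by
  obtain ⟨m, hm, hv', hv⟩ := hR.regularVelocity hT
  refine ⟨fun τ hτ μ hμ => ?_, fun hSC r hr => ?_, fun hSC r hr => ?_⟩
  · obtain ⟨r, hr, hμr⟩ := hμ.exists_probOn
    exact ⟨WassersteinControl.admissibleCosts_nonempty hv hm.le hτ.1 hτ.2 hr hμr,
      WassersteinControl.admissibleCosts_bddBelow hv hm.le hOCP.2 hτ.1 hτ.2 hr hμr⟩
  · obtain ⟨K, hK, h⟩ := WassersteinControl.value_strongSemiconcave hT hv hm.le hOCP.2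
      (WassersteinControl.StrongSemiconcave.of_geodesic hOCP.2 hSC.2)
      (fun R hR0 => hSC.strongVelocitySC hv hv' hR0) hr
    refine ⟨K, hK, fun τ₁ hτ₁ τ₂ hτ₂ μ₁ μ₂ hμ₁ hμ₂ γ hγ lam hlam => ?_⟩
    rw [WassersteinControl.wass_two_eq_of_optPlan hμ₁ hμ₂ hγ]
    exact h τ₁ hτ₁ τ₂ hτ₂ μ₁ μ₂ hμ₁ hμ₂ γ hγ.1 lam hlam
  · exact WassersteinControl.value_strongSemiconcave hT hv hm.le hOCP.2 hSC.2
      (fun R hR0 => hSC.strongVelocitySC hv hR0) hr
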